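/- **Conventions.** A category $V$ is *lextensive* if it has finite limits and small coproducts and is (infinitary) extensive: for every small family of commutative squares from maps $c_j:X_j\to P$ (over $f_j:X_j\to Y_j$ and $g:P\to Q$) to the inclusions $d_j:Y_j\to Q$ of a coproduct, the $c_j$ form a coproduct cocone if and only if all the squares are pullbacks. $MV$ is the category of finite sequences of objects of $V$, its maps being sequences of maps between sequences of the same length. A *multitensor* on $V$ is a functor $E:MV\to V$ with natural transformations $u_X:X\to E(X)$ and $\sigma_{X_{ij}}:E_iE_jX_{ij}\to E_{ij}X_{ij}$ satisfying the unit and associativity laws. It is *distributive* if $E$ preserves small coproducts in each variable, and *cartesian* if $E$ preserves pullbacks and the naturality squares of $u$ and $\sigma$ are pullbacks (that is, $u$ and $\sigma$ are *cartesian* transformations). $\mathcal GV$ is the category of $V$-graphs: a small set $X_0$ with objects $X(a,b)$ of $V$ for $a,b\in X_0$. Functors, transformations and monads on $\mathcal GV$ are *over* $\mathbf{Set}$ if they commute strictly with $X\mapsto X_0$ (transformations being identities on objects). For a functor $A:MV\to V$ the functor $\Gamma A:\mathcal GV\to\mathcal GV$ over $\mathbf{Set}$ is given by $$\Gamma A\,X(a,b)=\coprod_{n\ge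 0}\ \coprod_{a=x_0,\dots,x_n=b}A\bigl(X(x_0,x_1),\dots,X(x_{n-1},x_n)\bigr),$$ and for a distributive multitensor $E$ the unit and substitution of $E$ make $\Gamma E$ a monad over $\mathbf{Set}$. For a cartesian distributive multitensor $E$ on a lextensive $V$, $\mathrm{Coll}\,E$ is the category of cartesian transformations $\alpha:A\to E$ of functors $MV\to V$, with transformations over $E$ as maps. It is monoidal under the substitution product $(A\circ B)(X_1,\dots,X_n)=\coprod_{n_1+\dots+n_k=n}A_iB_jX_{ij}$, with the unit $I$ given by $I(X)=X$ and $I(X_1,\dots,X_n)=\emptyset$ for $n\ne1$, both mapped to $E$ by means of $\sigma$ and $u$. $\mathrm{Mult}\,E$ is the category of cartesian multitensors $A$ with a cartesian multitensor morphism $A\to E$ (*$E$-multitensors*), with multitensor morphisms over $E$ as maps; equivalently, of monoids in $\mathrm{Coll}\,E$. For a cartesian monad $T$ over $\mathbf{Set}$ on $\mathcal GV$, $\mathrm{NColl}\,T$ is the monoidal category of cartesian transformations $A\to T$ over $\mathbf{Set}$, with tensor product given by composition and the multiplication of $T$, and unit by the unit of $T$. $\mathrm{NOp}\,T$ is the category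 of cartesian monads over $\mathbf{Set}$ with a cartesian monad morphism over $\mathbf{Set}$ to $T$ (*$T$-operads over $\mathbf{Set}$*), with monad morphisms over $T$ as maps; equivalently, of monoids in $\mathrm{NColl}\,T$. **Theorem.** (1) Let $V$ be a lextensive category and $E$ a distributive cartesian multitensor on $V$. Then the monad $\Gamma E$ is cartesian; the functor $$\Gamma_E:\mathrm{Coll}\,E\to\mathrm{NColl}\,\Gamma E,\qquad (A\to E)\mapsto(\Gamma A\to\Gamma E),$$ is strong monoidal, by the canonical maps $\mathrm{id}\to\Gamma I$ and $\Gamma A\circ\Gamma B\to\Gamma(A\circ B)$, and is an equivalence of categories; and applying $\Gamma$ to $E$-multitensors gives an equivalence of categories $$\mathrm{Mult}\,E\simeq\mathrm{NOp}(\Gamma E).$$ (2) For a monad $T$ on a category with finite products let $T^\times$ be the multitensor $T^\times(X_1,\dots,X_n)=\prod_iT(X_i)$, with unit and substitution induced by the unit and multiplication of $T$. Let $\mathcal T_{\le0}$ be the identity monad on $\mathbf{Set}$ and $\mathcal T_{\le n+1}=\Gamma(\mathcal T_{\le n}^\times)$ on $\mathcal G^{n+1}\mathbf{Set}$ (the monads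 whose algebras are strict $n$-categories). Then for every $n\in\mathbb N$ this is well defined: $\mathcal G^n\mathbf{Set}$ is lextensive and $\mathcal T_{\le n}^\times$ is a distributive cartesian multitensor; $\mathcal T_{\le n+1}$ is a cartesian monad over $\mathbf{Set}$; and applying $\Gamma$ gives an equivalence of categories $$\mathrm{Mult}(\mathcal T_{\le n}^\times)\simeq\mathrm{NOp}(\mathcal T_{\le n+1})$$ between $n$-multitensors and $(n+1)$-operads over $\mathbf{Set}$. -/

import Mathlib

open CategoryTheory CategoryTheory.Limits

set_option linter.unusedSectionVars false
set_option linter.unusedVariables false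
set_option linter.unusedSimpArgs false

universe w v u v₁ u₁ v₂ u₂

namespace MultOp
/-! ### Finite sequences -/

section Lists

variable {C : Type u} [Category.{v} C] {D : Type u₁} [Category.{v₁} D]

/-- A map of sequences is a sequence of maps. -/
inductive SeqHom : List C → List C → Type (max u v)
  | nil : SeqHom [] []
  | cons {a b : C} {l m : List C} (f : a ⟶ b) (g : SeqHom l m) : SeqHom (a :: l) (b :: m)

namespace SeqHom

def id : (l : List C) → SeqHom l l
  | [] => nil
  | a :: l => cons (𝟙 a) (id l)

def comp {l m n : List C} : SeqHom l m → SeqHom m n → SeqHom l n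
  | nil, nil => nil
  | cons f g, cons f' g' => cons (f ≫ f') (comp g g')

end SeqHom

/-- The category `M C` of finite sequences of objects of `C`. -/
instance seqCategory : Category (List C) where
  Hom := SeqHom
  id := SeqHom.id
  comp := SeqHom.comp
  id_comp f := by
    induction f with
    | nil => rfl
    | cons f g ih => exact congr (congrArg SeqHom.cons (Category.id_comp f)) ih
  comp_id f := by
    induction f with
    | nil => rfl
    | cons f g ih => exact congr (congrArg SeqHom.cons (Category.comp_id f)) ih
  assoc {_ _ n o} f g h := by
    induction f generalizing n o with
    | nil => cases g; cases h; rfl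
    | cons f f' ih =>
      cases g with | cons g g' => cases h with | cons h h' =>
      exact congr (congrArg SeqHom.cons (Category.assoc f g h)) (ih g' h')

/-- The sequence of maps with first entry `f` and remaining entries `g`. -/
def consHom {a b : C} {l m : List C} (f : a ⟶ b) (g : l ⟶ m) : (a :: l) ⟶ (b :: m) :=
  SeqHom.cons f g

@[simp] lemma consHom_comp {a b c : C} {l m n : List C} (f : a ⟶ b) (g : l ⟶ m) (f' : b ⟶ c)
    (g' : m ⟶ n) : consHom f g ≫ consHom f' g' = consHom (f ≫ f') (g ≫ g') := rfl

@[simp] lemma consHom_id (a : C) (l : List C) : consHom (𝟙 a) (𝟙 l) = 𝟙 (a :: l) := rfl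

lemma nilHom_eq (f : ([] : List C) ⟶ []) : f = 𝟙 [] := by
  change SeqHom [] [] at f
  cases f; rfl

@[elab_as_elim]
lemma hom_induction {P : ∀ {l m : List C}, (l ⟶ m) → Prop} (nil : P (𝟙 ([] : List C)))
    (cons : ∀ {a b : C} {l m : List C} (f : a ⟶ b) (g : l ⟶ m), P g → P (consHom f g))
    {l m : List C} (f : l ⟶ m) : P f := by
  change SeqHom l m at f
  induction f with
  | nil => exact nil
  | cons f g ih => exact cons f g ih

lemma consHom_surj {a : C} {l n : List C} (f : (a :: l) ⟶ n) :
    ∃ (b : C) (m : List C) (f₁ : a ⟶ b) (f₂ : l ⟶ m) (_ : n = b :: m), HEq f (consHom f₁ f₂) := by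
  change SeqHom _ _ at f
  cases f with
  | cons f g => exact ⟨_, _, f, g, rfl, HEq.rfl⟩

lemma eqToHom_cons {a b : C} {l m : List C} (h : a = b) (h' : l = m)
    (h'' : a :: l = b :: m) : eqToHom h'' = consHom (eqToHom h) (eqToHom h') := by
  subst h h'; rfl

def mapHom (F : C ⥤ D) {l m : List C} : SeqHom l m → SeqHom (l.map F.obj) (m.map F.obj)
  | .nil => .nil
  | .cons f g => .cons (F.map f) (mapHom F g)

/-- The functor `M F`. -/
abbrev mapSeq (F : C ⥤ D) : List C ⥤ List D where
  obj l := l.map F.obj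
  map f := mapHom F f
  map_id l := by
    induction l with
    | nil => rfl
    | cons a l ih => exact congr (congrArg SeqHom.cons (F.map_id a)) ih
  map_comp {l m n} f g := by
    change SeqHom l m at f
    induction f generalizing n with
    | nil => change SeqHom _ _ at g; cases g; rfl
    | cons f f' ih =>
      change SeqHom _ _ at g
      cases g with | cons g g' => exact congr (congrArg SeqHom.cons (F.map_comp f g)) (ih g')

@[simp] lemma mapSeq_cons (F : C ⥤ D) {a b : C} {l m : List C} (f : a ⟶ b) (g : l ⟶ m) :
    (mapSeq F).map (consHom f g) = consHom (F.map f) ((mapSeq F).map g) := rfl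

/-- The functor sending an object to the sequence of length one. -/
abbrev single : C ⥤ List C where
  obj a := [a]
  map f := consHom f (𝟙 [])

def appendHom {l m l' m' : List C} : SeqHom l m → (l' ⟶ m') → ((l ++ l') ⟶ (m ++ m'))
  | .nil, g => g
  | .cons f f', g => consHom f (appendHom f' g)

lemma appendHom_id (l l' : List C) : appendHom (𝟙 l : l ⟶ l) (𝟙 l') = 𝟙 (l ++ l') := by
  induction l with
  | nil => rfl
  | cons a l ih => exact congrArg (consHom (𝟙 a)) ih

lemma appendHom_comp {l m n l' m' n' : List C} (f : l ⟶ m) (g : m ⟶ n) (f' : l' ⟶ m')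
    (g' : m' ⟶ n') : appendHom (f ≫ g) (f' ≫ g') = appendHom f f' ≫ appendHom g g' := by
  change SeqHom l m at f
  induction f generalizing n with
  | nil => change SeqHom _ _ at g; cases g; rfl
  | cons f f'' ih =>
    change SeqHom _ _ at g
    cases g with | cons g g'' => exact congrArg (consHom (f ≫ g)) (ih g'')

def flattenHom {l m : List (List C)} : SeqHom l m → (l.flatten ⟶ m.flatten)
  | .nil => 𝟙 _
  | .cons f g => appendHom f (flattenHom g)

/-- Concatenation. -/
abbrev flat : List (List C) ⥤ List C where
  obj l := l.flatten
  map f := flattenHom f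
  map_id l := by
    induction l with
    | nil => rfl
    | cons a l ih => exact (congrArg (appendHom (𝟙 a)) ih).trans (appendHom_id _ _)
  map_comp {l m n} f g := by
    change SeqHom l m at f
    induction f generalizing n with
    | nil => change SeqHom _ _ at g; cases g; rfl
    | cons f f' ih =>
      change SeqHom _ _ at g
      cases g with | cons g g' =>
      exact (congrArg (appendHom (f ≫ g)) (ih g')).trans (appendHom_comp _ _ _ _)

@[simp] lemma flat_cons {a b : List C} {l m : List (List C)} (f : a ⟶ b) (g : l ⟶ m) :
    flat.map (consHom f g) = appendHom f (flat.map g) := rfl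

end Lists

/-! ### Coproducts and extensivity -/

section Coproducts

variable {V : Type u} [Category.{v} V]

/-- The maps `c j : Z j ⟶ P` form a coproduct cocone. -/
def IsCoprod {J : Type*} {Z : J → V} {P : V} (c : ∀ j, Z j ⟶ P) : Prop :=
  ∀ ⦃W : V⦄ (f : ∀ j, Z j ⟶ W), ∃! g : P ⟶ W, ∀ j, c j ≫ g = f j

namespace IsCoprod

variable {J : Type*} {Z : J → V} {P : V} {c : ∀ j, Z j ⟶ P}

noncomputable def desc (h : IsCoprod c) {W : V} (f : ∀ j, Z j ⟶ W) : P ⟶ W := (h f).choose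

@[simp]
lemma fac (h : IsCoprod c) {W : V} (f : ∀ j, Z j ⟶ W) (j : J) : c j ≫ h.desc f = f j :=
  (h f).choose_spec.1 j

@[simp]
lemma fac_assoc (h : IsCoprod c) {W W' : V} (f : ∀ j, Z j ⟶ W) (j : J) (k : W ⟶ W') :
    c j ≫ h.desc f ≫ k = f j ≫ k := by
  rw [← Category.assoc, fac]

lemma hom_ext (h : IsCoprod c) {W : V} {f g : P ⟶ W} (e : ∀ j, c j ≫ f = c j ≫ g) : f = g :=
  (h fun j => c j ≫ g).unique e fun _ => rfl

lemma iff_isColimit {J : Type*} {Z : J → V} {P : V} (c : ∀ j, Z j ⟶ P) :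
    IsCoprod c ↔ Nonempty (IsColimit (Cofan.mk P c)) := by
  constructor
  · intro h
    exact ⟨Cofan.IsColimit.mk _ (fun s => h.desc s.inj) (fun s j => h.fac _ j)
      (fun s m hm => h.hom_ext fun j => (hm j).trans (h.fac _ j).symm)⟩
  · rintro ⟨h⟩ W f
    exact ⟨Cofan.IsColimit.desc h f, fun j => Cofan.IsColimit.fac h f j,
      fun g hg => Cofan.IsColimit.hom_ext h _ _ fun j => (hg j).trans (Cofan.IsColimit.fac h f j).symm⟩

/-- Change of the indexing type. -/
lemma reindex {J' : Type*} {Z' : J' → V} {c' : ∀ j, Z' j ⟶ P} (h : IsCoprod c) (e : J' → J)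
    (he : Function.Bijective e) (k : ∀ j, Z' j ⟶ Z (e j)) [∀ j, IsIso (k j)]
    (w : ∀ j, c' j = k j ≫ c (e j)) : IsCoprod c' := by
  intro W f
  obtain ⟨r, hl, hr⟩ := Function.bijective_iff_has_inverse.1 he
  have key : ∀ (g : P ⟶ W), (∀ j, c' j ≫ g = f j) ↔ ∀ j, c (e j) ≫ g = inv (k j) ≫ f j := by
    intro g
    refine forall_congr' fun j => ?_
    rw [w, Category.assoc, IsIso.eq_inv_comp]
  have key2 : ∀ (g : P ⟶ W), (∀ j, c (e j) ≫ g = inv (k j) ≫ f j) ↔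
      ∀ i, c i ≫ g = eqToHom (by rw [hr]) ≫ inv (k (r i)) ≫ f (r i) := by
    intro g
    constructor
    · intro H i
      rw [← H (r i)]
      have : ∀ (i i' : J) (h : i = i'), c i ≫ g = eqToHom (by rw [h]) ≫ c i' ≫ g := by
        rintro i _ rfl; simp
      exact this _ _ (hr i).symm
    · intro H j
      rw [H]
      have : ∀ (j j' : J') (h : j = j'), eqToHom (by rw [h]) ≫ inv (k j) ≫ f j =
          inv (k j') ≫ f j' := by
        rintro i _ rfl; simp
      exact this _ _ (hl j)
  simp only [key, key2]
  exact h _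

lemma comp_iso (h : IsCoprod c) {P' : V} (k : P ⟶ P') [IsIso k] :
    IsCoprod fun j => c j ≫ k := by
  intro W f
  obtain ⟨g, hg, hu⟩ := h f
  refine ⟨inv k ≫ g, by simpa using hg, fun g' hg' => ?_⟩
  rw [IsIso.eq_inv_comp]
  exact hu _ (by simpa using hg')

/-- Coproducts of coproducts. -/
lemma sigma (h : IsCoprod c) {K : J → Type*} {Y : ∀ j, K j → V} {d : ∀ j k, Y j k ⟶ Z j}
    (hd : ∀ j, IsCoprod (d j)) : IsCoprod fun i : Σ j, K j => d i.1 i.2 ≫ c i.1 := by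
  intro W f
  refine ⟨h.desc fun j => (hd j).desc fun k => f ⟨j, k⟩, by simp, fun g hg => ?_⟩
  refine h.hom_ext fun j => (hd j).hom_ext fun k => ?_
  have := hg ⟨j, k⟩
  simpa using this

/-- A map carrying one coproduct cocone to another one, along a bijection of the summands. -/
lemma isIso_of {J' : Type*} {Z' : J' → V} {P' : V} {c' : ∀ j, Z' j ⟶ P'} (h : IsCoprod c)
    (h' : IsCoprod c') (e : J → J') (he : Function.Bijective e) (k : ∀ j, Z j ⟶ Z' (e j))
    [∀ j, IsIso (k j)] (g : P ⟶ P') (w : ∀ j, c j ≫ g = k j ≫ c' (e j)) : IsIso g := by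
  have h2 : IsCoprod fun j => c j ≫ g := h'.reindex e he k w
  refine ⟨h2.desc c, h.hom_ext fun j => ?_, h2.hom_ext fun j => ?_⟩
  · have := h2.fac c j
    simpa using this
  · rw [h2.fac_assoc]; simp

end IsCoprod

lemma isCoprod_ι {J : Type*} (Z : J → V) [HasCoproduct Z] : IsCoprod (Sigma.ι Z) :=
  (IsCoprod.iff_isColimit _).2 ⟨coproductIsCoproduct Z⟩

variable (V)

/-- A category is extensive when it has small coproducts, pullbacks along coproduct inclusions and,
for every family of commutative squares from maps `c j` to the inclusions `d j` of a coproduct, the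
maps `c j` form a coproduct cocone if and only if all the squares are pullbacks. It is lextensive
when moreover it has finite limits (so that the pullbacks above exist). -/
class Lextensive : Prop where
  hasFiniteLimits : HasFiniteLimits V
  hasCoproducts : HasCoproducts.{v} V
  isCoprod_iff : ∀ {J : Type v} {X Y : J → V} {P Q : V} (c : ∀ j, X j ⟶ P) (d : ∀ j, Y j ⟶ Q)
    (f : ∀ j, X j ⟶ Y j) (g : P ⟶ Q), IsCoprod d → (∀ j, c j ≫ g = f j ≫ d j) →
    (IsCoprod c ↔ ∀ j, IsPullback (c j) (f j) g (d j))

variable {V} [Lextensive V]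

instance : HasFiniteLimits V := Lextensive.hasFiniteLimits

instance hasCoprod_of_small (J : Type*) [Small.{v} J] : HasColimitsOfShape (Discrete J) V :=
  haveI := Lextensive.hasCoproducts (V := V)
  hasColimitsOfShape_of_equivalence (Discrete.equivalence (equivShrink.{v} J).symm)

lemma IsCoprod.iff_isPullback {J : Type*} [Small.{v} J] {X Y : J → V} {P Q : V}
    {c : ∀ j, X j ⟶ P} {d : ∀ j, Y j ⟶ Q} {f : ∀ j, X j ⟶ Y j} {g : P ⟶ Q} (hd : IsCoprod d)
    (w : ∀ j, c j ≫ g = f j ≫ d j) : IsCoprod c ↔ ∀ j, IsPullback (c j) (f j) g (d j) := by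
  have e := (equivShrink.{v} J).symm
  have aux : ∀ {Z : J → V} {R : V} (c : ∀ j, Z j ⟶ R),
      IsCoprod c ↔ IsCoprod fun i => c (e i) := by
    intro Z R c
    constructor
    · intro h
      exact h.reindex e e.bijective (fun _ => 𝟙 _) (by simp)
    · intro h
      refine h.reindex e.symm e.symm.bijective (fun j => eqToHom (by simp)) fun j => ?_
      have : ∀ (i i' : J) (h : i = i'), c i = eqToHom (by rw [h]) ≫ c i' := by
        rintro i _ rfl; simp
      exact this _ _ (by simp)
  rw [aux, Lextensive.isCoprod_iff _ _ (fun i => f (e i)) g ((aux d).1 hd) fun i => w _]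
  exact ⟨fun h j => by obtain ⟨i, rfl⟩ := e.surjective j; exact h i, fun h i => h _⟩

open Classical in
lemma IsCoprod.disjoint {J : Type*} [Small.{v} J] {Y : J → V} {Q : V} {d : ∀ j, Y j ⟶ Q}
    (hd : IsCoprod d) (j : J) : Mono (d j) ∧ ∀ i, i ≠ j → ∀ (W : V) (p : W ⟶ Y j) (q : W ⟶ Y i),
      p ≫ d j = q ≫ d i → Nonempty (IsInitial W) := by
  let X : J → V := fun i => if i = j then Y j else ⊥_ V
  have hX : X j = Y j := if_pos rfl
  have hX' : ∀ i, i ≠ j → X i = ⊥_ V := fun i hi => if_neg hi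
  let c : ∀ i, X i ⟶ Y j := fun i =>
    if h : i = j then eqToHom (by rw [h, hX]) else eqToHom (hX' i h) ≫ initial.to _
  let f : ∀ i, X i ⟶ Y i := fun i =>
    if h : i = j then eqToHom (by subst h; rw [hX]) else eqToHom (hX' i h) ≫ initial.to _
  have hc : IsCoprod c := by
    intro W φ
    refine ⟨eqToHom hX.symm ≫ φ j, fun i => ?_, fun g hg => ?_⟩
    · by_cases h : i = j
      · subst h; simp [c]
      · rw [← cancel_epi (eqToHom (hX' i h).symm)]
        exact initialIsInitial.hom_ext _ _
    · rw [← hg j]; simp [c]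
  have key := (hd.iff_isPullback (c := c) (f := f) (g := d j) (fun i => by
    by_cases h : i = j
    · subst h; simp [c, f]
    · rw [← cancel_epi (eqToHom (hX' i h).symm)]
      exact initialIsInitial.hom_ext _ _)).1 hc
  constructor
  · have := key j
    constructor
    intro W a b hab
    have e1 : a = this.lift a b hab ≫ c j := (this.lift_fst _ _ _).symm
    have e2 : b = this.lift a b hab ≫ f j := (this.lift_snd _ _ _).symm
    have : c j = f j := by simp [c, f]
    exact e1.trans ((congrArg _ this).trans e2.symm)
  · intro i hi W p q hpq
    have h0 : IsCoprod (J := PEmpty.{v+1}) (Z := fun _ => X i) (P := X i) (fun j => j.elim) := by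
      intro W' φ
      refine ⟨eqToHom (hX' i hi) ≫ initial.to _, fun j => j.elim, fun g _ => ?_⟩
      rw [← cancel_epi (eqToHom (hX' i hi).symm)]
      exact initialIsInitial.hom_ext _ _
    have h1 : IsCoprod (J := PEmpty.{v+1}) (Z := fun _ => X i) (P := W) (fun j => j.elim) :=
      (h0.iff_isPullback (f := fun j => 𝟙 _) (g := (key i).lift p q hpq)
        (fun j => j.elim)).2 fun j => j.elim
    exact ⟨IsInitial.ofUniqueHom (fun Y => h1.desc fun j => j.elim)
      fun Y m => h1.hom_ext fun j => j.elim⟩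

lemma isPullback_of_isCoprod {J : Type*} [Small.{v} J] {A' C' : J → V} {A B C D : V}
    {a : ∀ j, A' j ⟶ A} {c : ∀ j, C' j ⟶ C} (ha : IsCoprod a) (hc : IsCoprod c)
    {k : ∀ j, A' j ⟶ C' j} {t : A ⟶ B} {s : A ⟶ C} {h : B ⟶ D} {g : C ⟶ D}
    (w : t ≫ h = s ≫ g) (wk : ∀ j, a j ≫ s = k j ≫ c j)
    (hp : ∀ j, IsPullback (a j ≫ t) (k j) h (c j ≫ g)) : IsPullback t s h g := by
  let l : A ⟶ pullback h g := pullback.lift t s w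
  have hl : ∀ j, IsPullback (a j ≫ l) (k j) (pullback.snd h g) (c j) := fun j => by
    refine IsPullback.of_right (h₁₂ := pullback.fst h g) (h₂₂ := g) (v₁₃ := h) ?_ ?_
      (IsPullback.of_hasPullback h g)
    · simpa only [l, Category.assoc, pullback.lift_fst] using hp j
    · simpa only [l, Category.assoc, pullback.lift_snd] using wk j
  have hl' : IsCoprod fun j => a j ≫ l := (hc.iff_isPullback fun j => (hl j).w).2 hl
  have : IsIso l := ha.isIso_of hl' id Function.bijective_id (fun _ => 𝟙 _) l (by simp)
  exact IsPullback.of_iso (IsPullback.of_hasPullback h g) (asIso l).symm (Iso.refl _) (Iso.refl _)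
    (Iso.refl _) (by simp [l, pullback.lift_fst]) (by simp [l, pullback.lift_snd]) (by simp) (by simp)

end Coproducts

/-! ### Left Kan extensions along discrete fibrations and opfibrations -/

section Lan

variable {A : Type u₁} [Category.{v₁} A] {B : Type u₂} [Category.{v₂} B]

/-- Functors with unique lifts of arrows from both ends, and with countable fibres. -/
class DiscFib (p : A ⥤ B) : Prop where
  bij : ∀ a, Function.Bijective
    fun t : Σ a', a ⟶ a' => (⟨p.obj t.1, p.map t.2⟩ : Σ X, p.obj a ⟶ X)
  bij' : ∀ a, Function.Bijective
    fun t : Σ a', a' ⟶ a => (⟨p.obj t.1, p.map t.2⟩ : Σ X, X ⟶ p.obj a)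
  countable : ∀ X, Countable {a // p.obj a = X}

attribute [instance] DiscFib.countable

variable (p : A ⥤ B) [DiscFib p]

lemma exists_lift {a : A} {X X' : B} (h : p.obj a = X) (f : X ⟶ X') :
    ∃ (a' : A) (g : a ⟶ a') (_ : p.obj a' = X'), HEq (p.map g) f := by
  subst h
  obtain ⟨⟨a', g⟩, h⟩ := (DiscFib.bij (p := p) a).2 ⟨X', f⟩
  cases h
  exact ⟨a', g, rfl, HEq.rfl⟩

lemma exists_lift' {a' : A} {X X' : B} (h : p.obj a' = X') (f : X ⟶ X') :
    ∃ (a : A) (g : a ⟶ a') (_ : p.obj a = X), HEq (p.map g) f := by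
  subst h
  obtain ⟨⟨a, g⟩, h⟩ := (DiscFib.bij' (p := p) a').2 ⟨X, f⟩
  cases h
  exact ⟨a, g, rfl, HEq.rfl⟩

variable {p} in
lemma lift_unique {a a' b : A} {X X' : B} {f : X ⟶ X'} (g : a ⟶ a') (k : a ⟶ b)
    (h' : p.obj a' = X') (hb : p.obj b = X') (hg : HEq (p.map g) f) (hk : HEq (p.map k) f) :
    (⟨b, k⟩ : Σ a', a ⟶ a') = ⟨a', g⟩ :=
  (DiscFib.bij (p := p) a).1 (Sigma.ext (hb.trans h'.symm) (hk.trans hg.symm))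

variable {p} in
lemma lift_unique' {a a' b : A} {X X' : B} {f : X ⟶ X'} (g : a ⟶ a') (k : b ⟶ a')
    (h : p.obj a = X) (hb : p.obj b = X) (hg : HEq (p.map g) f) (hk : HEq (p.map k) f) :
    (⟨b, k⟩ : Σ a, a ⟶ a') = ⟨a, g⟩ :=
  (DiscFib.bij' (p := p) a').1 (Sigma.ext (hb.trans h.symm) (hk.trans hg.symm))

variable {V : Type u} [Category.{v} V] [Lextensive V] (G : A ⥤ V)

section Construction

noncomputable def lanObj (X : B) : V := ∐ fun a : {a // p.obj a = X} => G.obj a.1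

noncomputable def lanι₀ (a : A) {X : B} (h : p.obj a = X) : G.obj a ⟶ lanObj p G X :=
  Sigma.ι (fun a : {a // p.obj a = X} => G.obj a.1) ⟨a, h⟩

lemma lan_isCoprod₀ (X : B) : IsCoprod fun a : {a // p.obj a = X} => lanι₀ p G a.1 a.2 :=
  isCoprod_ι _

noncomputable def lanMap {X X' : B} (f : X ⟶ X') : lanObj p G X ⟶ lanObj p G X' :=
  (lan_isCoprod₀ p G X).desc fun a => G.map (exists_lift p a.2 f).choose_spec.choose ≫
    lanι₀ p G _ (exists_lift p a.2 f).choose_spec.choose_spec.choose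

lemma lanι_lanMap {a a' : A} (g : a ⟶ a') {X X' : B} (h : p.obj a = X) (h' : p.obj a' = X')
    (f : X ⟶ X') (w : HEq (p.map g) f) :
    lanι₀ p G a h ≫ lanMap p G f = G.map g ≫ lanι₀ p G a' h' := by
  have e := (lan_isCoprod₀ p G X).fac (fun a => G.map (exists_lift p a.2 f).choose_spec.choose ≫
    lanι₀ p G _ (exists_lift p a.2 f).choose_spec.choose_spec.choose) ⟨a, h⟩
  refine e.trans ?_
  have key : ∀ (b : A) (k : a ⟶ b) (hb : p.obj b = X'), HEq (p.map k) f →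
      G.map k ≫ lanι₀ p G b hb = G.map g ≫ lanι₀ p G a' h' := by
    intro b k hb hk
    cases lift_unique g k h' hb w hk
    rfl
  exact key _ _ _ (exists_lift p h f).choose_spec.choose_spec.choose_spec

lemma lanι_lanMap_assoc {a a' : A} (g : a ⟶ a') {X X' : B} (h : p.obj a = X)
    (h' : p.obj a' = X') (f : X ⟶ X') (w : HEq (p.map g) f) {W : V} (k : lanObj p G X' ⟶ W) :
    lanι₀ p G a h ≫ lanMap p G f ≫ k = G.map g ≫ lanι₀ p G a' h' ≫ k := by
  rw [← Category.assoc, lanι_lanMap p G g h h' f w, Category.assoc]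

end Construction

/-- The left Kan extension of `G` along `p`: its value at `X` is the coproduct of the objects `G a`
with `p a = X`. -/
noncomputable def lan : B ⥤ V where
  obj := lanObj p G
  map := lanMap p G
  map_id X := (lan_isCoprod₀ p G X).hom_ext fun ⟨a, h⟩ => by
    rw [lanι_lanMap p G (𝟙 a) h h]
    · simp
    · subst h; simp
  map_comp {X _ _} f f' := (lan_isCoprod₀ p G X).hom_ext fun ⟨a, h⟩ => by
    obtain ⟨a', g, h', w⟩ := exists_lift p h f
    obtain ⟨a'', g', h'', w'⟩ := exists_lift p h' f'
    rw [lanι_lanMap_assoc p G g h h' f w, lanι_lanMap p G g' h' h'' f' w',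
      lanι_lanMap p G (g ≫ g') h h'']
    · simp
    · subst h h' h''; cases w; cases w'; simp

noncomputable def lanι (a : A) {X : B} (h : p.obj a = X) : G.obj a ⟶ (lan p G).obj X :=
  lanι₀ p G a h

lemma lan_isCoprod (X : B) : IsCoprod fun a : {a // p.obj a = X} => lanι p G a.1 a.2 :=
  lan_isCoprod₀ p G X

variable {p G} in
lemma lan_ext {X : B} {W : V} {f g : (lan p G).obj X ⟶ W}
    (e : ∀ a (h : p.obj a = X), lanι p G a h ≫ f = lanι p G a h ≫ g) : f = g :=
  (lan_isCoprod p G X).hom_ext fun a => e a.1 a.2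

lemma lanι_map {a a' : A} (g : a ⟶ a') {X X' : B} (h : p.obj a = X) (h' : p.obj a' = X')
    (f : X ⟶ X') (w : HEq (p.map g) f) :
    lanι p G a h ≫ (lan p G).map f = G.map g ≫ lanι p G a' h' :=
  lanι_lanMap p G g h h' f w

lemma lanι_map_assoc {a a' : A} (g : a ⟶ a') {X X' : B} (h : p.obj a = X) (h' : p.obj a' = X')
    (f : X ⟶ X') (w : HEq (p.map g) f) {W : V} (k : (lan p G).obj X' ⟶ W) :
    lanι p G a h ≫ (lan p G).map f ≫ k = G.map g ≫ lanι p G a' h' ≫ k :=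
  lanι_lanMap_assoc p G g h h' f w k

variable {p G} {K : B ⥤ V}

/-- Maps out of the left Kan extension. -/
noncomputable def lanDescApp (θ : G ⟶ p ⋙ K) (X : B) : (lan p G).obj X ⟶ K.obj X :=
  (lan_isCoprod p G X).desc fun a => θ.app a.1 ≫ K.map (eqToHom a.2)

lemma lanι_descApp (θ : G ⟶ p ⋙ K) (a : A) {X : B} (h : p.obj a = X) :
    lanι p G a h ≫ lanDescApp θ X = θ.app a ≫ K.map (eqToHom h) :=
  (lan_isCoprod p G X).fac (fun a => θ.app a.1 ≫ K.map (eqToHom a.2)) ⟨a, h⟩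

lemma lanι_descApp_assoc (θ : G ⟶ p ⋙ K) (a : A) {X : B} (h : p.obj a = X) {W : V}
    (k : K.obj X ⟶ W) :
    lanι p G a h ≫ lanDescApp θ X ≫ k = θ.app a ≫ K.map (eqToHom h) ≫ k := by
  rw [← Category.assoc, lanι_descApp, Category.assoc]

noncomputable def lanDesc (θ : G ⟶ p ⋙ K) : lan p G ⟶ K where
  app := lanDescApp θ
  naturality X X' f := lan_ext fun a h => by
    obtain ⟨a', g, h', w⟩ := exists_lift p h f
    rw [lanι_map_assoc p G g h h' f w, lanι_descApp, lanι_descApp_assoc]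
    subst h h'
    cases w
    simp

lemma lanι_desc (θ : G ⟶ p ⋙ K) (a : A) {X : B} (h : p.obj a = X) :
    lanι p G a h ≫ (lanDesc θ).app X = θ.app a ≫ K.map (eqToHom h) :=
  lanι_descApp θ a h

variable (p G) in
/-- The unit of the left Kan extension. -/
noncomputable def lanUnit : G ⟶ p ⋙ lan p G where
  app a := lanι p G a rfl
  naturality _ _ g := (lanι_map p G g rfl rfl _ HEq.rfl).symm

lemma lanι_eqToHom (a : A) {X X' : B} (h : p.obj a = X) (h' : X = X') :
    lanι p G a h ≫ (lan p G).map (eqToHom h') = lanι p G a (h.trans h') := by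
  subst h'; simp

lemma lanι_congr {a a' : A} (e : a = a') {X : B} (h : p.obj a = X) (h' : p.obj a' = X) :
    lanι p G a h = G.map (eqToHom e) ≫ lanι p G a' h' := by
  subst e; simp

variable (p) in
lemma lift_source_unique {a b c d : A} (hcd : c = d) (g : a ⟶ c) (k : b ⟶ d) {X X' : B}
    {f : X ⟶ X'} (ha : p.obj a = X) (hb : p.obj b = X) (hg : HEq (p.map g) f)
    (hk : HEq (p.map k) f) : a = b := by
  subst hcd
  exact congrArg Sigma.fst (lift_unique' k g hb ha hk hg)

lemma lanι_isPullback {θ : G ⟶ p ⋙ K} (hθ : NatTrans.Equifibered θ) {a a' : A} (g : a ⟶ a')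
    {X X' : B} (h : p.obj a = X) (h' : p.obj a' = X') (f : X ⟶ X') (w : HEq (p.map g) f) :
    IsPullback (lanι p G a h ≫ (lanDesc θ).app X) (G.map g) (K.map f)
      (lanι p G a' h' ≫ (lanDesc θ).app X') := by
  rw [lanι_desc, lanι_desc]
  subst h h'
  cases w
  simpa using (hθ g).flip

/-- The map out of the left Kan extension induced by a cartesian transformation is cartesian. -/
lemma lanDesc_equifibered {θ : G ⟶ p ⋙ K} (hθ : NatTrans.Equifibered θ) :
    NatTrans.Equifibered (lanDesc θ) := by
  intro X X' f
  have ex := fun a : {a // p.obj a = X} => exists_lift p a.2 f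
  choose e k he hk using ex
  have hbij : Function.Bijective fun a => (⟨e a, he a⟩ : {a // p.obj a = X'}) := by
    constructor
    · intro a b hab
      exact Subtype.ext (lift_source_unique p (congrArg Subtype.val hab) (k a) (k b) a.2 b.2
        (hk a) (hk b))
    · rintro ⟨b, hb⟩
      obtain ⟨a, g, ha, w⟩ := exists_lift' p hb f
      refine ⟨⟨a, ha⟩, Subtype.ext ?_⟩
      exact congrArg Sigma.fst (lift_unique g (k ⟨a, ha⟩) hb (he _) w (hk _))
  refine IsPullback.flip ?_
  exact isPullback_of_isCoprod (lan_isCoprod p G X)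
    (c := fun a => lanι p G (e a) (he a))
    ((lan_isCoprod p G X').reindex _ hbij (fun a => 𝟙 (G.obj (e a))) fun j => by simp)
    (k := fun a => G.map (k a)) ((lanDesc θ).naturality f).symm
    (fun a => lanι_map p G (k a) a.2 (he a) f (hk a))
    fun a => lanι_isPullback hθ (k a) a.2 (he a) f (hk a)

end Lan

/-! ### The discrete fibrations of sequences -/

section SeqLift

variable {C : Type u} [Category.{v} C]

lemma consHom_inj {a b b' : C} {l m m' : List C} {f : a ⟶ b} {g : l ⟶ m} {f' : a ⟶ b'} {g' : l ⟶ m'}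
    (h : (⟨b :: m, consHom f g⟩ : Σ n, (a :: l) ⟶ n) = ⟨b' :: m', consHom f' g'⟩) :
    (⟨b, f⟩ : Σ b, a ⟶ b) = ⟨b', f'⟩ ∧ (⟨m, g⟩ : Σ m, l ⟶ m) = ⟨m', g'⟩ := by
  cases h; exact ⟨rfl, rfl⟩

lemma consHom_inj' {a b b' : C} {l m m' : List C} {f : b ⟶ a} {g : m ⟶ l} {f' : b' ⟶ a} {g' : m' ⟶ l}
    (h : (⟨b :: m, consHom f g⟩ : Σ n, n ⟶ (a :: l)) = ⟨b' :: m', consHom f' g'⟩) :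
    (⟨b, f⟩ : Σ b, b ⟶ a) = ⟨b', f'⟩ ∧ (⟨m, g⟩ : Σ m, m ⟶ l) = ⟨m', g'⟩ := by
  cases h; exact ⟨rfl, rfl⟩

lemma exists_cons {a : C} {l : List C} (t : Σ n, (a :: l) ⟶ n) :
    ∃ (b : C) (m : List C) (f : a ⟶ b) (g : l ⟶ m), t = ⟨b :: m, consHom f g⟩ := by
  obtain ⟨n, t⟩ := t
  change SeqHom _ _ at t
  cases t with | cons f g => exact ⟨_, _, f, g, rfl⟩

lemma exists_cons' {a : C} {l : List C} (t : Σ n, n ⟶ (a :: l)) :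
    ∃ (b : C) (m : List C) (f : b ⟶ a) (g : m ⟶ l), t = ⟨b :: m, consHom f g⟩ := by
  obtain ⟨n, t⟩ := t
  change SeqHom _ _ at t
  cases t with | cons f g => exact ⟨_, _, f, g, rfl⟩

lemma eq_nil (t : Σ n, ([] : List C) ⟶ n) : t = ⟨[], 𝟙 _⟩ := by
  obtain ⟨n, t⟩ := t
  change SeqHom _ _ at t
  cases t; rfl

lemma eq_nil' (t : Σ n, n ⟶ ([] : List C)) : t = ⟨[], 𝟙 _⟩ := by
  obtain ⟨n, t⟩ := t
  change SeqHom _ _ at t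
  cases t; rfl

instance : DiscFib (single (C := C)) where
  bij a := by
    constructor
    · rintro ⟨b, f⟩ ⟨b', f'⟩ h
      exact (consHom_inj h).1
    · intro t
      obtain ⟨b, m, f, g, rfl⟩ := exists_cons t
      cases eq_nil ⟨_, g⟩
      exact ⟨⟨b, f⟩, rfl⟩
  bij' a := by
    constructor
    · rintro ⟨b, f⟩ ⟨b', f'⟩ h
      exact (consHom_inj' h).1
    · intro t
      obtain ⟨b, m, f, g, rfl⟩ := exists_cons' t
      cases eq_nil' ⟨_, g⟩
      exact ⟨⟨b, f⟩, rfl⟩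
  countable X := by
    have : Subsingleton {a : C // single.obj a = X} :=
      ⟨fun a b => Subtype.ext (List.singleton_injective (a.2.trans b.2.symm))⟩
    infer_instance

@[simp] lemma appendHom_nil {l m : List C} (g : l ⟶ m) :
    appendHom (𝟙 ([] : List C) : ([] : List C) ⟶ []) g = g := rfl

@[simp] lemma appendHom_cons {a b : C} {l m l' m' : List C} (f : a ⟶ b) (f' : l ⟶ m) (g : l' ⟶ m') :
    appendHom (consHom f f') g = consHom f (appendHom f' g) := rfl

lemma appendHom_inj {l m m' k n n' : List C} {f : l ⟶ m} {g : k ⟶ n} {f' : l ⟶ m'} {g' : k ⟶ n'}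
    (h : (⟨m ++ n, appendHom f g⟩ : Σ x, (l ++ k) ⟶ x) = ⟨m' ++ n', appendHom f' g'⟩) :
    (⟨m, f⟩ : Σ m, l ⟶ m) = ⟨m', f'⟩ ∧ (⟨n, g⟩ : Σ n, k ⟶ n) = ⟨n', g'⟩ := by
  induction l generalizing m m' with
  | nil =>
    cases eq_nil ⟨_, f⟩
    cases eq_nil ⟨_, f'⟩
    exact ⟨rfl, h⟩
  | cons a l ih =>
    obtain ⟨b, m, f₁, f₂, e⟩ := exists_cons ⟨_, f⟩
    obtain ⟨b', m', f₁', f₂', e'⟩ := exists_cons ⟨_, f'⟩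
    cases e; cases e'
    obtain ⟨h1, h2⟩ := consHom_inj h
    obtain ⟨h3, h4⟩ := ih h2
    cases h1; cases h3
    exact ⟨rfl, h4⟩

lemma appendHom_inj' {l m m' k n n' : List C} {f : m ⟶ l} {g : n ⟶ k} {f' : m' ⟶ l} {g' : n' ⟶ k}
    (h : (⟨m ++ n, appendHom f g⟩ : Σ x, x ⟶ (l ++ k)) = ⟨m' ++ n', appendHom f' g'⟩) :
    (⟨m, f⟩ : Σ m, m ⟶ l) = ⟨m', f'⟩ ∧ (⟨n, g⟩ : Σ n, n ⟶ k) = ⟨n', g'⟩ := by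
  induction l generalizing m m' with
  | nil =>
    cases eq_nil' ⟨_, f⟩
    cases eq_nil' ⟨_, f'⟩
    exact ⟨rfl, h⟩
  | cons a l ih =>
    obtain ⟨b, m, f₁, f₂, e⟩ := exists_cons' ⟨_, f⟩
    obtain ⟨b', m', f₁', f₂', e'⟩ := exists_cons' ⟨_, f'⟩
    cases e; cases e'
    obtain ⟨h1, h2⟩ := consHom_inj' h
    obtain ⟨h3, h4⟩ := ih h2
    cases h1; cases h3
    exact ⟨rfl, h4⟩

lemma exists_append {l k : List C} (t : Σ x, (l ++ k) ⟶ x) :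
    ∃ (m n : List C) (f : l ⟶ m) (g : k ⟶ n), t = ⟨m ++ n, appendHom f g⟩ := by
  induction l with
  | nil => exact ⟨[], t.1, 𝟙 _, t.2, rfl⟩
  | cons a l ih =>
    obtain ⟨b, m, f, g, rfl⟩ := exists_cons t
    obtain ⟨m', n', f', g', e⟩ := ih ⟨m, g⟩
    cases e
    exact ⟨b :: m', n', consHom f f', g', rfl⟩

lemma exists_append' {l k : List C} (t : Σ x, x ⟶ (l ++ k)) :
    ∃ (m n : List C) (f : m ⟶ l) (g : n ⟶ k), t = ⟨m ++ n, appendHom f g⟩ := by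
  induction l with
  | nil => exact ⟨[], t.1, 𝟙 _, t.2, rfl⟩
  | cons a l ih =>
    obtain ⟨b, m, f, g, rfl⟩ := exists_cons' t
    obtain ⟨m', n', f', g', e⟩ := ih ⟨m, g⟩
    cases e
    exact ⟨b :: m', n', consHom f f', g', rfl⟩

instance : DiscFib (flat (C := C)) where
  bij a := by
    constructor
    · rintro ⟨b, f⟩ ⟨b', f'⟩ h
      induction a generalizing b b' with
      | nil => exact (eq_nil _).trans (eq_nil _).symm
      | cons a l ih =>
        obtain ⟨b, m, f₁, f₂, e⟩ := exists_cons ⟨_, f⟩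
        obtain ⟨b', m', f₁', f₂', e'⟩ := exists_cons ⟨_, f'⟩
        cases e; cases e'
        obtain ⟨h1, h2⟩ := appendHom_inj h
        cases h1
        cases ih _ _ _ _ h2
        rfl
    · intro t
      induction a with
      | nil => exact ⟨⟨[], 𝟙 _⟩, (eq_nil _).trans (eq_nil _).symm⟩
      | cons a l ih =>
        obtain ⟨m, n, f, g, rfl⟩ := exists_append t
        obtain ⟨⟨y, z⟩, e⟩ := ih ⟨n, g⟩
        cases e
        exact ⟨⟨m :: y, consHom f z⟩, rfl⟩
  bij' a := by
    constructor
    · rintro ⟨b, f⟩ ⟨b', f'⟩ h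
      induction a generalizing b b' with
      | nil => exact (eq_nil' _).trans (eq_nil' _).symm
      | cons a l ih =>
        obtain ⟨b, m, f₁, f₂, e⟩ := exists_cons' ⟨_, f⟩
        obtain ⟨b', m', f₁', f₂', e'⟩ := exists_cons' ⟨_, f'⟩
        cases e; cases e'
        obtain ⟨h1, h2⟩ := appendHom_inj' h
        cases h1
        cases ih _ _ _ _ h2
        rfl
    · intro t
      induction a with
      | nil => exact ⟨⟨[], 𝟙 _⟩, (eq_nil' _).trans (eq_nil' _).symm⟩
      | cons a l ih =>
        obtain ⟨m, n, f, g, rfl⟩ := exists_append' t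
        obtain ⟨⟨y, z⟩, e⟩ := ih ⟨n, g⟩
        cases e
        exact ⟨⟨m :: y, consHom f z⟩, rfl⟩
  countable X := by
    have : Function.Injective fun a : {a : List (List C) // flat.obj a = X} =>
        a.1.map List.length := fun a b h =>
      Subtype.ext (List.eq_iff_flatten_eq.2 ⟨a.2.trans b.2.symm, h⟩)
    exact this.countable

end SeqLift

/-! ### Multitensors -/

section SeqHoms

variable {V : Type u} [Category.{v} V] {S T U : Type*}

/-- A map of sequences from a family of maps indexed by related entries. -/
def relHom {p : S → T} {G : S → V} {L : T → V} (c : ∀ s t, p s = t → (G s ⟶ L t)) :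
    (l : List S) → (m : List T) → l.map p = m → (l.map G ⟶ m.map L)
  | [], [], _ => 𝟙 []
  | s :: l, t :: m, h => consHom (c s t (List.cons.inj h).1) (relHom c l m (List.cons.inj h).2)
  | [], _ :: _, h => nomatch h
  | _ :: _, [], h => nomatch h

@[simp] lemma relHom_nil {p : S → T} {G : S → V} {L : T → V}
    (c : ∀ s t, p s = t → (G s ⟶ L t)) (h : ([] : List S).map p = []) :
    relHom c [] [] h = 𝟙 ([] : List V) := rfl

@[simp] lemma relHom_cons {p : S → T} {G : S → V} {L : T → V}
    (c : ∀ s t, p s = t → (G s ⟶ L t)) (s : S) (l : List S) (t : T) (m : List T)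
    (h : (s :: l).map p = t :: m) :
    relHom c (s :: l) (t :: m) h =
      consHom (c s t (List.cons.inj h).1) (relHom c l m (List.cons.inj h).2) := rfl

lemma relHom_comp {p : S → T} {q : T → U} {r : S → U} {G : S → V} {L : T → V} {K : U → V}
    (c : ∀ s t, p s = t → (G s ⟶ L t)) (d : ∀ t x, q t = x → (L t ⟶ K x))
    (e : ∀ s x, r s = x → (G s ⟶ K x))
    (w : ∀ s t x h₁ h₂ h₃, c s t h₁ ≫ d t x h₂ = e s x h₃) (l : List S) (m : List T) (n : List U)
    (h₁ : l.map p = m) (h₂ : m.map q = n) (h₃ : l.map r = n) :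
    relHom c l m h₁ ≫ relHom d m n h₂ = relHom e l n h₃ := by
  induction l generalizing m n with
  | nil => cases h₁; cases h₂; rfl
  | cons s l ih =>
    cases m with | nil => cases h₁ | cons t m =>
    cases n with | nil => cases h₂ | cons x n =>
    exact congr (congrArg consHom (w _ _ _ _ _ _)) (ih _ _ _ _ _)

end SeqHoms

section Fibre

variable {V : Type u} [Category.{v} V] {S T : Type*}

/-- `E` preserves small coproducts in each variable. -/
def Distributive (E : List V ⥤ V) : Prop :=
  ∀ (l m : List V) ⦃J : Type v⦄ (Z : J → V) (P : V) (c : ∀ j, Z j ⟶ P), IsCoprod c →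
    IsCoprod fun j => E.map (appendHom (𝟙 l : l ⟶ l) (consHom (c j) (𝟙 m)))

lemma Distributive.small {E : List V ⥤ V} (hE : Distributive E) (l m : List V) {J : Type*}
    [Small.{v} J] {Z : J → V} {P : V} {c : ∀ j, Z j ⟶ P} (hc : IsCoprod c) :
    IsCoprod fun j => E.map (appendHom (𝟙 l : l ⟶ l) (consHom (c j) (𝟙 m))) := by
  have e := (equivShrink.{v} J)
  have h1 : IsCoprod fun i => c (e.symm i) :=
    hc.reindex e.symm e.symm.bijective (fun _ => 𝟙 _) (by simp)
  refine (hE l m _ _ _ h1).reindex e e.bijective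
    (fun j => eqToHom (by simp)) fun j => ?_
  have : ∀ (i i' : J) (h : i = i'), E.map (appendHom (𝟙 l : l ⟶ l) (consHom (c i) (𝟙 m))) =
      eqToHom (by rw [h]) ≫ E.map (appendHom (𝟙 l : l ⟶ l) (consHom (c i') (𝟙 m))) := by
    rintro i _ rfl; simp
  exact this _ _ (by simp)

/-- Fixing the first variable. -/
def consFunctor (a : V) : List V ⥤ List V where
  obj l := a :: l
  map f := consHom (𝟙 a) f

lemma Distributive.consFunctor {E : List V ⥤ V} (hE : Distributive E) (a : V) :
    Distributive (MultOp.consFunctor a ⋙ E) :=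
  fun l m _ _ _ _ hc => hE (a :: l) m _ _ _ hc

instance small_map_fibre (p : S → T) [∀ t, Small.{w} {s // p s = t}] (m : List T) :
    Small.{w} {l : List S // l.map p = m} := by
  induction m with
  | nil =>
    have : Subsingleton {l : List S // l.map p = []} :=
      ⟨fun a b => Subtype.ext ((List.map_eq_nil_iff.1 a.2).trans (List.map_eq_nil_iff.1 b.2).symm)⟩
    infer_instance
  | cons t m ih =>
    let f : {s // p s = t} × {l : List S // l.map p = m} → {l : List S // l.map p = t :: m} :=
      fun x => ⟨x.1.1 :: x.2.1, by simp [x.1.2, x.2.2]⟩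
    refine small_of_surjective (f := f) ?_
    rintro ⟨l, hl⟩
    cases l with
    | nil => cases hl
    | cons s l =>
      obtain ⟨h1, h2⟩ := List.cons.inj hl
      exact ⟨(⟨s, h1⟩, ⟨l, h2⟩), rfl⟩

/-- Joint distributivity: coproducts in all variables at once. -/
lemma Distributive.fibre {E : List V ⥤ V} (hE : Distributive E) {p : S → T}
    [∀ t, Small.{v} {s // p s = t}] {G : S → V} {L : T → V}
    {c : ∀ s t, p s = t → (G s ⟶ L t)}
    (hc : ∀ t, IsCoprod fun s : {s // p s = t} => c s.1 t s.2) (m : List T) :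
    IsCoprod fun l : {l : List S // l.map p = m} => E.map (relHom c l.1 m l.2) := by
  induction m generalizing E with
  | nil =>
    intro W f
    refine ⟨f ⟨[], rfl⟩, ?_, fun g hg => ?_⟩
    · rintro ⟨l, hl⟩
      obtain rfl := List.map_eq_nil_iff.1 hl
      exact (congrArg (· ≫ _) (E.map_id _)).trans (Category.id_comp _)
    · exact ((congrArg (· ≫ g) (E.map_id _)).trans (Category.id_comp _)).symm.trans (hg ⟨[], rfl⟩)
  | cons t m ih =>
    have h2 := (ih (hE.consFunctor (L t))).sigma fun l => hE.small [] (l.1.map G) (hc t)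
    let e : {l : List S // l.map p = t :: m} →
        Σ _ : {l : List S // l.map p = m}, {s // p s = t} := fun l =>
      match l with
      | ⟨s :: l, h⟩ => ⟨⟨l, (List.cons.inj h).2⟩, ⟨s, (List.cons.inj h).1⟩⟩
    have he : Function.Bijective e := by
      constructor
      · rintro ⟨l, hl⟩ ⟨l', hl'⟩ h
        cases l with | nil => cases hl | cons s l =>
        cases l' with | nil => cases hl' | cons s' l' =>
        have h1 := congrArg (fun x => x.1.1) h
        have h2 := congrArg (fun x => x.2.1) h
        change l = l' at h1
        change s = s' at h2
        subst h1 h2; rfl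
      · rintro ⟨⟨l, hl⟩, ⟨s, hs⟩⟩
        exact ⟨⟨s :: l, by simp [hl, hs]⟩, rfl⟩
    have hk : ∀ l : {l : List S // l.map p = t :: m}, l.1.map G =
        G (e l).2.1 :: (e l).1.1.map G := by
      rintro ⟨l, hl⟩
      cases l with | nil => cases hl | cons s l => rfl
    refine h2.reindex e he (fun l => E.map (eqToHom (hk l))) ?_
    rintro ⟨l, hl⟩
    cases l with | nil => cases hl | cons s l =>
    change _ = E.map (𝟙 _) ≫ E.map _ ≫ E.map (consHom (𝟙 _) _)
    rw [E.map_id, Category.id_comp, ← E.map_comp]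
    change _ = E.map (consHom _ _ ≫ consHom _ _)
    rw [consHom_comp, Category.comp_id, Category.id_comp]
    rfl

end Fibre

lemma isPullback_of_existsUnique {C : Type u} [Category.{v} C] {P X Y Z : C} {f : P ⟶ X}
    {g : P ⟶ Y} {h : X ⟶ Z} {k : Y ⟶ Z} (w : f ≫ h = g ≫ k)
    (H : ∀ (W : C) (p : W ⟶ X) (q : W ⟶ Y), p ≫ h = q ≫ k → ∃! l : W ⟶ P, l ≫ f = p ∧ l ≫ g = q) :
    IsPullback f g h k :=
  ⟨⟨w⟩, ⟨PullbackCone.IsLimit.mk w (fun s => (H _ s.fst s.snd s.condition).choose)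
    (fun s => (H _ s.fst s.snd s.condition).choose_spec.1.1)
    (fun s => (H _ s.fst s.snd s.condition).choose_spec.1.2)
    (fun s m h₁ h₂ => (H _ s.fst s.snd s.condition).choose_spec.2 m ⟨h₁, h₂⟩)⟩⟩

section SeqNat

variable {C : Type u} [Category.{v} C] {D : Type u₁} [Category.{v₁} D]

def mapSeqTransApp {F G : C ⥤ D} (τ : F ⟶ G) : (l : List C) → (l.map F.obj ⟶ l.map G.obj)
  | [] => 𝟙 []
  | a :: l => consHom (τ.app a) (mapSeqTransApp τ l)

/-- The transformation `M τ`. -/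
def mapSeqTrans {F G : C ⥤ D} (τ : F ⟶ G) : mapSeq F ⟶ mapSeq G where
  app := mapSeqTransApp τ
  naturality l m f := by
    induction f using hom_induction with
    | nil => rfl
    | cons f g ih => exact congr (congrArg consHom (τ.naturality f)) ih

lemma mapSeqTrans_cons {F G : C ⥤ D} (τ : F ⟶ G) (a : C) (l : List C) :
    (mapSeqTrans τ).app (a :: l) = consHom (τ.app a) ((mapSeqTrans τ).app l) := rfl

lemma consHom_isPullback {a b c d : C} {f : a ⟶ b} {g : a ⟶ c} {h : b ⟶ d} {k : c ⟶ d}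
    {l m n o : List C} {f' : l ⟶ m} {g' : l ⟶ n} {h' : m ⟶ o} {k' : n ⟶ o}
    (sq : IsPullback f g h k) (sq' : IsPullback f' g' h' k') :
    IsPullback (consHom f f') (consHom g g') (consHom h h') (consHom k k') := by
  refine isPullback_of_existsUnique (by simp [sq.w, sq'.w]) fun W p q e => ?_
  obtain ⟨x, y, p₁, p₂, hp⟩ := exists_cons' ⟨_, p⟩
  cases hp
  obtain ⟨x', y', q₁, q₂, hq⟩ := exists_cons' ⟨_, q⟩
  cases hq
  have e' := consHom_inj (congrArg (Sigma.mk _) e)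
  have e₁ : p₁ ≫ h = q₁ ≫ k := eq_of_heq (Sigma.mk.inj e'.1).2
  have e₂ : p₂ ≫ h' = q₂ ≫ k' := eq_of_heq (Sigma.mk.inj e'.2).2
  refine ⟨consHom (sq.lift _ _ e₁) (sq'.lift _ _ e₂), by simp, ?_⟩
  intro r hr
  obtain ⟨b', m', r₁, r₂, hr'⟩ := exists_cons ⟨_, r⟩
  cases hr'
  obtain ⟨h1, h2⟩ := hr
  have h1' := consHom_inj (congrArg (Sigma.mk _) h1)
  have h2' := consHom_inj (congrArg (Sigma.mk _) h2)
  refine congr (congrArg consHom (sq.hom_ext ?_ ?_)) (sq'.hom_ext ?_ ?_)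
  · rw [sq.lift_fst]; exact eq_of_heq (Sigma.mk.inj h1'.1).2
  · rw [sq.lift_snd]; exact eq_of_heq (Sigma.mk.inj h2'.1).2
  · rw [sq'.lift_fst]; exact eq_of_heq (Sigma.mk.inj h1'.2).2
  · rw [sq'.lift_snd]; exact eq_of_heq (Sigma.mk.inj h2'.2).2

lemma mapSeqTrans_equifibered {F G : C ⥤ D} {τ : F ⟶ G} (h : NatTrans.Equifibered τ) :
    NatTrans.Equifibered (mapSeqTrans τ) := by
  intro l m f
  induction f using hom_induction with
  | nil => exact IsPullback.of_id_fst
  | cons f g ih => exact consHom_isPullback (h f) ih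

lemma appendHom_heq {k l m n k' l' m' n' : List C} {f : k ⟶ l} {g : m ⟶ n} {f' : k' ⟶ l'}
    {g' : m' ⟶ n'} (h₁ : k = k') (h₂ : l = l') (h₃ : m = m') (h₄ : n = n') (hf : HEq f f')
    (hg : HEq g g') : HEq (appendHom f g) (appendHom f' g') := by
  subst h₁ h₂ h₃ h₄; cases hf; cases hg; rfl

lemma consHom_heq {a b : C} {m n m' n' : List C} (f : a ⟶ b) {g : m ⟶ n}
    {g' : m' ⟶ n'} (h₃ : m = m') (h₄ : n = n')
    (hg : HEq g g') : HEq (consHom f g) (consHom f g') := by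
  subst h₃ h₄; cases hg; rfl

lemma mapSeq_append (F : C ⥤ D) {k l m n : List C} (f : k ⟶ l) (g : m ⟶ n) :
    HEq ((mapSeq F).map (appendHom f g)) (appendHom ((mapSeq F).map f) ((mapSeq F).map g)) := by
  induction f using hom_induction with
  | nil => rfl
  | cons f f' ih => exact consHom_heq _ List.map_append List.map_append ih

lemma flat_mapSeq (F : C ⥤ D) {Y Z : List (List C)} (f : Y ⟶ Z) :
    HEq (flat.map ((mapSeq (mapSeq F)).map f)) ((mapSeq F).map (flat.map f)) := by
  induction f using hom_induction with
  | nil => rfl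
  | cons f f' ih =>
    exact (appendHom_heq rfl rfl List.map_flatten.symm List.map_flatten.symm HEq.rfl ih).trans
      (mapSeq_append F _ _).symm

lemma appendHom_assoc {k l m n o p : List C} (f : k ⟶ l) (g : m ⟶ n) (h : o ⟶ p) :
    HEq (appendHom (appendHom f g) h) (appendHom f (appendHom g h)) := by
  induction f using hom_induction with
  | nil => rfl
  | cons f f' ih => exact consHom_heq _ (List.append_assoc _ _ _) (List.append_assoc _ _ _) ih

lemma flat_append {k l m n : List (List C)} (f : k ⟶ l) (g : m ⟶ n) :
    HEq (flat.map (appendHom f g)) (appendHom (flat.map f) (flat.map g)) := by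
  induction f using hom_induction with
  | nil => rfl
  | cons f f' ih =>
    exact (appendHom_heq rfl rfl List.flatten_append List.flatten_append HEq.rfl ih).trans
      (appendHom_assoc _ _ _).symm

lemma flat_flat {Y Z : List (List (List C))} (f : Y ⟶ Z) :
    HEq (flat.map (flat.map f)) (flat.map ((mapSeq flat).map f)) := by
  induction f using hom_induction with
  | nil => rfl
  | cons f f' ih =>
    exact (flat_append _ _).trans (appendHom_heq rfl rfl List.flatten_flatten
      List.flatten_flatten HEq.rfl ih)

lemma exists_lift_mapSeq (p : C ⥤ D) [DiscFib p] {Z : List C} {Y Y' : List D}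
    (h : (mapSeq p).obj Z = Y) (f : Y ⟶ Y') :
    ∃ (Z' : List C) (g : Z ⟶ Z') (_ : (mapSeq p).obj Z' = Y'), HEq ((mapSeq p).map g) f := by
  subst h
  induction Z generalizing Y' with
  | nil => cases eq_nil ⟨_, f⟩; exact ⟨[], 𝟙 _, rfl, HEq.rfl⟩
  | cons a l ih =>
    obtain ⟨b, m, f₁, f₂, e⟩ := exists_cons ⟨_, f⟩
    cases e
    obtain ⟨Z', g, h, w⟩ := ih f₂
    obtain ⟨b', g', h', w'⟩ := exists_lift p rfl f₁
    subst h h'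
    cases w; cases w'
    exact ⟨b' :: Z', consHom g' g, rfl, HEq.rfl⟩

end SeqNat

lemma exists_split {S T : Type*} (f : S → T) (W : List (List T)) (Y : List S)
    (h : W.flatten = Y.map f) : ∃ Z : List (List S), Z.flatten = Y ∧ Z.map (List.map f) = W := by
  induction W generalizing Y with
  | nil =>
    refine ⟨[], ?_, rfl⟩
    simpa using h.symm
  | cons w W ih =>
    obtain ⟨Y₁, Y₂, rfl, rfl, h₂⟩ := List.map_eq_append_iff.1 (show Y.map f = w ++ W.flatten from h.symm)
    obtain ⟨Z, rfl, rfl⟩ := ih Y₂ h₂.symm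
    exact ⟨Y₁ :: Z, rfl, rfl⟩

lemma split_unique {S T : Type*} (f : S → T) {Z Z' : List (List S)} (h : Z.flatten = Z'.flatten)
    (h' : Z.map (List.map f) = Z'.map (List.map f)) : Z = Z' := by
  refine List.eq_iff_flatten_eq.2 ⟨h, ?_⟩
  have := congrArg (List.map List.length) h'
  simpa [Function.comp_def] using this

noncomputable def IsCoprod.iso {V : Type u} [Category.{v} V] {J : Type*} {Z : J → V} {P P' : V}
    {c : ∀ j, Z j ⟶ P} {c' : ∀ j, Z j ⟶ P'} (h : IsCoprod c) (h' : IsCoprod c') : P ≅ P' where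
  hom := h.desc c'
  inv := h'.desc c
  hom_inv_id := h.hom_ext fun j => by simp
  inv_hom_id := h'.hom_ext fun j => by simp

lemma flat_map {C : Type u} [Category.{v} C] {D : Type u₁} [Category.{v₁} D] (F : C ⥤ D)
    (Z : List (List C)) (Y : List C) (h : flat.obj Z = Y) :
    flat.obj (Z.map (mapSeq F).obj) = (mapSeq F).obj Y := by
  subst h; exact List.map_flatten.symm

section Comp

variable {V : Type u} [Category.{v} V] [Lextensive V]

/-- The composite `A ∘ B`, whose value at a sequence `X` is the coproduct, over all the ways of
writing `X` as a concatenation of sequences `X₁, …, Xₖ`, of the objects `A (B X₁, …, B Xₖ)`. It is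
the left Kan extension of `A ∘ M B` along concatenation. -/
noncomputable abbrev comp (A B : List V ⥤ V) : List V ⥤ V := lan flat (mapSeq B ⋙ A)

/-- The unit of the composition: its value at a sequence `X` is `X₁` if `X = (X₁)`, and is initial
if `X` is not of length one. It is the left Kan extension of the identity along the inclusion of
the sequences of length one. -/
noncomputable abbrev unit : List V ⥤ V := lan single (𝟭 V)

section Assoc

variable (A B C : List V ⥤ V)

/-- `B (C Z₁, …, C Zₖ)`. -/
abbrev two (Y : List (List V)) : V := B.obj ((mapSeq C).obj Y)

/-- The inclusion of `A_i B_j C_k X_{ijk}` in `(A ∘ (B ∘ C)) X`. -/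
noncomputable def inclR (Z : List (List (List V))) (Y : List (List V)) (X : List V)
    (h : Z.map flat.obj = Y) (h' : flat.obj Y = X) :
    A.obj (Z.map (two B C)) ⟶ (comp A (comp B C)).obj X :=
  A.map (relHom (fun s t h => lanι flat (mapSeq C ⋙ B) s h) Z Y h) ≫
    lanι flat (mapSeq (comp B C) ⋙ A) Y h'

lemma map_two (Z : List (List (List V))) :
    Z.map (two B C) = (mapSeq B).obj (Z.map (mapSeq C).obj) := (List.map_map ..).symm

/-- The inclusion of `A_i B_j C_k X_{ijk}` in `((A ∘ B) ∘ C) X`. -/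
noncomputable def inclL (Z : List (List (List V))) (Y : List (List V)) (X : List V)
    (h : flat.obj Z = Y) (h' : flat.obj Y = X) :
    A.obj (Z.map (two B C)) ⟶ (comp (comp A B) C).obj X :=
  A.map (eqToHom (map_two B C Z)) ≫
    lanι flat (mapSeq B ⋙ A) (Z.map (mapSeq C).obj) (flat_map C Z Y h) ≫
      lanι flat (mapSeq C ⋙ comp A B) Y h'

lemma inclR_isCoprod (hA : Distributive A) (X : List V) :
    IsCoprod fun Z : {Z : List (List (List V)) // flat.obj (flat.obj Z) = X} =>
      inclR A B C Z.1 _ X rfl (List.flatten_flatten.symm.trans Z.2) := by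
  have h1 := fun Y : List (List V) => hA.fibre
    (c := fun s t h => lanι flat (mapSeq C ⋙ B) s h) (lan_isCoprod flat (mapSeq C ⋙ B)) Y
  have h2 := (lan_isCoprod flat (mapSeq (comp B C) ⋙ A) X).sigma fun Y => h1 Y.1
  refine h2.reindex (fun Z => ⟨⟨_, List.flatten_flatten.symm.trans Z.2⟩, ⟨Z.1, rfl⟩⟩) ⟨?_, ?_⟩
    (fun Z => 𝟙 _) fun Z => (Category.id_comp _).symm
  · intro Z Z' h
    exact Subtype.ext (congrArg (fun x => x.2.1) h)
  · rintro ⟨⟨Y, hY⟩, ⟨Z, hZ⟩⟩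
    change Z.map flat.obj = Y at hZ
    subst hZ
    exact ⟨⟨Z, List.flatten_flatten.trans hY⟩, rfl⟩

lemma inclL_isCoprod (X : List V) :
    IsCoprod fun Z : {Z : List (List (List V)) // flat.obj (flat.obj Z) = X} =>
      inclL A B C Z.1 _ X rfl Z.2 := by
  have h2 := (lan_isCoprod flat (mapSeq C ⋙ comp A B) X).sigma fun Y =>
    lan_isCoprod flat (mapSeq B ⋙ A) ((mapSeq C).obj Y.1)
  refine h2.reindex (fun Z => ⟨⟨_, Z.2⟩, ⟨Z.1.map (mapSeq C).obj, flat_map C _ _ rfl⟩⟩) ⟨?_, ?_⟩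
    (fun Z => A.map (eqToHom (map_two B C Z.1))) fun Z => rfl
  · intro Z Z' h
    refine Subtype.ext (split_unique C.obj ?_ ?_)
    · exact congrArg (fun x => x.1.1) h
    · exact congrArg (fun x => x.2.1) h
  · rintro ⟨⟨Y, hY⟩, ⟨W, hW⟩⟩
    obtain ⟨Z, rfl, rfl⟩ := exists_split C.obj W Y hW
    exact ⟨⟨Z, hY⟩, rfl⟩

def twoHom {Z Z' : List (List (List V))} (z : Z ⟶ Z') : Z.map (two B C) ⟶ Z'.map (two B C) :=
  (mapSeq (mapSeq C ⋙ B)).map z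

lemma eqToHom_naturality {D : Type u₁} [Category.{v₁} D] {a a' b b' : D} (h : a = a') (h' : b = b')
    (f : a ⟶ b) (f' : a' ⟶ b') (w : HEq f f') : eqToHom h ≫ f' = f ≫ eqToHom h' := by
  subst h h'; cases w; simp

lemma twoHom_heq {Z Z' : List (List (List V))} (z : Z ⟶ Z') :
    HEq (twoHom B C z) ((mapSeq B).map ((mapSeq (mapSeq C)).map z)) := by
  induction z using hom_induction with
  | nil => rfl
  | cons f g ih => exact consHom_heq _ (map_two B C _) (map_two B C _) ih

lemma relHom_twoHom {Z Z' : List (List (List V))} (z : Z ⟶ Z') :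
    relHom (fun s t h => lanι flat (mapSeq C ⋙ B) s h) Z (Z.map flat.obj) rfl ≫
      (mapSeq (comp B C)).map ((mapSeq flat).map z) =
    twoHom B C z ≫ relHom (fun s t h => lanι flat (mapSeq C ⋙ B) s h) Z' (Z'.map flat.obj) rfl := by
  induction z using hom_induction with
  | nil => rfl
  | cons f g ih =>
    exact congr (congrArg consHom (lanι_map flat (mapSeq C ⋙ B) f rfl rfl _ HEq.rfl)) ih

lemma inclR_naturality {Z Z' : List (List (List V))} (z : Z ⟶ Z') {X X' : List V}
    (h : flat.obj (Z.map flat.obj) = X) (h' : flat.obj (Z'.map flat.obj) = X') (f : X ⟶ X')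
    (w : HEq (flat.map (flat.map z)) f) :
    inclR A B C Z _ X rfl h ≫ (comp A (comp B C)).map f =
      A.map (twoHom B C z) ≫ inclR A B C Z' _ X' rfl h' := by
  have := lanι_map flat (mapSeq (comp B C) ⋙ A) ((mapSeq flat).map z) h h' f
    ((flat_flat z).symm.trans w)
  rw [inclR, inclR, Category.assoc, this, ← A.map_comp_assoc, ← relHom_twoHom, A.map_comp_assoc]
  rfl

lemma inclL_naturality {Z Z' : List (List (List V))} (z : Z ⟶ Z') {X X' : List V}
    (h : flat.obj (flat.obj Z) = X) (h' : flat.obj (flat.obj Z') = X') (f : X ⟶ X')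
    (w : HEq (flat.map (flat.map z)) f) :
    inclL A B C Z _ X rfl h ≫ (comp (comp A B) C).map f =
      A.map (twoHom B C z) ≫ inclL A B C Z' _ X' rfl h' := by
  have e1 := lanι_map flat (mapSeq C ⋙ comp A B) (flat.map z) h h' f w
  have e2 := lanι_map flat (mapSeq B ⋙ A) ((mapSeq (mapSeq C)).map z) (flat_map C Z _ rfl)
    (flat_map C Z' _ rfl) ((mapSeq C).map (flat.map z)) (flat_mapSeq C z)
  have e3 := eqToHom_naturality (map_two B C Z) (map_two B C Z') _ _ (twoHom_heq B C z)
  rw [inclL, inclL, Category.assoc, Category.assoc, e1, ← A.map_comp_assoc, ← e3,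
    A.map_comp_assoc]
  congr 1
  exact (Category.assoc _ _ _).symm.trans ((congrArg (· ≫ _) e2).trans (Category.assoc _ _ _))

/-- The associativity isomorphism. -/
noncomputable def assocIso (hA : Distributive A) : comp (comp A B) C ≅ comp A (comp B C) :=
  NatIso.ofComponents
    (fun X => (inclL_isCoprod A B C X).iso (inclR_isCoprod A B C hA X))
    fun {X X'} f => (inclL_isCoprod A B C X).hom_ext fun ⟨Z, h⟩ => by
      obtain ⟨Y', y, hY', w⟩ := exists_lift flat h f
      obtain ⟨Z', z, hZ', w'⟩ := exists_lift flat rfl y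
      subst h hZ' hY'
      cases w'; cases w
      have f1 := (inclL_isCoprod A B C (flat.obj (flat.obj Z))).fac
        (fun Z => inclR A B C Z.1 _ _ rfl (List.flatten_flatten.symm.trans Z.2)) ⟨Z, rfl⟩
      have f2 := (inclL_isCoprod A B C (flat.obj (flat.obj Z'))).fac
        (fun Z => inclR A B C Z.1 _ _ rfl (List.flatten_flatten.symm.trans Z.2)) ⟨Z', rfl⟩
      erw [reassoc_of% inclL_naturality A B C z rfl rfl _ HEq.rfl, f2, reassoc_of% f1,
        inclR_naturality A B C z _ List.flatten_flatten.symm _ HEq.rfl]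

end Assoc

end Comp

section LanMap

variable {A : Type u₁} [Category.{v₁} A] {B : Type u₂} [Category.{v₂} B] (p : A ⥤ B) [DiscFib p]
  {V : Type u} [Category.{v} V] [Lextensive V] {G G' G'' : A ⥤ V} {K : B ⥤ V}

/-- Functoriality of the left Kan extension. -/
noncomputable def lanMapTrans (θ : G ⟶ G') : lan p G ⟶ lan p G' := lanDesc (θ ≫ lanUnit p G')

lemma lanι_mapTrans (θ : G ⟶ G') (a : A) {X : B} (h : p.obj a = X) :
    lanι p G a h ≫ (lanMapTrans p θ).app X = θ.app a ≫ lanι p G' a h := by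
  rw [lanMapTrans, lanι_desc, NatTrans.comp_app, Category.assoc]
  exact congrArg (θ.app a ≫ ·) (lanι_eqToHom a rfl h)

lemma lanι_mapTrans_assoc (θ : G ⟶ G') (a : A) {X : B} (h : p.obj a = X) {W : V}
    (k : (lan p G').obj X ⟶ W) :
    lanι p G a h ≫ (lanMapTrans p θ).app X ≫ k = θ.app a ≫ lanι p G' a h ≫ k := by
  rw [← Category.assoc, lanι_mapTrans, Category.assoc]

lemma lanMapTrans_id : lanMapTrans p (𝟙 G) = 𝟙 _ := by
  ext X
  refine lan_ext fun a h => (lanι_mapTrans p _ a h).trans ?_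
  simp

lemma lanMapTrans_comp (θ : G ⟶ G') (θ' : G' ⟶ G'') :
    lanMapTrans p (θ ≫ θ') = lanMapTrans p θ ≫ lanMapTrans p θ' := by
  ext X
  refine lan_ext fun a h => (lanι_mapTrans p _ a h).trans ?_
  rw [NatTrans.comp_app, NatTrans.comp_app, lanι_mapTrans_assoc, lanι_mapTrans, Category.assoc]

lemma lanMapTrans_desc (θ : G ⟶ G') (κ : G' ⟶ p ⋙ K) :
    lanMapTrans p θ ≫ lanDesc κ = lanDesc (θ ≫ κ) := by
  ext X
  refine lan_ext fun a h => ?_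
  rw [NatTrans.comp_app, lanι_mapTrans_assoc, lanι_desc, lanι_desc, NatTrans.comp_app,
    Category.assoc]

end LanMap

section SingleFlat

variable {V : Type u} [Category.{v} V]

lemma flat_map_single (X : List V) : flat.obj ((mapSeq single).obj X) = X := by
  induction X with
  | nil => rfl
  | cons x X ih => exact congrArg (x :: ·) ih

lemma flat_mapSeq_single {X X' : List V} (f : X ⟶ X') :
    HEq (flat.map ((mapSeq single).map f)) f := by
  induction f using hom_induction with
  | nil => rfl
  | cons f g ih => exact consHom_heq _ (flat_map_single _) (flat_map_single _) ih

lemma flat_single (X : List V) : flat.obj [X] = X := List.append_nil X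

lemma flat_map_consHom {X X' : List V} (f : X ⟶ X') :
    HEq (flat.map (single.map f)) f := by
  change HEq (appendHom f (𝟙 ([] : List V))) f
  induction f using hom_induction with
  | nil => rfl
  | cons f g ih => exact consHom_heq _ (List.append_nil _) (List.append_nil _) ih

end SingleFlat

section CompMap

variable {V : Type u} [Category.{v} V] [Lextensive V]

lemma mapSeqTrans_id {C : Type u} [Category.{v} C] {D : Type u₁} [Category.{v₁} D] (F : C ⥤ D) :
    mapSeqTrans (𝟙 F) = 𝟙 (mapSeq F) := by
  ext l
  induction l with
  | nil => rfl
  | cons a l ih => exact congrArg (consHom (𝟙 (F.obj a))) ih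

lemma mapSeqTrans_comp {C : Type u} [Category.{v} C] {D : Type u₁} [Category.{v₁} D]
    {F G H : C ⥤ D} (τ : F ⟶ G) (τ' : G ⟶ H) :
    mapSeqTrans (τ ≫ τ') = mapSeqTrans τ ≫ mapSeqTrans τ' := by
  ext l
  induction l with
  | nil => rfl
  | cons a l ih => exact congrArg (consHom (τ.app a ≫ τ'.app a)) ih

/-- `B` followed by `A`, on maps. -/
def twoTrans {A A' B B' : List V ⥤ V} (φ : A ⟶ A') (ψ : B ⟶ B') :
    mapSeq B ⋙ A ⟶ mapSeq B' ⋙ A' := mapSeqTrans ψ ◫ φ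

lemma twoTrans_app {A A' B B' : List V ⥤ V} (φ : A ⟶ A') (ψ : B ⟶ B') (Y : List (List V)) :
    (twoTrans φ ψ).app Y = φ.app ((mapSeq B).obj Y) ≫ A'.map ((mapSeqTrans ψ).app Y) := rfl

lemma twoTrans_app' {A A' B B' : List V ⥤ V} (φ : A ⟶ A') (ψ : B ⟶ B') (Y : List (List V)) :
    (twoTrans φ ψ).app Y = A.map ((mapSeqTrans ψ).app Y) ≫ φ.app ((mapSeq B').obj Y) :=
  (φ.naturality _).symm

/-- Functoriality of the composition in both variables. -/
noncomputable def compMap {A A' B B' : List V ⥤ V} (φ : A ⟶ A') (ψ : B ⟶ B') :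
    comp A B ⟶ comp A' B' := lanMapTrans flat (twoTrans φ ψ)

lemma compMap_id (A B : List V ⥤ V) : compMap (𝟙 A) (𝟙 B) = 𝟙 (comp A B) := by
  have : twoTrans (𝟙 A) (𝟙 B) = 𝟙 (mapSeq B ⋙ A) := by
    ext Y
    rw [twoTrans_app, mapSeqTrans_id]
    exact (Category.id_comp _).trans (A.map_id _)
  rw [compMap, this, lanMapTrans_id]

lemma compMap_comp {A A' A'' B B' B'' : List V ⥤ V} (φ : A ⟶ A') (φ' : A' ⟶ A'') (ψ : B ⟶ B')
    (ψ' : B' ⟶ B'') : compMap (φ ≫ φ') (ψ ≫ ψ') = compMap φ ψ ≫ compMap φ' ψ' := by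
  rw [compMap, compMap, compMap, ← lanMapTrans_comp]
  rw [twoTrans, mapSeqTrans_comp, NatTrans.exchange]
  rfl

lemma lanι_compMap {A A' B B' : List V ⥤ V} (φ : A ⟶ A') (ψ : B ⟶ B') (Y : List (List V))
    {X : List V} (h : flat.obj Y = X) :
    lanι flat (mapSeq B ⋙ A) Y h ≫ (compMap φ ψ).app X =
      (twoTrans φ ψ).app Y ≫ lanι flat (mapSeq B' ⋙ A') Y h :=
  lanι_mapTrans flat _ Y h

/-- The sequence of maps `u x : x ⟶ E (x)`. -/
def unitSeq {E : List V ⥤ V} (u : 𝟭 V ⟶ single ⋙ E) :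
    (X : List V) → (X ⟶ (mapSeq E).obj (X.map single.obj))
  | [] => 𝟙 []
  | x :: X => consHom (u.app x) (unitSeq u X)

lemma unitSeq_naturality {E : List V ⥤ V} (u : 𝟭 V ⟶ single ⋙ E) {X X' : List V} (f : X ⟶ X') :
    f ≫ unitSeq u X' = unitSeq u X ≫ (mapSeq E).map ((mapSeq single).map f) := by
  induction f using hom_induction with
  | nil => rfl
  | cons f g ih => exact congr (congrArg consHom (u.naturality f)) ih

lemma unitSeq_mapTrans {E E' : List V ⥤ V} (u : 𝟭 V ⟶ single ⋙ E) (α : E ⟶ E') (X : List V) :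
    unitSeq u X ≫ (mapSeqTrans α).app (X.map single.obj) =
      unitSeq (u ≫ Functor.whiskerLeft single α) X := by
  induction X with
  | nil => rfl
  | cons x X ih => exact congrArg (consHom _) ih

section Unitors

variable (A : List V ⥤ V)

/-- The canonical map `A X ⟶ (I ∘ A) X`. -/
noncomputable def unitL : A ⟶ comp unit A where
  app X := lanι single (𝟭 V) (A.obj X) rfl ≫ lanι flat (mapSeq A ⋙ unit) [X] (flat_single X)
  naturality X X' f := by
    have e1 := lanι_map single (𝟭 V) (A.map f) rfl rfl _ HEq.rfl
    have e2 := lanι_map flat (mapSeq A ⋙ unit) (single.map f) (flat_single X) (flat_single X') f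
      (flat_map_consHom f)
    rw [Category.assoc, e2]
    exact (Category.assoc _ _ _).symm.trans ((congrArg (· ≫ _) e1.symm).trans (Category.assoc _ _ _))

/-- The canonical map `A X ⟶ (A ∘ I) X`. -/
noncomputable def unitR : A ⟶ comp A unit where
  app X := A.map (unitSeq (lanUnit single (𝟭 V)) X) ≫
    lanι flat (mapSeq unit ⋙ A) ((mapSeq single).obj X) (flat_map_single X)
  naturality X X' f := by
    have e1 := unitSeq_naturality (lanUnit single (𝟭 V)) f
    have e2 := lanι_map flat (mapSeq unit ⋙ A) ((mapSeq single).map f) (flat_map_single X)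
      (flat_map_single X') f (flat_mapSeq_single f)
    rw [Category.assoc, e2, ← A.map_comp_assoc, e1, A.map_comp_assoc]
    rfl

end Unitors

end CompMap

lemma IsCoprod.isIso_of_unit {V : Type u} [Category.{v} V] {P Q : V} {f : P ⟶ Q}
    (h : IsCoprod fun _ : Unit => f) : IsIso f := by
  refine ⟨h.desc fun _ => 𝟙 P, h.fac _ (), h.hom_ext fun _ => ?_⟩
  exact (h.fac_assoc _ () f).trans ((Category.id_comp f).trans (Category.comp_id f).symm)

section CompUnit

variable {V : Type u} [Category.{v} V] [Lextensive V] (A : List V ⥤ V)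

lemma unitL_isIso (X : List V) : IsIso ((unitL A).app X) := by
  have h := (lan_isCoprod flat (mapSeq A ⋙ unit) X).sigma fun Y =>
    lan_isCoprod single (𝟭 V) ((mapSeq A).obj Y.1)
  refine IsCoprod.isIso_of_unit (h.reindex
    (fun _ => ⟨⟨[X], flat_single X⟩, ⟨A.obj X, rfl⟩⟩) ⟨fun _ _ _ => rfl, ?_⟩ (fun _ => 𝟙 _)
    fun _ => (Category.id_comp _).symm)
  rintro ⟨⟨Y, hY⟩, ⟨a, ha⟩⟩
  cases Y with
  | nil => cases ha
  | cons y Y =>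
    cases Y with
    | nil =>
      obtain rfl : y = X := (flat_single y).symm.trans hY
      obtain rfl : a = A.obj y := (List.cons.inj ha).1
      exact ⟨(), rfl⟩
    | cons y' Y => exact nomatch (List.cons.inj ha).2

/-- The left unit isomorphism. -/
noncomputable def leftIso : comp unit A ≅ A :=
  haveI := unitL_isIso A
  haveI := NatIso.isIso_of_isIso_app (unitL A)
  (asIso (unitL A)).symm

lemma unitSeq_relHom (X : List V) (h : X.map (𝟭 V).obj = X) :
    eqToHom h ≫ unitSeq (lanUnit single (𝟭 V)) X =
      relHom (fun s t h => lanι single (𝟭 V) s h) X ((mapSeq single).obj X) rfl := by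
  induction X with
  | nil => rfl
  | cons x X ih =>
    have h' := (List.cons.inj h).2
    refine (congrArg (· ≫ _) (eqToHom_cons rfl h' h)).trans ?_
    exact congr (congrArg consHom (Category.id_comp _)) (ih h')

lemma unitR_isIso (hA : Distributive A) (X : List V) : IsIso ((unitR A).app X) := by
  have h1 := fun Y : List (List V) => hA.fibre
    (c := fun s t h => lanι single (𝟭 V) s h) (lan_isCoprod single (𝟭 V)) Y
  have h := (lan_isCoprod flat (mapSeq unit ⋙ A) X).sigma fun Y => h1 Y.1
  have hX : X = X.map (𝟭 V).obj := (List.map_id X).symm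
  refine IsCoprod.isIso_of_unit (h.reindex
    (fun _ => ⟨⟨(mapSeq single).obj X, flat_map_single X⟩, ⟨X, rfl⟩⟩) ⟨fun _ _ _ => rfl, ?_⟩
    (fun _ => A.map (eqToHom hX)) fun _ => ?_)
  · rintro ⟨⟨Y, hY⟩, ⟨Z, hZ⟩⟩
    change Z.map single.obj = Y at hZ
    subst hZ
    obtain rfl : Z = X := (flat_map_single Z).symm.trans hY
    exact ⟨(), rfl⟩
  · change A.map _ ≫ _ = _ ≫ A.map _ ≫ _
    rw [← unitSeq_relHom X hX.symm, ← A.map_comp_assoc, ← Category.assoc (eqToHom hX),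
      eqToHom_trans, eqToHom_refl, Category.id_comp]

/-- The right unit isomorphism. -/
noncomputable def rightIso (hA : Distributive A) : comp A unit ≅ A :=
  haveI := unitR_isIso A hA
  haveI := NatIso.isIso_of_isIso_app (unitR A)
  (asIso (unitR A)).symm

variable {A} {A' : List V ⥤ V}

lemma unitL_naturality (φ : A ⟶ A') : unitL A ≫ compMap (𝟙 unit) φ = φ ≫ unitL A' := by
  ext X
  have e1 := lanι_compMap (𝟙 unit) φ [X] (flat_single X)
  have e2 := lanι_map single (𝟭 V) (φ.app X) (rfl : single.obj (A.obj X) = _) rfl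
    ((mapSeqTrans φ).app [X]) HEq.rfl
  have e3 : (twoTrans (𝟙 unit) φ).app [X] = unit.map ((mapSeqTrans φ).app [X]) :=
    Category.id_comp _
  rw [e3] at e1
  rw [NatTrans.comp_app, NatTrans.comp_app]
  refine (Category.assoc _ _ _).trans ((congrArg (_ ≫ ·) e1).trans ?_)
  exact (Category.assoc _ _ _).symm.trans ((congrArg (· ≫ _) e2).trans (Category.assoc _ _ _))

lemma unitR_naturality (φ : A ⟶ A') : unitR A ≫ compMap φ (𝟙 unit) = φ ≫ unitR A' := by
  ext X
  have e1 := lanι_compMap φ (𝟙 unit) ((mapSeq single).obj X) (flat_map_single X)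
  have e3 : (twoTrans φ (𝟙 unit)).app ((mapSeq single).obj X) = φ.app _ := by
    rw [twoTrans_app, mapSeqTrans_id]
    exact (congrArg (_ ≫ ·) (A'.map_id _)).trans (Category.comp_id _)
  rw [e3] at e1
  rw [NatTrans.comp_app, NatTrans.comp_app]
  refine (Category.assoc _ _ _).trans ((congrArg (_ ≫ ·) e1).trans ?_)
  exact φ.naturality_assoc _ _

lemma inclL_assoc (A B C : List V ⥤ V) (hA : Distributive A) (Z : List (List (List V)))
    (X : List V) (h : flat.obj (flat.obj Z) = X) :
    inclL A B C Z _ X rfl h ≫ (assocIso A B C hA).hom.app X =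
      inclR A B C Z _ X rfl (List.flatten_flatten.symm.trans h) :=
  (inclL_isCoprod A B C X).fac
    (fun Z => inclR A B C Z.1 _ X rfl (List.flatten_flatten.symm.trans Z.2)) ⟨Z, h⟩

section Naturality

variable {B B' C C' : List V ⥤ V} (φ : A ⟶ A') (ψ : B ⟶ B') (χ : C ⟶ C')

/-- The effect of three transformations on `A_i B_j C_k X_{ijk}`. -/
def threeTrans (Z : List (List (List V))) :
    A.obj (Z.map (two B C)) ⟶ A'.obj (Z.map (two B' C')) :=
  φ.app _ ≫ A'.map ((mapSeqTrans (twoTrans ψ χ)).app Z)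

lemma three_aux {M N M' N' : List V} (r : M ⟶ N) (t : N ⟶ N') (s : M ⟶ M') (r' : M' ⟶ N')
    (e : r ≫ t = s ≫ r') {W : V} (k : A'.obj N' ⟶ W) :
    A.map r ≫ (φ.app N ≫ A'.map t) ≫ k = (φ.app M ≫ A'.map s) ≫ A'.map r' ≫ k := by
  rw [Category.assoc, Category.assoc, ← A'.map_comp_assoc s, ← e, φ.naturality_assoc,
    A'.map_comp_assoc]

lemma inclR_compMap (Z : List (List (List V))) (Y : List (List V)) (X : List V)
    (h : Z.map flat.obj = Y) (h' : flat.obj Y = X) :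
    inclR A B C Z Y X h h' ≫ (compMap φ (compMap ψ χ)).app X =
      threeTrans φ ψ χ Z ≫ inclR A' B' C' Z Y X h h' := by
  have e1 := lanι_compMap φ (compMap ψ χ) Y h'
  have e2 : relHom (fun s t h => lanι flat (mapSeq C ⋙ B) s h) Z Y h ≫
      (mapSeqTrans (compMap ψ χ)).app Y = (mapSeqTrans (twoTrans ψ χ)).app Z ≫
        relHom (fun s t h => lanι flat (mapSeq C' ⋙ B') s h) Z Y h := by
    subst h
    clear h' e1
    induction Z with
    | nil => rfl
    | cons z Z ih => exact congr (congrArg consHom (lanι_compMap ψ χ z rfl)) ih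
  rw [inclR, inclR, Category.assoc, e1]
  exact three_aux φ _ _ _ _ e2 _

lemma flat_mapSeqTrans (Z : List (List (List V))) (Y : List (List V)) (h : flat.obj Z = Y) :
    HEq (flat.map ((mapSeqTrans (mapSeqTrans χ)).app Z)) ((mapSeqTrans χ).app Y) := by
  subst h
  have app : ∀ X X' : List (List V),
      HEq (appendHom ((mapSeqTrans χ).app X) ((mapSeqTrans χ).app X'))
      ((mapSeqTrans χ).app (X ++ X')) := by
    intro X X'
    induction X with
    | nil => rfl
    | cons x X ih => exact consHom_heq _ List.map_append.symm List.map_append.symm ih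
  induction Z with
  | nil => rfl
  | cons z Z ih =>
    exact (appendHom_heq rfl rfl List.map_flatten.symm List.map_flatten.symm HEq.rfl ih).trans
      (app _ _)

lemma inclL_compMap (Z : List (List (List V))) (Y : List (List V)) (X : List V)
    (h : flat.obj Z = Y) (h' : flat.obj Y = X) :
    inclL A B C Z Y X h h' ≫ (compMap (compMap φ ψ) χ).app X =
      threeTrans φ ψ χ Z ≫ inclL A' B' C' Z Y X h h' := by
  have e1 := lanι_compMap (compMap φ ψ) χ Y h'
  have e2 := lanι_compMap φ ψ (Z.map (mapSeq C).obj) (flat_map C Z Y h)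
  have e3 := lanι_map flat (mapSeq B' ⋙ A') ((mapSeqTrans (mapSeqTrans χ)).app Z)
    (flat_map C Z Y h) (flat_map C' Z Y h) ((mapSeqTrans χ).app Y) (flat_mapSeqTrans χ Z Y h)
  have e4 : eqToHom (map_two B C Z) ≫ (mapSeqTrans ψ).app (Z.map (mapSeq C).obj) ≫
      (mapSeq B').map ((mapSeqTrans (mapSeqTrans χ)).app Z) =
      (mapSeqTrans (twoTrans ψ χ)).app Z ≫ eqToHom (map_two B' C' Z) := by
    clear e1 e2 e3 h h'
    induction Z with
    | nil => rfl
    | cons z Z ih =>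
      refine (congrArg (· ≫ _) (eqToHom_cons rfl (map_two B C Z) (map_two B C (z :: Z)))).trans ?_
      refine Eq.trans ?_ (congrArg (_ ≫ ·)
        (eqToHom_cons rfl (map_two B' C' Z) (map_two B' C' (z :: Z)))).symm
      refine congr (congrArg consHom ?_) ih
      exact (Category.id_comp _).trans (Category.comp_id _).symm
  rw [inclL, inclL, Category.assoc, Category.assoc, e1]
  have e5 : lanι flat (mapSeq B ⋙ A) (Z.map (mapSeq C).obj) (flat_map C Z Y h) ≫
      (twoTrans (compMap φ ψ) χ).app Y =
      (φ.app _ ≫ A'.map ((mapSeqTrans ψ).app (Z.map (mapSeq C).obj) ≫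
        (mapSeq B').map ((mapSeqTrans (mapSeqTrans χ)).app Z))) ≫
      lanι flat (mapSeq B' ⋙ A') (Z.map (mapSeq C').obj) (flat_map C' Z Y h) := by
    refine (Category.assoc _ _ _).symm.trans ((congrArg (· ≫ _) e2).trans ?_)
    refine (Category.assoc _ _ _).trans ((congrArg (_ ≫ ·) e3).trans ?_)
    rw [twoTrans_app, A'.map_comp]
    simp only [Category.assoc]
    rfl
  refine Eq.trans ?_ (three_aux φ _ _ _ _ e4 _)
  refine congrArg (_ ≫ ·) ?_
  refine (Category.assoc _ _ _).symm.trans ((congrArg (· ≫ _) e5).trans (Category.assoc _ _ _))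

lemma assocIso_naturality (hA : Distributive A) (hA' : Distributive A') :
    (assocIso A B C hA).hom ≫ compMap φ (compMap ψ χ) =
      compMap (compMap φ ψ) χ ≫ (assocIso A' B' C' hA').hom := by
  ext X
  refine (inclL_isCoprod A B C X).hom_ext fun ⟨Z, h⟩ => ?_
  have f1 := inclL_assoc A B C hA Z X h
  have f2 := inclL_assoc A' B' C' hA' Z X h
  rw [NatTrans.comp_app, NatTrans.comp_app, ← Category.assoc, f1, inclR_compMap, ← Category.assoc,
    inclL_compMap, Category.assoc, f2]

end Naturality

end CompUnit

section Triangle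

variable {V : Type u} [Category.{v} V] [Lextensive V] (A B : List V ⥤ V)

lemma inclL_assoc' (A B C : List V ⥤ V) (hA : Distributive A) (Z : List (List (List V)))
    (Y Y' : List (List V)) (X : List V) (h₁ : flat.obj Z = Y) (h₂ : flat.obj Y = X)
    (h₃ : Z.map flat.obj = Y') (h₄ : flat.obj Y' = X) :
    inclL A B C Z Y X h₁ h₂ ≫ (assocIso A B C hA).hom.app X = inclR A B C Z Y' X h₃ h₄ := by
  subst h₁ h₃
  exact inclL_assoc A B C hA Z X h₂

lemma map_single_map (Y : List (List V)) :
    (mapSeq single).obj ((mapSeq B).obj Y) = ((mapSeq single).obj Y).map (mapSeq B).obj := by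
  induction Y with
  | nil => rfl
  | cons y Y ih => exact congrArg ([B.obj y] :: ·) ih

lemma triangle_aux (Y : List (List V)) (h : ((mapSeq single).obj Y).map flat.obj = Y) :
    (unitSeq (lanUnit single (𝟭 V)) ((mapSeq B).obj Y) ≫
      (mapSeq unit).map (eqToHom (map_single_map B Y)) ≫ eqToHom (map_two unit B _).symm) ≫
      relHom (fun s t h => lanι flat (mapSeq B ⋙ unit) s h) ((mapSeq single).obj Y) Y h =
    (mapSeqTrans (unitL B)).app Y := by
  induction Y with
  | nil => rfl
  | cons y Y ih =>
    have h1 := eqToHom_cons rfl (map_single_map B Y) (map_single_map B (y :: Y))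
    have h2 := eqToHom_cons rfl (map_two unit B ((mapSeq single).obj Y)).symm
      (map_two unit B ((mapSeq single).obj (y :: Y))).symm
    refine (congrArg (· ≫ _) (congrArg (_ ≫ ·) (congr (congrArg (fun f g => (mapSeq unit).map f ≫ g)
      h1) h2))).trans ?_
    refine congr (congrArg consHom ?_) (ih (List.cons.inj h).2)
    have h3 : unit.map (single.map (eqToHom (rfl : B.obj y = _))) = 𝟙 _ := unit.map_id _
    refine (congrArg (· ≫ _) ((congrArg (_ ≫ ·) ?_).trans (Category.comp_id _))).trans rfl
    exact (Category.comp_id _).trans h3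

lemma triangle (hA : Distributive A) :
    compMap (unitR A) (𝟙 B) ≫ (assocIso A unit B hA).hom = compMap (𝟙 A) (unitL B) := by
  ext X
  refine lan_ext fun Y h => ?_
  have e1 := lanι_compMap (unitR A) (𝟙 B) Y h
  have e2 := lanι_compMap (𝟙 A) (unitL B) Y h
  have e3 : (twoTrans (unitR A) (𝟙 B)).app Y = (unitR A).app ((mapSeq B).obj Y) := by
    rw [twoTrans_app, mapSeqTrans_id]
    exact (congrArg (_ ≫ ·) ((comp A unit).map_id _)).trans (Category.comp_id _)
  have e4 : (twoTrans (𝟙 A) (unitL B)).app Y = A.map ((mapSeqTrans (unitL B)).app Y) :=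
    Category.id_comp _
  have hY := flat_map_single Y
  have hY' : ((mapSeq single).obj Y).map flat.obj = Y := by
    refine (List.map_map ..).trans ((List.map_congr_left fun y _ => ?_).trans (List.map_id Y))
    exact flat_single y
  have e5 := lanι_congr (p := flat) (G := mapSeq unit ⋙ A) (map_single_map B Y)
    (flat_map_single ((mapSeq B).obj Y)) (flat_map B _ Y hY)
  have e6 : (unitR A).app ((mapSeq B).obj Y) ≫ lanι flat (mapSeq B ⋙ comp A unit) Y h =
      A.map (unitSeq (lanUnit single (𝟭 V)) ((mapSeq B).obj Y) ≫
        (mapSeq unit).map (eqToHom (map_single_map B Y)) ≫ eqToHom (map_two unit B _).symm) ≫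
      inclL A unit B ((mapSeq single).obj Y) Y X hY h := by
    rw [inclL, ← A.map_comp_assoc, Category.assoc, Category.assoc, eqToHom_trans, eqToHom_refl,
      Category.comp_id, A.map_comp]
    refine (congrArg (· ≫ _) (congrArg (_ ≫ ·) e5)).trans ?_
    simp only [Category.assoc]
    rfl
  rw [NatTrans.comp_app, ← Category.assoc, e1, e2, e3, e4, e6, Category.assoc,
    inclL_assoc' A unit B hA _ Y Y X hY h hY' h, inclR, ← A.map_comp_assoc, triangle_aux]

end Triangle

section Pentagon

variable {V : Type u} [Category.{v} V] [Lextensive V] (A B C D : List V ⥤ V)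

lemma map_eqToHom_cancel (B : List V ⥤ V) {M N : List V} (h : M = N) (h' : N = M) {W W' : V}
    (x : B.obj N ⟶ W) (y : W ⟶ W') :
    B.map (eqToHom h') ≫ (B.map (eqToHom h) ≫ x) ≫ y = x ≫ y := by
  subst h; simp

/-- The sequence of inclusions `C_i D_j X_{ij} ⟶ (C ∘ D) X`. -/
noncomputable def inclSeq : (q : List (List (List V))) →
    ((q.map (mapSeq D).obj).map C.obj ⟶ (q.map flat.obj).map (comp C D).obj)
  | [] => 𝟙 []
  | s :: q => consHom (lanι flat (mapSeq D ⋙ C) s rfl) (inclSeq q)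

lemma inclSeq_eq (q : List (List (List V))) : eqToHom (map_two C D q).symm ≫
    relHom (fun s t h => lanι flat (mapSeq D ⋙ C) s h) q (q.map flat.obj) rfl =
      inclSeq C D q := by
  induction q with
  | nil => rfl
  | cons s q ih =>
    refine (congrArg (· ≫ _) (eqToHom_cons rfl (map_two C D q).symm
      (map_two C D (s :: q)).symm)).trans ?_
    exact congr (congrArg consHom (Category.id_comp _)) ih

/-- The sequence of sequences of inclusions. -/
noncomputable def inclSeqSeq : (Q : List (List (List (List V)))) →
    ((Q.map (mapSeq (mapSeq D)).obj).map (mapSeq C).obj ⟶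
      (Q.map (mapSeq flat).obj).map (mapSeq (comp C D)).obj)
  | [] => 𝟙 []
  | q :: Q => consHom (inclSeq C D q) (inclSeqSeq Q)

lemma inclSeq_append (q q' : List (List (List V))) :
    HEq (appendHom (inclSeq C D q) (inclSeq C D q')) (inclSeq C D (q ++ q')) := by
  have h : ∀ q q' : List (List (List V)), (q.map (mapSeq D).obj).map C.obj ++
      (q'.map (mapSeq D).obj).map C.obj = ((q ++ q').map (mapSeq D).obj).map C.obj := by simp
  have h' : ∀ q q' : List (List (List V)), (q.map flat.obj).map (comp C D).obj ++
      (q'.map flat.obj).map (comp C D).obj = ((q ++ q').map flat.obj).map (comp C D).obj := by simp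
  induction q with
  | nil => rfl
  | cons s q ih => exact consHom_heq _ (h q q') (h' q q') ih

lemma flat_inclSeqSeq (Q : List (List (List (List V)))) :
    HEq (flat.map (inclSeqSeq C D Q)) (inclSeq C D (flat.obj Q)) := by
  have h : ∀ Q : List (List (List (List V))),
      flat.obj ((Q.map (mapSeq (mapSeq D)).obj).map (mapSeq C).obj) =
      ((flat.obj Q).map (mapSeq D).obj).map C.obj := fun Q =>
    flat_map C _ _ (flat_map (mapSeq D) Q _ rfl)
  have h' : ∀ Q : List (List (List (List V))),
      flat.obj ((Q.map (mapSeq flat).obj).map (mapSeq (comp C D)).obj) =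
      ((flat.obj Q).map flat.obj).map (comp C D).obj := fun Q =>
    flat_map (comp C D) _ _ (flat_map flat Q _ rfl)
  induction Q with
  | nil => rfl
  | cons q Q ih =>
    exact (appendHom_heq rfl rfl (h Q) (h' Q) HEq.rfl ih).trans (inclSeq_append C D q (flat.obj Q))

lemma map_flat_map (Q : List (List (List (List V)))) :
    (Q.map (mapSeq (mapSeq D)).obj).map flat.obj = (Q.map flat.obj).map (mapSeq D).obj := by
  induction Q with
  | nil => rfl
  | cons q Q ih => exact congrArg₂ (· :: ·) (flat_map D q _ rfl) ih

lemma pentagon_aux (hB : Distributive B) (Q : List (List (List (List V))))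
    (h : (Q.map (mapSeq flat).obj).map flat.obj = (Q.map flat.obj).map flat.obj) :
    relHom (fun s t h => lanι flat (mapSeq C ⋙ B) s h) (Q.map (mapSeq (mapSeq D)).obj)
        ((Q.map (mapSeq (mapSeq D)).obj).map flat.obj) rfl ≫
      (mapSeq (comp B C)).map (eqToHom (map_flat_map D Q)) ≫
      eqToHom (map_two (comp B C) D (Q.map flat.obj)).symm ≫
      relHom (fun s t h => lanι flat (mapSeq D ⋙ comp B C) s h) (Q.map flat.obj)
        ((Q.map flat.obj).map flat.obj) rfl ≫
      (mapSeqTrans (assocIso B C D hB).hom).app ((Q.map flat.obj).map flat.obj) =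
    eqToHom (map_two B C (Q.map (mapSeq (mapSeq D)).obj)) ≫
      (mapSeq B).map (inclSeqSeq C D Q) ≫
      eqToHom (map_two B (comp C D) (Q.map (mapSeq flat).obj)).symm ≫
      relHom (fun s t h => lanι flat (mapSeq (comp C D) ⋙ B) s h) (Q.map (mapSeq flat).obj)
        ((Q.map flat.obj).map flat.obj) h := by
  induction Q with
  | nil => rfl
  | cons q Q ih =>
    have h1 := eqToHom_cons (flat_map D q _ rfl) (map_flat_map D Q) (map_flat_map D (q :: Q))
    have h2 := eqToHom_cons rfl (map_two (comp B C) D (Q.map flat.obj)).symm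
      (map_two (comp B C) D ((q :: Q).map flat.obj)).symm
    have h3 := eqToHom_cons rfl (map_two B C (Q.map (mapSeq (mapSeq D)).obj))
      (map_two B C ((q :: Q).map (mapSeq (mapSeq D)).obj))
    have h4 := eqToHom_cons rfl (map_two B (comp C D) (Q.map (mapSeq flat).obj)).symm
      (map_two B (comp C D) ((q :: Q).map (mapSeq flat).obj)).symm
    have hd : lanι flat (mapSeq C ⋙ B) (q.map (mapSeq D).obj) rfl ≫
        (comp B C).map (eqToHom (flat_map D q _ rfl)) ≫ 𝟙 _ ≫
        lanι flat (mapSeq D ⋙ comp B C) (flat.obj q) rfl ≫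
        (assocIso B C D hB).hom.app (flat.obj (flat.obj q)) =
        𝟙 _ ≫ B.map (inclSeq C D q) ≫ 𝟙 _ ≫
          lanι flat (mapSeq (comp C D) ⋙ B) (q.map flat.obj) (List.cons.inj h).1 := by
      have g1 := lanι_eqToHom (p := flat) (G := mapSeq C ⋙ B) (q.map (mapSeq D).obj) rfl
        (flat_map D q _ rfl)
      have g2 := inclL_assoc' B C D hB q (flat.obj q) (q.map flat.obj) _ rfl rfl rfl
        (List.cons.inj h).1
      rw [Category.id_comp, Category.id_comp, Category.id_comp, ← inclSeq_eq, B.map_comp,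
        Category.assoc]
      change _ = _ ≫ inclR B C D q (q.map flat.obj) _ rfl (List.cons.inj h).1
      rw [← g2, inclL]
      refine Eq.trans ?_ (map_eqToHom_cancel B _ _ _ _).symm
      rw [Category.assoc]
      exact (Category.assoc _ _ _).symm.trans (congrArg (· ≫ _) g1)
    rw [h1, h2, h3, h4]
    exact congr (congrArg consHom hd) (ih (List.cons.inj h).2)

end Pentagon

section Pentagon

variable {V : Type u} [Category.{v} V] [Lextensive V] (A B C D : List V ⥤ V)

lemma lan_inclL (Z : List (List (List V))) (Y : List (List V)) (X : List V)
    (h : flat.obj Z = Y) (h' : flat.obj Y = X) :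
    lanι flat (mapSeq B ⋙ A) (Z.map (mapSeq C).obj) (flat_map C Z Y h) ≫
      lanι flat (mapSeq C ⋙ comp A B) Y h' =
    A.map (eqToHom (map_two B C Z).symm) ≫ inclL A B C Z Y X h h' := by
  rw [inclL, ← A.map_comp_assoc, eqToHom_trans, eqToHom_refl, A.map_id, Category.id_comp]

lemma pentagon_left (Q : List (List (List (List V)))) (Y : List (List V)) (X : List V)
    (h : flat.obj (Q.map flat.obj) = Y) (h' : flat.obj Y = X)
    (h'' : flat.obj ((Q.map (mapSeq (mapSeq D)).obj).map flat.obj) = (mapSeq D).obj Y) :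
    inclR A B C (Q.map (mapSeq (mapSeq D)).obj) _ ((mapSeq D).obj Y) rfl h'' ≫
      lanι flat (mapSeq D ⋙ comp A (comp B C)) Y h' =
    A.map (relHom (fun s t h => lanι flat (mapSeq C ⋙ B) s h) (Q.map (mapSeq (mapSeq D)).obj)
        ((Q.map (mapSeq (mapSeq D)).obj).map flat.obj) rfl ≫
      (mapSeq (comp B C)).map (eqToHom (map_flat_map D Q)) ≫
      eqToHom (map_two (comp B C) D (Q.map flat.obj)).symm) ≫
      inclL A (comp B C) D (Q.map flat.obj) Y X h h' := by
  have e1 := lanι_congr (p := flat) (G := mapSeq (comp B C) ⋙ A) (map_flat_map D Q) h''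
    (flat_map D _ Y h)
  have e2 := lan_inclL A (comp B C) D (Q.map flat.obj) Y X h h'
  rw [inclR, Category.assoc, e1, Category.assoc, e2, A.map_comp, A.map_comp, Category.assoc,
    Category.assoc]
  rfl

lemma pentagon_right (hAB : Distributive (comp A B)) (Q : List (List (List (List V))))
    (Y : List (List V)) (X : List V) (h : flat.obj (flat.obj Q) = Y) (h' : flat.obj Y = X)
    (h'' : flat.obj (flat.obj (Q.map (mapSeq (mapSeq D)).obj)) = (mapSeq D).obj Y)
    (h₃ : flat.obj (Q.map (mapSeq flat).obj) = (flat.obj Q).map flat.obj)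
    (h₄ : flat.obj ((flat.obj Q).map flat.obj) = X) :
    inclL A B C (Q.map (mapSeq (mapSeq D)).obj) _ ((mapSeq D).obj Y) rfl h'' ≫
      lanι flat (mapSeq D ⋙ comp (comp A B) C) Y h' ≫
      (assocIso (comp A B) C D hAB).hom.app X =
    A.map (eqToHom (map_two B C (Q.map (mapSeq (mapSeq D)).obj)) ≫
      (mapSeq B).map (inclSeqSeq C D Q) ≫
      eqToHom (map_two B (comp C D) (Q.map (mapSeq flat).obj)).symm) ≫
      inclL A B (comp C D) (Q.map (mapSeq flat).obj) _ X h₃ h₄ := by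
  have e1 := lanι_congr (p := flat) (G := mapSeq C ⋙ comp A B) (flat_map (mapSeq D) Q _ rfl) h''
    (flat_map D _ Y h)
  have e2 := lan_inclL (comp A B) C D (flat.obj Q) Y X h h'
  have e3 := inclL_assoc' (comp A B) C D hAB (flat.obj Q) Y _ X h h' rfl h₄
  have key : lanι flat (mapSeq C ⋙ comp A B) (flat.obj (Q.map (mapSeq (mapSeq D)).obj)) h'' ≫
      lanι flat (mapSeq D ⋙ comp (comp A B) C) Y h' ≫ (assocIso (comp A B) C D hAB).hom.app X =
      (comp A B).map ((mapSeq C).map (eqToHom (flat_map (mapSeq D) Q _ rfl)) ≫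
        inclSeq C D (flat.obj Q)) ≫ lanι flat (mapSeq (comp C D) ⋙ comp A B) _ h₄ := by
    rw [e1, Category.assoc]
    refine (congrArg (_ ≫ ·) ((Category.assoc _ _ _).symm.trans ((congrArg (· ≫ _) e2).trans
      (Category.assoc _ _ _)))).trans ?_
    rw [e3, inclR, ← inclSeq_eq, Functor.map_comp, Functor.map_comp, Category.assoc,
      Category.assoc]
    rfl
  have hw : HEq (flat.map (inclSeqSeq C D Q))
      ((mapSeq C).map (eqToHom (flat_map (mapSeq D) Q _ rfl)) ≫ inclSeq C D (flat.obj Q)) := by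
    refine (flat_inclSeqSeq C D Q).trans ?_
    generalize inclSeq C D (flat.obj Q) = k
    revert k
    have : ∀ (M N : List (List V)) (e : M = N) (R : List V) (k : (mapSeq C).obj N ⟶ R),
        HEq k ((mapSeq C).map (eqToHom e) ≫ k) := by
      rintro M _ rfl R k
      rw [eqToHom_refl, (mapSeq C).map_id, Category.id_comp]
    exact fun k => this _ _ _ _ k
  have e5 := lanι_map flat (mapSeq B ⋙ A) (inclSeqSeq C D Q) (flat_map C _ _ rfl)
    (flat_map (comp C D) _ _ h₃) _ hw
  have e6 := lan_inclL A B (comp C D) (Q.map (mapSeq flat).obj) _ X h₃ h₄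
  rw [inclL, Category.assoc, Category.assoc, key, A.map_comp, A.map_comp, Category.assoc,
    Category.assoc, ← e6]
  refine congrArg (_ ≫ ·) ?_
  exact (Category.assoc _ _ _).symm.trans ((congrArg (· ≫ _) e5).trans (Category.assoc _ _ _))

lemma pentagon (hA : Distributive A) (hB : Distributive B) (hAB : Distributive (comp A B)) :
    compMap (assocIso A B C hA).hom (𝟙 D) ≫ (assocIso A (comp B C) D hA).hom ≫
      compMap (𝟙 A) (assocIso B C D hB).hom =
    (assocIso (comp A B) C D hAB).hom ≫ (assocIso A B (comp C D) hA).hom := by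
  ext X
  refine lan_ext fun Y hY => (inclL_isCoprod A B C ((mapSeq D).obj Y)).hom_ext fun ⟨Z, hZ⟩ => ?_
  obtain ⟨P, hP, hP'⟩ := exists_split D.obj (flat.obj Z) Y hZ
  obtain ⟨Q, hQ, hQ'⟩ := exists_split (List.map D.obj) Z P hP'.symm
  change Q.map (mapSeq (mapSeq D)).obj = Z at hQ'
  subst hQ'
  subst hQ
  have h₁ : flat.obj (Q.map flat.obj) = Y := List.flatten_flatten.symm.trans hP
  have h₂ : flat.obj ((Q.map (mapSeq (mapSeq D)).obj).map flat.obj) = (mapSeq D).obj Y :=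
    List.flatten_flatten.symm.trans hZ
  have h₃ : flat.obj (Q.map (mapSeq flat).obj) = (flat.obj Q).map flat.obj :=
    flat_map flat Q _ rfl
  have h₄ : flat.obj ((flat.obj Q).map flat.obj) = X :=
    List.flatten_flatten.symm.trans ((congrArg flat.obj hP).trans hY)
  have h₅ : (Q.map flat.obj).map flat.obj = (Q.map (mapSeq flat).obj).map flat.obj := by
    rw [List.map_map, List.map_map]
    exact List.map_congr_left fun q _ => List.flatten_flatten
  have h₆ : flat.obj ((Q.map flat.obj).map flat.obj) = X :=
    List.flatten_flatten.symm.trans ((congrArg flat.obj h₁).trans hY)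
  have e1 := lanι_compMap (assocIso A B C hA).hom (𝟙 D) Y hY
  have e2 : (twoTrans (assocIso A B C hA).hom (𝟙 D)).app Y =
      (assocIso A B C hA).hom.app ((mapSeq D).obj Y) := by
    rw [twoTrans_app, mapSeqTrans_id]
    exact (congrArg (_ ≫ ·) (CategoryTheory.Functor.map_id _ _)).trans (Category.comp_id _)
  have e3 := inclL_assoc A B C hA (Q.map (mapSeq (mapSeq D)).obj) _ hZ
  have e4 := pentagon_left A B C D Q Y X h₁ hY h₂
  have e5 := inclL_assoc' A (comp B C) D hA (Q.map flat.obj) Y _ X h₁ hY rfl h₆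
  have e6 := lanι_compMap (𝟙 A) (assocIso B C D hB).hom ((Q.map flat.obj).map flat.obj) h₆
  have e7 : (twoTrans (𝟙 A) (assocIso B C D hB).hom).app ((Q.map flat.obj).map flat.obj) =
    A.map ((mapSeqTrans (assocIso B C D hB).hom).app _) := Category.id_comp _
  have e8 := pentagon_right A B C D hAB Q Y X hP hY hZ h₃ h₄
  have e9 := inclL_assoc' A B (comp C D) hA (Q.map (mapSeq flat).obj) _ _ X h₃ h₄ h₅.symm h₆
  have e10 := pentagon_aux B C D hB Q h₅.symm
  rw [NatTrans.comp_app, NatTrans.comp_app, NatTrans.comp_app]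
  rw [← Category.assoc (lanι flat _ Y hY) ((compMap _ _).app X), e1, e2, Category.assoc]
  rw [← Category.assoc, e3, ← Category.assoc, e4, Category.assoc,
    ← Category.assoc (inclL A (comp B C) D _ Y X h₁ hY), e5, inclR, Category.assoc, e6, e7,
    ← A.map_comp_assoc, ← A.map_comp_assoc]
  have e11 := (congrArg (· ≫ (assocIso A B (comp C D) hA).hom.app X) e8).trans
    ((Category.assoc _ _ _).trans (congrArg (_ ≫ ·) e9))
  simp only [Category.assoc] at e11
  refine Eq.trans ?_ e11.symm
  rw [inclR, ← A.map_comp_assoc]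
  refine congrArg (A.map · ≫ _) ?_
  simp only [Category.assoc]
  exact e10

end Pentagon

/-! ### Multitensors -/

section Multitensors

variable {V : Type u} [Category.{v} V]

/-- The sequence of maps `σ : E_j E_k X_{ijk} ⟶ E_{jk} X_{ijk}`. -/
def sigmaSeq {E : List V ⥤ V} (σ : mapSeq E ⋙ E ⟶ flat ⋙ E) : (Z : List (List (List V))) →
    ((Z.map (mapSeq E).obj).map E.obj ⟶ (mapSeq E).obj (Z.map flat.obj))
  | [] => 𝟙 []
  | z :: Z => consHom (σ.app z) (sigmaSeq σ Z)

variable (V) in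
/-- A multitensor: a functor `E` from finite sequences of objects of `V` to `V`, with a unit
`u : X ⟶ E (X)` and a substitution `σ : E_i E_j X_{ij} ⟶ E_{ij} X_{ij}` satisfying the unit and
associativity laws. That is, a structure on `V` of lax algebra for the monad of finite sequences. -/
structure Multitensor where
  E : List V ⥤ V
  u : 𝟭 V ⟶ single ⋙ E
  σ : mapSeq E ⋙ E ⟶ flat ⋙ E
  unit_left (X : List V) :
    u.app (E.obj X) ≫ σ.app [X] ≫ E.map (eqToHom (flat_single X)) = 𝟙 (E.obj X)
  unit_right (X : List V) :
    E.map (unitSeq u X) ≫ σ.app ((mapSeq single).obj X) ≫ E.map (eqToHom (flat_map_single X)) =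
      𝟙 (E.obj X)
  assoc (Z : List (List (List V))) :
    E.map (sigmaSeq σ Z) ≫ σ.app (Z.map flat.obj) ≫
        E.map (eqToHom (List.flatten_flatten (L := Z)).symm) =
      σ.app (Z.map (mapSeq E).obj) ≫ E.map (eqToHom (flat_map E Z _ rfl)) ≫ σ.app (flat.obj Z)

namespace Multitensor

/-- A multitensor is cartesian when its functor preserves pullbacks, and its unit and substitution
are cartesian transformations. -/
class IsCartesian (M : Multitensor V) : Prop where
  pullbacks : PreservesLimitsOfShape WalkingCospan M.E
  unit : NatTrans.Equifibered M.u
  subst : NatTrans.Equifibered M.σ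

/-- The transformation `φ` is a multitensor morphism. -/
structure IsHom {M N : Multitensor V} (φ : M.E ⟶ N.E) : Prop where
  unit : M.u ≫ Functor.whiskerLeft single φ = N.u
  subst : M.σ ≫ Functor.whiskerLeft flat φ = (mapSeqTrans φ ◫ φ) ≫ N.σ

variable [Lextensive V] (M : Multitensor V)

/-- The substitution as a map from the composite. -/
noncomputable def mul : comp M.E M.E ⟶ M.E := lanDesc M.σ

/-- The unit as a map from the unit of the composition. -/
noncomputable def one : MultOp.unit ⟶ M.E := lanDesc M.u

lemma lanι_mul (Y : List (List V)) {X : List V} (h : flat.obj Y = X) :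
    lanι flat (mapSeq M.E ⋙ M.E) Y h ≫ M.mul.app X = M.σ.app Y ≫ M.E.map (eqToHom h) :=
  lanι_desc M.σ Y h

lemma lanι_one (a : V) {X : List V} (h : single.obj a = X) :
    lanι single (𝟭 V) a h ≫ M.one.app X = M.u.app a ≫ M.E.map (eqToHom h) :=
  lanι_desc M.u a h

lemma lanι_mul' (Y : List (List V)) :
    lanι flat (mapSeq M.E ⋙ M.E) Y rfl ≫ M.mul.app (flat.obj Y) = M.σ.app Y :=
  (M.lanι_mul Y rfl).trans ((congrArg (_ ≫ ·) (M.E.map_id _)).trans (Category.comp_id _))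

lemma lanι_one' (a : V) : lanι single (𝟭 V) a rfl ≫ M.one.app (single.obj a) = M.u.app a :=
  (M.lanι_one a rfl).trans ((congrArg (_ ≫ ·) (M.E.map_id _)).trans (Category.comp_id _))

lemma twoTrans_id_right {A A' B : List V ⥤ V} (φ : A ⟶ A') (Y : List (List V)) :
    (twoTrans φ (𝟙 B)).app Y = φ.app ((mapSeq B).obj Y) := by
  rw [twoTrans_app, mapSeqTrans_id]
  exact (congrArg (_ ≫ ·) (CategoryTheory.Functor.map_id _ _)).trans (Category.comp_id _)

lemma twoTrans_id_left {A B B' : List V ⥤ V} (ψ : B ⟶ B') (Y : List (List V)) :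
    (twoTrans (𝟙 A) ψ).app Y = A.map ((mapSeqTrans ψ).app Y) := Category.id_comp _

lemma one_mul : unitL M.E ≫ compMap M.one (𝟙 M.E) ≫ M.mul = 𝟙 M.E := by
  ext X
  have e1 := lanι_compMap M.one (𝟙 M.E) [X] (flat_single X)
  have e2 := M.lanι_one' (M.E.obj X)
  have e3 := M.lanι_mul [X] (flat_single X)
  rw [twoTrans_id_right] at e1
  rw [NatTrans.comp_app, NatTrans.comp_app, unitL]
  dsimp only
  rw [Category.assoc, ← Category.assoc (lanι flat _ [X] (flat_single X)), e1, Category.assoc, e3]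
  refine Eq.trans ?_ (M.unit_left X)
  exact (Category.assoc _ _ _).symm.trans (congrArg (· ≫ _) e2)

lemma unitSeq_one (X : List V) :
    unitSeq (lanUnit single (𝟭 V)) X ≫ (mapSeqTrans M.one).app ((mapSeq single).obj X) =
      unitSeq M.u X := by
  induction X with
  | nil => rfl
  | cons x X ih =>
    have e2 := M.lanι_one' x
    exact congr (congrArg consHom e2) ih

lemma mul_one : unitR M.E ≫ compMap (𝟙 M.E) M.one ≫ M.mul = 𝟙 M.E := by
  ext X
  have e1 := lanι_compMap (𝟙 M.E) M.one ((mapSeq single).obj X) (flat_map_single X)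
  have e3 := M.lanι_mul ((mapSeq single).obj X) (flat_map_single X)
  rw [twoTrans_id_left] at e1
  rw [NatTrans.comp_app, NatTrans.comp_app, unitR]
  dsimp only
  rw [Category.assoc, ← Category.assoc (lanι flat _ ((mapSeq single).obj X) (flat_map_single X)),
    e1, Category.assoc, e3, ← M.E.map_comp_assoc, unitSeq_one]
  exact M.unit_right X

lemma sigmaSeq_eq (Z : List (List (List V))) :
    eqToHom (map_two M.E M.E Z).symm ≫
      relHom (fun s t h => lanι flat (mapSeq M.E ⋙ M.E) s h) Z (Z.map flat.obj) rfl ≫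
      (mapSeqTrans M.mul).app (Z.map flat.obj) = sigmaSeq M.σ Z := by
  induction Z with
  | nil => rfl
  | cons z Z ih =>
    have e3 := M.lanι_mul' z
    have h2 := eqToHom_cons rfl (map_two M.E M.E Z).symm (map_two M.E M.E (z :: Z)).symm
    rw [h2]
    exact congr (congrArg consHom ((Category.id_comp _).trans e3)) ih

lemma mul_assoc (hE : Distributive M.E) :
    (assocIso M.E M.E M.E hE).hom ≫ compMap (𝟙 M.E) M.mul ≫ M.mul =
      compMap M.mul (𝟙 M.E) ≫ M.mul := by
  ext X
  refine (inclL_isCoprod M.E M.E M.E X).hom_ext fun ⟨Z, h⟩ => ?_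
  subst h
  have e1 := inclL_assoc M.E M.E M.E hE Z _ rfl
  have e2 := lanι_compMap (𝟙 M.E) M.mul (Z.map flat.obj) (List.flatten_flatten (L := Z)).symm
  have e3 := M.lanι_mul (Z.map flat.obj) (List.flatten_flatten (L := Z)).symm
  have e4 := lanι_compMap M.mul (𝟙 M.E) (flat.obj Z) rfl
  have e5 := M.lanι_mul (Z.map (mapSeq M.E).obj) (flat_map M.E Z _ rfl)
  have e6 := M.lanι_mul' (flat.obj Z)
  rw [twoTrans_id_left] at e2
  rw [twoTrans_id_right] at e4
  have e7 := M.assoc Z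
  rw [← M.sigmaSeq_eq] at e7
  rw [NatTrans.comp_app, NatTrans.comp_app, NatTrans.comp_app, ← Category.assoc, e1, inclR,
    Category.assoc, ← Category.assoc (lanι flat _ _ _) ((compMap _ _).app _), e2, Category.assoc, e3,
    inclL, Category.assoc, Category.assoc, ← Category.assoc (lanι flat _ _ _) ((compMap _ _).app _),
    e4, Category.assoc, e6, ← Category.assoc (lanι flat _ _ _) (M.mul.app _)]
  have e8 := congrArg (M.E.map (eqToHom (map_two M.E M.E Z)) ≫ ·) e7
  refine Eq.trans ?_ (e8.trans (congrArg (_ ≫ ·) ?_))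
  · simp only [← M.E.map_comp_assoc, eqToHom_trans_assoc, eqToHom_refl, Category.id_comp]
  · exact (Category.assoc _ _ _).symm.trans (congrArg (· ≫ _) e5.symm)

end Multitensor

end Multitensors

/-! ### Collections over a multitensor -/

section Collections

variable {V : Type u} [Category.{v} V]

/-- A functor with a cartesian transformation to a distributive functor is distributive. -/
lemma Distributive.of_equifibered [Lextensive V] {A E : List V ⥤ V} (hE : Distributive E)
    {α : A ⟶ E} (hα : NatTrans.Equifibered α) : Distributive A := fun l m J Z P c hc =>
  ((hE l m Z P c hc).iff_isPullback fun j => α.naturality _).2 fun j => hα _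

lemma twoTrans_equifibered {A A' B B' : List V ⥤ V} {φ : A ⟶ A'} {ψ : B ⟶ B'}
    (hφ : NatTrans.Equifibered φ) (hψ : NatTrans.Equifibered ψ)
    [PreservesLimitsOfShape WalkingCospan A'] : NatTrans.Equifibered (twoTrans φ ψ) := by
  have h := (hφ.whiskerLeft (mapSeq B)).comp ((mapSeqTrans_equifibered hψ).whiskerRight A')
  exact h

namespace Multitensor

/-- A multitensor is distributive when its functor is. -/
class IsDistributive (M : Multitensor V) : Prop where
  distributive : Distributive M.E

end Multitensor

/-- A collection over a multitensor `M` with functor `E`: a functor `A` from sequences of objects of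
`V` to `V` together with a cartesian transformation to `E`. -/
structure Coll (M : Multitensor V) where
  A : List V ⥤ V
  α : A ⟶ M.E
  cart : NatTrans.Equifibered α

namespace Coll

variable {M : Multitensor V}

/-- A morphism of collections is a transformation over `E`. -/
@[ext]
structure Hom (X Y : Coll M) where
  φ : X.A ⟶ Y.A
  w : φ ≫ Y.α = X.α

instance : Category (Coll M) where
  Hom := Hom
  id X := ⟨𝟙 _, Category.id_comp _⟩
  comp f g := ⟨f.φ ≫ g.φ, by rw [Category.assoc, g.w, f.w]⟩

@[ext] lemma hom_ext {X Y : Coll M} {f g : X ⟶ Y} (h : f.φ = g.φ) : f = g := Hom.ext h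

@[simp] lemma id_φ (X : Coll M) : Hom.φ (𝟙 X) = 𝟙 X.A := rfl
@[simp] lemma comp_φ {X Y Z : Coll M} (f : X ⟶ Y) (g : Y ⟶ Z) : (f ≫ g).φ = f.φ ≫ g.φ := rfl

def mkIso {X Y : Coll M} (e : X.A ≅ Y.A) (w : e.hom ≫ Y.α = X.α) : X ≅ Y where
  hom := ⟨e.hom, w⟩
  inv := ⟨e.inv, by rw [← w, e.inv_hom_id_assoc]⟩
  hom_inv_id := hom_ext e.hom_inv_id
  inv_hom_id := hom_ext e.inv_hom_id

variable [Lextensive V]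

lemma distributive [M.IsDistributive] (X : Coll M) : Distributive X.A :=
  (Multitensor.IsDistributive.distributive (M := M)).of_equifibered X.cart

variable [M.IsCartesian]

/-- The composite `A ∘ B`, over `E` by `A ∘ B ⟶ E ∘ E ⟶ E`. -/
noncomputable def tensor (X Y : Coll M) : Coll M where
  A := comp X.A Y.A
  α := compMap X.α Y.α ≫ M.mul
  cart := by
    have := Multitensor.IsCartesian.pullbacks (M := M)
    rw [compMap, Multitensor.mul, lanMapTrans_desc]
    exact lanDesc_equifibered
      ((twoTrans_equifibered X.cart Y.cart).comp Multitensor.IsCartesian.subst)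

variable (M) in
/-- The unit of the composition, over `E` by the unit of the multitensor. -/
noncomputable def unit : Coll M where
  A := MultOp.unit
  α := M.one
  cart := lanDesc_equifibered Multitensor.IsCartesian.unit

noncomputable def tensorHom {X X' Y Y' : Coll M} (f : X ⟶ X') (g : Y ⟶ Y') :
    tensor X Y ⟶ tensor X' Y' where
  φ := compMap f.φ g.φ
  w := by
    change _ ≫ compMap _ _ ≫ _ = compMap _ _ ≫ _
    rw [← Category.assoc, ← compMap_comp, f.w, g.w]

variable [M.IsDistributive]

noncomputable def assoc (X Y Z : Coll M) : tensor (tensor X Y) Z ≅ tensor X (tensor Y Z) :=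
  mkIso (assocIso X.A Y.A Z.A X.distributive) <| by
    have hE := Multitensor.IsDistributive.distributive (M := M)
    change _ ≫ compMap X.α (compMap Y.α Z.α ≫ M.mul) ≫ M.mul =
      compMap (compMap X.α Y.α ≫ M.mul) Z.α ≫ M.mul
    have e1 : compMap X.α (compMap Y.α Z.α ≫ M.mul) =
        compMap X.α (compMap Y.α Z.α) ≫ compMap (𝟙 _) M.mul := by
      rw [← compMap_comp, Category.comp_id]
    have e2 : compMap (compMap X.α Y.α ≫ M.mul) Z.α =
        compMap (compMap X.α Y.α) Z.α ≫ compMap M.mul (𝟙 _) := by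
      rw [← compMap_comp, Category.comp_id]
    rw [e1, e2, Category.assoc, Category.assoc, ← M.mul_assoc hE,
      ← Category.assoc, assocIso_naturality _ _ _ _ hE, Category.assoc]

noncomputable def leftUnitor (X : Coll M) : tensor (unit M) X ≅ X :=
  mkIso (leftIso X.A) <| by
    refine (Iso.eq_inv_comp (leftIso X.A)).1 ?_
    change _ = unitL X.A ≫ compMap M.one X.α ≫ M.mul
    have e : compMap M.one X.α = compMap (𝟙 MultOp.unit) X.α ≫ compMap M.one (𝟙 _) := by
      rw [← compMap_comp, Category.comp_id, Category.id_comp]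
    rw [e, Category.assoc, ← Category.assoc, unitL_naturality, Category.assoc, M.one_mul,
      Category.comp_id]

noncomputable def rightUnitor (X : Coll M) : tensor X (unit M) ≅ X :=
  mkIso (rightIso X.A X.distributive) <| by
    refine (Iso.eq_inv_comp (rightIso X.A X.distributive)).1 ?_
    change _ = unitR X.A ≫ compMap X.α M.one ≫ M.mul
    have e : compMap X.α M.one = compMap X.α (𝟙 MultOp.unit) ≫ compMap (𝟙 _) M.one := by
      rw [← compMap_comp, Category.comp_id, Category.id_comp]
    rw [e, Category.assoc, ← Category.assoc, unitR_naturality, Category.assoc, M.mul_one,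
      Category.comp_id]

noncomputable instance : MonoidalCategoryStruct (Coll M) where
  tensorObj := tensor
  tensorHom := tensorHom
  whiskerLeft X _ _ f := tensorHom (𝟙 X) f
  whiskerRight f Y := tensorHom f (𝟙 Y)
  tensorUnit := unit M
  associator := assoc
  leftUnitor := leftUnitor
  rightUnitor := rightUnitor

/-- The monoidal category of collections over a distributive cartesian multitensor. -/
noncomputable instance : MonoidalCategory (Coll M) :=
  MonoidalCategory.ofTensorHom
    (id_tensorHom_id := fun X Y => hom_ext (compMap_id X.A Y.A))
    (id_tensorHom := fun _ _ _ _ => rfl)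
    (tensorHom_id := fun _ _ => rfl)
    (tensorHom_comp_tensorHom := fun f f' g g' => hom_ext (compMap_comp _ _ _ _).symm)
    (associator_naturality := fun {X _ _ Y _ _} f g h => hom_ext
      (assocIso_naturality f.φ g.φ h.φ X.distributive Y.distributive).symm)
    (leftUnitor_naturality := fun {X Y} f => hom_ext <| by
      change compMap (𝟙 _) f.φ ≫ (leftIso Y.A).hom = (leftIso X.A).hom ≫ f.φ
      rw [← Iso.eq_comp_inv, Category.assoc, ← Iso.inv_comp_eq]
      exact unitL_naturality f.φ)
    (rightUnitor_naturality := fun {X Y} f => hom_ext <| by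
      change compMap f.φ (𝟙 _) ≫ (rightIso Y.A Y.distributive).hom = (rightIso X.A X.distributive).hom ≫ f.φ
      rw [← Iso.eq_comp_inv, Category.assoc, ← Iso.inv_comp_eq]
      exact unitR_naturality f.φ)
    (pentagon := fun W X Y Z => hom_ext
      (pentagon W.A X.A Y.A Z.A W.distributive X.distributive (tensor W X).distributive))
    (triangle := fun X Y => hom_ext <| by
      change (assocIso X.A MultOp.unit Y.A X.distributive).hom ≫
        compMap (𝟙 X.A) (leftIso Y.A).hom =
        compMap (rightIso X.A X.distributive).hom (𝟙 Y.A)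
      have e1 := triangle X.A Y.A X.distributive
      have e2 : compMap (rightIso X.A X.distributive).hom (𝟙 Y.A) ≫ compMap (unitR X.A) (𝟙 Y.A) =
          𝟙 _ := by
        rw [← compMap_comp, Category.comp_id]
        exact (congrArg (compMap · _) (rightIso X.A X.distributive).hom_inv_id).trans (compMap_id _ _)
      have e3 : compMap (𝟙 X.A) (unitL Y.A) ≫ compMap (𝟙 X.A) (leftIso Y.A).hom = 𝟙 _ := by
        rw [← compMap_comp, Category.comp_id]
        exact (congrArg (compMap _ ·) (leftIso Y.A).inv_hom_id).trans (compMap_id _ _)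
      rw [← Category.id_comp (assocIso _ _ _ _).hom, ← e2, Category.assoc, Category.assoc,
        ← Category.assoc (compMap (unitR _) _), e1, e3, Category.comp_id])

end Coll

end Collections

/-! ### Enriched graphs, and functors and monads over `Set` -/

section Graphs

/-- A `V`-graph: a set of objects with an object of `V` for every pair of objects. -/
structure Graph (V : Type u) [Category.{v} V] where
  obj : Type v
  hom : obj → obj → V

variable {V : Type u} [Category.{v} V]

namespace Graph

/-- A map of `V`-graphs. -/
structure Hom (X Y : Graph V) where
  obj : X.obj → Y.obj
  map (a b : X.obj) : X.hom a b ⟶ Y.hom (obj a) (obj b)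

/-- The category `G V`. -/
instance : Category (Graph V) where
  Hom := Hom
  id X := ⟨_root_.id, fun _ _ => 𝟙 _⟩
  comp f g := ⟨g.obj ∘ f.obj, fun a b => f.map a b ≫ g.map _ _⟩
  id_comp f := congrArg (Hom.mk f.obj) (funext fun _ => funext fun _ => Category.id_comp _)
  comp_id f := congrArg (Hom.mk f.obj) (funext fun _ => funext fun _ => Category.comp_id _)
  assoc f g h := congrArg (Hom.mk (h.obj ∘ g.obj ∘ f.obj))
    (funext fun _ => funext fun _ => Category.assoc _ _ _)

lemma mk_ext {X Y : Graph V} (o : X.obj → Y.obj)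
    {m m' : ∀ a b, X.hom a b ⟶ Y.hom (o a) (o b)} (h : ∀ a b, m a b = m' a b) :
    (Hom.mk o m : X ⟶ Y) = Hom.mk o m' :=
  congrArg (Hom.mk o) (funext fun a => funext fun b => h a b)

@[simp] lemma id_map (X : Graph V) (a b : X.obj) : Hom.map (𝟙 X) a b = 𝟙 (X.hom a b) := rfl

@[simp] lemma comp_map {X Y Z : Graph V} (f : X ⟶ Y) (g : Y ⟶ Z) (a b : X.obj) :
    (f ≫ g).map a b = f.map a b ≫ g.map (f.obj a) (f.obj b) := rfl

end Graph

variable (V) in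
/-- An endofunctor of `G V` over `Set`: one which leaves unchanged the sets of objects and the
object maps. It is therefore given by its effect on homs. -/
structure GFun where
  hom (X : Graph V) : X.obj → X.obj → V
  map {X Y : Graph V} (f : X ⟶ Y) (a b : X.obj) : hom X a b ⟶ hom Y (f.obj a) (f.obj b)
  map_id (X : Graph V) (a b : X.obj) : map (𝟙 X) a b = 𝟙 (hom X a b)
  map_comp {X Y Z : Graph V} (f : X ⟶ Y) (g : Y ⟶ Z) (a b : X.obj) :
    map (f ≫ g) a b = map f a b ≫ map g (f.obj a) (f.obj b)

namespace GFun

lemma map_congr (S : GFun V) {X Y : Graph V} (o : X.obj → Y.obj)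
    {m m' : ∀ a b, X.hom a b ⟶ Y.hom (o a) (o b)} (h : ∀ a b, m a b = m' a b) (a b : X.obj) :
    S.map (Graph.Hom.mk o m : X ⟶ Y) a b = S.map (Graph.Hom.mk o m' : X ⟶ Y) a b := by
  obtain rfl : m = m' := funext fun a => funext fun b => h a b
  rfl

/-- The underlying endofunctor of `G V`. -/
abbrev toFunctor (S : GFun V) : Graph V ⥤ Graph V where
  obj X := ⟨X.obj, S.hom X⟩
  map f := ⟨f.obj, S.map f⟩
  map_id X := Graph.mk_ext _root_.id (S.map_id X)
  map_comp {X _ Z} f g := Graph.mk_ext (X := ⟨X.obj, S.hom X⟩) (Y := ⟨Z.obj, S.hom Z⟩)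
    (g.obj ∘ f.obj) (m := S.map (f ≫ g)) (m' := fun a b => S.map f a b ≫ S.map g _ _)
    (S.map_comp f g)

/-- A natural transformation over `Set`: its components are identities on objects. -/
@[ext]
structure Hom (S T : GFun V) where
  app (X : Graph V) (a b : X.obj) : S.hom X a b ⟶ T.hom X a b
  naturality {X Y : Graph V} (f : X ⟶ Y) (a b : X.obj) :
    S.map f a b ≫ app Y (f.obj a) (f.obj b) = app X a b ≫ T.map f a b

instance : Category (GFun V) where
  Hom := Hom
  id S := ⟨fun _ _ _ => 𝟙 _, fun _ _ _ => (Category.comp_id _).trans (Category.id_comp _).symm⟩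
  comp φ ψ := ⟨fun X a b => φ.app X a b ≫ ψ.app X a b, fun f a b => by
    rw [← Category.assoc, φ.naturality, Category.assoc, ψ.naturality, Category.assoc]⟩
  id_comp φ := Hom.ext (funext fun _ => funext fun _ => funext fun _ => Category.id_comp _)
  comp_id φ := Hom.ext (funext fun _ => funext fun _ => funext fun _ => Category.comp_id _)
  assoc φ ψ χ := Hom.ext (funext fun _ => funext fun _ => funext fun _ => Category.assoc _ _ _)

variable {S S' S'' T T' T'' : GFun V}

lemma hom_ext {φ ψ : S ⟶ T} (h : ∀ X a b, φ.app X a b = ψ.app X a b) : φ = ψ :=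
  Hom.ext (funext fun X => funext fun a => funext fun b => h X a b)

@[simp] lemma id_app (X : Graph V) (a b : X.obj) : Hom.app (𝟙 S) X a b = 𝟙 (S.hom X a b) := rfl

@[simp] lemma comp_app {R : GFun V} (φ : S ⟶ T) (ψ : T ⟶ R) (X : Graph V) (a b : X.obj) :
    (φ ≫ ψ).app X a b = φ.app X a b ≫ ψ.app X a b := rfl

/-- The component of a transformation at `X`, as a map of graphs. -/
abbrev component (φ : S ⟶ T) (X : Graph V) : S.toFunctor.obj X ⟶ T.toFunctor.obj X :=
  ⟨_root_.id, φ.app X⟩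

/-- The underlying natural transformation. -/
abbrev toNatTrans (φ : S ⟶ T) : S.toFunctor ⟶ T.toFunctor where
  app := component φ
  naturality X Y f := Graph.mk_ext (X := ⟨X.obj, S.hom X⟩) (Y := ⟨Y.obj, T.hom Y⟩) f.obj
    (m := fun a b => S.map f a b ≫ φ.app Y _ _) (m' := fun a b => φ.app X a b ≫ T.map f a b)
    (φ.naturality f)

/-- A transformation is cartesian when its naturality squares are pullbacks of graphs. -/
def IsCartesian (φ : S ⟶ T) : Prop := NatTrans.Equifibered (toNatTrans φ)

variable (V) in
/-- The identity functor. -/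
def one : GFun V where
  hom X := X.hom
  map f := f.map
  map_id _ _ _ := rfl
  map_comp _ _ _ _ := rfl

/-- The composite functor, applying `T` first. -/
def comp (S T : GFun V) : GFun V where
  hom X := S.hom (T.toFunctor.obj X)
  map f := S.map (T.toFunctor.map f)
  map_id X a b := (S.map_congr (X := T.toFunctor.obj X) (Y := T.toFunctor.obj X) _root_.id
    (T.map_id X) a b).trans (S.map_id (T.toFunctor.obj X) a b)
  map_comp {X Y Z} f g a b := (S.map_congr (X := T.toFunctor.obj X) (Y := T.toFunctor.obj Z)
    (g.obj ∘ f.obj) (T.map_comp f g) a b).trans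
      (S.map_comp (T.toFunctor.map f) (T.toFunctor.map g) a b)

/-- The horizontal composite of transformations. -/
def hcomp (φ : S ⟶ S') (ψ : T ⟶ T') : comp S T ⟶ comp S' T' where
  app X a b := S.map (component ψ X) a b ≫ φ.app (T'.toFunctor.obj X) a b
  naturality {X Y} f a b := by
    have e : S.map (T.toFunctor.map f) a b ≫ S.map (component ψ Y) (f.obj a) (f.obj b) =
        S.map (component ψ X) a b ≫ S.map (T'.toFunctor.map f) a b :=
      (S.map_comp (T.toFunctor.map f) (component ψ Y) a b).symm.trans
        ((S.map_congr (X := T.toFunctor.obj X) (Y := T'.toFunctor.obj Y) f.obj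
          (ψ.naturality f) a b).trans (S.map_comp (component ψ X) (T'.toFunctor.map f) a b))
    exact (Category.assoc _ _ _).symm.trans ((congrArg (· ≫ _) e).trans
      ((Category.assoc _ _ _).trans ((congrArg (S.map (component ψ X) a b ≫ ·)
        (φ.naturality (T'.toFunctor.map f) a b)).trans (Category.assoc _ _ _).symm)))

lemma hcomp_id : hcomp (𝟙 S) (𝟙 T) = 𝟙 (comp S T) :=
  hom_ext fun X a b => (Category.comp_id _).trans (S.map_id (T.toFunctor.obj X) a b)

lemma hcomp_comp (φ : S ⟶ S') (φ' : S' ⟶ S'') (ψ : T ⟶ T') (ψ' : T' ⟶ T'') :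
    hcomp (φ ≫ φ') (ψ ≫ ψ') = hcomp φ ψ ≫ hcomp φ' ψ' := hom_ext fun X a b => by
  have e : S.map (component (ψ ≫ ψ') X) a b =
      S.map (component ψ X) a b ≫ S.map (component ψ' X) a b :=
    S.map_comp (component ψ X) (component ψ' X) a b
  have e' := φ.naturality (component ψ' X) a b
  change S.map (component (ψ ≫ ψ') X) a b ≫
      φ.app (T''.toFunctor.obj X) a b ≫ φ'.app (T''.toFunctor.obj X) a b =
    (S.map (component ψ X) a b ≫ φ.app (T'.toFunctor.obj X) a b) ≫ S'.map (component ψ' X) a b ≫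
      φ'.app (T''.toFunctor.obj X) a b
  rw [e, Category.assoc, Category.assoc]
  refine congrArg (S.map (component ψ X) a b ≫ ·) ?_
  exact (Category.assoc _ _ _).symm.trans ((congrArg (· ≫ _) e').trans (Category.assoc _ _ _))

lemma IsCartesian.comp {R : GFun V} {φ : S ⟶ T} {ψ : T ⟶ R} (hφ : IsCartesian φ)
    (hψ : IsCartesian ψ) : IsCartesian (φ ≫ ψ) := NatTrans.Equifibered.comp hφ hψ

lemma IsCartesian.hcomp {φ : S ⟶ S'} {ψ : T ⟶ T'} (hφ : IsCartesian φ) (hψ : IsCartesian ψ)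
    (h : PreservesLimitsOfShape WalkingCospan S'.toFunctor) : IsCartesian (hcomp φ ψ) := by
  have e : toNatTrans (GFun.hcomp φ ψ) = Functor.whiskerLeft T.toFunctor (toNatTrans φ) ≫
      Functor.whiskerRight (toNatTrans ψ) S'.toFunctor := by
    refine NatTrans.ext (funext fun X => ?_)
    exact Graph.mk_ext (X := S.toFunctor.obj (T.toFunctor.obj X))
      (Y := S'.toFunctor.obj (T'.toFunctor.obj X)) _root_.id (φ.naturality (component ψ X))
  rw [IsCartesian, e]
  exact (NatTrans.Equifibered.whiskerLeft hφ T.toFunctor).comp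
    (NatTrans.Equifibered.whiskerRight hψ S'.toFunctor)

end GFun

variable (V) in
/-- A monad over `Set` on `G V`: its functor, unit and multiplication are over `Set`. -/
structure MonadOverSet where
  T : GFun V
  η : GFun.one V ⟶ T
  μ : GFun.comp T T ⟶ T
  left_unit (X : Graph V) (a b : X.obj) :
    η.app (T.toFunctor.obj X) a b ≫ μ.app X a b = 𝟙 (T.hom X a b)
  right_unit (X : Graph V) (a b : X.obj) :
    T.map (GFun.component η X) a b ≫ μ.app X a b = 𝟙 (T.hom X a b)
  assoc (X : Graph V) (a b : X.obj) :
    T.map (GFun.component μ X) a b ≫ μ.app X a b =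
      μ.app (T.toFunctor.obj X) a b ≫ μ.app X a b

namespace MonadOverSet

/-- The underlying monad on `G V`. -/
def toMonad (T : MonadOverSet V) : Monad (Graph V) where
  toFunctor := T.T.toFunctor
  η := { app := fun X => GFun.component T.η X, naturality := (GFun.toNatTrans T.η).naturality }
  μ := { app := fun X => GFun.component T.μ X, naturality := (GFun.toNatTrans T.μ).naturality }
  assoc X := Graph.mk_ext (X := T.T.toFunctor.obj (T.T.toFunctor.obj (T.T.toFunctor.obj X)))
    (Y := T.T.toFunctor.obj X) _root_.id
    (m := fun a b => T.T.map (GFun.component T.μ X) a b ≫ T.μ.app X a b)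
    (m' := fun a b => T.μ.app (T.T.toFunctor.obj X) a b ≫ T.μ.app X a b) (T.assoc X)
  left_unit X := Graph.mk_ext _root_.id (T.left_unit X)
  right_unit X := Graph.mk_ext _root_.id (T.right_unit X)

/-- A monad over `Set` is cartesian when its functor preserves pullbacks, and its unit and
multiplication are cartesian. -/
class IsCartesian (T : MonadOverSet V) : Prop where
  pullbacks : PreservesLimitsOfShape WalkingCospan T.T.toFunctor
  unit : GFun.IsCartesian T.η
  mult : GFun.IsCartesian T.μ

/-- The transformation `φ` over `Set` is a morphism of monads. -/
structure IsHom {S T : MonadOverSet V} (φ : S.T ⟶ T.T) : Prop where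
  unit : S.η ≫ φ = T.η
  mult : S.μ ≫ φ = GFun.hcomp φ φ ≫ T.μ

end MonadOverSet

end Graphs

/-! ### Collections over a monad over `Set` -/

section NCollections

variable {V : Type u} [Category.{v} V]

namespace GFun

variable {A A' B B' C C' : GFun V}

lemma hcomp_assoc (φ : A ⟶ A') (ψ : B ⟶ B') (χ : C ⟶ C') :
    (hcomp (hcomp φ ψ) χ : comp (comp A B) C ⟶ comp (comp A' B') C') =
      hcomp φ (hcomp ψ χ) := hom_ext fun X a b => by
  have e := A.map_comp (B.toFunctor.map (component χ X)) (component ψ (C'.toFunctor.obj X)) a b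
  exact (Category.assoc _ _ _).symm.trans (congrArg
    (· ≫ φ.app (B'.toFunctor.obj (C'.toFunctor.obj X)) a b) e.symm)

lemma one_hcomp (φ : A ⟶ A') : (hcomp (𝟙 (one V)) φ : comp (one V) A ⟶ comp (one V) A') = φ :=
  hom_ext fun _ _ _ => Category.comp_id _

lemma hcomp_one (φ : A ⟶ A') : (hcomp φ (𝟙 (one V)) : comp A (one V) ⟶ comp A' (one V)) = φ :=
  hom_ext fun X a b => (congrArg (· ≫ _) (A.map_id X a b)).trans (Category.id_comp _)

end GFun

namespace MonadOverSet

variable (T : MonadOverSet V)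

lemma one_mul : GFun.hcomp T.η (𝟙 T.T) ≫ T.μ = (𝟙 T.T : T.T ⟶ T.T) :=
  GFun.hom_ext fun X a b => (congrArg (· ≫ _) (Category.id_comp _)).trans (T.left_unit X a b)

lemma mul_one : GFun.hcomp (𝟙 T.T) T.η ≫ T.μ = (𝟙 T.T : T.T ⟶ T.T) :=
  GFun.hom_ext fun X a b => (congrArg (· ≫ _) (Category.comp_id _)).trans (T.right_unit X a b)

lemma mul_assoc : GFun.hcomp T.μ (𝟙 T.T) ≫ T.μ =
    (GFun.hcomp (𝟙 T.T) T.μ ≫ T.μ : GFun.comp T.T (GFun.comp T.T T.T) ⟶ T.T) :=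
  GFun.hom_ext fun X a b => by
    refine (congrArg (· ≫ _) ((congrArg (· ≫ _)
      ((GFun.comp T.T T.T).map_id (T.T.toFunctor.obj X) a b)).trans (Category.id_comp _))).trans ?_
    exact (T.assoc X a b).symm.trans (congrArg (· ≫ _) (Category.comp_id _).symm)

end MonadOverSet

/-- A collection over `Set` over the monad `T`: a cartesian transformation `A ⟶ T` over `Set`. -/
structure NColl (T : MonadOverSet V) where
  A : GFun V
  α : A ⟶ T.T
  cart : GFun.IsCartesian α

namespace NColl

variable {T : MonadOverSet V}

/-- A morphism of collections is a transformation over `T`. -/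
@[ext]
structure Hom (X Y : NColl T) where
  φ : X.A ⟶ Y.A
  w : φ ≫ Y.α = X.α

instance : Category (NColl T) where
  Hom := Hom
  id X := ⟨𝟙 _, Category.id_comp _⟩
  comp f g := ⟨f.φ ≫ g.φ, by rw [Category.assoc, g.w, f.w]⟩

@[ext] lemma hom_ext {X Y : NColl T} {f g : X ⟶ Y} (h : f.φ = g.φ) : f = g := Hom.ext h

@[simp] lemma id_φ (X : NColl T) : Hom.φ (𝟙 X) = 𝟙 X.A := rfl
@[simp] lemma comp_φ {X Y Z : NColl T} (f : X ⟶ Y) (g : Y ⟶ Z) : (f ≫ g).φ = f.φ ≫ g.φ := rfl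

def mkIso {X Y : NColl T} (e : X.A ≅ Y.A) (w : e.hom ≫ Y.α = X.α) : X ≅ Y where
  hom := ⟨e.hom, w⟩
  inv := ⟨e.inv, by rw [← w, e.inv_hom_id_assoc]⟩
  hom_inv_id := hom_ext e.hom_inv_id
  inv_hom_id := hom_ext e.inv_hom_id

variable [T.IsCartesian]

/-- The composite, over `T` by the multiplication. -/
def tensor (X Y : NColl T) : NColl T where
  A := GFun.comp X.A Y.A
  α := GFun.hcomp X.α Y.α ≫ T.μ
  cart := (X.cart.hcomp Y.cart MonadOverSet.IsCartesian.pullbacks).comp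
      MonadOverSet.IsCartesian.mult

variable (T) in
/-- The identity functor, over `T` by the unit. -/
def unit : NColl T where
  A := GFun.one V
  α := T.η
  cart := MonadOverSet.IsCartesian.unit

def tensorHom {X X' Y Y' : NColl T} (f : X ⟶ X') (g : Y ⟶ Y') :
    tensor X Y ⟶ tensor X' Y' where
  φ := GFun.hcomp f.φ g.φ
  w := by
    change _ ≫ GFun.hcomp _ _ ≫ _ = GFun.hcomp _ _ ≫ _
    rw [← Category.assoc, ← GFun.hcomp_comp, f.w, g.w]

def assoc (X Y Z : NColl T) : tensor (tensor X Y) Z ≅ tensor X (tensor Y Z) :=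
  mkIso (Iso.refl (GFun.comp X.A (GFun.comp Y.A Z.A))) <| by
    refine (Category.id_comp _).trans ?_
    change GFun.hcomp X.α (GFun.hcomp Y.α Z.α ≫ T.μ) ≫ T.μ =
      GFun.hcomp (GFun.hcomp X.α Y.α ≫ T.μ) Z.α ≫ T.μ
    have e1 : GFun.hcomp X.α (GFun.hcomp Y.α Z.α ≫ T.μ) =
        GFun.hcomp X.α (GFun.hcomp Y.α Z.α) ≫ GFun.hcomp (𝟙 _) T.μ := by
      rw [← GFun.hcomp_comp, Category.comp_id]
    have e2 : GFun.hcomp (GFun.hcomp X.α Y.α ≫ T.μ) Z.α =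
        GFun.hcomp (GFun.hcomp X.α Y.α) Z.α ≫ GFun.hcomp T.μ (𝟙 _) := by
      rw [← GFun.hcomp_comp, Category.comp_id]
    rw [e1, e2, Category.assoc, Category.assoc]
    exact congrArg₂ (· ≫ ·) (GFun.hcomp_assoc X.α Y.α Z.α).symm T.mul_assoc.symm

def leftUnitor (X : NColl T) : tensor (unit T) X ≅ X :=
  mkIso (Iso.refl X.A) <| by
    refine (Category.id_comp _).trans ?_
    change _ = GFun.hcomp T.η X.α ≫ T.μ
    have e : GFun.hcomp T.η X.α = GFun.hcomp (𝟙 (GFun.one V)) X.α ≫ GFun.hcomp T.η (𝟙 _) := by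
      rw [← GFun.hcomp_comp, Category.comp_id, Category.id_comp]
    rw [e, Category.assoc, T.one_mul]
    exact (GFun.one_hcomp X.α).symm.trans (Category.comp_id _).symm

def rightUnitor (X : NColl T) : tensor X (unit T) ≅ X :=
  mkIso (Iso.refl X.A) <| by
    refine (Category.id_comp _).trans ?_
    change _ = GFun.hcomp X.α T.η ≫ T.μ
    have e : GFun.hcomp X.α T.η = GFun.hcomp X.α (𝟙 (GFun.one V)) ≫ GFun.hcomp (𝟙 _) T.η := by
      rw [← GFun.hcomp_comp, Category.comp_id, Category.id_comp]
    rw [e, Category.assoc, T.mul_one]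
    exact (GFun.hcomp_one X.α).symm.trans (Category.comp_id _).symm

instance : MonoidalCategoryStruct (NColl T) where
  tensorObj := tensor
  tensorHom := tensorHom
  whiskerLeft X _ _ f := tensorHom (𝟙 X) f
  whiskerRight f Y := tensorHom f (𝟙 Y)
  tensorUnit := unit T
  associator := assoc
  leftUnitor := leftUnitor
  rightUnitor := rightUnitor

/-- The monoidal category of collections over `Set` over a cartesian monad over `Set`. -/
instance : MonoidalCategory (NColl T) :=
  MonoidalCategory.ofTensorHom
    (id_tensorHom_id := fun X Y => hom_ext GFun.hcomp_id)
    (id_tensorHom := fun _ _ _ _ => rfl)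
    (tensorHom_id := fun _ _ => rfl)
    (tensorHom_comp_tensorHom := fun f f' g g' => hom_ext (GFun.hcomp_comp _ _ _ _).symm)
    (associator_naturality := fun f g h => hom_ext <|
      (Category.comp_id _).trans ((GFun.hcomp_assoc f.φ g.φ h.φ).trans (Category.id_comp _).symm))
    (leftUnitor_naturality := fun f => hom_ext <|
      (Category.comp_id _).trans ((GFun.one_hcomp f.φ).trans (Category.id_comp _).symm))
    (rightUnitor_naturality := fun f => hom_ext <|
      (Category.comp_id _).trans ((GFun.hcomp_one f.φ).trans (Category.id_comp _).symm))
    (pentagon := fun W X Y Z => hom_ext <| by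
      change GFun.hcomp (𝟙 (GFun.comp W.A (GFun.comp X.A Y.A))) (𝟙 Z.A) ≫
        𝟙 (GFun.comp W.A (GFun.comp (GFun.comp X.A Y.A) Z.A)) ≫
        GFun.hcomp (𝟙 W.A) (𝟙 (GFun.comp X.A (GFun.comp Y.A Z.A))) =
        𝟙 (GFun.comp W.A (GFun.comp X.A (GFun.comp Y.A Z.A))) ≫ 𝟙 _
      let K := GFun.comp W.A (GFun.comp X.A (GFun.comp Y.A Z.A))
      have e1 := GFun.hcomp_id (S := GFun.comp W.A (GFun.comp X.A Y.A)) (T := Z.A)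
      have e2 := GFun.hcomp_id (S := W.A) (T := GFun.comp X.A (GFun.comp Y.A Z.A))
      exact (congrArg₂ (fun f g : K ⟶ K => f ≫ 𝟙 K ≫ g) e1 e2).trans (Category.id_comp _))
    (triangle := fun X Y => hom_ext <| by
      change 𝟙 (GFun.comp X.A Y.A) ≫ GFun.hcomp (𝟙 X.A) (𝟙 Y.A) = GFun.hcomp (𝟙 X.A) (𝟙 Y.A)
      exact Category.id_comp _)

end NColl

end NCollections

/-! ### The construction `Γ` -/

section Paths

variable {O : Type v}

/-- A sequence `x₀, …, xₙ` of elements with `x₀ = a` and `xₙ = b`. -/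
inductive Path : O → O → Type v
  | nil (a : O) : Path a a
  | cons (a : O) {b c : O} (p : Path b c) : Path a c

namespace Path

/-- The sequence `G x₀ x₁, …, G xₙ₋₁ xₙ`. -/
def seq {D : Type*} (G : O → O → D) : {a b : O} → Path a b → List D
  | _, _, nil _ => []
  | _, _, cons a (b := b) p => G a b :: seq G p

def map {O' : Type v} (f : O → O') : {a b : O} → Path a b → Path (f a) (f b)
  | _, _, nil a => nil (f a)
  | _, _, cons a p => cons (f a) (map f p)

def append : {a b c : O} → Path a b → Path b c → Path a c
  | _, _, _, nil _, q => q
  | _, _, _, cons a p, q => cons a (append p q)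

lemma map_id : {a b : O} → (p : Path a b) → p.map _root_.id = p
  | _, _, nil _ => rfl
  | _, _, cons a p => congrArg (cons a) (map_id p)

lemma map_map {O' O'' : Type v} (f : O → O') (g : O' → O'') : {a b : O} → (p : Path a b) →
    (p.map f).map g = p.map (g ∘ f)
  | _, _, nil _ => rfl
  | _, _, cons _ p => congrArg (cons _) (map_map f g p)

lemma map_append {O' : Type v} (f : O → O') : {a b c : O} → (p : Path a b) → (q : Path b c) →
    (p.append q).map f = (p.map f).append (q.map f)
  | _, _, _, nil _, _ => rfl
  | _, _, _, cons _ p, q => congrArg (cons _) (map_append f p q)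

lemma seq_append {D : Type*} (G : O → O → D) : {a b c : O} → (p : Path a b) → (q : Path b c) →
    (p.append q).seq G = p.seq G ++ q.seq G
  | _, _, _, nil _, _ => rfl
  | _, _, _, cons _ p, q => congrArg (_ :: ·) (seq_append G p q)

variable {V : Type u} [Category.{v₁} V]

/-- The sequence of maps `m x₀ x₁, …, m xₙ₋₁ xₙ`. -/
def seqHom {O' : Type v} {G : O → O → V} {G' : O' → O' → V} (f : O → O')
    (m : ∀ a b, G a b ⟶ G' (f a) (f b)) : {a b : O} → (p : Path a b) →
    (p.seq G ⟶ (p.map f).seq G')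
  | _, _, nil _ => 𝟙 []
  | _, _, cons a p => consHom (m a _) (seqHom f m p)

/-- The sequence of maps `m x₀ x₁, …, m xₙ₋₁ xₙ`, for `m` the identity on objects. -/
def seqHom' {G G' : O → O → V} (m : ∀ a b, G a b ⟶ G' a b) : {a b : O} → (p : Path a b) →
    (p.seq G ⟶ p.seq G')
  | _, _, nil _ => 𝟙 []
  | _, _, cons a p => consHom (m a _) (seqHom' m p)

lemma seqHom_id {G G' : O → O → V} (m : ∀ a b, G a b ⟶ G' a b) : {a b : O} → (p : Path a b) →
    HEq (seqHom (G' := G') _root_.id m p) (seqHom' m p)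
  | _, _, nil _ => HEq.rfl
  | _, _, cons a p =>
    consHom_heq (m a _) rfl (congrArg (seq G') (map_id p)) (seqHom_id m p)

lemma seqHom'_id (G : O → O → V) : {a b : O} → (p : Path a b) →
    seqHom' (fun a b => 𝟙 (G a b)) p = 𝟙 (p.seq G)
  | _, _, nil _ => rfl
  | _, _, cons _ p => congrArg (consHom _) (seqHom'_id G p)

lemma seqHom_comp {O' O'' : Type v} {G : O → O → V} {G' : O' → O' → V} {G'' : O'' → O'' → V}
    (f : O → O') (f' : O' → O'') (m : ∀ a b, G a b ⟶ G' (f a) (f b))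
    (m' : ∀ a b, G' a b ⟶ G'' (f' a) (f' b)) : {a b : O} → (p : Path a b) →
    HEq (seqHom (G' := G'') (f' ∘ f) (fun a b => m a b ≫ m' (f a) (f b)) p)
      (seqHom f m p ≫ seqHom f' m' (p.map f))
  | _, _, nil _ => HEq.rfl
  | _, _, cons a p =>
    consHom_heq _ rfl (congrArg (seq G'') (map_map f f' p).symm) (seqHom_comp f f' m m' p)

end Path

end Paths

section Gamma

variable {V : Type u} [Category.{v} V] [Lextensive V]

noncomputable def gι₀ (A : List V ⥤ V) (X : Graph V) {a b : X.obj} (p : Path a b) :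
    A.obj (p.seq X.hom) ⟶ ∐ fun p : Path a b => A.obj (p.seq X.hom) :=
  Sigma.ι (fun p : Path a b => A.obj (p.seq X.hom)) p

lemma gι₀_isCoprod (A : List V ⥤ V) (X : Graph V) (a b : X.obj) :
    IsCoprod fun p : Path a b => gι₀ A X p := isCoprod_ι _

/-- The effect of `Γ A` on homs. -/
noncomputable def gMap (A : List V ⥤ V) {X Y : Graph V} (f : X ⟶ Y) (a b : X.obj) :
    (∐ fun p : Path a b => A.obj (p.seq X.hom)) ⟶
      ∐ fun p : Path (f.obj a) (f.obj b) => A.obj (p.seq Y.hom) :=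
  (gι₀_isCoprod A X a b).desc fun p => A.map (p.seqHom f.obj f.map) ≫ gι₀ A Y (p.map f.obj)

lemma gι₀_map (A : List V ⥤ V) {X Y : Graph V} (f : X ⟶ Y) {a b : X.obj} (p : Path a b) :
    gι₀ A X p ≫ gMap A f a b = A.map (p.seqHom f.obj f.map) ≫ gι₀ A Y (p.map f.obj) :=
  (gι₀_isCoprod A X a b).fac
    (fun p => A.map (p.seqHom f.obj f.map) ≫ gι₀ A Y (p.map f.obj)) p

lemma gι₀_map_assoc (A : List V ⥤ V) {X Y : Graph V} (f : X ⟶ Y) {a b : X.obj} (p : Path a b)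
    {W : V} (k : (∐ fun p : Path (f.obj a) (f.obj b) => A.obj (p.seq Y.hom)) ⟶ W) :
    gι₀ A X p ≫ gMap A f a b ≫ k = A.map (p.seqHom f.obj f.map) ≫ gι₀ A Y (p.map f.obj) ≫ k := by
  rw [← Category.assoc, gι₀_map, Category.assoc]

lemma map_gι₀ (A : List V ⥤ V) (X : Graph V) {a b : X.obj} {p q : Path a b} (h : p = q)
    {l : List V} {φ : l ⟶ p.seq X.hom} {ψ : l ⟶ q.seq X.hom} (w : HEq φ ψ) :
    A.map φ ≫ gι₀ A X p = A.map ψ ≫ gι₀ A X q := by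
  subst h; cases w; rfl

/-- The functor `Γ A` over `Set`: its hom `Γ A X (a, b)` is the coproduct of the objects
`A (X (x₀, x₁), …, X (xₙ₋₁, xₙ))` over all the sequences `a = x₀, …, xₙ = b` of objects of `X`. -/
noncomputable def gamma (A : List V ⥤ V) : GFun V where
  hom X a b := ∐ fun p : Path a b => A.obj (p.seq X.hom)
  map f := gMap A f
  map_id X a b := (gι₀_isCoprod A X a b).hom_ext fun p => by
    refine (gι₀_map A (𝟙 X) p).trans ?_
    refine (map_gι₀ A X p.map_id ((Path.seqHom_id _ p).trans
      (heq_of_eq (Path.seqHom'_id X.hom p)))).trans ?_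
    rw [A.map_id, Category.id_comp, Category.comp_id]
  map_comp {X Y Z} f g a b := (gι₀_isCoprod A X a b).hom_ext fun p => by
    refine (gι₀_map A (f ≫ g) p).trans ?_
    refine (map_gι₀ A Z (Path.map_map f.obj g.obj p).symm
      (Path.seqHom_comp f.obj g.obj f.map g.map p)).trans ?_
    rw [gι₀_map_assoc, gι₀_map, A.map_comp, Category.assoc]

/-- The inclusion of the summand of `Γ A X (a, b)` at a path. -/
noncomputable def gι (A : List V ⥤ V) (X : Graph V) {a b : X.obj} (p : Path a b) :
    A.obj (p.seq X.hom) ⟶ (gamma A).hom X a b := gι₀ A X p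

lemma gι_isCoprod (A : List V ⥤ V) (X : Graph V) (a b : X.obj) :
    IsCoprod fun p : Path a b => gι A X p := gι₀_isCoprod A X a b

lemma gι_map (A : List V ⥤ V) {X Y : Graph V} (f : X ⟶ Y) {a b : X.obj} (p : Path a b) :
    gι A X p ≫ (gamma A).map f a b = A.map (p.seqHom f.obj f.map) ≫ gι A Y (p.map f.obj) :=
  gι₀_map A f p

lemma gι_map_assoc (A : List V ⥤ V) {X Y : Graph V} (f : X ⟶ Y) {a b : X.obj} (p : Path a b)
    {W : V} (k : (gamma A).hom Y (f.obj a) (f.obj b) ⟶ W) :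
    gι A X p ≫ (gamma A).map f a b ≫ k =
      A.map (p.seqHom f.obj f.map) ≫ gι A Y (p.map f.obj) ≫ k :=
  gι₀_map_assoc A f p k

lemma map_gι (A : List V ⥤ V) (X : Graph V) {a b : X.obj} {p q : Path a b} (h : p = q)
    {l : List V} {φ : l ⟶ p.seq X.hom} {ψ : l ⟶ q.seq X.hom} (w : HEq φ ψ) :
    A.map φ ≫ gι A X p = A.map ψ ≫ gι A X q := map_gι₀ A X h w

/-- The effect of `Γ A` on a map which is the identity on objects. -/
lemma gι_map' (A : List V ⥤ V) {O : Type v} {G G' : O → O → V} (m : ∀ a b, G a b ⟶ G' a b)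
    {a b : O} (p : Path a b) :
    gι A ⟨O, G⟩ p ≫ (gamma A).map (Graph.Hom.mk _root_.id m : Graph.mk O G ⟶ Graph.mk O G') a b =
      A.map (p.seqHom' m) ≫ gι A ⟨O, G'⟩ p :=
  (gι_map A (Graph.Hom.mk _root_.id m : Graph.mk O G ⟶ Graph.mk O G') p).trans
    (map_gι A ⟨O, G'⟩ p.map_id (Path.seqHom_id m p))

/-- The effect of `Γ` on transformations. -/
noncomputable def gammaMap {A B : List V ⥤ V} (φ : A ⟶ B) : gamma A ⟶ gamma B where
  app X a b := (gι_isCoprod A X a b).desc fun p => φ.app _ ≫ gι B X p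
  naturality {X Y} f a b := (gι_isCoprod A X a b).hom_ext fun p => by
    refine (gι_map_assoc A f p _).trans ?_
    rw [(gι_isCoprod A Y _ _).fac, (gι_isCoprod A X a b).fac_assoc, φ.naturality_assoc,
      Category.assoc]
    exact congrArg (_ ≫ ·) (gι_map B f p).symm

lemma gι_gammaMap {A B : List V ⥤ V} (φ : A ⟶ B) (X : Graph V) {a b : X.obj} (p : Path a b) :
    gι A X p ≫ (gammaMap φ).app X a b = φ.app _ ≫ gι B X p :=
  (gι_isCoprod A X a b).fac (fun p => φ.app _ ≫ gι B X p) p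

lemma gammaMap_id (A : List V ⥤ V) : gammaMap (𝟙 A) = 𝟙 (gamma A) :=
  GFun.hom_ext fun X a b => (gι_isCoprod A X a b).hom_ext fun p =>
    (gι_gammaMap _ X p).trans ((Category.id_comp _).trans (Category.comp_id _).symm)

lemma gammaMap_comp {A B C : List V ⥤ V} (φ : A ⟶ B) (ψ : B ⟶ C) :
    gammaMap (φ ≫ ψ) = gammaMap φ ≫ gammaMap ψ :=
  GFun.hom_ext fun X a b => (gι_isCoprod A X a b).hom_ext fun p => by
    refine (gι_gammaMap _ X p).trans ?_
    rw [GFun.comp_app, ← Category.assoc, gι_gammaMap, Category.assoc, gι_gammaMap,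
      NatTrans.comp_app, Category.assoc]

end Gamma

section Lifts

variable {O : Type v}

namespace Path

/-- Families of elements of `K x₀ x₁, …, K xₙ₋₁ xₙ`. -/
def Lift (K : O → O → Type v) : {a b : O} → Path a b → Type v
  | _, _, nil _ => PUnit
  | _, _, cons a (b := b) p => K a b × Lift K p

def liftSeq {K : O → O → Type v} {D : Type*} (G : ∀ a b, K a b → D) : {a b : O} → (p : Path a b) →
    p.Lift K → List D
  | _, _, nil _, _ => []
  | _, _, cons _ p, k => G _ _ k.1 :: liftSeq G p k.2

/-- The concatenation of paths from `x₀` to `x₁`, …, from `xₙ₋₁` to `xₙ`. -/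
def join : {a b : O} → (p : Path a b) → p.Lift Path → Path a b
  | _, _, nil a, _ => nil a
  | _, _, cons _ p, k => k.1.append (join p k.2)

lemma flat_liftSeq {D : Type u} [Category.{v₁} D] (G : O → O → D) : {a b : O} → (p : Path a b) →
    (k : p.Lift Path) → flat.obj (p.liftSeq (fun _ _ q => q.seq G) k) = (p.join k).seq G
  | _, _, nil _, _ => rfl
  | _, _, cons _ p, k =>
    (congrArg (k.1.seq G ++ ·) (flat_liftSeq G p k.2)).trans (seq_append G k.1 _).symm

section LiftHom

variable {V : Type u} [Category.{v₁} V] {D : Type*} {K : O → O → Type v} {G : ∀ a b, K a b → D}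
  {β : D → V} {L : O → O → V}

def liftHom (c : ∀ a b (k : K a b), β (G a b k) ⟶ L a b) : {a b : O} → (p : Path a b) →
    (k : p.Lift K) → ((p.liftSeq G k).map β ⟶ p.seq L)
  | _, _, nil _, _ => 𝟙 []
  | _, _, cons _ p, k => consHom (c _ _ k.1) (liftHom c p k.2)

end LiftHom

end Path

/-- Joint distributivity: coproducts in all variables at once. -/
lemma Distributive.lift {V : Type u} [Category.{v} V] {D : Type*} {K : O → O → Type v}
    {G : ∀ a b, K a b → D} {β : D → V} {L : O → O → V} {E : List V ⥤ V} (hE : Distributive E)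
    {c : ∀ a b (k : K a b), β (G a b k) ⟶ L a b} (hc : ∀ a b, IsCoprod (c a b)) :
    ∀ {a b : O} (p : Path a b), IsCoprod fun k : p.Lift K => E.map (p.liftHom c k) := by
  intro a b p
  induction p generalizing E with
  | nil a =>
    intro W f
    refine ⟨f ⟨⟩, fun _ => ?_, fun g hg => ?_⟩
    · exact (congrArg (· ≫ _) (E.map_id _)).trans (Category.id_comp _)
    · exact ((congrArg (· ≫ g) (E.map_id _)).trans (Category.id_comp _)).symm.trans (hg ⟨⟩)
  | @cons a b c' p ih =>
    have h2 := (ih (hE.consFunctor (L a b))).sigma fun k =>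
      hE [] ((p.liftSeq G k).map β) _ _ _ (hc a b)
    refine @IsCoprod.reindex _ _ _ _ _ _ _ _ _ h2 (fun k => ⟨k.2, k.1⟩) ⟨?_, ?_⟩ (fun k => 𝟙 _)
      (fun k => IsIso.id (E.obj (((Path.cons a p).liftSeq G k).map β))) ?_
    · rintro ⟨k, k'⟩ ⟨l, l'⟩ h
      cases h; rfl
    · rintro ⟨k, k'⟩
      exact ⟨⟨k', k⟩, rfl⟩
    · rintro ⟨k, k'⟩
      refine Eq.trans ?_ (Category.id_comp _).symm
      refine Eq.trans ?_ (E.map_comp _ _)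
      refine congrArg (fun f => E.map f) ?_
      exact congr (congrArg consHom (Category.comp_id _).symm) (Category.id_comp _).symm

end Lifts

section GammaComp

variable {V : Type u} [Category.{v} V] [Lextensive V]

/-- The inclusion of `A_i B_j X (x_{i, j-1}, x_{ij})` in `Γ A (Γ B X) (a, b)`. -/
noncomputable def gι₂ (A B : List V ⥤ V) (X : Graph V) {a b : X.obj} (p : Path a b)
    (k : p.Lift Path) : A.obj ((mapSeq B).obj (p.liftSeq (fun _ _ q => q.seq X.hom) k)) ⟶
      (GFun.comp (gamma A) (gamma B)).hom X a b :=
  A.map (p.liftHom (fun _ _ q => gι B X q) k) ≫ gι A ((gamma B).toFunctor.obj X) p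

lemma gι₂_isCoprod {A : List V ⥤ V} (hA : Distributive A) (B : List V ⥤ V) (X : Graph V)
    (a b : X.obj) : IsCoprod fun i : (Σ p : Path a b, p.Lift Path) => gι₂ A B X i.1 i.2 :=
  (gι_isCoprod A ((gamma B).toFunctor.obj X) a b).sigma fun p =>
    hA.lift (fun a b => gι_isCoprod B X a b) p

/-- The inclusion of `A_i B_j X (x_{i, j-1}, x_{ij})` in `Γ (A ∘ B) X (a, b)`. -/
noncomputable def gι₂' (A B : List V ⥤ V) (X : Graph V) {a b : X.obj} (p : Path a b)
    (k : p.Lift Path) : A.obj ((mapSeq B).obj (p.liftSeq (fun _ _ q => q.seq X.hom) k)) ⟶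
      (gamma (comp A B)).hom X a b :=
  lanι flat (mapSeq B ⋙ A) _ (p.flat_liftSeq X.hom k) ≫ gι (comp A B) X (p.join k)

namespace Path

def mapLift {O O' : Type v} {K : O → O → Type v} {K' : O' → O' → Type v} (f : O → O')
    (F : ∀ a b, K a b → K' (f a) (f b)) : {a b : O} → (p : Path a b) → p.Lift K →
    (p.map f).Lift K'
  | _, _, nil _, _ => ⟨⟩
  | _, _, cons _ p, k => ⟨F _ _ k.1, mapLift f F p k.2⟩

lemma join_mapLift {O O' : Type v} (f : O → O') : {a b : O} → (p : Path a b) → (k : p.Lift Path) →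
    (p.map f).join (p.mapLift (K' := Path) f (fun _ _ q => q.map f) k) = (p.join k).map f
  | _, _, nil _, _ => rfl
  | _, _, cons _ p, k =>
    (congrArg (append _) (join_mapLift f p k.2)).trans (map_append f k.1 _).symm

/-- The effect of a map of graphs on the sequences of homs. -/
def segHom {X Y : Graph V} (f : X ⟶ Y) : {a b : X.obj} → (p : Path a b) → (k : p.Lift Path) →
    (p.liftSeq (fun _ _ q => q.seq X.hom) k ⟶
      (p.map f.obj).liftSeq (fun _ _ q => q.seq Y.hom)
        (p.mapLift (K' := Path) f.obj (fun _ _ q => q.map f.obj) k))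
  | _, _, nil _, _ => 𝟙 []
  | _, _, cons _ p, k => consHom (k.1.seqHom f.obj f.map) (segHom f p k.2)

lemma seqHom_append {X Y : Graph V} (f : X ⟶ Y) : {a b c : X.obj} → (p : Path a b) →
    (q : Path b c) → HEq (appendHom (p.seqHom f.obj f.map) (q.seqHom f.obj f.map))
      ((p.append q).seqHom f.obj f.map)
  | _, _, _, nil _, q => HEq.rfl
  | _, _, _, cons _ p, q => consHom_heq _ (seq_append X.hom p q).symm (by
      rw [map_append, seq_append]; rfl) (seqHom_append f p q)

lemma flat_segHom {X Y : Graph V} (f : X ⟶ Y) : {a b : X.obj} → (p : Path a b) →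
    (k : p.Lift Path) → HEq (flat.map (segHom f p k)) ((p.join k).seqHom f.obj f.map)
  | _, _, nil _, _ => HEq.rfl
  | _, _, cons _ p, k => (appendHom_heq rfl rfl (flat_liftSeq X.hom p k.2)
      ((flat_liftSeq Y.hom _ _).trans (by rw [join_mapLift])) HEq.rfl
      (flat_segHom f p k.2)).trans (seqHom_append f k.1 (p.join k.2))

end Path

lemma gι₂_naturality (A B : List V ⥤ V) {X Y : Graph V} (f : X ⟶ Y) {a b : X.obj} (p : Path a b)
    (k : p.Lift Path) :
    gι₂ A B X p k ≫ (GFun.comp (gamma A) (gamma B)).map f a b =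
      A.map ((mapSeq B).map (p.segHom f k)) ≫
        gι₂ A B Y (p.map f.obj) (p.mapLift (K' := Path) f.obj (fun _ _ q => q.map f.obj) k) := by
  have e1 := gι_map A ((gamma B).toFunctor.map f) p
  have e2 : p.liftHom (fun _ _ q => gι B X q) k ≫ p.seqHom f.obj ((gamma B).map f) =
      (mapSeq B).map (p.segHom f k) ≫ (p.map f.obj).liftHom (fun _ _ q => gι B Y q)
        (p.mapLift (K' := Path) f.obj (fun _ _ q => q.map f.obj) k) := by
    clear e1
    induction p with
    | nil a => rfl
    | cons a p ih => exact congr (congrArg consHom (gι_map B f k.1)) (ih k.2)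
  refine (Category.assoc _ _ _).trans ((congrArg
    (A.map (p.liftHom (fun _ _ q => gι B X q) k) ≫ ·) e1).trans ?_)
  refine Eq.trans ?_ ((congrArg (A.map · ≫ gι A ((gamma B).toFunctor.obj Y) (p.map f.obj))
    e2).trans ?_)
  · exact (A.map_comp_assoc _ _ _).symm
  · exact A.map_comp_assoc _ _ _

lemma gι₂'_naturality (A B : List V ⥤ V) {X Y : Graph V} (f : X ⟶ Y) {a b : X.obj} (p : Path a b)
    (k : p.Lift Path) :
    gι₂' A B X p k ≫ (gamma (comp A B)).map f a b =
      A.map ((mapSeq B).map (p.segHom f k)) ≫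
        gι₂' A B Y (p.map f.obj) (p.mapLift (K' := Path) f.obj (fun _ _ q => q.map f.obj) k) := by
  have h := p.join_mapLift f.obj k
  have e1 := lanι_map flat (mapSeq B ⋙ A) (p.segHom f k) (p.flat_liftSeq X.hom k)
    ((Path.flat_liftSeq Y.hom _ _).trans (congrArg (Path.seq Y.hom) h))
    ((p.join k).seqHom f.obj f.map) (p.flat_segHom f k)
  have e2 : ∀ (q q' : Path (f.obj a) (f.obj b)) (h : q' = q) (M : List (List V))
      (h₁ : flat.obj M = q'.seq Y.hom) (h₂ : flat.obj M = q.seq Y.hom),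
      lanι flat (mapSeq B ⋙ A) M h₂ ≫ gι (comp A B) Y q =
        lanι flat (mapSeq B ⋙ A) M h₁ ≫ gι (comp A B) Y q' := by
    rintro q _ rfl M h₁ h₂; rfl
  rw [gι₂', gι₂', Category.assoc, gι_map, ← Category.assoc, e1, Category.assoc]
  exact congrArg (_ ≫ ·) (e2 _ _ h _ _ _)

/-- The canonical map `Γ A ∘ Γ B ⟶ Γ (A ∘ B)`, for `A` distributive. It identifies the two
coproducts of the objects `A_i B_j X (x_{i, j-1}, x_{ij})`. -/
noncomputable def gammaComp {A : List V ⥤ V} (hA : Distributive A) (B : List V ⥤ V) :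
    GFun.comp (gamma A) (gamma B) ⟶ gamma (comp A B) where
  app X a b := (gι₂_isCoprod hA B X a b).desc fun i => gι₂' A B X i.1 i.2
  naturality {X Y} f a b := (gι₂_isCoprod hA B X a b).hom_ext fun i => by
    refine (Category.assoc _ _ _).symm.trans ((congrArg (· ≫ _) (gι₂_naturality A B f i.1 i.2)).trans
      ((Category.assoc _ _ _).trans (Eq.trans ?_
        ((gι₂_isCoprod hA B X a b).fac_assoc (fun i => gι₂' A B X i.1 i.2) i _).symm)))
    refine Eq.trans ?_ (gι₂'_naturality A B f i.1 i.2).symm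
    exact congrArg (A.map ((mapSeq B).map (i.1.segHom f i.2)) ≫ ·)
      ((gι₂_isCoprod hA B Y _ _).fac (fun i => gι₂' A B Y i.1 i.2)
        ⟨_, i.1.mapLift (K' := Path) f.obj (fun _ _ q => q.map f.obj) i.2⟩)

lemma gι₂_gammaComp {A : List V ⥤ V} (hA : Distributive A) (B : List V ⥤ V) (X : Graph V)
    {a b : X.obj} (p : Path a b) (k : p.Lift Path) :
    gι₂ A B X p k ≫ (gammaComp hA B).app X a b = gι₂' A B X p k :=
  (gι₂_isCoprod hA B X a b).fac (fun i => gι₂' A B X i.1 i.2) ⟨p, k⟩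

/-- The canonical map `id ⟶ Γ I`. -/
noncomputable def gammaUnit : GFun.one V ⟶ gamma (unit (V := V)) where
  app X a b := lanι single (𝟭 V) (X.hom a b) rfl ≫ gι unit X (Path.cons a (Path.nil b))
  naturality {X Y} f a b := by
    have e := lanι_map single (𝟭 V) (f.map a b) rfl rfl _ HEq.rfl
    refine Eq.trans ?_ ((Category.assoc _ _ _).trans (congrArg (_ ≫ ·)
      (gι_map unit f (Path.cons a (Path.nil b))))).symm
    exact (Category.assoc _ _ _).symm.trans
      ((congrArg (· ≫ _) e.symm).trans (Category.assoc _ _ _))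

end GammaComp

/-! ### The monad `Γ M` -/

namespace Path

variable {O : Type v}

/-- The families of paths of length one. -/
def ones : {a b : O} → (p : Path a b) → p.Lift Path
  | _, _, nil _ => ⟨⟩
  | _, _, cons a p => ⟨cons a (nil _), ones p⟩

lemma join_ones : {a b : O} → (p : Path a b) → p.join p.ones = p
  | _, _, nil _ => rfl
  | _, _, cons a p => congrArg (cons a) (join_ones p)

lemma append_nil : {a b : O} → (p : Path a b) → p.append (nil b) = p
  | _, _, nil _ => rfl
  | _, _, cons a p => congrArg (cons a) (append_nil p)

lemma append_assoc : {a b c d : O} → (p : Path a b) → (q : Path b c) → (r : Path c d) →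
    (p.append q).append r = p.append (q.append r)
  | _, _, _, _, nil _, _, _ => rfl
  | _, _, _, _, cons a p, q, r => congrArg (cons a) (append_assoc p q r)

lemma liftSeq_ones {D : Type u} [Category.{v₁} D] (G : O → O → D) : {a b : O} → (p : Path a b) →
    (p.seq G).map single.obj = p.liftSeq (fun _ _ q => q.seq G) p.ones
  | _, _, nil _ => rfl
  | _, _, cons _ p => congrArg (_ :: ·) (liftSeq_ones G p)

/-- The families of paths with families of paths. -/
abbrev Two (a b : O) : Type v := Σ q : Path a b, q.Lift Path

def fsts : {a b : O} → (p : Path a b) → p.Lift Two → p.Lift Path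
  | _, _, nil _, _ => ⟨⟩
  | _, _, cons _ p, κ => ⟨κ.1.1, fsts p κ.2⟩

def joins : {a b : O} → (p : Path a b) → p.Lift Two → p.Lift Path
  | _, _, nil _, _ => ⟨⟩
  | _, _, cons _ p, κ => ⟨κ.1.1.join κ.1.2, joins p κ.2⟩

def appendLift : {a b c : O} → (p : Path a b) → p.Lift Path → (q : Path b c) → q.Lift Path →
    (p.append q).Lift Path
  | _, _, _, nil _, _, _, l => l
  | _, _, _, cons _ p, k, q, l => ⟨k.1, appendLift p k.2 q l⟩

def snds : {a b : O} → (p : Path a b) → (κ : p.Lift Two) → (p.join (p.fsts κ)).Lift Path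
  | _, _, nil _, _ => ⟨⟩
  | _, _, cons _ p, κ => appendLift κ.1.1 κ.1.2 (p.join (p.fsts κ.2)) (snds p κ.2)

lemma join_appendLift : {a b c : O} → (p : Path a b) → (k : p.Lift Path) → (q : Path b c) →
    (l : q.Lift Path) → (p.append q).join (p.appendLift k q l) = (p.join k).append (q.join l)
  | _, _, _, nil _, _, _, _ => rfl
  | _, _, _, cons _ p, k, q, l =>
    (congrArg (append k.1) (join_appendLift p k.2 q l)).trans (append_assoc _ _ _).symm

lemma join_snds : {a b : O} → (p : Path a b) → (κ : p.Lift Two) →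
    (p.join (p.fsts κ)).join (p.snds κ) = p.join (p.joins κ)
  | _, _, nil _, _ => rfl
  | _, _, cons _ p, κ => (join_appendLift _ _ _ _).trans (congrArg _ (join_snds p κ.2))

section

variable {D : Type*} (G : O → O → D)

/-- The sequences of the homs of a family of paths. -/
abbrev segs {a b : O} (p : Path a b) (k : p.Lift Path) : List (List D) :=
  p.liftSeq (fun _ _ q => q.seq G) k

/-- The sequences of sequences of homs. -/
abbrev segs₂ {a b : O} (p : Path a b) (κ : p.Lift Two) : List (List (List D)) :=
  p.liftSeq (fun _ _ i => i.1.segs G i.2) κ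

lemma segs_appendLift : {a b c : O} → (p : Path a b) → (k : p.Lift Path) → (q : Path b c) →
    (l : q.Lift Path) → (p.append q).segs G (p.appendLift k q l) = p.segs G k ++ q.segs G l
  | _, _, _, nil _, _, _, _ => rfl
  | _, _, _, cons _ p, k, q, l => congrArg (_ :: ·) (segs_appendLift p k.2 q l)

lemma flat_segs₂ : {a b : O} → (p : Path a b) → (κ : p.Lift Two) →
    (p.segs₂ G κ).flatten = (p.join (p.fsts κ)).segs G (p.snds κ)
  | _, _, nil _, _ => rfl
  | _, _, cons _ p, κ =>
    (congrArg (_ ++ ·) (flat_segs₂ p κ.2)).trans (segs_appendLift G _ _ _ _).symm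

lemma map_flat_segs₂ {V : Type u} [Category.{v₁} V] (G : O → O → V) : {a b : O} →
    (p : Path a b) → (κ : p.Lift Two) → (p.segs₂ G κ).map flat.obj = p.segs G (p.joins κ)
  | _, _, nil _, _ => rfl
  | _, _, cons _ p, κ => congr (congrArg List.cons (flat_liftSeq G κ.1.1 κ.1.2))
      (map_flat_segs₂ G p κ.2)

end

end Path

section GammaMonad

variable {V : Type u} [Category.{v} V] [Lextensive V]

namespace Multitensor

section

variable (M : Multitensor V) (X : Graph V) {a b : X.obj}

/-- Substitution followed by the inclusion of a summand. -/
noncomputable def σι (Z : List (List V)) (q : Path a b) (h : flat.obj Z = q.seq X.hom) :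
    M.E.obj ((mapSeq M.E).obj Z) ⟶ (gamma M.E).hom X a b :=
  M.σ.app Z ≫ M.E.map (eqToHom h) ≫ gι M.E X q

variable {X} in
lemma σι_congr {Z Z' : List (List V)} (e : Z = Z') {q q' : Path a b} (eq : q = q')
    (h : flat.obj Z = q.seq X.hom) (h' : flat.obj Z' = q'.seq X.hom)
    (w : (mapSeq M.E).obj Z = (mapSeq M.E).obj Z') :
    M.E.map (eqToHom w) ≫ M.σι X Z' q' h' = M.σι X Z q h := by
  subst e eq
  exact (congrArg (· ≫ M.σι X Z q h) (M.E.map_id _)).trans (Category.id_comp _)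

variable {X} in
lemma σι_path {Z : List (List V)} {q q' : Path a b} (eq : q = q')
    (h : flat.obj Z = q.seq X.hom) (h' : flat.obj Z = q'.seq X.hom) :
    M.σι X Z q h = M.σι X Z q' h' := by
  subst eq; rfl

/-- The unit `id ⟶ Γ E`: the inclusion of the summands `E (X (a, b))`, after the unit of `E`. -/
noncomputable def gammaη : GFun.one V ⟶ gamma M.E := gammaUnit ≫ gammaMap M.one

variable [M.IsDistributive]

/-- The multiplication `Γ E ∘ Γ E ⟶ Γ E`, which is induced by the substitution of `E`. -/
noncomputable def gammaμ : GFun.comp (gamma M.E) (gamma M.E) ⟶ gamma M.E :=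
  gammaComp IsDistributive.distributive M.E ≫ gammaMap M.mul

end

variable {M : Multitensor V} (X : Graph V) {a b : X.obj}

lemma gammaη_app : M.gammaη.app X a b =
    M.u.app (X.hom a b) ≫ gι M.E X (Path.cons a (Path.nil b)) := by
  have e := gι_gammaMap M.one X (Path.cons a (Path.nil b))
  exact (Category.assoc _ _ _).trans ((congrArg (lanι single (𝟭 V) (X.hom a b) rfl ≫ ·) e).trans
    ((Category.assoc _ _ _).symm.trans (congrArg (· ≫ _) (M.lanι_one' (X.hom a b)))))

variable [M.IsDistributive]

lemma gι₂_gammaμ (p : Path a b) (k : p.Lift Path) :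
    gι₂ M.E M.E X p k ≫ M.gammaμ.app X a b =
      M.σι X (p.segs X.hom k) (p.join k) (p.flat_liftSeq X.hom k) := by
  have e1 := gι₂_gammaComp (IsDistributive.distributive (M := M)) M.E X p k
  have e2 := gι_gammaMap M.mul X (p.join k)
  have e3 := M.lanι_mul (p.segs X.hom k) (p.flat_liftSeq X.hom k)
  refine (Category.assoc _ _ _).symm.trans ((congrArg (· ≫ (gammaMap M.mul).app X a b) e1).trans
    ((Category.assoc _ _ _).trans ((congrArg (lanι flat (mapSeq M.E ⋙ M.E) _ _ ≫ ·) e2).trans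
    ((Category.assoc _ _ _).symm.trans ((congrArg (· ≫ gι M.E X (p.join k)) e3).trans
      (Category.assoc _ _ _))))))

lemma gamma_left_unit : M.gammaη.app ((gamma M.E).toFunctor.obj X) a b ≫ M.gammaμ.app X a b =
    𝟙 ((gamma M.E).hom X a b) := (gι_isCoprod M.E X a b).hom_ext fun p => by
  let ΓX := (gamma M.E).toFunctor.obj X
  have e1 := gammaη_app (M := M) ΓX (a := a) (b := b)
  have e2 := gι₂_gammaμ (M := M) X (Path.cons a (Path.nil b)) ⟨p, ⟨⟩⟩
  have e3 : gι M.E X p ≫ M.u.app ((gamma M.E).hom X a b) =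
      M.u.app _ ≫ M.E.map (consHom (gι M.E X p) (𝟙 [])) := M.u.naturality (gι M.E X p)
  have e4 := M.unit_left (p.seq X.hom)
  have e5 : gι M.E X p ≫ M.gammaη.app ΓX a b =
      M.u.app _ ≫ gι₂ M.E M.E X (Path.cons a (Path.nil b)) ⟨p, ⟨⟩⟩ :=
    (congrArg (gι M.E X p ≫ ·) e1).trans ((Category.assoc _ _ _).symm.trans
      ((congrArg (· ≫ gι M.E ΓX (Path.cons a (Path.nil b))) e3).trans (Category.assoc _ _ _)))
  refine (Category.assoc _ _ _).symm.trans ((congrArg (· ≫ M.gammaμ.app X a b) e5).trans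
    ((Category.assoc _ _ _).trans ((congrArg (M.u.app (M.E.obj (p.seq X.hom)) ≫ ·) e2).trans ?_)))
  refine (congrArg (M.u.app (M.E.obj (p.seq X.hom)) ≫ ·)
    (M.σι_path p.append_nil _ (flat_single (p.seq X.hom)))).trans ?_
  refine Eq.trans ?_ ((congrArg (· ≫ gι M.E X p) e4).trans
    ((Category.id_comp _).trans (Category.comp_id _).symm))
  exact (congrArg (M.u.app (M.E.obj (p.seq X.hom)) ≫ ·) (Category.assoc _ _ _).symm).trans
    (Category.assoc _ _ _).symm

/-- The sequence of inclusions of summands. -/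
noncomputable abbrev lift₁ (p : Path a b) (k : p.Lift Path) :
    (mapSeq M.E).obj (p.segs X.hom k) ⟶ p.seq ((gamma M.E).hom X) :=
  p.liftHom (fun _ _ q => gι M.E X q) k

lemma seqHom'_gammaη : {a b : X.obj} → (p : Path a b) →
    (w : (mapSeq M.E).obj ((p.seq X.hom).map single.obj) =
      (mapSeq M.E).obj (p.segs X.hom p.ones)) →
    p.seqHom' (G := X.hom) (G' := (gamma M.E).hom X) (M.gammaη.app X) =
      unitSeq M.u (p.seq X.hom) ≫ eqToHom w ≫ lift₁ (M := M) X p p.ones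
  | _, _, .nil _, _ => rfl
  | _, _, .cons a p, w => by
    have ih := seqHom'_gammaη p (congrArg (mapSeq M.E).obj (p.liftSeq_ones X.hom))
    have e := eqToHom_cons rfl (congrArg (mapSeq M.E).obj (p.liftSeq_ones X.hom)) w
    refine Eq.trans ?_ (congrArg (fun f => unitSeq M.u (X.hom a _ :: p.seq X.hom) ≫ f ≫
      lift₁ (M := M) X (Path.cons a p) (Path.cons a p).ones) e.symm)
    exact congr (congrArg consHom ((gammaη_app X).trans
      (congrArg (M.u.app _ ≫ ·) (Category.id_comp _).symm))) ih

lemma gamma_right_unit : (gamma M.E).map (GFun.component M.gammaη X) a b ≫ M.gammaμ.app X a b =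
    𝟙 ((gamma M.E).hom X a b) := (gι_isCoprod M.E X a b).hom_ext fun p => by
  let ΓX := (gamma M.E).toFunctor.obj X
  have w := congrArg (mapSeq M.E).obj (p.liftSeq_ones X.hom)
  have e1 := gι_map' M.E (G := X.hom) (G' := (gamma M.E).hom X) (M.gammaη.app X) p
  have e2 := seqHom'_gammaη (M := M) X p w
  have e3 := gι₂_gammaμ (M := M) X p p.ones
  have e4 := M.unit_right (p.seq X.hom)
  have e5 := M.σι_congr (p.liftSeq_ones X.hom) p.join_ones.symm
    (flat_map_single (p.seq X.hom)) (p.flat_liftSeq X.hom p.ones) w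
  have e6 : M.E.map (p.seqHom' (G := X.hom) (G' := (gamma M.E).hom X) (M.gammaη.app X)) ≫
      gι M.E ΓX p = M.E.map (unitSeq M.u (p.seq X.hom)) ≫ M.E.map (eqToHom w) ≫
        gι₂ M.E M.E X p p.ones := by
    rw [e2]
    refine (congrArg (· ≫ gι M.E ΓX p) ((M.E.map_comp _ _).trans
      (congrArg (M.E.map (unitSeq M.u (p.seq X.hom)) ≫ ·) (M.E.map_comp _ _)))).trans ?_
    exact (Category.assoc _ _ _).trans (congrArg (M.E.map (unitSeq M.u (p.seq X.hom)) ≫ ·)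
      (Category.assoc _ _ _))
  refine (Category.assoc _ _ _).symm.trans ((congrArg (· ≫ M.gammaμ.app X a b)
    (e1.trans e6)).trans ((Category.assoc _ _ _).trans
      ((congrArg (M.E.map (unitSeq M.u (p.seq X.hom)) ≫ ·) ((Category.assoc _ _ _).trans
        ((congrArg (M.E.map (eqToHom w) ≫ ·) e3).trans e5))).trans ?_)))
  refine Eq.trans ?_ ((congrArg (· ≫ gι M.E X p) e4).trans
    ((Category.id_comp _).trans (Category.comp_id _).symm))
  exact (congrArg (M.E.map (unitSeq M.u (p.seq X.hom)) ≫ ·) (Category.assoc _ _ _).symm).trans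
    (Category.assoc _ _ _).symm

/-- The sequence of inclusions of summands. -/
noncomputable abbrev lift₂ (p : Path a b) (κ : p.Lift Path.Two) :
    (p.segs₂ X.hom κ).map (two M.E M.E) ⟶ p.seq ((GFun.comp (gamma M.E) (gamma M.E)).hom X) :=
  Path.liftHom (K := Path.Two) (G := fun _ _ (i : Path.Two _ _) => i.1.segs X.hom i.2)
    (β := two M.E M.E) (L := (GFun.comp (gamma M.E) (gamma M.E)).hom X)
    (fun _ _ i => gι₂ M.E M.E X i.1 i.2) p κ

/-- The inclusion of a summand in `Γ E (Γ E (Γ E X)) (a, b)`. -/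
noncomputable def gι₃ (p : Path a b) (κ : p.Lift Path.Two) :
    M.E.obj ((p.segs₂ X.hom κ).map (two M.E M.E)) ⟶
      (gamma M.E).hom ((GFun.comp (gamma M.E) (gamma M.E)).toFunctor.obj X) a b :=
  M.E.map (lift₂ (M := M) X p κ) ≫
    gι M.E ((GFun.comp (gamma M.E) (gamma M.E)).toFunctor.obj X) p

lemma gι₃_isCoprod (a b : X.obj) :
    IsCoprod fun i : (Σ p : Path a b, p.Lift Path.Two) => gι₃ (M := M) X i.1 i.2 :=
  (gι_isCoprod M.E ((GFun.comp (gamma M.E) (gamma M.E)).toFunctor.obj X) a b).sigma fun p =>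
    (IsDistributive.distributive (M := M)).lift (K := Path.Two)
      (G := fun _ _ (i : Path.Two _ _) => i.1.segs X.hom i.2) (β := two M.E M.E)
      (fun a b => gι₂_isCoprod (IsDistributive.distributive (M := M)) M.E X a b) p

lemma seqHom'_gammaμ : {a b : X.obj} → (p : Path a b) → (κ : p.Lift Path.Two) →
    (w : (p.segs₂ X.hom κ).map (two M.E M.E) =
      ((p.segs₂ X.hom κ).map (mapSeq M.E).obj).map M.E.obj) →
    (w' : (mapSeq M.E).obj ((p.segs₂ X.hom κ).map flat.obj) =
      (mapSeq M.E).obj (p.segs X.hom (p.joins κ))) →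
    lift₂ (M := M) X p κ ≫
        p.seqHom' (G := (GFun.comp (gamma M.E) (gamma M.E)).hom X) (G' := (gamma M.E).hom X)
          (M.gammaμ.app X) =
      eqToHom w ≫ sigmaSeq M.σ (p.segs₂ X.hom κ) ≫ eqToHom w' ≫
        lift₁ (M := M) X p (p.joins κ)
  | _, _, .nil _, _, _, _ => rfl
  | _, _, .cons a p, κ, w, w' => by
    have ih := seqHom'_gammaμ p κ.2 (map_two _ _ _)
      (congrArg (mapSeq M.E).obj (p.map_flat_segs₂ X.hom κ.2))
    have e := eqToHom_cons rfl (map_two _ _ _) w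
    have e' := eqToHom_cons (congrArg M.E.obj (Path.flat_liftSeq X.hom κ.1.1 κ.1.2))
      (congrArg (mapSeq M.E).obj (p.map_flat_segs₂ X.hom κ.2)) w'
    refine Eq.trans ?_ (congrArg₂ (fun f g => f ≫ sigmaSeq M.σ ((Path.cons a p).segs₂ X.hom κ) ≫ g ≫
      lift₁ (M := M) X (Path.cons a p) ((Path.cons a p).joins κ)) e.symm e'.symm)
    refine congr (congrArg consHom ((gι₂_gammaμ X κ.1.1 κ.1.2).trans
      (Eq.trans ?_ (Category.id_comp _).symm))) ih
    exact congrArg (fun f => M.σ.app _ ≫ f ≫ gι M.E X _) (eqToHom_map M.E _)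

/-- The sequence of sequences of inclusions of summands. -/
noncomputable def inclSeq₂ : {a b : X.obj} → (p : Path a b) → (κ : p.Lift Path.Two) →
    ((p.segs₂ X.hom κ).map (mapSeq M.E).obj ⟶ p.segs ((gamma M.E).hom X) (p.fsts κ))
  | _, _, .nil _, _ => 𝟙 []
  | _, _, .cons _ p, κ =>
    consHom (lift₁ (M := M) X κ.1.1 κ.1.2) (inclSeq₂ p κ.2)

lemma liftHom_gι₂ : {a b : X.obj} → (p : Path a b) → (κ : p.Lift Path.Two) →
    (w : (p.segs₂ X.hom κ).map (two M.E M.E) =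
      ((p.segs₂ X.hom κ).map (mapSeq M.E).obj).map M.E.obj) →
    lift₂ (M := M) X p κ =
      eqToHom w ≫ (mapSeq M.E).map (inclSeq₂ X p κ) ≫
        lift₁ (M := M) ((gamma M.E).toFunctor.obj X) p (p.fsts κ)
  | _, _, .nil _, _, _ => rfl
  | _, _, .cons _ p, κ, w => by
    have ih := liftHom_gι₂ p κ.2 (map_two _ _ _)
    refine Eq.trans ?_ (congrArg (· ≫ (mapSeq M.E).map (inclSeq₂ X (Path.cons _ p) κ) ≫
      lift₁ (M := M) ((gamma M.E).toFunctor.obj X) (Path.cons _ p) ((Path.cons _ p).fsts κ))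
      (eqToHom_cons rfl (map_two _ _ _) w).symm)
    exact congr (congrArg consHom (Category.id_comp _).symm) ih

lemma liftHom_append : {a b c : X.obj} → (p : Path a b) → (k : p.Lift Path) → (q : Path b c) →
    (l : q.Lift Path) →
    HEq (appendHom (lift₁ (M := M) X p k) (lift₁ (M := M) X q l))
      (lift₁ (M := M) X (p.append q) (p.appendLift k q l))
  | _, _, _, .nil _, _, _, _ => HEq.rfl
  | _, _, _, .cons _ p, k, q, l => consHom_heq _
      (List.map_append.symm.trans (congrArg (List.map M.E.obj) (p.segs_appendLift X.hom k.2 q l).symm))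
      (p.seq_append _ q).symm (liftHom_append p k.2 q l)

lemma flat_inclSeq₂ : {a b : X.obj} → (p : Path a b) → (κ : p.Lift Path.Two) →
    HEq (flat.map (inclSeq₂ (M := M) X p κ))
      (lift₁ (M := M) X (p.join (p.fsts κ)) (p.snds κ))
  | _, _, .nil _, _ => HEq.rfl
  | _, _, .cons _ p, κ => (appendHom_heq rfl rfl
      ((flat_map M.E _ _ rfl).trans (congrArg (List.map M.E.obj) (p.flat_segs₂ X.hom κ.2)))
      (p.flat_liftSeq _ _) HEq.rfl (flat_inclSeq₂ p κ.2)).trans (liftHom_append X _ _ _ _)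

lemma gamma_assoc : (gamma M.E).map (GFun.component M.gammaμ X) a b ≫ M.gammaμ.app X a b =
    M.gammaμ.app ((gamma M.E).toFunctor.obj X) a b ≫ M.gammaμ.app X a b := by
  refine (gι₃_isCoprod X a b).hom_ext fun ⟨p, κ⟩ => ?_
  let ΓX := (gamma M.E).toFunctor.obj X
  let Z := p.segs₂ X.hom κ
  have w : Z.map (two M.E M.E) = (Z.map (mapSeq M.E).obj).map M.E.obj := map_two _ _ _
  have w' := congrArg (mapSeq M.E).obj (p.map_flat_segs₂ X.hom κ)
  have w₁ : flat.obj (Z.map (mapSeq M.E).obj) = (mapSeq M.E).obj (flat.obj Z) :=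
    flat_map M.E _ _ rfl
  have w₂ := congrArg (mapSeq M.E).obj (p.flat_segs₂ X.hom κ)
  have hl : flat.obj (Z.map flat.obj) = (p.join (p.joins κ)).seq X.hom :=
    (congrArg flat.obj (p.map_flat_segs₂ X.hom κ)).trans (p.flat_liftSeq X.hom (p.joins κ))
  have hr : flat.obj (flat.obj Z) = (p.join (p.joins κ)).seq X.hom :=
    (List.flatten_flatten (L := Z)).trans hl
  have l1 : gι₃ X p κ ≫ (gamma M.E).map (GFun.component M.gammaμ X) a b =
      M.E.map (eqToHom w) ≫ M.E.map (sigmaSeq M.σ Z) ≫ M.E.map (eqToHom w') ≫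
        gι₂ M.E M.E X p (p.joins κ) := by
    refine (Category.assoc _ _ _).trans ((congrArg (M.E.map (lift₂ (M := M) X p κ) ≫ ·)
      (gι_map' M.E (G := (GFun.comp (gamma M.E) (gamma M.E)).hom X) (G' := (gamma M.E).hom X)
        (M.gammaμ.app X) p)).trans ((M.E.map_comp_assoc _ _ _).symm.trans
      ((congrArg (fun f => M.E.map f ≫ gι M.E ΓX p) (seqHom'_gammaμ X p κ w w')).trans ?_)))
    exact (M.E.map_comp_assoc _ _ _).trans (congrArg (M.E.map (eqToHom w) ≫ ·)
      ((M.E.map_comp_assoc _ _ _).trans (congrArg (M.E.map (sigmaSeq M.σ Z) ≫ ·)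
        (M.E.map_comp_assoc _ _ _))))
  have l2 : gι₃ X p κ ≫ (gamma M.E).map (GFun.component M.gammaμ X) a b ≫ M.gammaμ.app X a b =
      M.E.map (eqToHom w) ≫ M.E.map (sigmaSeq M.σ Z) ≫
        M.σι X (Z.map flat.obj) (p.join (p.joins κ)) hl := by
    refine (Category.assoc _ _ _).symm.trans ((congrArg (· ≫ M.gammaμ.app X a b) l1).trans ?_)
    refine (Category.assoc _ _ _).trans (congrArg (M.E.map (eqToHom w) ≫ ·)
      ((Category.assoc _ _ _).trans (congrArg (M.E.map (sigmaSeq M.σ Z) ≫ ·)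
      ((Category.assoc _ _ _).trans ((congrArg (M.E.map (eqToHom w') ≫ ·)
        (gι₂_gammaμ X p (p.joins κ))).trans
          (M.σι_congr (p.map_flat_segs₂ X.hom κ) rfl hl _ w'))))))
  have r0 : M.E.map (flat.map (inclSeq₂ (M := M) X p κ)) ≫
      M.E.map (eqToHom (p.flat_liftSeq ΓX.hom (p.fsts κ))) =
      M.E.map (eqToHom (w₁.trans w₂)) ≫
        M.E.map (lift₁ (M := M) X (p.join (p.fsts κ)) (p.snds κ)) := by
    refine (M.E.map_comp _ _).symm.trans (Eq.trans (congrArg M.E.map ?_) (M.E.map_comp _ _))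
    exact (eqToHom_naturality (w₁.trans w₂) (p.flat_liftSeq ΓX.hom (p.fsts κ))
      _ _ (flat_inclSeq₂ X p κ)).symm
  have r1 : gι₃ X p κ ≫ M.gammaμ.app ΓX a b =
      M.E.map (eqToHom w) ≫ M.σ.app (Z.map (mapSeq M.E).obj) ≫
        M.E.map (eqToHom (w₁.trans w₂)) ≫ gι₂ M.E M.E X (p.join (p.fsts κ)) (p.snds κ) := by
    have e : gι₃ (M := M) X p κ = M.E.map (eqToHom w) ≫ M.E.map ((mapSeq M.E).map
        (inclSeq₂ (M := M) X p κ)) ≫ gι₂ M.E M.E ΓX p (p.fsts κ) := by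
      refine (congrArg (fun f => M.E.map f ≫ gι M.E ((GFun.comp (gamma M.E)
        (gamma M.E)).toFunctor.obj X) p) (liftHom_gι₂ X p κ w)).trans ?_
      exact (M.E.map_comp_assoc _ _ _).trans (congrArg (M.E.map (eqToHom w) ≫ ·)
        (M.E.map_comp_assoc _ _ _))
    refine (congrArg (· ≫ M.gammaμ.app ΓX a b) e).trans ?_
    refine (Category.assoc _ _ _).trans (congrArg (M.E.map (eqToHom w) ≫ ·)
      ((Category.assoc _ _ _).trans ((congrArg (M.E.map ((mapSeq M.E).map
        (inclSeq₂ (M := M) X p κ)) ≫ ·) (gι₂_gammaμ ΓX p (p.fsts κ))).trans ?_)))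
    refine (Category.assoc _ _ _).symm.trans ((congrArg (· ≫ M.E.map (eqToHom
      (p.flat_liftSeq ΓX.hom (p.fsts κ))) ≫ gι M.E ΓX (p.join (p.fsts κ)))
        (M.σ.naturality (inclSeq₂ (M := M) X p κ))).trans ((Category.assoc _ _ _).trans
          (congrArg (M.σ.app (Z.map (mapSeq M.E).obj) ≫ ·) ?_)))
    exact (Category.assoc _ _ _).symm.trans ((congrArg (· ≫ gι M.E ΓX (p.join (p.fsts κ))) r0).trans
      (Category.assoc _ _ _))
  have r2 : gι₃ X p κ ≫ M.gammaμ.app ΓX a b ≫ M.gammaμ.app X a b =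
      M.E.map (eqToHom w) ≫ M.σ.app (Z.map (mapSeq M.E).obj) ≫ M.E.map (eqToHom w₁) ≫
        M.σι X (flat.obj Z) (p.join (p.joins κ)) hr := by
    refine (Category.assoc _ _ _).symm.trans ((congrArg (· ≫ M.gammaμ.app X a b) r1).trans ?_)
    refine (Category.assoc _ _ _).trans (congrArg (M.E.map (eqToHom w) ≫ ·)
      ((Category.assoc _ _ _).trans (congrArg (M.σ.app (Z.map (mapSeq M.E).obj) ≫ ·)
      ((Category.assoc _ _ _).trans ((congrArg (M.E.map (eqToHom (w₁.trans w₂)) ≫ ·)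
        (gι₂_gammaμ X (p.join (p.fsts κ)) (p.snds κ))).trans ?_)))))
    have e := M.σι_congr (p.flat_segs₂ X.hom κ) (p.join_snds κ).symm hr
      ((p.join (p.fsts κ)).flat_liftSeq X.hom (p.snds κ)) w₂
    rw [← e, ← M.E.map_comp_assoc, eqToHom_trans]
  have e := congrArg (· ≫ M.E.map (eqToHom hr) ≫ gι M.E X (p.join (p.joins κ))) (M.assoc Z)
  refine l2.trans (Eq.trans (congrArg (M.E.map (eqToHom w) ≫ ·) ?_) r2.symm)
  refine Eq.trans ?_ (e.trans ?_)
  · rw [σι]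
    simp only [Category.assoc, ← M.E.map_comp_assoc, eqToHom_trans]
  · rw [σι]
    simp only [Category.assoc]

end Multitensor

end GammaMonad

/-! ### The functor `Γ` on collections -/

section GammaColl

variable {V : Type u} [Category.{v} V]

/-- A transformation over `Set` is cartesian when it is so on all the homs. -/
lemma GFun.isCartesian_of {S T : GFun V} (φ : S ⟶ T)
    (h : ∀ {X Y : Graph V} (f : X ⟶ Y) (a b : X.obj),
      IsPullback (S.map f a b) (φ.app X a b) (φ.app Y (f.obj a) (f.obj b)) (T.map f a b)) :
    GFun.IsCartesian φ := by
  intro X Y f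
  have key : ∀ (W : Graph V) (p : W ⟶ S.toFunctor.obj Y) (q : W ⟶ T.toFunctor.obj X),
      p ≫ component φ Y = q ≫ T.toFunctor.map f →
      ∃ l : W ⟶ S.toFunctor.obj X, (l ≫ S.toFunctor.map f = p ∧ l ≫ component φ X = q) ∧
        ∀ l' : W ⟶ S.toFunctor.obj X, l' ≫ S.toFunctor.map f = p → l' ≫ component φ X = q →
          l' = l := by
    rintro W ⟨po, pm⟩ ⟨qo, qm⟩ w
    obtain rfl : po = f.obj ∘ qo := congrArg Graph.Hom.obj w
    have wm : ∀ a b, pm a b ≫ φ.app Y _ _ = qm a b ≫ T.map f _ _ := fun a b =>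
      congrFun (congrFun (eq_of_heq (Graph.Hom.mk.inj w).2) a) b
    refine ⟨⟨qo, fun a b => (h f (qo a) (qo b)).lift (pm a b) (qm a b) (wm a b)⟩, ⟨?_, ?_⟩, ?_⟩
    · exact Graph.mk_ext (X := W) (Y := S.toFunctor.obj Y) (f.obj ∘ qo)
        fun a b => (h f (qo a) (qo b)).lift_fst _ _ _
    · exact Graph.mk_ext (X := W) (Y := T.toFunctor.obj X) qo
        fun a b => (h f (qo a) (qo b)).lift_snd _ _ _
    · rintro ⟨lo, lm⟩ e₁ e₂
      obtain rfl : lo = qo := congrArg Graph.Hom.obj e₂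
      refine Graph.mk_ext (X := W) (Y := S.toFunctor.obj X) lo fun a b =>
        (h f (lo a) (lo b)).hom_ext ?_ ?_
      · exact (congrFun (congrFun (eq_of_heq (Graph.Hom.mk.inj e₁).2) a) b).trans
          ((h f (lo a) (lo b)).lift_fst _ _ _).symm
      · exact (congrFun (congrFun (eq_of_heq (Graph.Hom.mk.inj e₂).2) a) b).trans
          ((h f (lo a) (lo b)).lift_snd _ _ _).symm
  choose l hl hl' using key
  exact ⟨⟨(toNatTrans φ).naturality f⟩, ⟨PullbackCone.IsLimit.mk _
    (fun s => l s.pt s.fst s.snd s.condition) (fun s => (hl s.pt s.fst s.snd s.condition).1)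
    (fun s => (hl s.pt s.fst s.snd s.condition).2)
    fun s m h₁ h₂ => hl' s.pt s.fst s.snd s.condition m h₁ h₂⟩⟩

variable [Lextensive V]

lemma gammaMap_isCartesian {A B : List V ⥤ V} {φ : A ⟶ B} (hφ : NatTrans.Equifibered φ) :
    GFun.IsCartesian (gammaMap φ) := by
  refine GFun.isCartesian_of _ fun {X Y} f a b => ?_
  have h1 : ∀ {Y : Graph V} {a b : Y.obj} (q : Path a b),
      IsPullback (gι A Y q) (φ.app (q.seq Y.hom)) ((gammaMap φ).app Y a b) (gι B Y q) :=
    fun {Y a b} => ((gι_isCoprod B Y a b).iff_isPullback fun q => gι_gammaMap φ Y q).1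
      (gι_isCoprod A Y a b)
  refine (isPullback_of_isCoprod (gι_isCoprod A X a b) (gι_isCoprod B X a b)
    (k := fun p => φ.app (p.seq X.hom)) ((gammaMap φ).naturality f a b)
    (gι_gammaMap φ X) fun p => ?_)
  rw [gι_map, gι_map]
  exact (hφ (p.seqHom f.obj f.map)).paste_horiz (h1 (p.map f.obj))

lemma liftHom_gammaMap {B B' : List V ⥤ V} (ψ : B ⟶ B') (X : Graph V) : {a b : X.obj} →
    (p : Path a b) → (k : p.Lift Path) →
    p.liftHom (fun _ _ q => gι B X q) k ≫
        p.seqHom' (G := (gamma B).hom X) (G' := (gamma B').hom X) ((gammaMap ψ).app X) =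
      (mapSeqTrans ψ).app (p.segs X.hom k) ≫ p.liftHom (fun _ _ q => gι B' X q) k
  | _, _, .nil _, _ => rfl
  | _, _, .cons _ p, k =>
    congr (congrArg consHom (gι_gammaMap ψ X k.1)) (liftHom_gammaMap ψ X p k.2)

/-- Naturality of the comparison map. -/
lemma gammaComp_naturality {A A' B B' : List V ⥤ V} (hA : Distributive A) (hA' : Distributive A')
    (φ : A ⟶ A') (ψ : B ⟶ B') :
    gammaComp hA B ≫ gammaMap (compMap φ ψ) =
      GFun.hcomp (gammaMap φ) (gammaMap ψ) ≫ gammaComp hA' B' :=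
  GFun.hom_ext fun X a b => (gι₂_isCoprod hA B X a b).hom_ext fun ⟨p, k⟩ => by
  have e1 := gι₂_gammaComp hA B X p k
  have e2 := gι_gammaMap (compMap φ ψ) X (p.join k)
  have e3 := lanι_compMap φ ψ (p.segs X.hom k) (p.flat_liftSeq X.hom k)
  have e4 : gι₂ A B X p k ≫ (GFun.hcomp (gammaMap φ) (gammaMap ψ)).app X a b =
      (twoTrans φ ψ).app (p.segs X.hom k) ≫ gι₂ A' B' X p k := by
    have f1 := gι_map' A (G := (gamma B).hom X) (G' := (gamma B').hom X) ((gammaMap ψ).app X) p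
    have f2 := gι_gammaMap φ ((gamma B').toFunctor.obj X) p
    have f3 : p.liftHom (fun _ _ q => gι B X q) k ≫
        p.seqHom' (G := (gamma B).hom X) (G' := (gamma B').hom X) ((gammaMap ψ).app X) =
        (mapSeqTrans ψ).app (p.segs X.hom k) ≫ p.liftHom (fun _ _ q => gι B' X q) k :=
      liftHom_gammaMap ψ X p k
    have f4 : gι₂ A B X p k ≫ (gamma A).map (GFun.component (gammaMap ψ) X) a b =
        A.map ((mapSeqTrans ψ).app (p.segs X.hom k)) ≫
          A.map (p.liftHom (fun _ _ q => gι B' X q) k) ≫ gι A ((gamma B').toFunctor.obj X) p := by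
      refine (Category.assoc _ _ _).trans ((congrArg
        (A.map (p.liftHom (fun _ _ q => gι B X q) k) ≫ ·) f1).trans
        ((A.map_comp_assoc _ _ _).symm.trans ((congrArg (fun f => A.map f ≫
          gι A ((gamma B').toFunctor.obj X) p) f3).trans (A.map_comp_assoc _ _ _))))
    refine (Category.assoc _ _ _).symm.trans ((congrArg
      (· ≫ (gammaMap φ).app ((gamma B').toFunctor.obj X) a b) f4).trans ?_)
    have f5 : (A.map (p.liftHom (fun _ _ q => gι B' X q) k) ≫
        gι A ((gamma B').toFunctor.obj X) p) ≫ (gammaMap φ).app ((gamma B').toFunctor.obj X) a b =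
        φ.app _ ≫ gι₂ A' B' X p k :=
      (Category.assoc _ _ _).trans ((congrArg (A.map (p.liftHom
        (fun _ _ q => gι B' X q) k) ≫ ·) f2).trans
          (φ.naturality_assoc (p.liftHom (fun _ _ q => gι B' X q) k)
            (gι A' ((gamma B').toFunctor.obj X) p)))
    refine (Category.assoc _ _ _).trans ((congrArg (A.map ((mapSeqTrans ψ).app
      (p.segs X.hom k)) ≫ ·) f5).trans ?_)
    refine (φ.naturality_assoc ((mapSeqTrans ψ).app (p.segs X.hom k)) _).trans ?_
    rw [twoTrans_app]
    exact (Category.assoc _ _ _).symm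
  have e5 := gι₂_gammaComp hA' B' X p k
  refine (Category.assoc _ _ _).symm.trans ((congrArg (· ≫ (gammaMap (compMap φ ψ)).app X a b)
    e1).trans (Eq.trans ?_ ((Category.assoc _ _ _).symm.trans
      ((congrArg (· ≫ (gammaComp hA' B').app X a b) e4).trans (Category.assoc _ _ _))).symm))
  refine (Category.assoc _ _ _).trans ((congrArg (lanι flat (mapSeq B ⋙ A) _ _ ≫ ·) e2).trans ?_)
  refine Eq.trans ?_ (congrArg ((twoTrans φ ψ).app (p.segs X.hom k) ≫ ·) e5.symm)
  exact (Category.assoc _ _ _).symm.trans ((congrArg (· ≫ gι (comp A' B') X (p.join k)) e3).trans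
    (Category.assoc _ _ _))

end GammaColl

/-! ### Operads over `Set` and multitensors over a multitensor -/

section CartesianOver

/-- A functor with a cartesian transformation to a functor preserving pullbacks preserves pullbacks. -/
lemma preservesPullbacks_of_equifibered {C : Type u} [Category.{v} C] {D : Type u₁}
    [Category.{v₁} D] {F G : C ⥤ D} {α : F ⟶ G} (h : NatTrans.Equifibered α)
    (hG : PreservesLimitsOfShape WalkingCospan G) : PreservesLimitsOfShape WalkingCospan F := by
  have key : ∀ {X Y Z : C} (f : X ⟶ Z) (g : Y ⟶ Z), PreservesLimit (cospan f g) F := by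
    intro X Y Z f g
    refine ⟨fun {c} hc => ⟨(PullbackCone.isLimitMapConeEquiv c F).symm ?_⟩⟩
    have sq : IsPullback (PullbackCone.fst c) (PullbackCone.snd c) f g :=
      ⟨⟨PullbackCone.condition c⟩, ⟨hc.ofIsoLimit
      (PullbackCone.ext (Iso.refl _) (Category.id_comp _).symm (Category.id_comp _).symm)⟩⟩
    have h1 := (h (PullbackCone.fst c)).paste_vert (sq.map G)
    have h2 : IsPullback (F.map (PullbackCone.fst c)) (F.map (PullbackCone.snd c) ≫ α.app Y)
        (F.map f ≫ α.app Z) (G.map g) := by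
      rw [α.naturality, α.naturality]; exact h1
    exact (IsPullback.of_bot h2 (by rw [← F.map_comp, ← F.map_comp, sq.w]) (h g)).isLimit
  exact ⟨fun {K} => preservesLimit_of_iso_diagram F (diagramIsoCospan K).symm⟩

end CartesianOver

variable {V : Type u} [Category.{v} V]

namespace MonadOverSet

/-- A monad over `Set` with a cartesian morphism to a cartesian monad is cartesian. -/
lemma IsCartesian.of_isHom {S T : MonadOverSet V} [T.IsCartesian] {α : S.T ⟶ T.T}
    (h : GFun.IsCartesian α) (hα : IsHom α) : S.IsCartesian := by
  have hS : PreservesLimitsOfShape WalkingCospan S.T.toFunctor :=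
    preservesPullbacks_of_equifibered h IsCartesian.pullbacks
  have cancel : ∀ {A B C : GFun V} {φ : A ⟶ B} {ψ : B ⟶ C}, GFun.IsCartesian (φ ≫ ψ) →
      GFun.IsCartesian ψ → GFun.IsCartesian φ := by
    intro A B C φ ψ h₁ h₂ X Y f
    exact IsPullback.of_bot (h₁ f) ((GFun.toNatTrans φ).naturality f) (h₂ f)
  refine ⟨hS, cancel (ψ := α) ?_ h, cancel (ψ := α) ?_ h⟩
  · rw [hα.unit]
    exact IsCartesian.unit
  · rw [hα.mult]
    exact (h.hcomp h IsCartesian.pullbacks).comp IsCartesian.mult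

end MonadOverSet

/-- An operad over `Set` over the monad `T`: a cartesian monad over `Set` together with a cartesian
monad morphism over `Set` to `T`. -/
structure NOp (T : MonadOverSet V) where
  S : MonadOverSet V
  isCartesian : S.IsCartesian
  α : S.T ⟶ T.T
  cart : GFun.IsCartesian α
  isHom : MonadOverSet.IsHom α

namespace NOp

variable {T : MonadOverSet V}

/-- A morphism of operads is a monad morphism over `T`. -/
@[ext]
structure Hom (X Y : NOp T) where
  φ : X.S.T ⟶ Y.S.T
  isHom : MonadOverSet.IsHom φ
  w : φ ≫ Y.α = X.α

lemma isHom_id (S : MonadOverSet V) : MonadOverSet.IsHom (S := S) (T := S) (𝟙 S.T) :=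
  ⟨Category.comp_id _, by rw [GFun.hcomp_id]; exact (Category.comp_id _).trans (Category.id_comp _).symm⟩

lemma isHom_comp {S S' S'' : MonadOverSet V} {φ : S.T ⟶ S'.T} {ψ : S'.T ⟶ S''.T}
    (hφ : MonadOverSet.IsHom φ) (hψ : MonadOverSet.IsHom ψ) :
    MonadOverSet.IsHom (S := S) (T := S'') (φ ≫ ψ) :=
  ⟨by rw [← Category.assoc, hφ.unit, hψ.unit], by
    rw [← Category.assoc, hφ.mult, Category.assoc, hψ.mult, GFun.hcomp_comp, Category.assoc]⟩

instance : Category (NOp T) where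
  Hom := Hom
  id X := ⟨𝟙 _, isHom_id _, Category.id_comp _⟩
  comp f g := ⟨f.φ ≫ g.φ, isHom_comp f.isHom g.isHom, by rw [Category.assoc, g.w, f.w]⟩
  id_comp f := Hom.ext (Category.id_comp f.φ)
  comp_id f := Hom.ext (Category.comp_id f.φ)
  assoc f g h := Hom.ext (Category.assoc f.φ g.φ h.φ)

end NOp

/-- A multitensor over the multitensor `M`: a cartesian multitensor together with a cartesian
multitensor morphism to `M`. -/
structure MultOver (M : Multitensor V) where
  N : Multitensor V
  isCartesian : N.IsCartesian
  α : N.E ⟶ M.E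
  cart : NatTrans.Equifibered α
  isHom : Multitensor.IsHom α

namespace MultOver

variable {M : Multitensor V}

/-- A morphism of multitensors over `M` is a multitensor morphism over `M`. -/
@[ext]
structure Hom (X Y : MultOver M) where
  φ : X.N.E ⟶ Y.N.E
  isHom : Multitensor.IsHom φ
  w : φ ≫ Y.α = X.α

lemma isHom_id (N : Multitensor V) : Multitensor.IsHom (M := N) (N := N) (𝟙 N.E) where
  unit := Category.comp_id _
  subst := by
    have e : mapSeqTrans (𝟙 N.E) ◫ 𝟙 N.E = 𝟙 (mapSeq N.E ⋙ N.E) := by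
      rw [mapSeqTrans_id]
      ext Y
      exact (Category.id_comp _).trans (N.E.map_id _)
    rw [e]
    exact (Category.comp_id _).trans (Category.id_comp _).symm

lemma isHom_comp {N N' N'' : Multitensor V} {φ : N.E ⟶ N'.E} {ψ : N'.E ⟶ N''.E}
    (hφ : Multitensor.IsHom φ) (hψ : Multitensor.IsHom ψ) :
    Multitensor.IsHom (M := N) (N := N'') (φ ≫ ψ) where
  unit := by
    rw [Functor.whiskerLeft_comp, ← Category.assoc, hφ.unit, hψ.unit]
  subst := by
    rw [Functor.whiskerLeft_comp, ← Category.assoc, hφ.subst, Category.assoc, hψ.subst,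
      mapSeqTrans_comp, ← Category.assoc, NatTrans.exchange]

instance : Category (MultOver M) where
  Hom := Hom
  id X := ⟨𝟙 _, isHom_id _, Category.id_comp _⟩
  comp f g := ⟨f.φ ≫ g.φ, isHom_comp f.isHom g.isHom, by rw [Category.assoc, g.w, f.w]⟩
  id_comp f := Hom.ext (Category.id_comp f.φ)
  comp_id f := Hom.ext (Category.comp_id f.φ)
  assoc f g h := Hom.ext (Category.assoc f.φ g.φ h.φ)

end MultOver

section GammaFunctors

variable [Lextensive V]

namespace Multitensor

/-- The monad `Γ M` over `Set`. -/
noncomputable def gammaMonad (M : Multitensor V) [M.IsDistributive] : MonadOverSet V where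
  T := gamma M.E
  η := M.gammaη
  μ := M.gammaμ
  left_unit X _ _ := gamma_left_unit X
  right_unit X _ _ := gamma_right_unit X
  assoc X _ _ := gamma_assoc X

lemma lanDesc_comp {A : Type u₁} [Category.{v₁} A] {B : Type u₂} [Category.{v₂} B] (p : A ⥤ B)
    [DiscFib p] {G : A ⥤ V} {K L : B ⥤ V} (θ : G ⟶ p ⋙ K) (φ : K ⟶ L) :
    lanDesc θ ≫ φ = lanDesc (θ ≫ Functor.whiskerLeft p φ) := by
  ext X
  refine lan_ext fun a h => ?_
  have e1 := lanι_desc θ a h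
  have e2 := lanι_desc (θ ≫ Functor.whiskerLeft p φ) a h
  refine (Category.assoc _ _ _).symm.trans ((congrArg (· ≫ φ.app X) e1).trans
    (Eq.trans ?_ e2.symm))
  simp

lemma IsHom.one {M N : Multitensor V} {φ : M.E ⟶ N.E} (h : IsHom φ) : M.one ≫ φ = N.one :=
  (lanDesc_comp single M.u φ).trans (congrArg lanDesc h.unit)

lemma IsHom.mul {M N : Multitensor V} {φ : M.E ⟶ N.E} (h : IsHom φ) :
    M.mul ≫ φ = compMap φ φ ≫ N.mul :=
  (lanDesc_comp flat M.σ φ).trans ((congrArg lanDesc h.subst).trans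
    (lanMapTrans_desc flat (twoTrans φ φ) N.σ).symm)

lemma IsHom.gammaMap {M N : Multitensor V} [M.IsDistributive] [N.IsDistributive] {φ : M.E ⟶ N.E}
    (h : IsHom φ) : MonadOverSet.IsHom (S := M.gammaMonad) (T := N.gammaMonad)
      (MultOp.gammaMap φ) where
  unit := by
    change (gammaUnit ≫ MultOp.gammaMap M.one) ≫ MultOp.gammaMap φ = gammaUnit ≫ MultOp.gammaMap N.one
    rw [Category.assoc, ← gammaMap_comp]
    exact congrArg (gammaUnit ≫ MultOp.gammaMap ·) h.one
  mult := by
    change (gammaComp _ _ ≫ MultOp.gammaMap M.mul) ≫ MultOp.gammaMap φ =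
      GFun.hcomp (MultOp.gammaMap φ) (MultOp.gammaMap φ) ≫ gammaComp _ _ ≫ MultOp.gammaMap N.mul
    rw [Category.assoc, ← gammaMap_comp, ← Category.assoc (GFun.hcomp _ _),
      ← gammaComp_naturality, Category.assoc, ← gammaMap_comp]
    exact congrArg (gammaComp _ M.E ≫ MultOp.gammaMap ·) h.mul

end Multitensor

/-- The functor `Γ` from collections over `M` to collections over `Set` over `Γ M`. -/
noncomputable def gammaColl (M : Multitensor V) [M.IsDistributive] :
    Coll M ⥤ NColl M.gammaMonad where
  obj X := ⟨gamma X.A, gammaMap X.α, gammaMap_isCartesian X.cart⟩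
  map f := ⟨gammaMap f.φ, (gammaMap_comp _ _).symm.trans (congrArg gammaMap f.w)⟩
  map_id X := NColl.hom_ext (gammaMap_id X.A)
  map_comp f g := NColl.hom_ext (gammaMap_comp f.φ g.φ)

lemma MultOver.isDistributive {M : Multitensor V} [M.IsDistributive] (X : MultOver M) :
    X.N.IsDistributive :=
  ⟨Multitensor.IsDistributive.distributive.of_equifibered X.cart⟩

/-- The functor `Γ` from multitensors over `M` to operads over `Set` over `Γ M`. -/
noncomputable def gammaMult (M : Multitensor V) [M.IsDistributive] [M.gammaMonad.IsCartesian] :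
    MultOver M ⥤ NOp M.gammaMonad where
  obj X :=
    haveI := X.isDistributive
    { S := X.N.gammaMonad
      isCartesian := .of_isHom (gammaMap_isCartesian X.cart) X.isHom.gammaMap
      α := gammaMap X.α
      cart := gammaMap_isCartesian X.cart
      isHom := X.isHom.gammaMap }
  map {X Y} f :=
    haveI := X.isDistributive
    haveI := Y.isDistributive
    { φ := gammaMap f.φ
      isHom := f.isHom.gammaMap
      w := (gammaMap_comp _ _).symm.trans (congrArg gammaMap f.w) }
  map_id X := NOp.Hom.ext (gammaMap_id X.N.E)
  map_comp f g := NOp.Hom.ext (gammaMap_comp f.φ g.φ)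

end GammaFunctors

/-! ### The multitensor of a monad -/

section Products

variable {V : Type u} [Category.{v} V] [HasFiniteProducts V]

/-- The map `(A × L) × M ⟶ A × N` given by `L × M ⟶ N`. -/
noncomputable def shift (A : V) {L M N : V} (α : L ⨯ M ⟶ N) : (A ⨯ L) ⨯ M ⟶ A ⨯ N :=
  prod.lift (prod.fst ≫ prod.fst) (prod.map prod.snd (𝟙 M) ≫ α)

lemma shift_naturality {A A' L L' M M' N N' : V} (f : A ⟶ A') {f' : L ⟶ L'} {g : M ⟶ M'}
    {n : N ⟶ N'} {α : L ⨯ M ⟶ N} {α' : L' ⨯ M' ⟶ N'} (h : prod.map f' g ≫ α' = α ≫ n) :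
    prod.map (prod.map f f') g ≫ shift A' α' = shift A α ≫ prod.map f n := by
  refine Limits.prod.hom_ext ?_ ?_
  · simp [shift, prod.lift_fst, prod.lift_snd, prod.lift_fst_assoc, prod.lift_snd_assoc]
  · have e : prod.map (prod.map f f') g ≫ prod.map prod.snd (𝟙 M') =
        prod.map prod.snd (𝟙 M) ≫ prod.map f' g := by simp
    simp only [shift, Category.assoc, prod.lift_snd, prod.map_snd, prod.lift_snd_assoc]
    rw [← Category.assoc, e, Category.assoc, h]

lemma shift_fst (A : V) {L M N : V} {α : L ⨯ M ⟶ N} {c : N ⟶ L} (h : α ≫ c = prod.fst) :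
    shift A α ≫ prod.map (𝟙 A) c = prod.fst := by
  refine Limits.prod.hom_ext ?_ ?_
  · simp [shift, prod.lift_fst, prod.lift_snd, prod.lift_fst_assoc, prod.lift_snd_assoc]
  · simp only [shift, Category.assoc, prod.map_snd, prod.lift_snd_assoc, h, prod.map_fst]

lemma shift_assoc (A : V) {L M N P Q R S : V} {α : L ⨯ M ⟶ P} {β : P ⨯ N ⟶ Q} {c : Q ⟶ R}
    {γ : M ⨯ N ⟶ S} {δ : L ⨯ S ⟶ R}
    (h : prod.map α (𝟙 N) ≫ β ≫ c = (Limits.prod.associator L M N).hom ≫ prod.map (𝟙 L) γ ≫ δ) :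
    prod.map (shift A α) (𝟙 N) ≫ shift A β ≫ prod.map (𝟙 A) c =
      (Limits.prod.associator (A ⨯ L) M N).hom ≫ prod.map (𝟙 (A ⨯ L)) γ ≫ shift A δ := by
  refine Limits.prod.hom_ext ?_ ?_
  · simp [shift, prod.lift_fst, prod.lift_snd, prod.lift_fst_assoc, prod.lift_snd_assoc]
  · have e : prod.map (shift A α) (𝟙 N) ≫ prod.map prod.snd (𝟙 N) =
        prod.map (prod.map prod.snd (𝟙 M)) (𝟙 N) ≫ prod.map α (𝟙 N) := by simp [shift, prod.lift_fst, prod.lift_snd, prod.lift_fst_assoc, prod.lift_snd_assoc]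
    have e' : (Limits.prod.associator (A ⨯ L) M N).hom ≫ prod.map (𝟙 (A ⨯ L)) γ ≫
        prod.map prod.snd (𝟙 S) = prod.map (prod.map prod.snd (𝟙 M)) (𝟙 N) ≫
          (Limits.prod.associator L M N).hom ≫ prod.map (𝟙 L) γ := by
      refine Limits.prod.hom_ext ?_ ?_
      · simp [prod.lift_fst, prod.lift_snd, prod.lift_fst_assoc, prod.lift_snd_assoc]
      · simp only [Category.assoc, prod.map_snd, Category.comp_id]
        simp only [← Category.assoc]
        refine congrArg (· ≫ γ) (Limits.prod.hom_ext ?_ ?_) <;> simp [prod.lift_fst, prod.lift_snd, prod.lift_fst_assoc, prod.lift_snd_assoc]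
    have e'' : (shift A β ≫ prod.map (𝟙 A) c) ≫ prod.snd = prod.map prod.snd (𝟙 N) ≫ β ≫ c := by
      simp [shift, prod.lift_fst, prod.lift_snd, prod.lift_fst_assoc, prod.lift_snd_assoc]
    have e3 : shift A δ ≫ prod.snd = prod.map prod.snd (𝟙 S) ≫ δ := by simp [shift, prod.lift_fst, prod.lift_snd, prod.lift_fst_assoc, prod.lift_snd_assoc]
    rw [Category.assoc, e'', ← Category.assoc, e, Category.assoc, h]
    rw [Category.assoc, Category.assoc, e3]
    have := congrArg (· ≫ δ) e'
    simpa only [Category.assoc] using this.symm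

lemma shift_eq (A : V) {L M N : V} (α : L ⨯ M ⟶ N) :
    shift A α = (Limits.prod.associator A L M).hom ≫ prod.map (𝟙 A) α := by
  refine Limits.prod.hom_ext ?_ ?_
  · simp [shift, prod.lift_fst, prod.lift_snd, prod.lift_fst_assoc, prod.lift_snd_assoc]
  · simp only [shift, Category.assoc, prod.lift_snd, prod.map_snd, Limits.prod.associator_hom,
      prod.lift_snd_assoc]
    refine congrArg (· ≫ α) (Limits.prod.hom_ext ?_ ?_) <;> simp [prod.lift_fst, prod.lift_snd, prod.lift_fst_assoc, prod.lift_snd_assoc]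

lemma snd_assoc (L : V) {M N S : V} (γ : M ⨯ N ⟶ S) :
    prod.map (prod.snd : L ⨯ M ⟶ M) (𝟙 N) ≫ γ ≫ 𝟙 S =
      (Limits.prod.associator L M N).hom ≫ prod.map (𝟙 L) γ ≫ prod.snd := by
  simp only [Category.comp_id, prod.map_snd, Limits.prod.associator_hom, prod.lift_snd_assoc]
  refine congrArg (· ≫ γ) (Limits.prod.hom_ext ?_ ?_) <;> simp [prod.lift_fst, prod.lift_snd, prod.lift_fst_assoc, prod.lift_snd_assoc]

variable (T : Monad V)

/-- The product of a free algebra and an algebra. -/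
noncomputable def algCons (a : V) {L : V} (k : T.obj L ⟶ L) : T.obj (T.obj a ⨯ L) ⟶ T.obj a ⨯ L :=
  prod.lift (T.map prod.fst ≫ T.μ.app a) (T.map prod.snd ≫ k)

variable {T}

lemma algCons_naturality {a b L M : V} (f : a ⟶ b) {g : L ⟶ M} {k : T.obj L ⟶ L}
    {k' : T.obj M ⟶ M} (h : T.map g ≫ k' = k ≫ g) :
    T.map (prod.map (T.map f) g) ≫ algCons T b k' = algCons T a k ≫ prod.map (T.map f) g := by
  refine Limits.prod.hom_ext ?_ ?_
  · simp only [algCons, Category.assoc, prod.lift_fst, prod.map_fst, prod.lift_fst_assoc,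
      ← T.map_comp_assoc]
    rw [T.map_comp_assoc]
    exact congrArg (_ ≫ ·) (T.μ.naturality f)
  · simp only [algCons, Category.assoc, prod.lift_snd, prod.map_snd, prod.lift_snd_assoc,
      ← T.map_comp_assoc]
    rw [T.map_comp_assoc, h]

lemma algCons_unit (a : V) {L : V} {k : T.obj L ⟶ L} (h : T.η.app L ≫ k = 𝟙 L) :
    T.η.app (T.obj a ⨯ L) ≫ algCons T a k = 𝟙 _ := by
  refine Limits.prod.hom_ext ?_ ?_
  · simp only [algCons, Category.assoc, prod.lift_fst, Category.id_comp]
    have := T.η.naturality_assoc (prod.fst : T.obj a ⨯ L ⟶ _) (T.μ.app a)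
    exact this.symm.trans ((congrArg (_ ≫ ·) (T.left_unit a)).trans (Category.comp_id _))
  · simp only [algCons, Category.assoc, prod.lift_snd, Category.id_comp]
    have := T.η.naturality_assoc (prod.snd : T.obj a ⨯ L ⟶ _) k
    exact this.symm.trans ((congrArg (_ ≫ ·) h).trans (Category.comp_id _))

lemma algCons_assoc (a : V) {L : V} {k : T.obj L ⟶ L} (h : T.map k ≫ k = T.μ.app L ≫ k) :
    T.map (algCons T a k) ≫ algCons T a k = T.μ.app _ ≫ algCons T a k := by
  refine Limits.prod.hom_ext ?_ ?_
  · simp only [algCons, Category.assoc, prod.lift_fst, ← T.map_comp_assoc]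
    rw [T.map_comp_assoc, T.assoc]
    exact T.μ.naturality_assoc (prod.fst : T.obj a ⨯ L ⟶ _) (T.μ.app a)
  · simp only [algCons, Category.assoc, prod.lift_snd, ← T.map_comp_assoc]
    rw [T.map_comp_assoc, h]
    exact T.μ.naturality_assoc (prod.snd : T.obj a ⨯ L ⟶ _) k

lemma algCons_shift (a : V) {L M N : V} {α : L ⨯ M ⟶ N} {k : T.obj L ⟶ L} {k' : T.obj M ⟶ M}
    {k'' : T.obj N ⟶ N}
    (h : T.map α ≫ k'' = prod.lift (T.map prod.fst ≫ k) (T.map prod.snd ≫ k') ≫ α) :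
    T.map (shift (T.obj a) α) ≫ algCons T a k'' =
      prod.lift (T.map prod.fst ≫ algCons T a k) (T.map prod.snd ≫ k') ≫ shift (T.obj a) α := by
  refine Limits.prod.hom_ext ?_ ?_
  · simp only [algCons, shift, Category.assoc, prod.lift_fst, prod.lift_fst_assoc,
      ← T.map_comp_assoc]
  · simp only [algCons, shift, Category.assoc, prod.lift_snd, prod.lift_fst_assoc,
      ← T.map_comp_assoc]
    rw [T.map_comp_assoc, h, ← Category.assoc, ← Category.assoc]
    refine congrArg (· ≫ α) ?_
    refine Limits.prod.hom_ext ?_ ?_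
    · simp only [algCons, Category.assoc, prod.lift_fst, prod.lift_snd, prod.lift_fst_assoc, prod.lift_snd_assoc,
        prod.map_fst, prod.map_snd, prod.map_fst_assoc, prod.map_snd_assoc, Category.comp_id,
        ← T.map_comp_assoc]
    · simp only [algCons, Category.assoc, prod.lift_fst, prod.lift_snd, prod.lift_fst_assoc, prod.lift_snd_assoc,
        prod.map_fst, prod.map_snd, prod.map_fst_assoc, prod.map_snd_assoc, Category.comp_id,
        ← T.map_comp_assoc]

lemma algCons_map (a : V) {L L' M : V} {k : T.obj L ⟶ L} {k' : T.obj L' ⟶ L'} {c : T.obj M ⟶ M}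
    (f : T.obj a ⟶ M) {g : L ⟶ L'} (hf : T.map f ≫ c = T.μ.app a ≫ f) (hg : T.map g ≫ k' = k ≫ g) :
    T.map (prod.map f g) ≫ prod.lift (T.map prod.fst ≫ c) (T.map prod.snd ≫ k') =
      algCons T a k ≫ prod.map f g := by
  refine Limits.prod.hom_ext ?_ ?_
  · simp only [algCons, Category.assoc, prod.lift_fst, prod.map_fst, prod.lift_fst_assoc,
      ← T.map_comp_assoc]
    rw [T.map_comp_assoc, hf]
  · simp only [algCons, Category.assoc, prod.lift_snd, prod.map_snd, prod.lift_snd_assoc,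
      ← T.map_comp_assoc]
    rw [T.map_comp_assoc, hg]

lemma algCons_unit_right (a : V) {L M N : V} {s : L ⟶ M} {r : M ⟶ N} {c : N ⟶ L}
    (k : T.obj (⊤_ V) ⟶ ⊤_ V) (h : s ≫ r ≫ c = 𝟙 L) :
    prod.map (T.map (prod.lift (T.η.app a) (terminal.from a))) s ≫
        (prod.map (algCons T a k) r ≫ shift (T.obj a) prod.snd) ≫ prod.map (𝟙 _) c = 𝟙 _ := by
  refine Limits.prod.hom_ext ?_ ?_
  · simp only [algCons, shift, Category.assoc, prod.lift_fst, prod.map_fst, prod.lift_fst_assoc,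
      prod.map_fst_assoc, ← T.map_comp_assoc, Category.comp_id, Category.id_comp, T.right_unit]
    rfl
  · simp only [shift, Category.assoc, prod.lift_snd, prod.map_snd, prod.lift_snd_assoc,
      prod.map_snd_assoc, Category.comp_id, Category.id_comp, h]
    rfl

end Products

section Times

variable {V : Type u} [Category.{v} V] [HasFiniteProducts V]

/-- The product `T X₁ × ⋯ × T Xₙ`. -/
noncomputable def timesObj (T : V ⥤ V) : List V → V
  | [] => ⊤_ V
  | a :: l => T.obj a ⨯ timesObj T l

noncomputable def timesMap (T : V ⥤ V) : {l m : List V} → SeqHom l m →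
    (timesObj T l ⟶ timesObj T m)
  | _, _, .nil => 𝟙 _
  | _, _, .cons f g => prod.map (T.map f) (timesMap T g)

/-- The functor sending `X₁, …, Xₙ` to `T X₁ × ⋯ × T Xₙ`. -/
noncomputable abbrev times (T : V ⥤ V) : List V ⥤ V where
  obj := timesObj T
  map f := timesMap T f
  map_id l := by
    induction l with
    | nil => rfl
    | cons a l ih =>
      exact (congrArg₂ prod.map (T.map_id a) ih).trans prod.map_id_id
  map_comp {l m n} f g := by
    change SeqHom l m at f
    induction f generalizing n with
    | nil => change SeqHom _ _ at g; cases g; exact (Category.id_comp _).symm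
    | cons f f' ih =>
      change SeqHom _ _ at g
      cases g with | cons g g' =>
      exact (congrArg₂ prod.map (T.map_comp f g) (ih g')).trans (prod.map_map _ _ _ _).symm

/-- The canonical map `(T X₁ × ⋯ × T Xₙ) × (T Y₁ × ⋯ × T Yₘ) ⟶ T X₁ × ⋯ × T Yₘ`. -/
noncomputable def timesAppend (T : V ⥤ V) : (l m : List V) →
    (timesObj T l ⨯ timesObj T m ⟶ timesObj T (l ++ m))
  | [], _ => prod.snd
  | a :: l, m => shift (T.obj a) (timesAppend T l m)

lemma timesAppend_naturality (T : V ⥤ V) {l l' m m' : List V} (f : SeqHom l l') (g : m ⟶ m') :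
    prod.map (timesMap T f) (timesMap T g) ≫ timesAppend T l' m' =
      timesAppend T l m ≫ timesMap T (appendHom f g) := by
  induction f with
  | nil => exact prod.map_snd _ _
  | cons f f' ih => exact shift_naturality (T.map f) ih

lemma timesMap_eqToHom_rfl (T : V ⥤ V) (l : List V) :
    timesMap T (eqToHom (rfl : l = l)) = 𝟙 (timesObj T l) := (times T).map_id l

lemma timesMap_eqToHom_cons (T : V ⥤ V) (a : V) {l m : List V} (h : l = m)
    (h' : a :: l = a :: m) :
    timesMap T (eqToHom h') = prod.map (𝟙 (T.obj a)) (timesMap T (eqToHom h)) := by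
  subst h
  rw [timesMap_eqToHom_rfl, timesMap_eqToHom_rfl]
  exact prod.map_id_id.symm

lemma timesAppend_nil (T : V ⥤ V) : (l : List V) → (h : l ++ [] = l) →
    timesAppend T l [] ≫ timesMap T (eqToHom h) = prod.fst
  | [], h => terminalIsTerminal.hom_ext _ _
  | a :: l, h => (congrArg (_ ≫ ·) (timesMap_eqToHom_cons T a (List.append_nil l) h)).trans
      (shift_fst (T.obj a) (timesAppend_nil T l (List.append_nil l)))

lemma timesAppend_assoc (T : V ⥤ V) : (l m n : List V) → (h : (l ++ m) ++ n = l ++ (m ++ n)) →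
    prod.map (timesAppend T l m) (𝟙 _) ≫ timesAppend T (l ++ m) n ≫ timesMap T (eqToHom h) =
      (Limits.prod.associator _ _ _).hom ≫ prod.map (𝟙 _) (timesAppend T m n) ≫
        timesAppend T l (m ++ n)
  | [], m, n, h => by
    exact (congrArg (fun f => prod.map (timesAppend T [] m) (𝟙 _) ≫ timesAppend T m n ≫ f)
      (timesMap_eqToHom_rfl T (m ++ n))).trans (snd_assoc (⊤_ V) (timesAppend T m n))
  | a :: l, m, n, h => (congrArg (fun f => prod.map (timesAppend T (a :: l) m) (𝟙 _) ≫
        timesAppend T (a :: (l ++ m)) n ≫ f)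
      (timesMap_eqToHom_cons T a (List.append_assoc l m n) h)).trans
        (shift_assoc (T.obj a) (timesAppend_assoc T l m n (List.append_assoc l m n)))

lemma timesAppend_cast (T : V ⥤ V) (l : List V) {m m' : List V} (h : m = m')
    (h' : l ++ m = l ++ m') :
    prod.map (𝟙 _) (timesMap T (eqToHom h)) ≫ timesAppend T l m' =
      timesAppend T l m ≫ timesMap T (eqToHom h') := by
  subst h
  rw [timesMap_eqToHom_rfl, timesMap_eqToHom_rfl, prod.map_id_id, Category.id_comp,
    Category.comp_id]

lemma timesAppend_shift (T : V ⥤ V) (l m n w : List V) (h : m ++ n = w)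
    (h' : (l ++ m) ++ n = l ++ w) :
    shift (timesObj T l) (timesAppend T m n ≫ timesMap T (eqToHom h)) ≫ timesAppend T l w =
      prod.map (timesAppend T l m) (𝟙 _) ≫ timesAppend T (l ++ m) n ≫
        timesMap T (eqToHom h') := by
  subst h
  rw [timesAppend_assoc T l m n h', timesMap_eqToHom_rfl, Category.comp_id, shift_eq,
    Category.assoc]

lemma timesMap_eqToHom_trans (T : V ⥤ V) {l m n : List V} (h : l = m) (h' : m = n) :
    timesMap T (eqToHom h) ≫ timesMap T (eqToHom h') = timesMap T (eqToHom (h.trans h')) := by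
  subst h h'
  rw [timesMap_eqToHom_rfl, Category.id_comp]

end Times

section TimesMonad

variable {V : Type u} [Category.{v} V] [HasFiniteProducts V] (T : Monad V)

/-- The product of the free algebra structures on `T X₁, …, T Xₙ`. -/
noncomputable def timesAlg : (l : List V) → (T.obj (timesObj T.toFunctor l) ⟶ timesObj T.toFunctor l)
  | [] => terminal.from _
  | a :: l => algCons T a (timesAlg l)

lemma timesAlg_naturality {l m : List V} (f : SeqHom l m) :
    T.map (timesMap T.toFunctor f) ≫ timesAlg T m = timesAlg T l ≫ timesMap T.toFunctor f := by
  induction f with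
  | nil => exact terminalIsTerminal.hom_ext _ _
  | cons f g ih => exact algCons_naturality f ih

lemma timesAlg_unit : (l : List V) → T.η.app (timesObj T.toFunctor l) ≫ timesAlg T l = 𝟙 _
  | [] => terminalIsTerminal.hom_ext _ _
  | a :: l => algCons_unit a (timesAlg_unit l)

lemma timesAlg_assoc : (l : List V) → T.map (timesAlg T l) ≫ timesAlg T l =
    T.μ.app _ ≫ timesAlg T l
  | [] => terminalIsTerminal.hom_ext _ _
  | a :: l => algCons_assoc a (timesAlg_assoc l)

lemma timesAlg_append : (l m : List V) →
    T.map (timesAppend T.toFunctor l m) ≫ timesAlg T (l ++ m) =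
      prod.lift (T.map prod.fst ≫ timesAlg T l) (T.map prod.snd ≫ timesAlg T m) ≫
        timesAppend T.toFunctor l m
  | [], _ => (prod.lift_snd _ _).symm
  | a :: l, m => algCons_shift a (timesAlg_append l m)

/-- The substitution, which is induced by the maps `T (T X₁ × ⋯ × T Xₙ) ⟶ T X₁ × ⋯ × T Xₙ`. -/
noncomputable def timesSubst : (Y : List (List V)) →
    (timesObj T.toFunctor (Y.map (timesObj T.toFunctor)) ⟶ timesObj T.toFunctor Y.flatten)
  | [] => 𝟙 _
  | y :: Y => prod.map (timesAlg T y) (timesSubst Y) ≫ timesAppend T.toFunctor y Y.flatten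

lemma timesSubst_naturality {Y Z : List (List V)} (f : SeqHom Y Z) :
    timesMap T.toFunctor (mapHom (times T.toFunctor) f) ≫ timesSubst T Z =
      timesSubst T Y ≫ timesMap T.toFunctor (flattenHom f) := by
  induction f with
  | nil => rfl
  | cons f g ih =>
    have e1 := timesAlg_naturality T f
    have e2 := timesAppend_naturality T.toFunctor f (flattenHom g)
    refine (Category.assoc _ _ _).symm.trans ((congrArg (· ≫ timesAppend T.toFunctor _ _)
      ((prod.map_map _ _ _ _).trans ((congrArg₂ prod.map e1 ih).trans
        (prod.map_map _ _ _ _).symm))).trans ?_)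
    exact (Category.assoc _ _ _).trans ((congrArg (_ ≫ ·) e2).trans (Category.assoc _ _ _).symm)

lemma timesSubst_append : (Y Z : List (List V)) →
    (h : (Y ++ Z).map (timesObj T.toFunctor) =
      Y.map (timesObj T.toFunctor) ++ Z.map (timesObj T.toFunctor)) →
    (h' : Y.flatten ++ Z.flatten = (Y ++ Z).flatten) →
    timesAppend T.toFunctor (Y.map (timesObj T.toFunctor)) (Z.map (timesObj T.toFunctor)) ≫
        timesMap T.toFunctor (eqToHom h.symm) ≫ timesSubst T (Y ++ Z) =
      prod.map (timesSubst T Y) (timesSubst T Z) ≫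
        timesAppend T.toFunctor Y.flatten Z.flatten ≫ timesMap T.toFunctor (eqToHom h')
  | [], Z, h, h' => by
    rw [timesMap_eqToHom_rfl, timesMap_eqToHom_rfl]
    refine (congrArg (_ ≫ ·) (Category.id_comp _)).trans ?_
    exact (prod.map_snd _ _).symm.trans (congrArg (_ ≫ ·) (Category.comp_id _).symm)
  | y :: Y, Z, h, h' => by
    have ih := timesSubst_append Y Z List.map_append List.flatten_append.symm
    have hf : Y.flatten ++ Z.flatten = (Y ++ Z).flatten := List.flatten_append.symm
    let c := timesMap T.toFunctor (eqToHom
      (List.map_append (f := timesObj T.toFunctor) (l₁ := Y) (l₂ := Z)).symm)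
    have e1 := shift_naturality (timesAlg T y) (f' := timesSubst T Y) (g := timesSubst T Z)
      (α := timesAppend T.toFunctor (Y.map (timesObj T.toFunctor)) (Z.map (timesObj T.toFunctor)))
      (α' := timesAppend T.toFunctor Y.flatten Z.flatten ≫ timesMap T.toFunctor (eqToHom hf))
      (n := c ≫ timesSubst T (Y ++ Z)) ih.symm
    have e2 : timesMap T.toFunctor (eqToHom h.symm) = prod.map (𝟙 _) c :=
      timesMap_eqToHom_cons T.toFunctor (timesObj T.toFunctor y)
        (List.map_append (f := timesObj T.toFunctor) (l₁ := Y) (l₂ := Z)).symm h.symm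
    have e3 := timesAppend_shift T.toFunctor y Y.flatten Z.flatten _ hf h'
    have e4 : timesMap T.toFunctor (eqToHom h.symm) ≫ timesSubst T (y :: (Y ++ Z)) =
        prod.map (timesAlg T y) (c ≫ timesSubst T (Y ++ Z)) ≫
          timesAppend T.toFunctor y (Y ++ Z).flatten := by
      refine (congrArg (· ≫ timesSubst T (y :: (Y ++ Z))) e2).trans
        ((Category.assoc _ _ _).symm.trans (congrArg (· ≫ timesAppend T.toFunctor y _)
          ((prod.map_map _ _ _ _).trans ?_)))
      exact congrArg (prod.map · _) (Category.id_comp _)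
    refine (congrArg (_ ≫ ·) e4).trans ((Category.assoc _ _ _).symm.trans
      ((congrArg (· ≫ timesAppend T.toFunctor y (Y ++ Z).flatten) e1.symm).trans
        ((Category.assoc _ _ _).trans ((congrArg (_ ≫ ·) e3).trans ?_))))
    refine (Category.assoc _ _ _).symm.trans (congrArg (· ≫ timesAppend T.toFunctor
      (y ++ Y.flatten) Z.flatten ≫ timesMap T.toFunctor (eqToHom h')) ?_)
    exact (prod.map_map _ _ _ _).trans (congrArg (prod.map _ ·) (Category.comp_id _))

/-- The substitution is a map of algebras. -/
lemma timesSubst_alg : (Y : List (List V)) →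
    T.map (timesSubst T Y) ≫ timesAlg T Y.flatten =
      timesAlg T (Y.map (timesObj T.toFunctor)) ≫ timesSubst T Y
  | [] => terminalIsTerminal.hom_ext _ _
  | y :: Y => by
    have e1 := timesAlg_append T y Y.flatten
    have e2 := algCons_map (timesObj T.toFunctor y) (timesAlg T y) (timesAlg_assoc T y)
      (timesSubst_alg Y)
    refine (T.map_comp_assoc _ _ _).trans ((congrArg (_ ≫ ·) e1).trans
      ((Category.assoc _ _ _).symm.trans ((congrArg (· ≫ timesAppend T.toFunctor y Y.flatten)
        e2).trans (Category.assoc _ _ _))))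

lemma times_unit_left (X : List V) :
    prod.lift (T.η.app (timesObj T.toFunctor X)) (terminal.from _) ≫ timesSubst T [X] ≫
      timesMap T.toFunctor (eqToHom (flat_single X)) = 𝟙 (timesObj T.toFunctor X) := by
  have e := timesAppend_nil T.toFunctor X (flat_single X)
  refine (congrArg (prod.lift (T.η.app _) (terminal.from _) ≫ ·) ((Category.assoc _ _ _).trans
    ((congrArg (prod.map (timesAlg T X) (𝟙 _) ≫ ·) e).trans (prod.map_fst _ _)))).trans ?_
  exact (prod.lift_fst_assoc _ _ _).trans (timesAlg_unit T X)

/-- The unit. -/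
noncomputable def timesUnit : 𝟭 V ⟶ single ⋙ times T.toFunctor where
  app a := prod.lift (T.η.app a) (terminal.from a)
  naturality a b f := Limits.prod.hom_ext
    (by
      refine (Category.assoc _ _ _).trans ((congrArg (f ≫ ·) (prod.lift_fst _ _)).trans
        ((T.η.naturality f).trans (Eq.trans ?_ (Category.assoc _ _ _).symm)))
      refine Eq.trans ?_ (congrArg (prod.lift (T.η.app a) (terminal.from a) ≫ ·)
        (prod.map_fst _ _).symm)
      exact (prod.lift_fst_assoc _ _ _).symm)
    (terminalIsTerminal.hom_ext _ _)

lemma times_unit_right : (X : List V) →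
    timesMap T.toFunctor (unitSeq (timesUnit T) X) ≫ timesSubst T ((mapSeq single).obj X) ≫
      timesMap T.toFunctor (eqToHom (flat_map_single X)) = 𝟙 (timesObj T.toFunctor X)
  | [] => terminalIsTerminal.hom_ext _ _
  | a :: X => by
    refine Eq.trans ?_ (algCons_unit_right a (terminal.from _) (times_unit_right X))
    exact congrArg (fun f => timesMap T.toFunctor (unitSeq (timesUnit T) (a :: X)) ≫
      timesSubst T ((mapSeq single).obj (a :: X)) ≫ f) (timesMap_eqToHom_cons T.toFunctor a
        (flat_map_single X) (flat_map_single (a :: X)))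

/-- The substitution, as a transformation. -/
noncomputable def timesσ : mapSeq (times T.toFunctor) ⋙ times T.toFunctor ⟶
    flat ⋙ times T.toFunctor where
  app := timesSubst T
  naturality _ _ f := timesSubst_naturality T f

lemma times_assoc : (Z : List (List (List V))) →
    timesMap T.toFunctor (sigmaSeq (timesσ T) Z) ≫ timesSubst T (Z.map List.flatten) ≫
        timesMap T.toFunctor (eqToHom (List.flatten_flatten (L := Z)).symm) =
      timesSubst T (Z.map (List.map (timesObj T.toFunctor))) ≫
        timesMap T.toFunctor (eqToHom (flat_map (times T.toFunctor) Z _ rfl)) ≫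
        timesSubst T Z.flatten
  | [] => rfl
  | z :: Z => by
    have ih := times_assoc Z
    have e1 := timesSubst_alg T z
    have e2 := timesSubst_append T z Z.flatten List.map_append List.flatten_append.symm
    have hi : (Z.map List.flatten).flatten = Z.flatten.flatten := List.flatten_flatten.symm
    have hi' := congrArg (z.flatten ++ ·) hi
    have hk : (Z.map (List.map (timesObj T.toFunctor))).flatten =
      Z.flatten.map (timesObj T.toFunctor) := flat_map (times T.toFunctor) Z _ rfl
    have hk' := congrArg (z.map (timesObj T.toFunctor) ++ ·) hk
    have e3 := timesAppend_cast T.toFunctor z.flatten hi hi'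
    have e4 := timesAppend_cast T.toFunctor (z.map (timesObj T.toFunctor)) hk hk'
    let s := timesMap T.toFunctor (sigmaSeq (timesσ T) Z)
    let r := timesSubst T (Z.map List.flatten)
    let t := timesSubst T (Z.map (List.map (timesObj T.toFunctor)))
    have hl : (List.map List.flatten (z :: Z)).flatten = ((z :: Z).flatten).flatten :=
      List.flatten_flatten.symm
    have hr : (List.map (List.map (timesObj T.toFunctor)) (z :: Z)).flatten =
      (z :: Z).flatten.map (timesObj T.toFunctor) := flat_map (times T.toFunctor) (z :: Z) _ rfl
    have hj : z.flatten ++ Z.flatten.flatten = (z ++ Z.flatten).flatten := List.flatten_append.symm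
    have hm : z.map (timesObj T.toFunctor) ++ Z.flatten.map (timesObj T.toFunctor) =
      (z ++ Z.flatten).map (timesObj T.toFunctor) := List.map_append.symm
    have l1 : timesMap T.toFunctor (eqToHom hl) =
        timesMap T.toFunctor (eqToHom hi') ≫ timesMap T.toFunctor (eqToHom hj) :=
      (timesMap_eqToHom_trans T.toFunctor hi' hj).symm
    have r1 : timesMap T.toFunctor (eqToHom hr) =
        timesMap T.toFunctor (eqToHom hk') ≫ timesMap T.toFunctor (eqToHom hm) :=
      (timesMap_eqToHom_trans T.toFunctor hk' hm).symm
    have l2 : timesMap T.toFunctor (sigmaSeq (timesσ T) (z :: Z)) ≫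
        timesSubst T ((z :: Z).map List.flatten) ≫ timesMap T.toFunctor (eqToHom hl) =
        prod.map (T.map (timesSubst T z) ≫ timesAlg T z.flatten)
            (s ≫ r ≫ timesMap T.toFunctor (eqToHom hi)) ≫
          timesAppend T.toFunctor z.flatten Z.flatten.flatten ≫
            timesMap T.toFunctor (eqToHom hj) := by
      rw [l1]
      change prod.map (T.map (timesSubst T z)) s ≫ (prod.map (timesAlg T z.flatten) r ≫
        timesAppend T.toFunctor z.flatten (Z.map List.flatten).flatten) ≫
        timesMap T.toFunctor (eqToHom hi') ≫ timesMap T.toFunctor (eqToHom hj) = _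
      have e5 := congrArg (· ≫ timesMap T.toFunctor (eqToHom hj)) e3
      simp only [Category.assoc] at e5 ⊢
      rw [← e5]
      simp only [prod.map_map_assoc, Category.comp_id, Category.assoc]
    have r2 : timesSubst T ((z :: Z).map (List.map (timesObj T.toFunctor))) ≫
        timesMap T.toFunctor (eqToHom hr) ≫ timesSubst T (z ++ Z.flatten) =
        prod.map (timesAlg T (z.map (timesObj T.toFunctor)) ≫ timesSubst T z)
            (t ≫ timesMap T.toFunctor (eqToHom hk) ≫ timesSubst T Z.flatten) ≫
          timesAppend T.toFunctor z.flatten Z.flatten.flatten ≫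
            timesMap T.toFunctor (eqToHom hj) := by
      rw [r1]
      change (prod.map (timesAlg T (z.map (timesObj T.toFunctor))) t ≫
        timesAppend T.toFunctor (z.map (timesObj T.toFunctor))
          (Z.map (List.map (timesObj T.toFunctor))).flatten) ≫
        (timesMap T.toFunctor (eqToHom hk') ≫ timesMap T.toFunctor (eqToHom hm)) ≫
          timesSubst T (z ++ Z.flatten) = _
      have e5 := congrArg (· ≫ timesMap T.toFunctor (eqToHom hm) ≫ timesSubst T (z ++ Z.flatten)) e4
      simp only [Category.assoc] at e5 ⊢
      rw [← e5, e2]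
      simp only [prod.map_map_assoc, Category.id_comp, Category.assoc]
    rw [l2.trans (congrArg₂ (fun f g => prod.map f g ≫ timesAppend T.toFunctor z.flatten
      Z.flatten.flatten ≫ timesMap T.toFunctor (eqToHom hj)) e1 ih)]
    exact r2.symm

/-- The multitensor of a monad `T`: the functor sending `X₁, …, Xₙ` to `T X₁ × ⋯ × T Xₙ`, with the
unit and the substitution given by the unit and the multiplication of `T`. -/
noncomputable def timesMult : Multitensor V where
  E := times T.toFunctor
  u := timesUnit T
  σ := timesσ T
  unit_left := times_unit_left T
  unit_right := times_unit_right T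
  assoc := times_assoc T

end TimesMonad

/-! ### The monads for strict `n`-categories -/

section Globular

/-- A category equipped with a monad. -/
structure Stage where
  V : Type (w + 1)
  [cat : Category.{w} V]
  T : Monad V

attribute [instance] Stage.cat

/-- `IsStrictMonad n S` means that `S` is the category `G ⋯ G Set` of `n`-globular sets with the
monad `T_{≤ n}`. These are defined by recursion: `T_{≤ 0}` is the identity monad on `Set`, and
`T_{≤ n + 1}` is the monad `Γ` of the multitensor given by the products of values of `T_{≤ n}`. -/
inductive IsStrictMonad : ℕ → Stage.{w} → Prop
  | zero : IsStrictMonad 0 ⟨Type w, Monad.id (Type w)⟩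
  | succ {n : ℕ} {S : Stage.{w}} [Lextensive S.V] [(timesMult S.T).IsDistributive]
      (h : IsStrictMonad n S) :
      IsStrictMonad (n + 1) ⟨Graph S.V, (timesMult S.T).gammaMonad.toMonad⟩

end Globular

end MultOp

/-! The equivalence on collections is an instance of extensivity. Let `S` be a functor over `Set`
with a cartesian transformation to `ΓE`. Each hom of `ΓE X` is a coproduct indexed by paths in `X`,
so pulling back along its inclusions splits the corresponding hom of `S X` into pieces indexed by
the same paths. Cartesianness at the map from `X` to the terminal graph shows that the piece at a
path depends only on its sequence of homs: for a sequence `l` it is the pullback of `S(1) → ΓE(1)`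
along the canonical map `E(l) → ΓE(1)`, which is `toLoop`. Taking this pullback as the value at `l`
defines a functor `A`, cartesian over `E`, with `ΓA ≅ S`; this is `restrict`, and
`restrictι_isCoprod` carries the argument. Conversely `toLoop_isPullback` recovers any collection
`A` from `ΓA` at the terminal graph, and this makes `Γ` full and faithful on collections.

For the monoidal structure, distributivity of `A` presents `ΓA ∘ ΓB` as a coproduct over paths of
paths, while `Γ(A ∘ B)` is a coproduct over paths together with a cutting of their sequence of homs
into blocks. These index sets correspond under concatenation (`join_inj`, `exists_join`) and the
summands are the same, so the comparison map is invertible. The unit comparison is invertible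
because `I` is concentrated on sequences of length one. Coherence is checked on summands.
Multitensors and operads are monoids in the two categories of collections. A strong monoidal
equivalence lifts monoid structures, which gives essential surjectivity on operads, while fullness
and faithfulness on monoids follow from the same properties on collections together with
invertibility of the comparison maps.

The monad `ΓE` is cartesian for two reasons. Its unit and multiplication are an invertible
comparison map followed by `Γ` of a cartesian transformation. Its functor preserves pullbacks
(`gamma_pullbacks`): a path in a pullback of graphs is a pair of paths with the same image, and
pairs with different images contribute initial objects since coproducts are disjoint.

The statement on strict `n`-categories is an induction carrying lextensivity of the base,
preservation of small coproducts and of pullbacks by the monad, and cartesianness of its unit and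
multiplication (`Stage.IsGood`). Products with a fixed object are pullbacks along projections, so
they preserve coproducts, and finite products of pullback squares are pullback squares; hence `T^×`
is distributive and cartesian. A coproduct of graphs is a disjoint union with initial homs between
different summands (`Graph.isSum_iff`), from which lextensivity of graphs follows. Finally `Γ`
preserves coproducts of graphs: a path that leaves a summand passes through an initial hom, and a
distributive functor is initial at a sequence with an initial entry. -/

namespace MultOp

/-! ### Coproducts in lextensive categories -/

section Coproducts

variable {V : Type u} [Category.{v} V]

/-- Initial summands can be left out of a coproduct. -/
lemma IsCoprod.of_injective {J L : Type*} {Z : J → V} {P : V} {c : ∀ j, Z j ⟶ P} (hc : IsCoprod c)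
    (e : L → J) (he : Function.Injective e)
    (h0 : ∀ j, (∀ l, e l ≠ j) → Nonempty (IsInitial (Z j))) : IsCoprod fun l => c (e l) := by
  classical
  intro W f
  -- The family on the summands reached by `e` is extended to all summands: by injectivity on the
  -- image of `e`, by initiality elsewhere.
  have key : ∀ j, ∃ g : Z j ⟶ W, ∀ l (h : e l = j), f l = eqToHom (congrArg Z h) ≫ g := by
    intro j
    by_cases h : ∃ l, e l = j
    · obtain ⟨l, rfl⟩ := h
      refine ⟨f l, fun l' h => ?_⟩
      cases he h
      simp
    · obtain ⟨h1⟩ := h0 j fun l hl => h ⟨l, hl⟩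
      exact ⟨h1.to W, fun l hl => (h ⟨l, hl⟩).elim⟩
  choose g hg using key
  refine ⟨hc.desc g, fun l => ?_, fun k hk => hc.hom_ext fun j => ?_⟩
  · rw [hc.fac, hg _ l rfl]; simp
  · rw [hc.fac]
    by_cases h : ∃ l, e l = j
    · obtain ⟨l, rfl⟩ := h
      rw [hk l, hg _ l rfl]; simp
    · obtain ⟨h1⟩ := h0 j fun l hl => h ⟨l, hl⟩
      exact h1.hom_ext _ _

lemma isCoprod_empty_iff {J : Type*} [IsEmpty J] {Z : J → V} {P : V} (c : ∀ j, Z j ⟶ P) :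
    IsCoprod c ↔ Nonempty (IsInitial P) := by
  constructor
  · intro h
    exact ⟨IsInitial.ofUniqueHom (fun W => h.desc isEmptyElim) fun W m => h.hom_ext isEmptyElim⟩
  · rintro ⟨h⟩ W f
    exact ⟨h.to W, isEmptyElim, fun g _ => h.hom_ext _ _⟩

variable [Lextensive V]

/-- Strictness of initial objects is extensivity for the empty family: every square over the empty
coproduct `I` is vacuously a pullback, so `W` is an empty coproduct too. -/
lemma nonempty_isInitial_of_hom {W I : V} (f : W ⟶ I) (h : Nonempty (IsInitial I)) :
    Nonempty (IsInitial W) := by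
  have h0 := (isCoprod_empty_iff (J := PEmpty.{v+1}) (Z := fun _ => I) (P := I)
    (fun j => j.elim)).2 h
  exact (isCoprod_empty_iff (J := PEmpty.{v+1}) (Z := fun _ => I) (P := W) (fun j => j.elim)).1
    ((h0.iff_isPullback (f := fun j => 𝟙 _) (g := f) (fun j => j.elim)).2 fun j => j.elim)

/-- A square of coproducts is a pullback if the summands of its source are the pullbacks of the
summands of the other objects. -/
lemma isPullback_of_isCoprod₂ {I J K L : Type*} [Small.{v} I] [Small.{v} J] [Small.{v} K]
    {X' : I → V} {Y' : J → V} {Z' : K → V} {P' : L → V} {X Y Z P : V}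
    {x : ∀ i, X' i ⟶ X} {y : ∀ j, Y' j ⟶ Y} {z : ∀ k, Z' k ⟶ Z} {p : ∀ l, P' l ⟶ P}
    (hx : IsCoprod x) (hy : IsCoprod y) (hz : IsCoprod z) (hp : IsCoprod p)
    (α : L → I) (β : L → J) (φ : I → K) (ψ : J → K)
    (hinj : ∀ l l', α l = α l' → β l = β l' → l = l')
    (hsurj : ∀ i j, φ i = ψ j → ∃ l, α l = i ∧ β l = j)
    {fst : P ⟶ X} {snd : P ⟶ Y} {f : X ⟶ Z} {g : Y ⟶ Z} (sq : fst ≫ f = snd ≫ g)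
    {f' : ∀ i, X' i ⟶ Z' (φ i)} (hf : ∀ i, x i ≫ f = f' i ≫ z (φ i))
    {g' : ∀ j, Y' j ⟶ Z' (ψ j)} (hg : ∀ j, y j ≫ g = g' j ≫ z (ψ j))
    {s : ∀ l, P' l ⟶ X' (α l)} (hs : ∀ l, p l ≫ fst = s l ≫ x (α l))
    {t : ∀ l, P' l ⟶ Y' (β l)} (ht : ∀ l, p l ≫ snd = t l ≫ y (β l))
    (hpb : ∀ l, IsPullback (s l) (t l) (x (α l) ≫ f) (y (β l) ≫ g)) :
    IsPullback fst snd f g := by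
  let q₁ : ∀ i, pullback (x i ≫ f) g ⟶ pullback f g := fun i =>
    pullback.lift (pullback.fst _ _ ≫ x i) (pullback.snd _ _)
      (by rw [Category.assoc, pullback.condition])
  have h₁ : IsCoprod q₁ := (hx.iff_isPullback (f := fun i => pullback.fst (x i ≫ f) g)
    (g := pullback.fst f g) fun i => pullback.lift_fst _ _ _).2 fun i =>
      IsPullback.of_right (h₁₂ := pullback.snd f g) (h₂₂ := f) (v₁₃ := g)
        (by simpa only [q₁, pullback.lift_snd] using (IsPullback.of_hasPullback (x i ≫ f) g).flip)
        (pullback.lift_fst _ _ _) (IsPullback.of_hasPullback f g).flip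
  -- Each piece is decomposed again, now over the summands of `Y`.
  let q₂ : ∀ i j, pullback (x i ≫ f) (y j ≫ g) ⟶ pullback (x i ≫ f) g := fun i j =>
    pullback.lift (pullback.fst _ _) (pullback.snd _ _ ≫ y j)
      (by rw [pullback.condition, Category.assoc])
  have h₂ : ∀ i, IsCoprod (q₂ i) := fun i =>
    (hy.iff_isPullback (f := fun j => pullback.snd (x i ≫ f) (y j ≫ g))
      (g := pullback.snd (x i ≫ f) g) fun j => pullback.lift_snd _ _ _).2 fun j =>
      IsPullback.of_right (h₁₂ := pullback.fst (x i ≫ f) g) (h₂₂ := g) (v₁₃ := x i ≫ f)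
        (by simpa only [q₂, pullback.lift_fst] using IsPullback.of_hasPullback (x i ≫ f) (y j ≫ g))
        (pullback.lift_snd _ _ _) (IsPullback.of_hasPullback _ g)
  -- If `φ i ≠ ψ j`, the piece at `(i, j)` maps into two different summands of `Z` and is initial by
  -- disjointness. The remaining pairs are exactly those indexed by `L`.
  have h₃ := (h₁.sigma h₂).of_injective (fun l : L => ⟨α l, β l⟩)
    (fun l l' h => hinj l l' (congrArg Sigma.fst h) (eq_of_heq (Sigma.mk.inj h).2)) <| by
      rintro ⟨i, j⟩ hij
      have hne : φ i ≠ ψ j := fun h => by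
        obtain ⟨l, rfl, rfl⟩ := hsurj i j h
        exact hij l rfl
      refine (hz.disjoint (ψ j)).2 (φ i) hne _ (pullback.snd (x i ≫ f) (y j ≫ g) ≫ g' j)
        (pullback.fst (x i ≫ f) (y j ≫ g) ≫ f' i) ?_
      rw [Category.assoc, Category.assoc, ← hf, ← hg, pullback.condition]
  have : ∀ l, IsIso (hpb l).isoPullback.hom := fun l => inferInstance
  have h₄ : IsIso (pullback.lift fst snd sq) := hp.isIso_of h₃ id Function.bijective_id
    (fun l => (hpb l).isoPullback.hom) _ fun l => by
      apply pullback.hom_ext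
      · simp only [id, q₁, q₂, Category.assoc, pullback.lift_fst, pullback.lift_fst_assoc,
          IsPullback.isoPullback_hom_fst_assoc, hs]
      · simp only [id, q₁, q₂, Category.assoc, pullback.lift_snd,
          IsPullback.isoPullback_hom_snd_assoc, ht]
  exact IsPullback.of_iso (IsPullback.of_hasPullback f g) (asIso (pullback.lift fst snd sq)).symm
    (Iso.refl _) (Iso.refl _) (Iso.refl _) (by simp [pullback.lift_fst])
    (by simp [pullback.lift_snd]) (by simp) (by simp)

end Coproducts

/-- Cancellation for cartesian transformations. -/
lemma equifibered_of_comp {C : Type u} [Category.{v} C] {D : Type u₁} [Category.{v₁} D]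
    {F G H : C ⥤ D} {φ : F ⟶ G} {ψ : G ⟶ H} (h₁ : NatTrans.Equifibered (φ ≫ ψ))
    (h₂ : NatTrans.Equifibered ψ) : NatTrans.Equifibered φ := fun _ _ f =>
  IsPullback.of_bot (h₁ f) (φ.naturality f) (h₂ f)

/-! ### Pullbacks of graphs -/

section GraphPullbacks

variable {V : Type u} [Category.{v} V]

namespace Graph

/-- The homs in which `f.map` and `g.map` take values depend on the object maps, so an equality of
graph maps can be read on homs only through a transport. The transport is left arbitrary in the
statement, so that it matches any proof that occurs. -/
lemma map_eq_of_eq {X Y : Graph V} {f g : X ⟶ Y} (h : f = g) (a b : X.obj)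
    (e : Y.hom (g.obj a) (g.obj b) = Y.hom (f.obj a) (f.obj b)) :
    f.map a b = g.map a b ≫ eqToHom e := by
  subst h; simp

lemma hom_ext {X Y : Graph V} {f g : X ⟶ Y} (h : f.obj = g.obj)
    (h' : ∀ a b, f.map a b = g.map a b ≫
      eqToHom (by rw [h] : Y.hom (g.obj a) (g.obj b) = Y.hom (f.obj a) (f.obj b))) : f = g := by
  obtain ⟨fo, fm⟩ := f
  obtain ⟨go, gm⟩ := g
  obtain rfl : fo = go := h
  exact mk_ext fo fun a b => by simpa using h' a b

/-- A square of graphs is a pullback when it is so on objects and on homs. -/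
lemma isPullback_of {P X Y Z : Graph V} {p : P ⟶ X} {q : P ⟶ Y} {f : X ⟶ Z} {g : Y ⟶ Z}
    (w : p ≫ f = q ≫ g)
    (ho : ∀ x y, f.obj x = g.obj y → ∃! t, p.obj t = x ∧ q.obj t = y)
    (hm : ∀ t t' (e : Z.hom (g.obj (q.obj t)) (g.obj (q.obj t')) =
      Z.hom (f.obj (p.obj t)) (f.obj (p.obj t'))),
      IsPullback (p.map t t') (q.map t t') (f.map _ _) (g.map _ _ ≫ eqToHom e)) :
    IsPullback p q f g := by
  refine isPullback_of_existsUnique w ?_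
  rintro W ⟨ro, rm⟩ ⟨so, sm⟩ w'
  have hc : ∀ a, f.obj (ro a) = g.obj (so a) := congrFun (congrArg Graph.Hom.obj w')
  choose lo hlo hlo' using fun a => ho _ _ (hc a)
  -- Once the object maps of the cone are replaced by composites with `lo`, the homs in `X` and `Y`
  -- have matching types and only those of `Z` need a transport.
  obtain rfl : (fun a => p.obj (lo a)) = ro := funext fun a => (hlo a).1
  obtain rfl : (fun a => q.obj (lo a)) = so := funext fun a => (hlo a).2
  have e : ∀ a b, Z.hom (g.obj (q.obj (lo a))) (g.obj (q.obj (lo b))) =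
      Z.hom (f.obj (p.obj (lo a))) (f.obj (p.obj (lo b))) := fun a b => by rw [hc, hc]
  have wm : ∀ a b, rm a b ≫ f.map _ _ = sm a b ≫ g.map _ _ ≫ eqToHom (e a b) := fun a b =>
    (map_eq_of_eq w' a b (e a b)).trans (Category.assoc _ _ _)
  refine ⟨⟨lo, fun a b => (hm (lo a) (lo b) (e a b)).lift _ _ (wm a b)⟩, ⟨?_, ?_⟩, ?_⟩
  · exact mk_ext (X := W) (Y := X) (fun a => p.obj (lo a))
      fun a b => (hm (lo a) (lo b) (e a b)).lift_fst _ _ _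
  · exact mk_ext (X := W) (Y := Y) (fun a => q.obj (lo a))
      fun a b => (hm (lo a) (lo b) (e a b)).lift_snd _ _ _
  · rintro ⟨mo, mm⟩ ⟨e₁, e₂⟩
    obtain rfl : mo = lo := funext fun a => hlo' a (mo a)
      ⟨congrFun (congrArg Graph.Hom.obj e₁) a, congrFun (congrArg Graph.Hom.obj e₂) a⟩
    refine mk_ext (X := W) (Y := P) mo fun a b => (hm (mo a) (mo b) (e a b)).hom_ext ?_ ?_
    · exact (congrFun (congrFun (eq_of_heq (Graph.Hom.mk.inj e₁).2) a) b).trans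
        ((hm (mo a) (mo b) (e a b)).lift_fst _ _ _).symm
    · exact (congrFun (congrFun (eq_of_heq (Graph.Hom.mk.inj e₂).2) a) b).trans
        ((hm (mo a) (mo b) (e a b)).lift_snd _ _ _).symm

section

variable [HasPullbacks V] {X Y Z : Graph V} (f : X ⟶ Z) (g : Y ⟶ Z)

/-- The pullback of graphs. -/
noncomputable def pb : Graph V where
  obj := {t : X.obj × Y.obj // f.obj t.1 = g.obj t.2}
  hom t t' := pullback (f.map t.1.1 t'.1.1) (g.map t.1.2 t'.1.2 ≫
    eqToHom (by rw [t.2, t'.2] : Z.hom _ _ = Z.hom (f.obj t.1.1) (f.obj t'.1.1)))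

noncomputable def pbFst : pb f g ⟶ X := ⟨fun t => t.1.1, fun _ _ => pullback.fst _ _⟩

noncomputable def pbSnd : pb f g ⟶ Y := ⟨fun t => t.1.2, fun _ _ => pullback.snd _ _⟩

lemma pb_w : pbFst f g ≫ f = pbSnd f g ≫ g :=
  hom_ext (funext fun t => t.2) fun a b => by
    refine (pullback.condition (f := f.map a.1.1 b.1.1)).trans ?_
    exact (Category.assoc _ _ _).symm

lemma pb_obj (x : X.obj) (y : Y.obj) (h : f.obj x = g.obj y) :
    ∃! t, (pbFst f g).obj t = x ∧ (pbSnd f g).obj t = y :=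
  ⟨⟨(x, y), h⟩, ⟨rfl, rfl⟩, fun t ht => Subtype.ext (Prod.ext ht.1 ht.2)⟩

lemma pb_map (t t' : (pb f g).obj) (e : Z.hom (g.obj ((pbSnd f g).obj t)) (g.obj ((pbSnd f g).obj t')) =
      Z.hom (f.obj ((pbFst f g).obj t)) (f.obj ((pbFst f g).obj t'))) :
    IsPullback ((pbFst f g).map t t') ((pbSnd f g).map t t') (f.map _ _) (g.map _ _ ≫ eqToHom e) :=
  IsPullback.of_hasPullback _ _

lemma pb_isPullback : IsPullback (pbFst f g) (pbSnd f g) f g :=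
  isPullback_of (pb_w f g) (pb_obj f g) (pb_map f g)

end

section Arrow

variable [HasInitial V]

/-- The graph with two objects and one nontrivial hom. -/
noncomputable def arrow (W : V) : Graph V where
  obj := ULift Bool
  hom a b := match a, b with
    | ⟨false⟩, ⟨true⟩ => W
    | ⟨false⟩, ⟨false⟩ => ⊥_ V
    | ⟨true⟩, ⟨false⟩ => ⊥_ V
    | ⟨true⟩, ⟨true⟩ => ⊥_ V

/-- Since the other homs of `arrow W` are initial, a graph map out of it amounts to two vertices of
`X` and one map `W ⟶ X.hom a b`. Universal properties of graphs can therefore be tested on a single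
hom. -/
noncomputable def arrowHom {W : V} {X : Graph V} {a b : X.obj} (h : W ⟶ X.hom a b) :
    arrow W ⟶ X where
  obj t := match t with
    | ⟨false⟩ => a
    | ⟨true⟩ => b
  map a b := match a, b with
    | ⟨false⟩, ⟨true⟩ => h
    | ⟨false⟩, ⟨false⟩ => initial.to _
    | ⟨true⟩, ⟨false⟩ => initial.to _
    | ⟨true⟩, ⟨true⟩ => initial.to _

lemma arrowHom_comp {W : V} {X Y : Graph V} {a b : X.obj} (h : W ⟶ X.hom a b) (f : X ⟶ Y) :
    arrowHom h ≫ f = arrowHom (h ≫ f.map a b) := by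
  refine hom_ext (funext fun t => ?_) ?_
  · rcases t with ⟨_ | _⟩ <;> rfl
  · rintro ⟨_ | _⟩ ⟨_ | _⟩
    · exact initialIsInitial.hom_ext _ _
    · exact (Category.comp_id _).symm
    · exact initialIsInitial.hom_ext _ _
    · exact initialIsInitial.hom_ext _ _

lemma arrowHom_inj {W : V} {X : Graph V} {a b : X.obj} {h h' : W ⟶ X.hom a b}
    (e : arrowHom h = arrowHom h') : h = h' := by
  have := map_eq_of_eq e ⟨false⟩ ⟨true⟩ rfl
  exact this.trans (Category.comp_id _)

end Arrow

end Graph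

namespace GFun

/-- The naturality squares of a cartesian transformation are pullbacks on homs. -/
lemma IsCartesian.isPullback [HasInitial V] {S T : GFun V} {φ : S ⟶ T} (h : IsCartesian φ)
    {X Y : Graph V} (f : X ⟶ Y) (a b : X.obj) :
    IsPullback (S.map f a b) (φ.app X a b) (φ.app Y (f.obj a) (f.obj b)) (T.map f a b) := by
  refine isPullback_of_existsUnique (φ.naturality f a b) fun W p q e => ?_
  have sq := h f
  -- The pullback square of graphs is tested on `arrow W`, with all endpoints prescribed.
  let P : Graph.arrow W ⟶ S.toFunctor.obj Y := Graph.arrowHom (a := f.obj a) (b := f.obj b) p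
  let Q : Graph.arrow W ⟶ T.toFunctor.obj X := Graph.arrowHom (a := a) (b := b) q
  have w : P ≫ component φ Y = Q ≫ T.toFunctor.map f :=
    (Graph.arrowHom_comp (X := S.toFunctor.obj Y) p (component φ Y)).trans
      ((congrArg (Graph.arrowHom (X := T.toFunctor.obj Y)) e).trans
        (Graph.arrowHom_comp (X := T.toFunctor.obj X) q (T.toFunctor.map f)).symm)
  -- The component of `φ` is the identity on objects, so the lift has the object map of `Q`; on the
  -- only hom of `arrow W` that is not initial it is the required map `L`.
  have hl : ∃ L : W ⟶ S.hom X a b, sq.lift P Q w = Graph.arrowHom (X := S.toFunctor.obj X) L := by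
    have e₂ : sq.lift P Q w ≫ component φ X = Q := sq.lift_snd _ _ _
    generalize sq.lift P Q w = l at e₂
    obtain ⟨lo, lm⟩ := l
    obtain rfl : lo = Q.obj := congrArg Graph.Hom.obj e₂
    refine ⟨lm ⟨false⟩ ⟨true⟩, Graph.mk_ext (Y := S.toFunctor.obj X) Q.obj ?_⟩
    rintro ⟨_ | _⟩ ⟨_ | _⟩
    · exact initialIsInitial.hom_ext _ _
    · rfl
    · exact initialIsInitial.hom_ext _ _
    · exact initialIsInitial.hom_ext _ _
  obtain ⟨L, hL⟩ := hl
  have key : ∀ L' : W ⟶ S.hom X a b, (L' ≫ S.map f a b = p ∧ L' ≫ φ.app X a b = q) ↔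
      Graph.arrowHom (X := S.toFunctor.obj X) L' = sq.lift P Q w := by
    intro L'
    have e₁ := Graph.arrowHom_comp (X := S.toFunctor.obj X) L' (S.toFunctor.map f)
    have e₂ := Graph.arrowHom_comp (X := S.toFunctor.obj X) L' (component φ X)
    constructor
    · rintro ⟨rfl, rfl⟩
      refine sq.hom_ext ?_ ?_
      · rw [sq.lift_fst]; exact e₁
      · rw [sq.lift_snd]; exact e₂
    · intro h'
      constructor
      · refine Graph.arrowHom_inj (X := S.toFunctor.obj Y) (e₁.symm.trans ?_)
        rw [h']; exact sq.lift_fst _ _ _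
      · refine Graph.arrowHom_inj (X := T.toFunctor.obj X) (e₂.symm.trans ?_)
        rw [h']; exact sq.lift_snd _ _ _
  refine ⟨L, (key L).2 hL.symm, fun L' hL' => ?_⟩
  exact Graph.arrowHom_inj (X := S.toFunctor.obj X) (((key L').1 hL').trans hL)

/-- A transformation over `Set` is invertible when its components are. -/
lemma isIso_of {S T : GFun V} (φ : S ⟶ T) (h : ∀ X a b, IsIso (φ.app X a b)) : IsIso φ :=
  ⟨⟨fun X a b => inv (φ.app X a b), fun {X Y} f a b => by
      rw [IsIso.comp_inv_eq, Category.assoc, IsIso.eq_inv_comp, φ.naturality]⟩,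
    hom_ext fun X a b => IsIso.hom_inv_id (φ.app X a b),
    hom_ext fun X a b => IsIso.inv_hom_id (φ.app X a b)⟩

lemma isIso_app {S T : GFun V} (φ : S ⟶ T) [IsIso φ] (X : Graph V) (a b : X.obj) :
    IsIso (φ.app X a b) :=
  ⟨(inv φ).app X a b, congrArg (fun ψ => Hom.app ψ X a b) (IsIso.hom_inv_id φ),
    congrArg (fun ψ => Hom.app ψ X a b) (IsIso.inv_hom_id φ)⟩

lemma IsCartesian.of_isIso {S T : GFun V} (φ : S ⟶ T) [IsIso φ] : IsCartesian φ :=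
  isCartesian_of φ fun {X Y} f a b =>
    haveI := isIso_app φ X a b
    haveI := isIso_app φ Y (f.obj a) (f.obj b)
    IsPullback.of_vert_isIso ⟨φ.naturality f a b⟩

end GFun

end GraphPullbacks

/-! ### The comparison maps are invertible -/

namespace Path

section

variable {O : Type v}

/-- The sequence of vertices of a path, without its source. -/
def verts : {a b : O} → Path a b → List O
  | _, _, nil _ => []
  | _, _, cons _ (b := b) p => b :: verts p

lemma verts_map {O' : Type v} (f : O → O') : {a b : O} → (p : Path a b) →
    (p.map f).verts = p.verts.map f
  | _, _, nil _ => rfl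
  | _, _, cons _ p => congrArg (f _ :: ·) (verts_map f p)

/-- The endpoints are part of the type of a path, so paths whose endpoints agree only
propositionally cannot be compared directly. Their lists of vertices can, and these determine the
path between fixed endpoints. -/
lemma verts_inj : {a b : O} → {p q : Path a b} → p.verts = q.verts → p = q
  | _, _, nil _, nil _, _ => rfl
  | _, _, nil _, cons _ _, h => nomatch h
  | _, _, cons _ _, nil _, h => nomatch h
  | _, _, cons _ p, cons _ q, h => by
    obtain ⟨h₁, h₂⟩ := List.cons.inj h
    subst h₁
    rw [verts_inj h₂]

def cast {a b a' b' : O} (h : a = a') (h' : b = b') (p : Path a b) : Path a' b' := h ▸ h' ▸ p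

lemma verts_cast {a b a' b' : O} (h : a = a') (h' : b = b') (p : Path a b) :
    (p.cast h h').verts = p.verts := by
  subst h h'; rfl

/-- The number of steps of the first factor fixes the vertex at which a path is cut and hence both
factors. That number is measured by the length of `q.seq G`. -/
lemma append_inj {D : Type*} (G : O → O → D) : {a c c' b : O} → (q : Path a c) → (q' : Path a c') →
    (r : Path c b) → (r' : Path c' b) → q.append r = q'.append r' →
    (q.seq G).length = (q'.seq G).length →
    (⟨c, q, r⟩ : Σ c, Path a c × Path c b) = ⟨c', q', r'⟩
  | _, _, _, _, nil _, nil _, _, _, h, _ => by cases h; rfl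
  | _, _, _, _, nil _, cons _ _, _, _, _, h => nomatch h
  | _, _, _, _, cons _ _, nil _, _, _, _, h => nomatch h
  | _, _, _, _, cons a q, cons _ q', r, r', h, h' => by
    obtain ⟨h₁, h₂⟩ := Path.cons.inj h
    subst h₁
    cases append_inj G q q' r r' (eq_of_heq h₂) (Nat.succ.inj h')
    rfl

/-- The lengths of the blocks tell where the concatenated path was cut. This is the injectivity half
of the matching between summands of `ΓA ∘ ΓB` and of `Γ(A ∘ B)`. -/
lemma join_inj {D : Type*} (G : O → O → D) : {a b : O} → (p p' : Path a b) → (k : p.Lift Path) →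
    (k' : p'.Lift Path) → p.join k = p'.join k' → p.segs G k = p'.segs G k' →
    (⟨p, k⟩ : Σ p : Path a b, p.Lift Path) = ⟨p', k'⟩
  | _, _, nil _, nil _, _, _, _, _ => rfl
  | _, _, nil _, cons _ _, _, _, _, h => nomatch h
  | _, _, cons _ _, nil _, _, _, _, h => nomatch h
  | _, _, cons _ p, cons _ p', k, k', h, h' => by
    obtain ⟨q, k⟩ := k
    obtain ⟨q', k'⟩ := k'
    obtain ⟨h₁, h₂⟩ := List.cons.inj h'
    have e := append_inj G q q' (p.join k) (p'.join k') h (congrArg List.length h₁)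
    obtain ⟨h₃, h₄⟩ := Sigma.mk.inj e
    subst h₃
    obtain ⟨h₅, h₆⟩ := Prod.mk.inj (eq_of_heq h₄)
    subst h₅
    cases join_inj G p p' k k' h₆ h₂
    rfl

lemma exists_append {D : Type*} (G : O → O → D) (y y' : List D) {a b : O} (q : Path a b)
    (h : q.seq G = y ++ y') : ∃ (c : O) (r : Path a c) (r' : Path c b),
      r.append r' = q ∧ r.seq G = y ∧ r'.seq G = y' := by
  induction y generalizing a b with
  | nil => exact ⟨a, nil a, q, rfl, rfl, h⟩
  | cons x y ih =>
    cases q with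
    | nil => cases h
    | cons _ q =>
      obtain ⟨h₁, h₂⟩ := List.cons.inj h
      obtain ⟨c, r, r', rfl, rfl, rfl⟩ := ih q h₂
      subst h₁
      exact ⟨c, cons _ r, r', rfl, rfl, rfl⟩

/-- A cutting of the sequence of homs into blocks cuts the path at the corresponding vertices, an
empty block giving a path of length zero. This is the surjectivity half of the same matching. -/
lemma exists_join {D : Type*} (G : O → O → D) (Y : List (List D)) {a b : O} (q : Path a b)
    (h : q.seq G = Y.flatten) : ∃ (p : Path a b) (k : p.Lift Path),
      p.join k = q ∧ p.segs G k = Y := by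
  induction Y generalizing a b with
  | nil =>
    cases q with
    | nil => exact ⟨nil a, ⟨⟩, rfl, rfl⟩
    | cons _ q => cases h
  | cons y Y ih =>
    obtain ⟨c, r, r', rfl, rfl, h'⟩ := exists_append G y Y.flatten q h
    obtain ⟨p, k, rfl, rfl⟩ := ih r' h'
    exact ⟨cons a p, ⟨r, k⟩, rfl, rfl⟩

end

end Path

section Comparison

variable {V : Type u} [Category.{v} V] [Lextensive V]

/-- A summand here is a path with a cutting of its sequence of homs into blocks, and by `join_inj`
and `exists_join` this is the same as a path of paths. Distributivity plays no role on this side; it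
enters only for `ΓA ∘ ΓB`. -/
lemma gι₂'_isCoprod (A B : List V ⥤ V) (X : Graph V) (a b : X.obj) :
    IsCoprod fun i : (Σ p : Path a b, p.Lift Path) => gι₂' A B X i.1 i.2 := by
  have h := (gι_isCoprod (comp A B) X a b).sigma fun q =>
    lan_isCoprod flat (mapSeq B ⋙ A) (q.seq X.hom)
  refine h.reindex (fun i => ⟨i.1.join i.2, ⟨i.1.segs X.hom i.2, i.1.flat_liftSeq X.hom i.2⟩⟩)
    ⟨?_, ?_⟩ (fun _ => 𝟙 _) fun i => (Category.id_comp _).symm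
  · rintro ⟨p, k⟩ ⟨p', k'⟩ e
    refine Path.join_inj X.hom p p' k k' (congrArg Sigma.fst e) ?_
    exact congrArg (fun x : Σ q : Path a b, {Y // flat.obj Y = q.seq X.hom} => x.2.1) e
  · rintro ⟨q, Y, hY⟩
    obtain ⟨p, k, rfl, rfl⟩ := Path.exists_join X.hom Y q hY.symm
    exact ⟨⟨p, k⟩, rfl⟩

/-- The comparison carries one coproduct cocone over paths of paths to another with the same
summands. -/
instance gammaComp_isIso {A : List V ⥤ V} (hA : Distributive A) (B : List V ⥤ V) :
    IsIso (gammaComp hA B) :=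
  GFun.isIso_of _ fun X a b => (gι₂_isCoprod hA B X a b).isIso_of (gι₂'_isCoprod A B X a b) _root_.id
    Function.bijective_id (fun _ => 𝟙 _) _ fun i =>
      (gι₂_gammaComp hA B X i.1 i.2).trans (Category.id_comp _).symm

/-- The Kan extension `unit` has a summand only at a sequence of length one, so the double coproduct
has a single index: the path with one step from `a` to `b`. -/
instance gammaUnit_isIso : IsIso (gammaUnit (V := V)) :=
  GFun.isIso_of _ fun X a b => IsCoprod.isIso_of_unit <| by
    have h := (gι_isCoprod unit X a b).sigma fun q => lan_isCoprod single (𝟭 V) (q.seq X.hom)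
    refine @IsCoprod.reindex _ _ _ _ _ _ _ _ _ h
      (fun _ => ⟨Path.cons a (Path.nil b), ⟨X.hom a b, rfl⟩⟩) ⟨?_, ?_⟩
      (fun _ => 𝟙 (X.hom a b)) (fun _ => IsIso.id (X.hom a b)) fun i => (Category.id_comp _).symm
    · intro _ _ _; rfl
    · rintro ⟨q, x, hx⟩
      refine ⟨⟨⟩, ?_⟩
      cases q with
      | nil => cases hx
      | cons _ q =>
        cases q with
        | nil => cases hx; rfl
        | cons _ q => cases hx

end Comparison

/-! ### The functors `Γ A` preserve pullbacks -/

section GammaPullbacks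

namespace Path

section

variable {O : Type v} {OX OY OP : Type v} {f : OX → O} {g : OY → O}

/-- Vertices with equal images pair up to vertices of the pullback. The hypothesis compares vertices
because the images of `i` and `j` are paths between endpoints that are equal only through `h` and
`h'`. -/
lemma exists_pb : {x x' : OX} → {y y' : OY} → (i : Path x x') → (j : Path y y') →
    (h : f x = g y) → (h' : f x' = g y') → i.verts.map f = j.verts.map g →
    ∃ l : Path (⟨(x, y), h⟩ : {t : OX × OY // f t.1 = g t.2}) ⟨(x', y'), h'⟩,
      l.map (fun t => t.1.1) = i ∧ l.map (fun t => t.1.2) = j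
  | _, _, _, _, nil _, nil _, _, _, _ => ⟨nil _, rfl, rfl⟩
  | _, _, _, _, nil _, cons _ _, _, _, e => nomatch e
  | _, _, _, _, cons _ _, nil _, _, _, e => nomatch e
  | _, _, _, _, cons _ i, cons _ j, h, h', e => by
    obtain ⟨h₁, h₂⟩ := List.cons.inj e
    obtain ⟨l, rfl, rfl⟩ := exists_pb i j h₁ h' h₂
    exact ⟨cons _ l, rfl, rfl⟩

lemma map_inj₂ {p : OP → OX} {q : OP → OY} (h : ∀ t t', p t = p t' → q t = q t' → t = t')
    {a b : OP} {l l' : Path a b} (h₁ : l.map p = l'.map p) (h₂ : l.map q = l'.map q) : l = l' := by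
  refine verts_inj ?_
  have e₁ := congrArg verts h₁
  have e₂ := congrArg verts h₂
  rw [verts_map, verts_map] at e₁ e₂
  generalize l.verts = m at e₁ e₂
  generalize l'.verts = m' at e₁ e₂
  induction m generalizing m' with
  | nil => exact (List.map_eq_nil_iff.1 e₁.symm).symm
  | cons t m ih =>
    cases m' with
    | nil => cases e₁
    | cons t' m' =>
      obtain ⟨h₁, h₂⟩ := List.cons.inj e₁
      obtain ⟨h₃, h₄⟩ := List.cons.inj e₂
      rw [h _ _ h₁ h₃, ih _ h₂ h₄]

end

variable {V : Type u} [Category.{v} V]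

/-- Pullbacks of sequences are formed entry by entry, so the pullbacks on the homs along the steps
of `l` assemble to one. The transport `e` is needed since the two images of `l` in `Z` have the same
vertices only propositionally. -/
lemma seqHom_isPullback {P X Y Z : Graph V} {p : P ⟶ X} {q : P ⟶ Y} {f : X ⟶ Z} {g : Y ⟶ Z}
    (ho : ∀ t, f.obj (p.obj t) = g.obj (q.obj t))
    (hm : ∀ t t' (e : Z.hom (g.obj (q.obj t)) (g.obj (q.obj t')) =
      Z.hom (f.obj (p.obj t)) (f.obj (p.obj t'))),
      IsPullback (p.map t t') (q.map t t') (f.map _ _) (g.map _ _ ≫ eqToHom e)) :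
    {a b : P.obj} → (l : Path a b) → (e : ((l.map q.obj).map g.obj).seq Z.hom =
      ((l.map p.obj).map f.obj).seq Z.hom) →
    IsPullback (l.seqHom p.obj p.map) (l.seqHom q.obj q.map) ((l.map p.obj).seqHom f.obj f.map)
      ((l.map q.obj).seqHom g.obj g.map ≫ eqToHom e)
  | _, _, nil _, e => IsPullback.of_vert_isIso (f := 𝟙 []) (snd := 𝟙 ([] : List V))
      ⟨(nilHom_eq _).trans (nilHom_eq _).symm⟩
  | a, _, cons (b := b) _ l, e => by
    have e₁ : Z.hom (g.obj (q.obj a)) (g.obj (q.obj b)) =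
      Z.hom (f.obj (p.obj a)) (f.obj (p.obj b)) := by rw [ho, ho]
    have e₂ := (List.cons.inj e).2
    have := consHom_isPullback (hm a b e₁) (seqHom_isPullback ho hm l e₂)
    rw [← consHom_comp, ← eqToHom_cons e₁ e₂ e] at this
    exact this

end Path

variable {V : Type u} [Category.{v} V]

/-- Used with `m` the inclusion of a summand of a hom of `ΓA Z`, which is monic by disjointness: a
pullback over the summand is then one over the whole hom. -/
lemma isPullback_comp_mono {P X Y Z Z' : V} {p : P ⟶ X} {q : P ⟶ Y} {f : X ⟶ Z} {g : Y ⟶ Z}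
    (sq : IsPullback p q f g) (m : Z ⟶ Z') [Mono m] : IsPullback p q (f ≫ m) (g ≫ m) :=
  isPullback_of_existsUnique (by rw [← Category.assoc, sq.w, Category.assoc]) fun W r s e => by
    have e' : r ≫ f = s ≫ g := by
      rw [← cancel_mono m, Category.assoc, Category.assoc, e]
    exact ⟨sq.lift r s e', ⟨sq.lift_fst _ _ _, sq.lift_snd _ _ _⟩, fun l hl =>
      sq.hom_ext (hl.1.trans (sq.lift_fst _ _ _).symm) (hl.2.trans (sq.lift_snd _ _ _).symm)⟩

variable [Lextensive V]

instance gι_mono (A : List V ⥤ V) (X : Graph V) {a b : X.obj} (p : Path a b) : Mono (gι A X p) :=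
  ((gι_isCoprod A X a b).disjoint p).1

lemma gι_cast (A : List V ⥤ V) (Z : Graph V) {c c' d d' : Z.obj} (h : c = d) (h' : c' = d')
    (r : Path c c') (r' : Path d d') (w : r.verts = r'.verts)
    (e : (gamma A).hom Z c c' = (gamma A).hom Z d d') (e' : r.seq Z.hom = r'.seq Z.hom) :
    gι A Z r ≫ eqToHom e = A.map (eqToHom e') ≫ gι A Z r' := by
  subst h h'
  cases Path.verts_inj w
  simp

lemma Path.seq_eq_of_verts (Z : Graph V) {c c' d d' : Z.obj} (h : c = d) (h' : c' = d')
    {r : Path c c'} {r' : Path d d'} (w : r.verts = r'.verts) : r.seq Z.hom = r'.seq Z.hom := by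
  subst h h'
  cases Path.verts_inj w
  rfl

/-- Paths in the pullback of graphs are pairs of paths with the same image in `Z`. At such a pair
the summand is a pullback because `A` preserves pullbacks of sequences, and
`isPullback_of_isCoprod₂` assembles the summands, discarding the pairs with different images. -/
lemma gamma_pullbacks {A : List V ⥤ V} (hA : PreservesLimitsOfShape WalkingCospan A) :
    PreservesLimitsOfShape WalkingCospan (gamma A).toFunctor := by
  -- It is enough to exhibit one preserved pullback for every cospan; the explicit one is taken.
  refine preservesLimitsOfShape_walkingCospan_of_forall_isPullback fun X Y Z f g _ =>
    ⟨Graph.pb f g, Graph.pbFst f g, Graph.pbSnd f g, Graph.pb_isPullback f g, ?_⟩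
  let p := Graph.pbFst f g
  let q := Graph.pbSnd f g
  have w : (gamma A).toFunctor.map p ≫ (gamma A).toFunctor.map f =
      (gamma A).toFunctor.map q ≫ (gamma A).toFunctor.map g := by
    rw [← Functor.map_comp, ← Functor.map_comp, Graph.pb_w f g]
  refine Graph.isPullback_of w (Graph.pb_obj f g) fun t t' e => ?_
  have ho : ∀ t, f.obj (p.obj t) = g.obj (q.obj t) := fun t => t.2
  have hv : ∀ {c c' : (Graph.pb f g).obj} (l : Path c c'),
      ((l.map q.obj).map g.obj).verts = ((l.map p.obj).map f.obj).verts := by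
    intro c c' l
    rw [Path.verts_map, Path.verts_map, Path.verts_map, Path.verts_map, List.map_map, List.map_map]
    exact congrArg (l.verts.map ·) (funext fun t => (ho t).symm)
  -- Images under `g` are transported to the endpoints written in terms of `f`, so that the paths
  -- from `X` and from `Y` map to the same index set of summands of `Z`.
  let ψ : Path (q.obj t) (q.obj t') → Path (f.obj (p.obj t)) (f.obj (p.obj t')) := fun j =>
    (j.map g.obj).cast (ho t).symm (ho t').symm
  have hψ : ∀ j, (j.map g.obj).verts = (ψ j).verts := fun j => (Path.verts_cast _ _ _).symm
  have hs : ∀ j, (j.map g.obj).seq Z.hom = (ψ j).seq Z.hom := fun j =>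
    Path.seq_eq_of_verts Z (ho t).symm (ho t').symm (hψ j)
  have hg : ∀ j, gι A Y j ≫ (gamma A).map g (q.obj t) (q.obj t') ≫ eqToHom e =
      (A.map (j.seqHom g.obj g.map) ≫ A.map (eqToHom (hs j))) ≫ gι A Z (ψ j) := fun j => by
    rw [gι_map_assoc, gι_cast A Z (ho t).symm (ho t').symm _ (ψ j) (hψ j) e (hs j), Category.assoc]
  refine isPullback_of_isCoprod₂ (gι_isCoprod A X (p.obj t) (p.obj t'))
    (gι_isCoprod A Y (q.obj t) (q.obj t')) (gι_isCoprod A Z (f.obj (p.obj t)) (f.obj (p.obj t')))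
    (gι_isCoprod A (Graph.pb f g) t t') (fun l => l.map p.obj) (fun l => l.map q.obj)
    (fun i => i.map f.obj) ψ ?_ ?_ ?_ (gι_map A f) hg (gι_map A p) (gι_map A q) ?_
  · exact fun l l' h₁ h₂ => Path.map_inj₂ (fun t t' h h' => Subtype.ext (Prod.ext h h')) h₁ h₂
  · intro i j h
    refine Path.exists_pb i j t.2 t'.2 ?_
    rw [← Path.verts_map, ← Path.verts_map, hψ, ← h]
  · exact (Graph.map_eq_of_eq w t t' e).trans (Category.assoc _ _ _)
  · intro l
    have e' : ((l.map q.obj).map g.obj).seq Z.hom = ((l.map p.obj).map f.obj).seq Z.hom :=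
      Path.seq_eq_of_verts Z (ho t).symm (ho t').symm (hv l)
    have h := isPullback_comp_mono ((Path.seqHom_isPullback ho (Graph.pb_map f g) l e').map A)
      (gι A Z ((l.map p.obj).map f.obj))
    have e₁ := gι_map A f (l.map p.obj)
    have e₂ : gι A Y (l.map q.obj) ≫ (gamma A).map g (q.obj t) (q.obj t') ≫ eqToHom e =
        A.map ((l.map q.obj).seqHom g.obj g.map ≫ eqToHom e') ≫ gι A Z ((l.map p.obj).map f.obj) := by
      rw [gι_map_assoc, gι_cast A Z (ho t).symm (ho t').symm _ _ (hv l) e e', A.map_comp,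
        Category.assoc]
    rw [← e₁, ← e₂] at h
    exact h

end GammaPullbacks

/-! ### Cartesianness of the monad given by a multitensor -/

section GammaCartesian

variable {V : Type u} [Category.{v} V] [Lextensive V]

/-- The monad `Γ M` is cartesian. -/
instance gammaMonad_isCartesian (M : Multitensor V) [M.IsDistributive] [M.IsCartesian] :
    M.gammaMonad.IsCartesian where
  pullbacks := gamma_pullbacks Multitensor.IsCartesian.pullbacks
  -- The unit and the multiplication are each an invertible comparison map followed by `Γ` of a
  -- cartesian transformation, the latter being induced on the Kan extension by the cartesian unit
  -- or substitution of `M`.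
  unit := (GFun.IsCartesian.of_isIso gammaUnit).comp
    (gammaMap_isCartesian (lanDesc_equifibered Multitensor.IsCartesian.unit))
  mult := (GFun.IsCartesian.of_isIso (gammaComp _ _)).comp
    (gammaMap_isCartesian (lanDesc_equifibered Multitensor.IsCartesian.subst))

end GammaCartesian

/-! ### Collections as collections over `Set` -/

section Terminal

variable {V : Type u} [Category.{v} V] [Lextensive V]

variable (V) in
/-- The terminal graph. -/
noncomputable abbrev pt : Graph V := ⟨PUnit, fun _ _ => ⊤_ V⟩

noncomputable abbrev toPt (X : Graph V) : X ⟶ pt V := ⟨fun _ => ⟨⟩, fun _ _ => terminal.from _⟩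

/-- The path in the terminal graph of the length of a sequence. -/
def loop : List V → Path (O := (pt V).obj) ⟨⟩ ⟨⟩
  | [] => .nil _
  | _ :: l => .cons _ (loop l)

/-- A sequence need not be the sequence of homs of a path, but it always maps to the homs of the
closed path of its length in the terminal graph. In this way functors over `Set` can be evaluated on
sequences. -/
noncomputable def loopHom : (l : List V) → (l ⟶ (loop l).seq (pt V).hom)
  | [] => 𝟙 []
  | x :: l => consHom (terminal.from x) (loopHom l)

lemma loop_eq {l m : List V} (f : l ⟶ m) : loop l = loop m := by
  induction f using hom_induction with
  | nil => rfl
  | cons f g ih => exact congrArg (Path.cons _) ih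

/-- Entry by entry this is uniqueness of maps to a terminal object. It is heterogeneous because
`loop l` and `loop m` are equal by recursion on `f` and not by definition. -/
lemma loopHom_heq {l m : List V} (f : l ⟶ m) : HEq (f ≫ loopHom m) (loopHom l) := by
  induction f using hom_induction with
  | nil => rfl
  | @cons a b l m f g ih =>
    have e : (loop m).seq (pt V).hom = (loop l).seq (pt V).hom := by rw [loop_eq g]
    have h : terminal.from a = f ≫ terminal.from b := terminalIsTerminal.hom_ext _ _
    change HEq (consHom (f ≫ terminal.from b) (g ≫ loopHom m))
      (consHom (terminal.from a) (loopHom l))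
    rw [h]
    exact consHom_heq _ rfl e ih

lemma loop_path (X : Graph V) : {a b : X.obj} → (p : Path a b) →
    p.map (toPt X).obj = loop (p.seq X.hom)
  | _, _, .nil _ => rfl
  | _, _, .cons _ p => congrArg (Path.cons _) (loop_path X p)

lemma loopHom_path (X : Graph V) : {a b : X.obj} → (p : Path a b) →
    HEq (p.seqHom (toPt X).obj (toPt X).map) (loopHom (p.seq X.hom))
  | _, _, .nil _ => HEq.rfl
  | _, _, .cons _ p => consHom_heq _ rfl (congrArg (fun q => q.seq (pt V).hom) (loop_path X p))
      (loopHom_path X p)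

/-- The map from `A X₁ … Xₙ` to the hom of `Γ A` at the terminal graph. -/
noncomputable def toLoop (A : List V ⥤ V) (l : List V) : A.obj l ⟶ (gamma A).hom (pt V) ⟨⟩ ⟨⟩ :=
  A.map (loopHom l) ≫ gι A (pt V) (loop l)

lemma toLoop_naturality (A : List V ⥤ V) {l m : List V} (f : l ⟶ m) :
    A.map f ≫ toLoop A m = toLoop A l := by
  rw [toLoop, ← A.map_comp_assoc]
  exact map_gι A (pt V) (loop_eq f).symm (loopHom_heq f)

lemma toLoop_gammaMap {A B : List V ⥤ V} (φ : A ⟶ B) (l : List V) :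
    toLoop A l ≫ (gammaMap φ).app (pt V) ⟨⟩ ⟨⟩ = φ.app l ≫ toLoop B l := by
  rw [toLoop, toLoop, Category.assoc, gι_gammaMap, φ.naturality_assoc]

/-- Collapsing `X` to a point sends the summand at a path to the summand at the loop of the same
length, by a map that depends only on the sequence of homs. This is the reduction from paths in
graphs to sequences. -/
lemma gι_toPt (A : List V ⥤ V) (X : Graph V) {a b : X.obj} (p : Path a b) :
    gι A X p ≫ (gamma A).map (toPt X) a b = toLoop A (p.seq X.hom) :=
  (gι_map A (toPt X) p).trans (map_gι A (pt V) (loop_path X p) (loopHom_path X p))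

lemma gι_isPullback {A B : List V ⥤ V} (φ : A ⟶ B) (X : Graph V) {a b : X.obj} (p : Path a b) :
    IsPullback (gι A X p) (φ.app (p.seq X.hom)) ((gammaMap φ).app X a b) (gι B X p) :=
  ((gι_isCoprod B X a b).iff_isPullback fun q => gι_gammaMap φ X q).1 (gι_isCoprod A X a b) p

/-- Two pullbacks are pasted: the naturality square of `α` at `loopHom l`, and the square of the
summand at `loop l`, a pullback by extensivity. Thus `A.obj l` is determined by `Γα` at the terminal
graph together with `E`. -/
lemma toLoop_isPullback {A E : List V ⥤ V} {α : A ⟶ E} (hα : NatTrans.Equifibered α) (l : List V) :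
    IsPullback (toLoop A l) (α.app l) ((gammaMap α).app (pt V) ⟨⟩ ⟨⟩) (toLoop E l) :=
  (hα (loopHom l)).paste_horiz (gι_isPullback α (pt V) (loop l))

section Lift

variable {A B E : List V ⥤ V} (α : A ⟶ E) {β : B ⟶ E} (hβ : NatTrans.Equifibered β)

/-- By `toLoop_isPullback` a map into `B.obj l` is determined by its composites to `E.obj l`, which
agree by `w`, and to the hom of `ΓB` at the terminal graph, which depend only on the image under
`Γ`. -/
lemma gammaMap_injective {φ ψ : A ⟶ B} (hβ : NatTrans.Equifibered β) (w : φ ≫ β = ψ ≫ β)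
    (h : gammaMap φ = gammaMap ψ) : φ = ψ := by
  ext l
  refine (toLoop_isPullback hβ l).hom_ext ?_ (congrArg (fun θ => NatTrans.app θ l) w)
  rw [← toLoop_gammaMap, ← toLoop_gammaMap, h]

variable {α} (τ : gamma A ⟶ gamma B)

lemma gammaLift_aux (w : τ ≫ gammaMap β = gammaMap α) (l : List V) : (toLoop A l ≫ τ.app (pt V) ⟨⟩ ⟨⟩) ≫
    (gammaMap β).app (pt V) ⟨⟩ ⟨⟩ = α.app l ≫ toLoop E l := by
  rw [← toLoop_gammaMap, ← w, Category.assoc]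
  rfl

variable (w : τ ≫ gammaMap β = gammaMap α)

/-- The transformation inducing a given transformation over `Set`. -/
noncomputable def gammaLift : A ⟶ B where
  app l := (toLoop_isPullback hβ l).lift (toLoop A l ≫ τ.app (pt V) ⟨⟩ ⟨⟩) (α.app l)
    (gammaLift_aux τ w l)
  naturality l m f := (toLoop_isPullback hβ m).hom_ext
    (by
      rw [Category.assoc, IsPullback.lift_fst, Category.assoc, toLoop_naturality,
        IsPullback.lift_fst, ← Category.assoc, toLoop_naturality])
    (by
      rw [Category.assoc, IsPullback.lift_snd, Category.assoc, β.naturality,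
        IsPullback.lift_snd_assoc, α.naturality])

lemma gammaLift_comp : gammaLift hβ τ w ≫ β = α := by
  ext l
  exact (toLoop_isPullback hβ l).lift_snd _ _ _

/-- Since `gammaMap β` is cartesian, two maps into a hom of `ΓB X` agree as soon as they do over the
terminal graph and over `ΓE X`. The first is the defining property of the lift, the second holds
because both transformations lie over `α`. -/
lemma gammaMap_gammaLift : gammaMap (gammaLift hβ τ w) = τ :=
  GFun.hom_ext fun X a b => (gι_isCoprod A X a b).hom_ext fun p => by
    rw [gι_gammaMap]
    refine ((gammaMap_isCartesian hβ).isPullback (toPt X) a b).hom_ext ?_ ?_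
    · rw [Category.assoc, gι_toPt, Category.assoc, ← τ.naturality, ← Category.assoc, gι_toPt]
      exact (toLoop_isPullback hβ _).lift_fst _ _ _
    · rw [Category.assoc, gι_gammaMap, ← Category.assoc, ← NatTrans.comp_app, gammaLift_comp,
        Category.assoc]
      refine Eq.trans ?_ (congrArg (fun σ => gι A X p ≫ GFun.Hom.app σ X a b) w.symm)
      exact (gι_gammaMap α X p).symm

end Lift

section Restrict

variable {E : List V ⥤ V} {S : GFun V} (ς : S ⟶ gamma E)

/-- The functor inducing a functor over `Set` with a cartesian transformation to `Γ E`. -/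
noncomputable def restrict : List V ⥤ V where
  -- This choice is forced: `toLoop_isPullback` exhibits the value at `l` as this pullback whenever
  -- `S` is already of the form `ΓA`.
  obj l := pullback (ς.app (pt V) ⟨⟩ ⟨⟩) (toLoop E l)
  map f := pullback.lift (pullback.fst _ _) (pullback.snd _ _ ≫ E.map f) (by
    rw [Category.assoc, toLoop_naturality, pullback.condition])
  map_id l := pullback.hom_ext (by simp [pullback.lift_fst]) (by simp [pullback.lift_snd])
  map_comp f g := pullback.hom_ext (by simp [pullback.lift_fst])
    (by simp [pullback.lift_snd, pullback.lift_snd_assoc])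

noncomputable def restrictHom : restrict ς ⟶ E where
  app l := pullback.snd _ _
  naturality _ _ _ := pullback.lift_snd _ _ _

/-- The values at `l` and at `m` are pullbacks of one and the same map, along `toLoop E l` and
`toLoop E m`. The former factors through the latter by `E.map f`, so cancellation of pullbacks
leaves the naturality square. -/
lemma restrictHom_equifibered : NatTrans.Equifibered (restrictHom ς) := fun l m f =>
  IsPullback.of_right (h₁₂ := pullback.fst (ς.app (pt V) ⟨⟩ ⟨⟩) (toLoop E m))
    (h₂₂ := toLoop E m) (v₁₃ := ς.app (pt V) ⟨⟩ ⟨⟩)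
    (by
      rw [toLoop_naturality]
      refine (congrArg (fun k => IsPullback k _ _ _) (pullback.lift_fst _ _ _)).mpr ?_
      exact IsPullback.of_hasPullback _ _)
    (pullback.lift_snd _ _ _) (IsPullback.of_hasPullback _ _)

variable {ς} (hς : GFun.IsCartesian ς)

lemma restrictι_aux (X : Graph V) {a b : X.obj} (p : Path a b) :
    pullback.fst (ς.app (pt V) ⟨⟩ ⟨⟩) (toLoop E (p.seq X.hom)) ≫ ς.app (pt V) ⟨⟩ ⟨⟩ =
      (pullback.snd (ς.app (pt V) ⟨⟩ ⟨⟩) (toLoop E (p.seq X.hom)) ≫ gι E X p) ≫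
        (gamma E).map (toPt X) a b := by
  rw [Category.assoc, gι_toPt, pullback.condition]

/-- The inclusions of the summands of `S X (a, b)`. -/
noncomputable def restrictι (X : Graph V) {a b : X.obj} (p : Path a b) :
    (restrict ς).obj (p.seq X.hom) ⟶ S.hom X a b :=
  (hς.isPullback (toPt X) a b).lift (pullback.fst _ _) (pullback.snd _ _ ≫ gι E X p)
    (restrictι_aux X p)

lemma restrictι_map (X : Graph V) {a b : X.obj} (p : Path a b) :
    restrictι hς X p ≫ S.map (toPt X) a b = pullback.fst _ _ :=
  (hς.isPullback (toPt X) a b).lift_fst _ _ _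

lemma restrictι_app (X : Graph V) {a b : X.obj} (p : Path a b) :
    restrictι hς X p ≫ ς.app X a b = (restrictHom ς).app (p.seq X.hom) ≫ gι E X p :=
  (hς.isPullback (toPt X) a b).lift_snd _ _ _

/-- The square over `gι E X p`, pasted with the cartesian square of `ς` at `toPt X`, is the pullback
defining `restrict`, so it is itself a pullback. Extensivity then turns the coproduct cocone of `ΓE
X` into one of `S X`. -/
lemma restrictι_isCoprod (X : Graph V) (a b : X.obj) :
    IsCoprod fun p : Path a b => restrictι hς X p :=
  ((gι_isCoprod E X a b).iff_isPullback fun p => restrictι_app hς X p).2 fun p =>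
    IsPullback.of_right (h₁₂ := S.map (toPt X) a b) (h₂₂ := (gamma E).map (toPt X) a b)
      (v₁₃ := ς.app (pt V) ⟨⟩ ⟨⟩)
      (by
        rw [restrictι_map, gι_toPt]
        exact IsPullback.of_hasPullback _ _)
      (restrictι_app hς X p) (hς.isPullback (toPt X) a b)

/-- The isomorphism of `Γ` of the restriction with `S`. -/
noncomputable def restrictCounit : gamma (restrict ς) ⟶ S where
  app X a b := (gι_isCoprod (restrict ς) X a b).desc fun p => restrictι hς X p
  naturality {X Y} f a b := (gι_isCoprod (restrict ς) X a b).hom_ext fun p => by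
    rw [gι_map_assoc, IsCoprod.fac, IsCoprod.fac_assoc]
    -- A hom of `S Y` is a pullback over the terminal graph, so the two sides are compared after
    -- collapsing `Y` and after applying `ς`.
    refine (hς.isPullback (toPt Y) (f.obj a) (f.obj b)).hom_ext ?_ ?_
    · have e₁ := restrictι_map hς Y (p.map f.obj)
      have e₂ : S.map f a b ≫ S.map (toPt Y) (f.obj a) (f.obj b) = S.map (toPt X) a b :=
        (S.map_comp f (toPt Y) a b).symm.trans
          (S.map_congr (X := X) (Y := pt V) _ (fun _ _ => terminalIsTerminal.hom_ext _ _) a b)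
      refine (Category.assoc _ _ _).trans ((congrArg (_ ≫ ·) e₁).trans ?_)
      refine Eq.trans ?_ ((Category.assoc _ _ _).trans ((congrArg (_ ≫ ·) e₂).trans
        (restrictι_map hς X p))).symm
      exact pullback.lift_fst _ _ _
    · rw [Category.assoc, Category.assoc, ς.naturality, restrictι_app, ← Category.assoc,
        ← Category.assoc, restrictι_app, (restrictHom ς).naturality, Category.assoc, Category.assoc,
        gι_map]

lemma gι_restrictCounit (X : Graph V) {a b : X.obj} (p : Path a b) :
    gι (restrict ς) X p ≫ (restrictCounit hς).app X a b = restrictι hς X p :=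
  (gι_isCoprod (restrict ς) X a b).fac _ p

lemma restrictCounit_comp : restrictCounit hς ≫ ς = gammaMap (restrictHom ς) :=
  GFun.hom_ext fun X a b => (gι_isCoprod (restrict ς) X a b).hom_ext fun p => by
    rw [gι_gammaMap, GFun.comp_app, ← Category.assoc, gι_restrictCounit, restrictι_app]

instance restrictCounit_isIso : IsIso (restrictCounit hς) :=
  GFun.isIso_of _ fun X a b => (gι_isCoprod (restrict ς) X a b).isIso_of (restrictι_isCoprod hς X a b)
    _root_.id Function.bijective_id (fun _ => 𝟙 _) _ fun p =>
      (gι_restrictCounit hς X p).trans (Category.id_comp _).symm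

end Restrict

variable (M : Multitensor V) [M.IsDistributive]

/-- The collection inducing a collection over `Set`. -/
noncomputable def restrictColl (Y : NColl M.gammaMonad) : Coll M :=
  ⟨restrict Y.α, restrictHom Y.α, restrictHom_equifibered Y.α⟩

noncomputable def restrictCollIso (Y : NColl M.gammaMonad) :
    (gammaColl M).obj (restrictColl M Y) ≅ Y :=
  NColl.mkIso (@asIso _ _ (gamma (restrict (E := M.E) Y.α)) Y.A (restrictCounit (E := M.E) Y.cart)
    (restrictCounit_isIso (E := M.E) Y.cart)) (restrictCounit_comp Y.cart)

instance : (gammaColl M).Faithful where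
  map_injective {X Y f g} h := Coll.hom_ext <|
    gammaMap_injective Y.cart (f.w.trans g.w.symm) (congrArg NColl.Hom.φ h)

instance : (gammaColl M).Full where
  map_surjective {X Y} f := ⟨⟨gammaLift Y.cart f.φ f.w, gammaLift_comp Y.cart f.φ f.w⟩,
    NColl.hom_ext (gammaMap_gammaLift Y.cart f.φ f.w)⟩

instance : (gammaColl M).EssSurj where
  mem_essImage Y := ⟨restrictColl M Y, ⟨restrictCollIso M Y⟩⟩

instance gammaColl_isEquivalence : (gammaColl M).IsEquivalence where

end Terminal

/-! ### Coherence of the comparison maps -/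

section Coherence

variable {V : Type u} [Category.{v} V] [Lextensive V] (A B C : List V ⥤ V) (X : Graph V)

section

variable {X} {a b : X.obj}

/-- The inclusion of a summand of `Γ (A ∘ B) X (a, b)`. -/
noncomputable def inclι (Y : List (List V)) (q : Path a b) (h : flat.obj Y = q.seq X.hom) :
    A.obj ((mapSeq B).obj Y) ⟶ (gamma (comp A B)).hom X a b :=
  lanι flat (mapSeq B ⋙ A) Y h ≫ gι (comp A B) X q

/-- It absorbs the transports which arise because the two descriptions of the blocks of a path, and
of its concatenation, agree only propositionally. -/
lemma inclι_congr {Y Y' : List (List V)} (e : Y = Y') {q q' : Path a b} (eq : q = q')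
    (h : flat.obj Y = q.seq X.hom) (h' : flat.obj Y' = q'.seq X.hom)
    (w : (mapSeq B).obj Y = (mapSeq B).obj Y') :
    A.map (eqToHom w) ≫ inclι A B Y' q' h' = inclι A B Y q h := by
  subst e eq
  exact (congrArg (· ≫ _) (A.map_id _)).trans (Category.id_comp _)

lemma inclι_path {Y : List (List V)} {q q' : Path a b} (eq : q = q')
    (h : flat.obj Y = q.seq X.hom) (h' : flat.obj Y = q'.seq X.hom) :
    inclι A B Y q' h' = inclι A B Y q h := by
  subst eq; rfl

end

/-- Both sides send the summand at `p` to the summand at `p` taken as a single block. Concatenating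
that one block gives `p` with a trivial path appended, hence `append_nil`. -/
lemma gammaUnit_gammaComp (hU : Distributive (unit (V := V))) (a b : X.obj) :
    gammaUnit.app ((gamma A).toFunctor.obj X) a b ≫ (gammaComp hU A).app X a b =
      (gammaMap (unitL A)).app X a b := (gι_isCoprod A X a b).hom_ext fun p => by
  have e1 := lanι_map single (𝟭 V) (gι A X p) rfl rfl _ HEq.rfl
  have e2 : gι A X p ≫ gammaUnit.app ((gamma A).toFunctor.obj X) a b =
      lanι single (𝟭 V) (A.obj (p.seq X.hom)) rfl ≫
        gι₂ unit A X (Path.cons a (Path.nil b)) ⟨p, ⟨⟩⟩ :=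
    (Category.assoc _ _ _).symm.trans ((congrArg (· ≫ gι unit ((gamma A).toFunctor.obj X)
      (Path.cons a (Path.nil b))) e1.symm).trans (Category.assoc _ _ _))
  have e3 := gι₂_gammaComp hU A X (Path.cons a (Path.nil b)) ⟨p, ⟨⟩⟩
  have e4 : gι₂' unit A X (Path.cons a (Path.nil b)) ⟨p, ⟨⟩⟩ =
      inclι unit A [p.seq X.hom] p (flat_single _) := inclι_path unit A p.append_nil.symm _ _
  refine (Category.assoc _ _ _).symm.trans ((congrArg (· ≫ (gammaComp hU A).app X a b) e2).trans
    ((Category.assoc _ _ _).trans ((congrArg (_ ≫ ·) (e3.trans e4)).trans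
      (Eq.trans ?_ (gι_gammaMap (unitL A) X p).symm))))
  exact (Category.assoc _ _ _).symm

lemma seqHom'_gammaUnit : {a b : X.obj} → (p : Path a b) →
    (w : (mapSeq unit).obj ((p.seq X.hom).map single.obj) =
      (mapSeq unit).obj (p.segs X.hom p.ones)) →
    p.seqHom' (G := X.hom) (G' := (gamma unit).hom X) (gammaUnit.app X) =
      unitSeq (lanUnit single (𝟭 V)) (p.seq X.hom) ≫ eqToHom w ≫
        p.liftHom (fun _ _ q => gι unit X q) p.ones
  | _, _, .nil _, _ => rfl
  | _, _, .cons a p, w => by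
    have ih := seqHom'_gammaUnit p (congrArg (mapSeq unit).obj (p.liftSeq_ones X.hom))
    have e := eqToHom_cons rfl (congrArg (mapSeq unit).obj (p.liftSeq_ones X.hom)) w
    refine Eq.trans ?_ (congrArg (fun f => unitSeq (lanUnit single (𝟭 V))
      (X.hom a _ :: p.seq X.hom) ≫ f ≫
        (Path.cons a p).liftHom (fun _ _ q => gι unit X q) (Path.cons a p).ones) e.symm)
    exact congr (congrArg consHom (congrArg (lanι single (𝟭 V) (X.hom a _) rfl ≫ ·)
      (Category.id_comp _).symm)) ih

/-- The other unit law: here the summand at `p` goes to the one where `p` is cut into its single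
steps, that is, to the family `p.ones`. -/
lemma gammaUnit_gammaComp' (hA : Distributive A) (a b : X.obj) :
    (gamma A).map (GFun.component gammaUnit X) a b ≫ (gammaComp hA unit).app X a b =
      (gammaMap (unitR A)).app X a b := (gι_isCoprod A X a b).hom_ext fun p => by
  let ΓX := (gamma (unit (V := V))).toFunctor.obj X
  have w := congrArg (mapSeq (unit (V := V))).obj (p.liftSeq_ones X.hom)
  have e1 := gι_map' A (G := X.hom) (G' := (gamma unit).hom X) (gammaUnit.app X) p
  have e2 := seqHom'_gammaUnit X p w
  have e3 := gι₂_gammaComp hA unit X p p.ones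
  have e5 := inclι_congr A unit (p.liftSeq_ones X.hom) p.join_ones.symm
    (flat_map_single (p.seq X.hom)) (p.flat_liftSeq X.hom p.ones) w
  have e6 : A.map (p.seqHom' (G := X.hom) (G' := (gamma unit).hom X) (gammaUnit.app X)) ≫
      gι A ΓX p = A.map (unitSeq (lanUnit single (𝟭 V)) (p.seq X.hom)) ≫ A.map (eqToHom w) ≫
        gι₂ A unit X p p.ones := by
    rw [e2]
    exact (A.map_comp_assoc _ _ _).trans (congrArg (A.map _ ≫ ·) (A.map_comp_assoc _ _ _))
  refine (Category.assoc _ _ _).symm.trans ((congrArg (· ≫ (gammaComp hA unit).app X a b)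
    (e1.trans e6)).trans ((Category.assoc _ _ _).trans
      ((congrArg (A.map (unitSeq (lanUnit single (𝟭 V)) (p.seq X.hom)) ≫ ·)
        ((Category.assoc _ _ _).trans ((congrArg (A.map (eqToHom w) ≫ ·) e3).trans e5))).trans ?_)))
  exact (Category.assoc _ _ _).symm.trans (gι_gammaMap (unitR A) X p).symm

/-- The sequence of inclusions of summands. -/
noncomputable abbrev gιSeq₂ {a b : X.obj} (p : Path a b) (κ : p.Lift Path.Two) :
    (p.segs₂ X.hom κ).map (two B C) ⟶ p.seq ((GFun.comp (gamma B) (gamma C)).hom X) :=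
  Path.liftHom (K := Path.Two) (G := fun _ _ (i : Path.Two _ _) => i.1.segs X.hom i.2)
    (β := two B C) (L := (GFun.comp (gamma B) (gamma C)).hom X)
    (fun _ _ i => gι₂ B C X i.1 i.2) p κ

/-- The inclusion of a summand in `Γ A (Γ B (Γ C X)) (a, b)`. -/
noncomputable def gιThree {a b : X.obj} (p : Path a b) (κ : p.Lift Path.Two) :
    A.obj ((p.segs₂ X.hom κ).map (two B C)) ⟶
      (gamma A).hom ((GFun.comp (gamma B) (gamma C)).toFunctor.obj X) a b :=
  A.map (gιSeq₂ B C X p κ) ≫ gι A ((GFun.comp (gamma B) (gamma C)).toFunctor.obj X) p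

variable {A B} in
-- Distributivity of `B` splits the inner composite and distributivity of `A` then splits all the
-- variables at once. Maps out of the triple composite can thus be compared on nested paths.
lemma gιThree_isCoprod (hA : Distributive A) (hB : Distributive B) (a b : X.obj) :
    IsCoprod fun i : (Σ p : Path a b, p.Lift Path.Two) => gιThree A B C X i.1 i.2 :=
  (gι_isCoprod A ((GFun.comp (gamma B) (gamma C)).toFunctor.obj X) a b).sigma fun p =>
    hA.lift (K := Path.Two) (G := fun _ _ (i : Path.Two _ _) => i.1.segs X.hom i.2)
      (β := two B C) (fun a b => gι₂_isCoprod hB C X a b) p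

variable {B} in
lemma seqHom'_gammaComp (hB : Distributive B) : {a b : X.obj} → (p : Path a b) →
    (κ : p.Lift Path.Two) → (w' : (mapSeq (comp B C)).obj ((p.segs₂ X.hom κ).map flat.obj) =
      (mapSeq (comp B C)).obj (p.segs X.hom (p.joins κ))) →
    gιSeq₂ B C X p κ ≫
        p.seqHom' (G := (GFun.comp (gamma B) (gamma C)).hom X) (G' := (gamma (comp B C)).hom X)
          ((gammaComp hB C).app X) =
      relHom (fun s t h => lanι flat (mapSeq C ⋙ B) s h) (p.segs₂ X.hom κ)
        ((p.segs₂ X.hom κ).map flat.obj) rfl ≫ eqToHom w' ≫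
        p.liftHom (fun _ _ q => gι (comp B C) X q) (p.joins κ)
  | _, _, .nil _, _, _ => rfl
  | _, _, .cons a p, κ, w' => by
    have ih := seqHom'_gammaComp hB p κ.2
      (congrArg (mapSeq (comp B C)).obj (p.map_flat_segs₂ X.hom κ.2))
    have e' := eqToHom_cons (congrArg (comp B C).obj (Path.flat_liftSeq X.hom κ.1.1 κ.1.2))
      (congrArg (mapSeq (comp B C)).obj (p.map_flat_segs₂ X.hom κ.2)) w'
    refine Eq.trans ?_ (congrArg (fun g => relHom (fun s t h => lanι flat (mapSeq C ⋙ B) s h)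
      ((Path.cons a p).segs₂ X.hom κ) (((Path.cons a p).segs₂ X.hom κ).map flat.obj) rfl ≫ g ≫
      (Path.cons a p).liftHom (fun _ _ q => gι (comp B C) X q) ((Path.cons a p).joins κ)) e'.symm)
    refine congr (congrArg consHom ((gι₂_gammaComp hB C X κ.1.1 κ.1.2).trans ?_)) ih
    have e₁ := lanι_eqToHom (p := flat) (G := mapSeq C ⋙ B) (κ.1.1.segs X.hom κ.1.2) rfl
      (Path.flat_liftSeq X.hom κ.1.1 κ.1.2)
    have e₂ := e₁.symm.trans (congrArg (_ ≫ ·) (eqToHom_map (comp B C) _))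
    exact (congrArg (· ≫ gι (comp B C) X (κ.1.1.join κ.1.2)) e₂).trans (Category.assoc _ _ _)

/-- The sequence of sequences of inclusions of summands. -/
noncomputable def gιSeqSeq : {a b : X.obj} → (p : Path a b) → (κ : p.Lift Path.Two) →
    ((p.segs₂ X.hom κ).map (mapSeq C).obj ⟶ p.segs ((gamma C).hom X) (p.fsts κ))
  | _, _, .nil _, _ => 𝟙 []
  | _, _, .cons _ p, κ =>
    consHom (κ.1.1.liftHom (fun _ _ q => gι C X q) κ.1.2) (gιSeqSeq p κ.2)

lemma gιSeq₂_eq : {a b : X.obj} → (p : Path a b) → (κ : p.Lift Path.Two) →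
    (w : (p.segs₂ X.hom κ).map (two B C) =
      ((p.segs₂ X.hom κ).map (mapSeq C).obj).map B.obj) →
    gιSeq₂ B C X p κ = eqToHom w ≫ (mapSeq B).map (gιSeqSeq C X p κ) ≫
      p.liftHom (fun _ _ q => gι B ((gamma C).toFunctor.obj X) q) (p.fsts κ)
  | _, _, .nil _, _, _ => rfl
  | _, _, .cons _ p, κ, w => by
    have ih := gιSeq₂_eq p κ.2 (map_two _ _ _)
    refine Eq.trans ?_ (congrArg (· ≫ (mapSeq B).map (gιSeqSeq C X (Path.cons _ p) κ) ≫
      (Path.cons _ p).liftHom (fun _ _ q => gι B ((gamma C).toFunctor.obj X) q)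
        ((Path.cons _ p).fsts κ)) (eqToHom_cons rfl (map_two _ _ _) w).symm)
    exact congr (congrArg consHom (Category.id_comp _).symm) ih

lemma liftHom_appendLift : {a b c : X.obj} → (p : Path a b) → (k : p.Lift Path) →
    (q : Path b c) → (l : q.Lift Path) →
    HEq (appendHom (p.liftHom (fun _ _ q => gι C X q) k) (q.liftHom (fun _ _ q => gι C X q) l))
      ((p.append q).liftHom (fun _ _ q => gι C X q) (p.appendLift k q l))
  | _, _, _, .nil _, _, _, _ => HEq.rfl
  | _, _, _, .cons _ p, k, q, l => consHom_heq _
      (List.map_append.symm.trans (congrArg (List.map C.obj) (p.segs_appendLift X.hom k.2 q l).symm))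
      (p.seq_append _ q).symm (liftHom_appendLift p k.2 q l)

/-- Forgetting the outer grouping of the inclusions corresponds to passing from `κ` to the family
`p.snds κ` over the concatenated path. The sequences of objects on both sides agree only
propositionally. -/
lemma flat_gιSeqSeq : {a b : X.obj} → (p : Path a b) → (κ : p.Lift Path.Two) →
    HEq (flat.map (gιSeqSeq C X p κ))
      ((p.join (p.fsts κ)).liftHom (fun _ _ q => gι C X q) (p.snds κ))
  | _, _, .nil _, _ => HEq.rfl
  | _, _, .cons _ p, κ => (appendHom_heq rfl rfl
      ((flat_map C _ _ rfl).trans (congrArg (List.map C.obj) (p.flat_segs₂ X.hom κ.2)))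
      (p.flat_liftSeq _ _) HEq.rfl (flat_gιSeqSeq p κ.2)).trans (liftHom_appendLift C X _ _ _ _)

variable {A B}

/-- The inner composites are compared first, so the innermost paths are concatenated within each
step of `p`, giving `p.joins κ`. Hence the right-bracketed inclusion `inclR`. -/
lemma gιThree_gammaComp_right (hA : Distributive A) (hB : Distributive B) {a b : X.obj}
    (p : Path a b) (κ : p.Lift Path.Two)
    (h : flat.obj ((p.segs₂ X.hom κ).map flat.obj) = (p.join (p.joins κ)).seq X.hom) :
    gιThree A B C X p κ ≫ (gamma A).map (GFun.component (gammaComp hB C) X) a b ≫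
        (gammaComp hA (comp B C)).app X a b =
      inclR A B C (p.segs₂ X.hom κ) _ _ rfl h ≫
        gι (comp A (comp B C)) X (p.join (p.joins κ)) := by
  let ΓX := (gamma (comp B C)).toFunctor.obj X
  let r := relHom (fun s t h => lanι flat (mapSeq C ⋙ B) s h) (p.segs₂ X.hom κ)
        ((p.segs₂ X.hom κ).map flat.obj) rfl
  have w' := congrArg (mapSeq (comp B C)).obj (p.map_flat_segs₂ X.hom κ)
  have l1 : gιThree A B C X p κ ≫ (gamma A).map (GFun.component (gammaComp hB C) X) a b =
      A.map r ≫ A.map (eqToHom w') ≫ gι₂ A (comp B C) X p (p.joins κ) := by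
    refine (Category.assoc _ _ _).trans ((congrArg (A.map (gιSeq₂ B C X p κ) ≫ ·)
      (gι_map' A (G := (GFun.comp (gamma B) (gamma C)).hom X) (G' := (gamma (comp B C)).hom X)
        ((gammaComp hB C).app X) p)).trans ((A.map_comp_assoc _ _ _).symm.trans
      ((congrArg (fun f => A.map f ≫ gι A ΓX p) (seqHom'_gammaComp C X hB p κ w')).trans ?_)))
    exact (A.map_comp_assoc _ _ _).trans (congrArg (A.map r ≫ ·) (A.map_comp_assoc _ _ _))
  have e := inclι_congr A (comp B C) (p.map_flat_segs₂ X.hom κ) rfl h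
    (p.flat_liftSeq X.hom (p.joins κ)) w'
  refine (Category.assoc _ _ _).symm.trans ((congrArg (· ≫ (gammaComp hA (comp B C)).app X a b)
    l1).trans ((Category.assoc _ _ _).trans ((congrArg (A.map r ≫ ·) ((Category.assoc _ _ _).trans
      ((congrArg (A.map (eqToHom w') ≫ ·) (gι₂_gammaComp hA (comp B C) X p (p.joins κ))).trans
        e))).trans ?_)))
  exact (Category.assoc _ _ _).symm

/-- The outer composite is compared first: the paths `p.fsts κ` are concatenated, and the innermost
paths become the family `p.snds κ` over the result. By `join_snds` the final path is the same as for
the other bracketing. -/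
lemma gιThree_gammaComp_left (hA : Distributive A) (hAB : Distributive (comp A B)) {a b : X.obj}
    (p : Path a b) (κ : p.Lift Path.Two)
    (h : flat.obj (flat.obj (p.segs₂ X.hom κ)) = (p.join (p.joins κ)).seq X.hom) :
    gιThree A B C X p κ ≫ (gammaComp hA B).app ((gamma C).toFunctor.obj X) a b ≫
        (gammaComp hAB C).app X a b =
      inclL A B C (p.segs₂ X.hom κ) _ _ rfl h ≫
        gι (comp (comp A B) C) X (p.join (p.joins κ)) := by
  let ΓX := (gamma C).toFunctor.obj X
  let Z := p.segs₂ X.hom κ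
  let s := gιSeqSeq C X p κ
  let L := lanι flat (mapSeq B ⋙ A) (Z.map (mapSeq C).obj) (flat_map C Z _ rfl)
  have w : Z.map (two B C) = (Z.map (mapSeq C).obj).map B.obj := map_two _ _ _
  have w₁ : flat.obj (Z.map (mapSeq C).obj) = (mapSeq C).obj (flat.obj Z) := flat_map C _ _ rfl
  have w₂ := congrArg (mapSeq C).obj (p.flat_segs₂ X.hom κ)
  have e1 : gιThree A B C X p κ = A.map (eqToHom w) ≫ A.map ((mapSeq B).map s) ≫
      gι₂ A B ΓX p (p.fsts κ) := by
    refine (congrArg (fun f => A.map f ≫ gι A ((GFun.comp (gamma B)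
      (gamma C)).toFunctor.obj X) p) (gιSeq₂_eq B C X p κ w)).trans ?_
    exact (A.map_comp_assoc _ _ _).trans (congrArg (A.map (eqToHom w) ≫ ·)
      (A.map_comp_assoc _ _ _))
  let t := (p.join (p.fsts κ)).liftHom (fun _ _ q => gι C X q) (p.snds κ)
  have e2 : A.map ((mapSeq B).map s) ≫
        lanι flat (mapSeq B ⋙ A) _ (p.flat_liftSeq ΓX.hom (p.fsts κ)) =
      L ≫ (comp A B).map (eqToHom w₂) ≫ (comp A B).map t := by
    have h1 := lanι_map flat (mapSeq B ⋙ A) s w₁ (p.flat_liftSeq ΓX.hom (p.fsts κ))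
      (eqToHom w₂ ≫ t) ((flat_gιSeqSeq C X p κ).trans (by
        generalize_proofs
        exact (eqToHom_comp_heq t w₂).symm))
    exact h1.symm.trans (congrArg (L ≫ ·) ((comp A B).map_comp _ _))
  have e3 : gιThree A B C X p κ ≫ (gammaComp hA B).app ΓX a b =
      A.map (eqToHom w) ≫ L ≫ (comp A B).map (eqToHom w₂) ≫
        gι₂ (comp A B) C X (p.join (p.fsts κ)) (p.snds κ) := by
    refine (congrArg (· ≫ (gammaComp hA B).app ΓX a b) e1).trans ((Category.assoc _ _ _).trans
      (congrArg (A.map (eqToHom w) ≫ ·) ((Category.assoc _ _ _).trans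
        ((congrArg (A.map ((mapSeq B).map s) ≫ ·) (gι₂_gammaComp hA B ΓX p (p.fsts κ))).trans ?_))))
    refine (Category.assoc _ _ _).symm.trans ((congrArg
      (· ≫ gι (comp A B) ΓX (p.join (p.fsts κ))) e2).trans ((Category.assoc _ _ _).trans
        (congrArg (L ≫ ·) (Category.assoc _ _ _))))
  have e4 := inclι_congr (comp A B) C (p.flat_segs₂ X.hom κ) (p.join_snds κ).symm h
    ((p.join (p.fsts κ)).flat_liftSeq X.hom (p.snds κ)) w₂
  refine (Category.assoc _ _ _).symm.trans ((congrArg (· ≫ (gammaComp hAB C).app X a b)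
    e3).trans ((Category.assoc _ _ _).trans ((congrArg (A.map (eqToHom w) ≫ ·)
      ((Category.assoc _ _ _).trans (congrArg (L ≫ ·) ((Category.assoc _ _ _).trans
        ((congrArg ((comp A B).map (eqToHom w₂) ≫ ·) (gι₂_gammaComp hAB C X _ _)).trans
          e4))))).trans ?_)))
  exact ((Category.assoc _ _ _).trans (congrArg (A.map (eqToHom w) ≫ ·)
      (Category.assoc _ _ _))).symm

/-- At a nested path the two routes end in `inclL` and `inclR`, followed by the inclusion at the
same concatenated path, and the associativity isomorphism is the map carrying the one to the other.
-/
lemma gammaComp_assoc (hA : Distributive A) (hB : Distributive B)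
    (hAB : Distributive (comp A B)) (a b : X.obj) :
    (gammaComp hA B).app ((gamma C).toFunctor.obj X) a b ≫ (gammaComp hAB C).app X a b ≫
        (gammaMap (assocIso A B C hA).hom).app X a b =
      (gamma A).map (GFun.component (gammaComp hB C) X) a b ≫
        (gammaComp hA (comp B C)).app X a b :=
  (gιThree_isCoprod C X hA hB a b).hom_ext fun ⟨p, κ⟩ => by
  let Z := p.segs₂ X.hom κ
  have hl : flat.obj (Z.map flat.obj) = (p.join (p.joins κ)).seq X.hom :=
    (congrArg flat.obj (p.map_flat_segs₂ X.hom κ)).trans (p.flat_liftSeq X.hom (p.joins κ))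
  have hr : flat.obj (flat.obj Z) = (p.join (p.joins κ)).seq X.hom :=
    (List.flatten_flatten (L := Z)).trans hl
  have e1 := gιThree_gammaComp_left C X hA hAB p κ hr
  have e2 := gιThree_gammaComp_right C X hA hB p κ hl
  have e3 := inclL_assoc A B C hA Z _ hr
  refine Eq.trans ?_ e2.symm
  refine ((congrArg (gιThree A B C X p κ ≫ ·) (Category.assoc _ _ _).symm).trans
    (Category.assoc _ _ _).symm).trans ((congrArg
      (· ≫ (gammaMap (assocIso A B C hA).hom).app X a b) e1).trans ?_)
  refine (Category.assoc _ _ _).trans ((congrArg (inclL A B C Z _ _ rfl hr ≫ ·)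
    (gι_gammaMap (assocIso A B C hA).hom X (p.join (p.joins κ)))).trans ?_)
  exact (Category.assoc _ _ _).symm.trans (congrArg
    (· ≫ gι (comp A (comp B C)) X (p.join (p.joins κ))) e3)

end Coherence

/-! ### `Γ` is strong monoidal -/

section Monoidal

variable {V : Type u} [Category.{v} V] [Lextensive V]

variable (M : Multitensor V) [M.IsDistributive] [M.IsCartesian]

open MonoidalCategory

/-- The comparison of the units. -/
noncomputable def gammaCollε : 𝟙_ (NColl M.gammaMonad) ≅ (gammaColl M).obj (𝟙_ (Coll M)) :=
  NColl.mkIso (X := NColl.unit M.gammaMonad) (Y := (gammaColl M).obj (Coll.unit M))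
    (@asIso _ _ (GFun.one V) (gamma MultOp.unit) gammaUnit gammaUnit_isIso) rfl

/-- The comparison of the tensor products. -/
noncomputable def gammaCollμ (X Y : Coll M) :
    (gammaColl M).obj X ⊗ (gammaColl M).obj Y ≅ (gammaColl M).obj (X ⊗ Y) :=
  NColl.mkIso (X := NColl.tensor ((gammaColl M).obj X) ((gammaColl M).obj Y))
    (Y := (gammaColl M).obj (Coll.tensor X Y))
    (@asIso _ _ (GFun.comp (gamma X.A) (gamma Y.A)) (gamma (comp X.A Y.A))
      (gammaComp X.distributive Y.A) (gammaComp_isIso X.distributive Y.A)) (by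
    change gammaComp X.distributive Y.A ≫ gammaMap (compMap X.α Y.α ≫ M.mul) =
      GFun.hcomp (gammaMap X.α) (gammaMap Y.α) ≫ gammaComp _ _ ≫ gammaMap M.mul
    rw [gammaMap_comp, ← Category.assoc, gammaComp_naturality X.distributive
      (Multitensor.IsDistributive.distributive (M := M)), Category.assoc])

lemma gammaCollμ_naturality {X X' Y Y' : Coll M} (f : X ⟶ X') (g : Y ⟶ Y') :
    ((gammaColl M).map f ⊗ₘ (gammaColl M).map g) ≫ (gammaCollμ M X' Y').hom =
      (gammaCollμ M X Y).hom ≫ (gammaColl M).map (f ⊗ₘ g) :=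
  NColl.hom_ext (gammaComp_naturality X.distributive X'.distributive f.φ g.φ).symm

/-- The strong monoidal structure of `Γ`. -/
noncomputable def gammaCollCore : (gammaColl M).CoreMonoidal where
  εIso := gammaCollε M
  μIso := gammaCollμ M
  μIso_hom_natural_left {X Y} f X' := by
    have e := gammaCollμ_naturality M f (𝟙 X')
    rwa [CategoryTheory.Functor.map_id, tensorHom_id, tensorHom_id] at e
  μIso_hom_natural_right {X Y} X' f := by
    have e := gammaCollμ_naturality M (𝟙 X') f
    rwa [CategoryTheory.Functor.map_id, id_tensorHom, id_tensorHom] at e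
  -- The associator of collections over `Set` is the identity on underlying functors, so after
  -- removing identity factors only `gammaComp_assoc` is left.
  associativity X Y Z := NColl.hom_ext <| GFun.hom_ext fun G a b => by
    have e := gammaComp_assoc Z.A G X.distributive Y.distributive (Coll.tensor X Y).distributive a b
    have e1 := (GFun.comp (gamma X.A) (gamma Y.A)).map_id ((gamma Z.A).toFunctor.obj G) a b
    refine (congrArg (· ≫ (_ ≫ _)) ((congrArg (· ≫ _) e1).trans (Category.id_comp _))).trans
      (e.trans ?_)
    exact ((Category.id_comp _).trans (congrArg (· ≫ _) (Category.comp_id _))).symm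
  -- The unitors of collections over `Set` are identities on underlying functors, and those of `Coll
  -- M` are inverse to `unitL` and `unitR`. Both unit laws thus reduce to the lemmas on `gammaUnit`.
  left_unitality X := NColl.hom_ext <| GFun.hom_ext fun G a b => by
    have e := gammaUnit_gammaComp X.A G (Coll.unit M).distributive a b
    have e2 : (gammaMap (unitL X.A)).app G a b ≫ (gammaMap (leftIso X.A).hom).app G a b =
        𝟙 _ := by
      rw [← GFun.comp_app, ← gammaMap_comp]
      exact congrArg (fun f => GFun.Hom.app f G a b)
        ((congrArg gammaMap (leftIso X.A).inv_hom_id).trans (gammaMap_id _))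
    refine Eq.trans e2.symm ((congrArg (· ≫ _) e.symm).trans ((Category.assoc _ _ _).trans ?_))
    exact congrArg (· ≫ (_ ≫ _)) (Category.id_comp _).symm
  right_unitality X := NColl.hom_ext <| GFun.hom_ext fun G a b => by
    have e := gammaUnit_gammaComp' X.A G X.distributive a b
    have e2 : (gammaMap (unitR X.A)).app G a b ≫
        (gammaMap (rightIso X.A X.distributive).hom).app G a b = 𝟙 _ := by
      rw [← GFun.comp_app, ← gammaMap_comp]
      exact congrArg (fun f => GFun.Hom.app f G a b)
        ((congrArg gammaMap (rightIso X.A X.distributive).inv_hom_id).trans (gammaMap_id _))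
    refine Eq.trans e2.symm ((congrArg (· ≫ _) e.symm).trans ((Category.assoc _ _ _).trans ?_))
    exact congrArg (· ≫ (_ ≫ _)) (Category.comp_id _).symm

lemma gammaColl_monoidal : ∃ m : (gammaColl M).Monoidal,
    (Functor.LaxMonoidal.ε (gammaColl M)).φ = gammaUnit ∧
      ∀ X Y : Coll M, (Functor.LaxMonoidal.μ (gammaColl M) X Y).φ = gammaComp X.distributive Y.A :=
  ⟨(gammaCollCore M).toMonoidal, rfl, fun _ _ => rfl⟩

end Monoidal

/-! ### `Γ` on multitensors -/

section MonoidsToMultitensors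

variable {V : Type u} [Category.{v} V] [Lextensive V]

section Lan

variable {A : Type u₁} [Category.{v₁} A] {B : Type u₂} [Category.{v₂} B] (p : A ⥤ B)
    [DiscFib p] {G : A ⥤ V} {K : B ⥤ V}

lemma lanι_rfl_desc (θ : G ⟶ p ⋙ K) (a : A) :
    lanι p G a rfl ≫ (lanDesc θ).app (p.obj a) = θ.app a :=
  (lanι_desc θ a rfl).trans ((congrArg (θ.app a ≫ ·) (K.map_id _)).trans (Category.comp_id _))

lemma lanDesc_injective {θ θ' : G ⟶ p ⋙ K} (h : lanDesc θ = lanDesc θ') : θ = θ' := by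
  ext a
  rw [← lanι_rfl_desc p θ, ← lanι_rfl_desc p θ', h]

/-- With `lanι_rfl_desc` this makes maps out of the Kan extension the same as transformations out of
`G`. It translates between the unit and multiplication of a monoid and the unit and substitution of
a multitensor. -/
lemma lanDesc_lanUnit (φ : lan p G ⟶ K) :
    lanDesc (lanUnit p G ≫ Functor.whiskerLeft p φ) = φ := by
  ext X
  refine lan_ext fun a h => ?_
  subst h
  exact lanι_rfl_desc p _ a

end Lan

section

variable {E : List V ⥤ V} (o : unit ⟶ E) (m : comp E E ⟶ E)

/-- The unit given by a map from the unit of the composition. -/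
noncomputable def unitOf : 𝟭 V ⟶ single ⋙ E := lanUnit single (𝟭 V) ≫ Functor.whiskerLeft single o

/-- The substitution given by a map from the composite. -/
noncomputable def substOf : mapSeq E ⋙ E ⟶ flat ⋙ E :=
  lanUnit flat (mapSeq E ⋙ E) ≫ Functor.whiskerLeft flat m

lemma lanι_substOf (Y : List (List V)) {X : List V} (h : flat.obj Y = X) :
    lanι flat (mapSeq E ⋙ E) Y h ≫ m.app X = (substOf m).app Y ≫ E.map (eqToHom h) := by
  have e := lanι_desc (substOf m) Y h
  rwa [substOf, lanDesc_lanUnit] at e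

lemma unitSeq_unitOf (X : List V) :
    unitSeq (lanUnit single (𝟭 V)) X ≫ (mapSeqTrans o).app ((mapSeq single).obj X) =
      unitSeq (unitOf o) X := by
  induction X with
  | nil => rfl
  | cons x X ih => exact congr (congrArg consHom rfl) ih

lemma sigmaSeq_substOf (Z : List (List (List V))) :
    eqToHom (map_two E E Z).symm ≫
      relHom (fun s t h => lanι flat (mapSeq E ⋙ E) s h) Z (Z.map flat.obj) rfl ≫
      (mapSeqTrans m).app (Z.map flat.obj) = sigmaSeq (substOf m) Z := by
  induction Z with
  | nil => rfl
  | cons z Z ih =>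
    have h2 := eqToHom_cons rfl (map_two E E Z).symm (map_two E E (z :: Z)).symm
    rw [h2]
    exact congr (congrArg consHom (Category.id_comp _)) ih

/-- The multitensor given by a monoid for the substitution product. -/
noncomputable def Multitensor.ofMonoid (hE : Distributive E)
    (one_mul : unitL E ≫ compMap o (𝟙 E) ≫ m = 𝟙 E)
    (mul_one : unitR E ≫ compMap (𝟙 E) o ≫ m = 𝟙 E)
    (mul_assoc : (assocIso E E E hE).hom ≫ compMap (𝟙 E) m ≫ m = compMap m (𝟙 E) ≫ m) :
    Multitensor V where
  E := E
  u := unitOf o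
  σ := substOf m
  unit_left X := by
    have e1 := lanι_compMap o (𝟙 E) [X] (flat_single X)
    have e3 := lanι_substOf m [X] (flat_single X)
    have h := congrArg (fun f => NatTrans.app f X) one_mul
    rw [Multitensor.twoTrans_id_right] at e1
    rw [NatTrans.comp_app, NatTrans.comp_app, unitL] at h
    dsimp only at h
    rw [Category.assoc, ← Category.assoc (lanι flat _ [X] (flat_single X)), e1, Category.assoc,
      e3] at h
    exact (Category.assoc _ _ _).trans h
  unit_right X := by
    have e1 := lanι_compMap (𝟙 E) o ((mapSeq single).obj X) (flat_map_single X)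
    have e3 := lanι_substOf m ((mapSeq single).obj X) (flat_map_single X)
    have h := congrArg (fun f => NatTrans.app f X) mul_one
    rw [Multitensor.twoTrans_id_left] at e1
    rw [NatTrans.comp_app, NatTrans.comp_app, unitR] at h
    dsimp only at h
    rw [Category.assoc, ← Category.assoc (lanι flat _ ((mapSeq single).obj X) (flat_map_single X)),
      e1, Category.assoc, e3, ← E.map_comp_assoc, unitSeq_unitOf] at h
    exact h
  assoc Z := by
    have e1 := inclL_assoc E E E hE Z _ rfl
    have e2 := lanι_compMap (𝟙 E) m (Z.map flat.obj) (List.flatten_flatten (L := Z)).symm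
    have e3 := lanι_substOf m (Z.map flat.obj) (List.flatten_flatten (L := Z)).symm
    have e4 := lanι_compMap m (𝟙 E) (flat.obj Z) rfl
    have e5 := lanι_substOf m (Z.map (mapSeq E).obj) (flat_map E Z _ rfl)
    rw [Multitensor.twoTrans_id_left] at e2
    rw [Multitensor.twoTrans_id_right] at e4
    -- The law of a multitensor at `Z` is the monoid law at the full concatenation of `Z`,
    -- restricted to the summand of `Z` itself.
    have h := congrArg (fun f => inclL E E E Z _ _ rfl rfl ≫ NatTrans.app f (flat.obj (flat.obj Z)))
      mul_assoc
    dsimp only at h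
    rw [NatTrans.comp_app, NatTrans.comp_app, NatTrans.comp_app, ← Category.assoc, e1, inclR,
      Category.assoc, ← Category.assoc (lanι flat _ _ _) ((compMap _ _).app _), e2, Category.assoc,
      e3, inclL, Category.assoc, Category.assoc,
      ← Category.assoc (lanι flat _ _ _) ((compMap _ _).app _),
      e4, Category.assoc, ← Category.assoc (lanι flat _ _ _) (m.app _)] at h
    rw [← sigmaSeq_substOf]
    have h' := congrArg (E.map (eqToHom (map_two E E Z).symm) ≫ ·) h
    refine Eq.trans ?_ (h'.trans ?_)
    · simp only [← E.map_comp_assoc, Category.assoc]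
    · refine (E.map_comp_assoc _ _ _).symm.trans ((congrArg (· ≫ _) ((congrArg E.map
        (eqToHom_trans _ _)).trans (E.map_id _))).trans ((Category.id_comp _).trans ?_))
      refine Eq.trans ?_ ((congrArg (· ≫ (substOf m).app (flat.obj Z)) e5).trans
        (Category.assoc _ _ _))
      rfl

end

end MonoidsToMultitensors

/-! ### Equivalence of multitensors over `M` with operads over `ΓM` -/

section GammaMult

variable {V : Type u} [Category.{v} V]

section NOpMon

open MonoidalCategory

variable {T : MonadOverSet V}

/-- The collection underlying an operad. -/
def NOp.toNColl (Y : NOp T) : NColl T := ⟨Y.S.T, Y.α, Y.cart⟩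

/-- An operad is a monoid in the category of collections. -/
noncomputable abbrev NOp.monObj [T.IsCartesian] (Y : NOp T) : MonObj Y.toNColl where
  one := ⟨Y.S.η, Y.isHom.unit⟩
  mul := ⟨Y.S.μ, Y.isHom.mult⟩
  one_mul := NColl.hom_ext Y.S.one_mul
  mul_one := NColl.hom_ext Y.S.mul_one
  mul_assoc := NColl.hom_ext (Y.S.mul_assoc.trans (Category.id_comp _).symm)

/-- The monad laws for `f` pass to the inverse transformation because horizontal composition is
functorial. -/
lemma NOp.isIso_of {X Y : NOp T} (f : X ⟶ Y) [IsIso f.φ] : IsIso f := by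
  have h : MonadOverSet.IsHom (S := Y.S) (T := X.S) (inv f.φ) :=
    ⟨(IsIso.comp_inv_eq f.φ).2 f.isHom.unit.symm, by
      rw [IsIso.comp_inv_eq, Category.assoc, f.isHom.mult, ← Category.assoc, ← GFun.hcomp_comp,
        IsIso.inv_hom_id, GFun.hcomp_id]
      exact (Category.id_comp _).symm⟩
  exact ⟨⟨inv f.φ, h, (IsIso.inv_comp_eq f.φ).2 f.w.symm⟩,
    NOp.Hom.ext (IsIso.hom_inv_id f.φ), NOp.Hom.ext (IsIso.inv_hom_id f.φ)⟩

end NOpMon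

variable [Lextensive V] {M : Multitensor V} [M.IsDistributive]

section FullyFaithful

variable [M.gammaMonad.IsCartesian]

instance : (gammaMult M).Faithful where
  map_injective {X Y f g} h := MultOver.Hom.ext <|
    gammaMap_injective Y.cart (f.w.trans g.w.symm) (congrArg NOp.Hom.φ h)

/-- A monad morphism over `ΓM` comes from a transformation over `M`, by fullness on collections.
Whether the latter respects unit and substitution can be tested after `Γ`, which is injective on
transformations over `M`; there the invertible comparison maps cancel from the monad morphism laws.
-/
instance : (gammaMult M).Full where
  map_surjective {X Y} τ := by
    have := X.isDistributive
    have := Y.isDistributive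
    let φ : X.N.E ⟶ Y.N.E := gammaLift Y.cart τ.φ τ.w
    have hα : φ ≫ Y.α = X.α := gammaLift_comp Y.cart τ.φ τ.w
    have hφ : gammaMap φ = τ.φ := gammaMap_gammaLift Y.cart τ.φ τ.w
    have h1 : X.N.one ≫ φ = Y.N.one := by
      refine gammaMap_injective Y.cart ?_ ?_
      · rw [Category.assoc, hα, X.isHom.one, Y.isHom.one]
      · have e : (gammaUnit ≫ gammaMap X.N.one) ≫ gammaMap φ = gammaUnit ≫ gammaMap Y.N.one :=
          (congrArg (_ ≫ ·) hφ).trans τ.isHom.unit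
        have := gammaUnit_isIso (V := V)
        refine (cancel_epi gammaUnit).1 ?_
        rw [gammaMap_comp, ← e, Category.assoc]
    have h2 : X.N.mul ≫ φ = compMap φ φ ≫ Y.N.mul := by
      refine gammaMap_injective Y.cart ?_ ?_
      · rw [Category.assoc, hα, Category.assoc, X.isHom.mul, Y.isHom.mul, ← Category.assoc,
          ← compMap_comp, hα]
      · have hX := X.isDistributive.distributive
        have hY := Y.isDistributive.distributive
        have e : (gammaComp hX X.N.E ≫ gammaMap X.N.mul) ≫ gammaMap φ =
            GFun.hcomp (gammaMap φ) (gammaMap φ) ≫ gammaComp hY Y.N.E ≫ gammaMap Y.N.mul :=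
          (congrArg (_ ≫ ·) hφ).trans (τ.isHom.mult.trans
            (congrArg (fun t => GFun.hcomp t t ≫ gammaComp hY Y.N.E ≫ gammaMap Y.N.mul) hφ.symm))
        have := gammaComp_isIso hX X.N.E
        refine (cancel_epi (gammaComp hX X.N.E)).1 ?_
        rw [gammaMap_comp, ← Category.assoc, e, gammaMap_comp, ← Category.assoc, ← Category.assoc,
          gammaComp_naturality hX hY]
    refine ⟨⟨φ, ⟨lanDesc_injective single ?_, lanDesc_injective flat ?_⟩, hα⟩, NOp.Hom.ext hφ⟩
    · exact (Multitensor.lanDesc_comp single X.N.u φ).symm.trans h1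
    · exact (Multitensor.lanDesc_comp flat X.N.σ φ).symm.trans
        (h2.trans (lanMapTrans_desc flat (twoTrans φ φ) Y.N.σ))

end FullyFaithful

section EssSurj

open MonoidalCategory

variable [M.IsCartesian]

section

variable (X : Coll M) [MonObj X]

/-- The multitensor given by a monoid of collections. -/
noncomputable def Multitensor.ofMon : Multitensor V :=
  Multitensor.ofMonoid (MonObj.one (X := X)).φ (MonObj.mul (X := X)).φ X.distributive
    (by
      have h := congrArg Coll.Hom.φ (MonObj.one_mul X)
      exact (congrArg (unitL X.A ≫ ·) h).trans (leftIso X.A).inv_hom_id)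
    (by
      have h := congrArg Coll.Hom.φ (MonObj.mul_one X)
      exact (congrArg (unitR X.A ≫ ·) h).trans (rightIso X.A X.distributive).inv_hom_id)
    (congrArg Coll.Hom.φ (MonObj.mul_assoc X)).symm

lemma Multitensor.ofMon_one : (Multitensor.ofMon X).one = (MonObj.one (X := X)).φ :=
  lanDesc_lanUnit single _

lemma Multitensor.ofMon_mul : (Multitensor.ofMon X).mul = (MonObj.mul (X := X)).φ :=
  lanDesc_lanUnit flat _

/-- The unit and multiplication of the monoid are maps over `M`. Through the universal property of
the Kan extensions this says that `X.α` is a morphism of multitensors. -/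
lemma Multitensor.ofMon_isHom :
    Multitensor.IsHom (M := Multitensor.ofMon X) (N := M) X.α where
  unit := lanDesc_injective single <| (Multitensor.lanDesc_comp single _ X.α).symm.trans <|
    (congrArg (· ≫ X.α) (Multitensor.ofMon_one X)).trans (MonObj.one (X := X)).w
  subst := lanDesc_injective flat <| (Multitensor.lanDesc_comp flat _ X.α).symm.trans <|
    (congrArg (· ≫ X.α) (Multitensor.ofMon_mul X)).trans <| (MonObj.mul (X := X)).w.trans
      (lanMapTrans_desc flat (twoTrans X.α X.α) M.σ)

/-- The multitensor over `M` given by a monoid of collections. -/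
noncomputable def MultOver.ofMon : MultOver M where
  N := Multitensor.ofMon X
  -- Cartesianness is inherited from `M`: composed with a whiskering of the cartesian `X.α`, the
  -- unit and the substitution become cartesian transformations, and `X.α` cancels.
  isCartesian :=
    { pullbacks := preservesPullbacks_of_equifibered X.cart Multitensor.IsCartesian.pullbacks
      unit := equifibered_of_comp (ψ := Functor.whiskerLeft single X.α)
        (by rw [(Multitensor.ofMon_isHom X).unit]; exact Multitensor.IsCartesian.unit)
        (X.cart.whiskerLeft single)
      subst := equifibered_of_comp (ψ := Functor.whiskerLeft flat X.α)
        (by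
          rw [(Multitensor.ofMon_isHom X).subst]
          have := Multitensor.IsCartesian.pullbacks (M := M)
          exact (twoTrans_equifibered X.cart X.cart).comp Multitensor.IsCartesian.subst)
        (X.cart.whiskerLeft flat) }
  α := X.α
  cart := X.cart
  isHom := Multitensor.ofMon_isHom X

end

instance : (gammaMult M).EssSurj where
  mem_essImage Y := by
    let := (gammaCollCore M).toMonoidal
    let : MonObj Y.toNColl := Y.monObj
    -- Since `gammaColl M` is fully faithful and strong monoidal, the monoid structure of the operad
    -- is carried to any collection inducing its underlying collection.
    obtain ⟨N, ⟨i⟩⟩ : (gammaColl M).mapMon.essImage ⟨Y.toNColl⟩ :=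
      Functor.essImage_mapMon.2 (Functor.EssSurj.mem_essImage (F := gammaColl M) Y.toNColl)
    have hone : gammaUnit ≫ gammaMap (MonObj.one (X := N.X)).φ ≫ i.hom.hom.φ = Y.S.η := by
      have h := congrArg NColl.Hom.φ (IsMonHom.one_hom i.hom.hom)
      exact (Category.assoc _ _ _).symm.trans h
    have hmul : gammaComp N.X.distributive N.X.A ≫ gammaMap (MonObj.mul (X := N.X)).φ ≫
        i.hom.hom.φ = GFun.hcomp i.hom.hom.φ i.hom.hom.φ ≫ Y.S.μ := by
      have h := congrArg NColl.Hom.φ (IsMonHom.mul_hom i.hom.hom)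
      exact (Category.assoc _ _ _).symm.trans h
    -- The unit and multiplication of a monoid in the image of `mapMon` include the comparison maps,
    -- just as those of the monad `Γ` of a multitensor do. The isomorphism of monoids is therefore a
    -- morphism of operads.
    let f : (gammaMult M).obj (MultOver.ofMon N.X) ⟶ Y :=
      { φ := i.hom.hom.φ
        isHom := by
          refine ⟨Eq.trans ?_ hone, Eq.trans ?_ hmul⟩
          · refine (congrArg (fun o => (gammaUnit ≫ gammaMap o) ≫ i.hom.hom.φ)
              (Multitensor.ofMon_one N.X)).trans (Category.assoc _ _ _)
          · refine (congrArg (fun o => (gammaComp N.X.distributive N.X.A ≫ gammaMap o) ≫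
              i.hom.hom.φ) (Multitensor.ofMon_mul N.X)).trans (Category.assoc _ _ _)
        w := i.hom.hom.w }
    have : IsIso f.φ := ⟨i.inv.hom.φ,
      congrArg (fun g => NColl.Hom.φ (Mon.Hom.hom g)) i.hom_inv_id,
      congrArg (fun g => NColl.Hom.φ (Mon.Hom.hom g)) i.inv_hom_id⟩
    have := NOp.isIso_of f
    exact ⟨_, ⟨asIso f⟩⟩

instance gammaMult_isEquivalence : (gammaMult M).IsEquivalence where

end EssSurj

end GammaMult

/-! ### The category of sets is lextensive -/

section Types

lemma types_isCoprod_of_bijective {J : Type*} {Z : J → Type w} {P : Type w} {c : ∀ j, Z j ⟶ P}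
    (h : Function.Bijective fun x : Σ j, Z j => c x.1 x.2) : IsCoprod c := by
  intro W f
  let e := Equiv.ofBijective _ h
  refine ⟨↾fun x => f (e.symm x).1 (e.symm x).2, fun j => ?_, fun g hg => ?_⟩
  · ext x
    have : e.symm (c j x) = ⟨j, x⟩ := e.symm_apply_eq.2 rfl
    change f (e.symm (c j x)).1 (e.symm (c j x)).2 = f j x
    rw [this]
  · ext x
    obtain ⟨⟨j, z⟩, rfl⟩ := h.2 x
    have : e.symm (c j z) = ⟨j, z⟩ := e.symm_apply_eq.2 rfl
    change g (c j z) = f (e.symm (c j z)).1 (e.symm (c j z)).2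
    rw [this, ← hg j]
    rfl

/-- A coproduct cocone is compared with the disjoint union; the resulting isomorphism is the map on
pairs, hence bijective. -/
lemma types_isCoprod_iff {J : Type w} {Z : J → Type w} {P : Type w} {c : ∀ j, Z j ⟶ P} :
    IsCoprod c ↔ Function.Bijective fun x : Σ j, Z j => c x.1 x.2 := by
  refine ⟨fun h => ?_, types_isCoprod_of_bijective⟩
  let ι : ∀ j, Z j ⟶ (Σ j, Z j : Type w) := fun j => ↾fun x => ⟨j, x⟩
  have hι : IsCoprod ι := types_isCoprod_of_bijective Function.bijective_id
  have hb := (isIso_iff_bijective (hι.iso h).hom).1 inferInstance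
  have e : (fun x : Σ j, Z j => c x.1 x.2) = (hι.iso h).hom := by
    funext x
    exact (congrArg (fun k : Z x.1 ⟶ P => k x.2) (hι.fac c x.1)).symm
  rw [e]
  exact hb

/-- The sets `Y j` partition `Q`, so `P` is partitioned by the parts lying over them, and these
parts are the pullbacks. The `X j` form a partition of `P` compatible with this one exactly when
each is the corresponding part. -/
instance types_lextensive : Lextensive (Type w) where
  hasFiniteLimits := inferInstance
  hasCoproducts := inferInstance
  isCoprod_iff {J X Y P Q} c d f g hd w := by
    rw [types_isCoprod_iff] at hd ⊢
    have w' : ∀ j x, g (c j x) = d j (f j x) := fun j x =>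
      congrArg (fun k : X j ⟶ Q => k x) (w j)
    constructor
    · intro hc j
      refine (Types.isPullback_iff _ _ _ _).2 ⟨w j, fun x y h => ?_, fun p y h => ?_⟩
      · have := @hc.1 ⟨j, x⟩ ⟨j, y⟩ h.1
        cases this; rfl
      · obtain ⟨⟨i, x⟩, rfl⟩ := hc.2 p
        have := @hd.1 ⟨i, f i x⟩ ⟨j, y⟩ ((w' i x).symm.trans h)
        cases this
        exact ⟨x, rfl, rfl⟩
    · intro h
      refine ⟨?_, fun p => ?_⟩
      · rintro ⟨i, x⟩ ⟨j, y⟩ e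
        have e1 : d i (f i x) = d j (f j y) := by rw [← w', ← w']; exact congrArg g e
        have e2 := @hd.1 ⟨i, f i x⟩ ⟨j, f j y⟩ e1
        obtain rfl : i = j := congrArg Sigma.fst e2
        exact congrArg (Sigma.mk i) (((Types.isPullback_iff _ _ _ _).1 (h i)).2.1 x y
          ⟨e, eq_of_heq (Sigma.mk.inj e2).2⟩)
      · obtain ⟨⟨j, y⟩, hy⟩ := hd.2 (g p)
        obtain ⟨x, hx, -⟩ := ((Types.isPullback_iff _ _ _ _).1 (h j)).2.2 p y hy.symm
        exact ⟨⟨j, x⟩, hx⟩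

end Types

/-! ### Coproducts of graphs -/

section GraphSums

variable {V : Type u} [Category.{v} V]

namespace Graph

lemma bijective_obj {X Y : Graph V} (k : X ⟶ Y) [IsIso k] : Function.Bijective k.obj :=
  Function.bijective_iff_has_inverse.2 ⟨(inv k).obj,
    congrFun (congrArg Hom.obj (IsIso.hom_inv_id k)),
    congrFun (congrArg Hom.obj (IsIso.inv_hom_id k))⟩

/-- On homs, the composites of `k` with its inverse are transports, hence invertible, in both
orders. So the hom map of the inverse is both monic and split epi, therefore invertible, and
cancelling it shows that `k.map a b` is invertible. -/
lemma isIso_map {X Y : Graph V} (k : X ⟶ Y) [IsIso k] (a b : X.obj) : IsIso (k.map a b) := by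
  have key : ∀ {X Y : Graph V} (f : X ⟶ Y) (g : Y ⟶ X), f ≫ g = 𝟙 X → ∀ a b,
      IsIso (f.map a b ≫ g.map (f.obj a) (f.obj b)) := by
    intro X Y f g h a b
    have ho : ∀ a, g.obj (f.obj a) = a := congrFun (congrArg Hom.obj h)
    have := map_eq_of_eq h a b (by exact congrArg₂ X.hom (ho a).symm (ho b).symm)
    rw [comp_map] at this
    rw [this]
    exact (inferInstance : IsIso (𝟙 (X.hom a b) ≫ eqToHom _))
  have h1 := key k (inv k) (IsIso.hom_inv_id k) a b
  have h2 := key (inv k) k (IsIso.inv_hom_id k) (k.obj a) (k.obj b)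
  have : Mono ((inv k).map (k.obj a) (k.obj b)) := mono_of_mono _ (k.map _ _)
  have : IsSplitEpi ((inv k).map (k.obj a) (k.obj b)) :=
    IsSplitEpi.mk' ⟨inv (k.map a b ≫ (inv k).map (k.obj a) (k.obj b)) ≫ k.map a b, by simp⟩
  have := isIso_of_mono_of_isSplitEpi ((inv k).map (k.obj a) (k.obj b))
  exact IsIso.of_isIso_comp_right (k.map a b) ((inv k).map (k.obj a) (k.obj b))

end Graph

end GraphSums

/-! ### Disjoint unions of graphs and lextensivity -/

section GraphLextensive

variable {V : Type u} [Category.{v} V]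

namespace Graph

section

variable [HasPullbacks V] {P X Y Z : Graph V} {p : P ⟶ X} {q : P ⟶ Y} {f : X ⟶ Z} {g : Y ⟶ Z}

/-- Any pullback of graphs is isomorphic to the explicit one, whose objects are the pairs with equal
images. -/
lemma obj_of_isPullback (sq : IsPullback p q f g) (x : X.obj) (y : Y.obj)
    (h : f.obj x = g.obj y) : ∃! t, p.obj t = x ∧ q.obj t = y := by
  let k := (sq.isoIsPullback _ _ (pb_isPullback f g)).hom
  have hp : k ≫ pbFst f g = p := sq.isoIsPullback_hom_fst _ _ (pb_isPullback f g)
  have hq : k ≫ pbSnd f g = q := sq.isoIsPullback_hom_snd _ _ (pb_isPullback f g)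
  obtain ⟨t, ht, hu⟩ := pb_obj f g x y h
  obtain ⟨s, rfl⟩ := (bijective_obj k).2 t
  rw [← hp, ← hq]
  exact ⟨s, ht, fun s' hs' => (bijective_obj k).1 (hu _ hs')⟩

/-- In the explicit pullback the homs are pullbacks in `V`, where the pullback of an isomorphism is
an isomorphism. -/
lemma isIso_map_of_isPullback (sq : IsPullback p q f g) (hg : ∀ a b, IsIso (g.map a b))
    (a b : P.obj) : IsIso (p.map a b) := by
  let k := (sq.isoIsPullback _ _ (pb_isPullback f g)).hom
  have hp : k ≫ pbFst f g = p := sq.isoIsPullback_hom_fst _ _ (pb_isPullback f g)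
  have hb : ∀ a b, IsIso ((pbFst f g).map a b) := fun a b => by
    have := hg a.1.2 b.1.2
    exact pullback_fst_iso_of_right_iso _ _
  have := isIso_map k a b
  rw [← hp]
  exact IsIso.comp_isIso (f := k.map a b) (h := (pbFst f g).map (k.obj a) (k.obj b))

end

variable {J : Type*} {Z : J → Graph V} {P : Graph V}

/-- A cocone of graphs is a disjoint union when it is bijective on objects, invertible on the homs
of the summands and has initial homs between different summands. -/
structure IsSum (c : ∀ j, Z j ⟶ P) : Prop where
  bijective : Function.Bijective fun x : Σ j, (Z j).obj => (c x.1).obj x.2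
  isIso (j : J) (a b : (Z j).obj) : IsIso ((c j).map a b)
  cross (i j : J) (a : (Z i).obj) (b : (Z j).obj) : i ≠ j →
    Nonempty (IsInitial (P.hom ((c i).obj a) ((c j).obj b)))

namespace IsSum

variable {c : ∀ j, Z j ⟶ P}

lemma fst_eq (h : IsSum c) {i j : J} {a : (Z i).obj} {b : (Z j).obj}
    (e : (c i).obj a = (c j).obj b) : i = j :=
  congrArg Sigma.fst (@h.bijective.1 ⟨i, a⟩ ⟨j, b⟩ e)

lemma injective (h : IsSum c) (j : J) : Function.Injective (c j).obj := fun a b e =>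
  eq_of_heq (Sigma.mk.inj (@h.bijective.1 ⟨j, a⟩ ⟨j, b⟩ e)).2

lemma exists_eq (h : IsSum c) (x : P.obj) : ∃ j a, (c j).obj a = x :=
  let ⟨⟨j, a⟩, e⟩ := h.bijective.2 x
  ⟨j, a, e⟩

/-- A map out of `P` is forced on objects by bijectivity, on homs within a summand by invertibility
of `(c j).map`, and on homs between different summands by initiality. -/
lemma isCoprod (h : IsSum c) : IsCoprod c := by
  intro W f
  obtain ⟨o, ho⟩ : ∃ o : P.obj → W.obj, ∀ j a, o ((c j).obj a) = (f j).obj a := by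
    let e := Equiv.ofBijective _ h.bijective
    refine ⟨fun x => (f (e.symm x).1).obj (e.symm x).2, fun j a => ?_⟩
    have : e.symm ((c j).obj a) = ⟨j, a⟩ := e.symm_apply_eq.2 rfl
    change (f (e.symm ((c j).obj a)).1).obj (e.symm ((c j).obj a)).2 = (f j).obj a
    rw [this]
  -- The hom map is characterised at arbitrary vertices, through the equations `hx` and `hy` rather
  -- than chosen preimages, so that the maps obtained by unique choice already have the right types.
  have key : ∀ x y : P.obj, ∃! m : P.hom x y ⟶ W.hom (o x) (o y),
      ∀ j a b (hx : (c j).obj a = x) (hy : (c j).obj b = y),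
        (c j).map a b ≫ eqToHom (congrArg₂ P.hom hx hy) ≫ m = (f j).map a b ≫
          eqToHom (congrArg₂ W.hom ((ho j a).symm.trans (congrArg o hx))
            ((ho j b).symm.trans (congrArg o hy))) := by
    intro x y
    obtain ⟨i, a, rfl⟩ := h.exists_eq x
    obtain ⟨j, b, rfl⟩ := h.exists_eq y
    by_cases hij : i = j
    · subst hij
      have := h.isIso i a b
      refine ⟨inv ((c i).map a b) ≫ (f i).map a b ≫ eqToHom (by rw [ho, ho]), ?_, ?_⟩
      · intro k a' b' hx hy
        obtain rfl := h.fst_eq hx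
        obtain rfl := h.injective _ hx
        obtain rfl := h.injective _ hy
        simp
      · intro m hm
        have := hm i a b rfl rfl
        rw [IsIso.eq_inv_comp, ← this]
        simp
    · obtain ⟨h0⟩ := h.cross i j a b hij
      refine ⟨h0.to _, ?_, fun m _ => h0.hom_ext _ _⟩
      intro k a' b' hx hy
      exact absurd ((h.fst_eq hx).symm.trans (h.fst_eq hy)) hij
  choose m hm hu using key
  refine ⟨⟨o, m⟩, fun j => hom_ext (funext (ho j)) fun a b => ?_, ?_⟩
  · have := hm _ _ j a b rfl rfl
    simpa using this
  · rintro ⟨go, gm⟩ hg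
    obtain rfl : o = go := by
      funext x
      obtain ⟨j, a, rfl⟩ := h.exists_eq x
      exact (ho j a).trans (congrFun (congrArg Hom.obj (hg j)) a).symm
    refine mk_ext o fun x y => hu x y (gm x y) ?_
    rintro j a b rfl rfl
    have := map_eq_of_eq (hg j) a b (congrArg₂ W.hom (ho j a).symm (ho j b).symm)
    simpa using this

lemma comp_iso (h : IsSum c) {P' : Graph V} (k : P ⟶ P') [IsIso k] : IsSum fun j => c j ≫ k where
  bijective := (bijective_obj k).comp h.bijective
  isIso j a b := by
    have := h.isIso j a b
    have := isIso_map k ((c j).obj a) ((c j).obj b)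
    exact IsIso.comp_isIso (f := (c j).map a b) (h := k.map ((c j).obj a) ((c j).obj b))
  cross i j a b hij := by
    obtain ⟨h0⟩ := h.cross i j a b hij
    have := isIso_map k ((c i).obj a) ((c j).obj b)
    exact ⟨h0.ofIso (asIso (k.map ((c i).obj a) ((c j).obj b)))⟩

end IsSum

/-- The vertices are pairs, with initial homs between different indices. Equality of indices is
decided classically, so homs within a summand agree with those of `Z j` only up to `eqToHom`. -/
lemma exists_isSum [HasInitial V] {J : Type v} (Z : J → Graph V) :
    ∃ (P : Graph V) (c : ∀ j, Z j ⟶ P), IsSum c := by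
  classical
  let H : (Σ j, (Z j).obj) → (Σ j, (Z j).obj) → V := fun x y =>
    if h : x.1 = y.1 then (Z y.1).hom (h ▸ x.2) y.2 else ⊥_ V
  have hH : ∀ j a b, H ⟨j, a⟩ ⟨j, b⟩ = (Z j).hom a b := fun _ _ _ => dif_pos rfl
  refine ⟨⟨Σ j, (Z j).obj, H⟩, fun j => ⟨fun a => ⟨j, a⟩, fun a b =>
    eqToHom (hH j a b).symm⟩, Function.bijective_id, fun j a b => ?_,
    fun i j a b hij => ?_⟩
  · exact (inferInstance : IsIso (eqToHom (hH j a b).symm))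
  · exact ⟨initialIsInitial.ofIso (eqToIso (show H ⟨i, a⟩ ⟨j, b⟩ = ⊥_ V from dif_neg hij).symm)⟩

/-- Coproducts are unique up to isomorphism, and being a disjoint union is invariant under
isomorphism of the target. -/
lemma isSum_iff [HasInitial V] {J : Type v} {Z : J → Graph V} {c : ∀ j, Z j ⟶ P} :
    IsSum c ↔ IsCoprod c := by
  refine ⟨IsSum.isCoprod, fun h => ?_⟩
  obtain ⟨S, ι, hι⟩ := exists_isSum Z
  have := hι.comp_iso (hι.isCoprod.iso h).hom
  have e : (fun j => ι j ≫ (hι.isCoprod.iso h).hom) = c := funext fun j => hι.isCoprod.fac c j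
  rwa [e] at this

end Graph

variable [Lextensive V]

lemma graph_hasTerminal : HasTerminal (Graph V) :=
  IsTerminal.hasTerminal (X := pt V) (IsTerminal.ofUniqueHom toPt fun X f =>
    Graph.mk_ext (X := X) (Y := pt V) _ fun _ _ => terminalIsTerminal.hom_ext _ _)

/-- On vertices the extensivity axiom is that of sets. Homs within a summand map isomorphically to
those of the coproduct, so their squares are pullbacks; homs between different summands map to
initial objects and are initial by strictness. -/
instance graph_lextensive : Lextensive (Graph V) where
  hasFiniteLimits := by
    have := graph_hasTerminal (V := V)
    have : ∀ {X Y Z : Graph V} {f : X ⟶ Z} {g : Y ⟶ Z}, HasLimit (cospan f g) :=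
      fun {_ _ _ f g} => (Graph.pb_isPullback f g).hasPullback
    have := hasPullbacks_of_hasLimit_cospan (Graph V)
    exact hasFiniteLimits_of_hasTerminal_and_pullbacks
  hasCoproducts := by
    choose P c h using @Graph.exists_isSum V _ _
    refine hasCoproducts_of_colimit_cofans (fun {J} f => Cofan.mk (P f) (c f)) fun {J} f => ?_
    exact ((IsCoprod.iff_isColimit _).1 (h f).isCoprod).some
  isCoprod_iff {J X Y P Q} c d f g hd w := by
    rw [← Graph.isSum_iff] at hd ⊢
    have w' : ∀ j x, g.obj ((c j).obj x) = (d j).obj ((f j).obj x) := fun j =>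
      congrFun (congrArg Graph.Hom.obj (w j))
    constructor
    · intro hc j
      refine Graph.isPullback_of (w j) (fun x y h => ?_) fun t t' e => ?_
      · obtain ⟨i, a, rfl⟩ := hc.exists_eq x
        have e := (w' i a).symm.trans h
        obtain rfl := hd.fst_eq e
        exact ⟨a, ⟨rfl, hd.injective i e⟩, fun a' h' => hc.injective i h'.1⟩
      · have := hc.isIso j t t'
        have := hd.isIso j ((f j).obj t) ((f j).obj t')
        exact IsPullback.of_horiz_isIso
          ⟨(Graph.map_eq_of_eq (w j) t t' e).trans (Category.assoc _ _ _)⟩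
    · intro h
      refine ⟨⟨?_, fun x => ?_⟩, fun j => Graph.isIso_map_of_isPullback (h j) (hd.isIso j),
        fun i j a b hij => ?_⟩
      · rintro ⟨i, a⟩ ⟨j, b⟩ e
        have e1 : (d i).obj ((f i).obj a) = (d j).obj ((f j).obj b) := by
          rw [← w', ← w']; exact congrArg g.obj e
        obtain rfl := hd.fst_eq e1
        exact congrArg (Sigma.mk i) ((Graph.obj_of_isPullback (h i) _ _ (w' i b)).unique
          ⟨e, hd.injective i e1⟩ ⟨rfl, rfl⟩)
      · obtain ⟨j, y, hy⟩ := hd.exists_eq (g.obj x)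
        obtain ⟨t, ht, -⟩ := Graph.obj_of_isPullback (h j) x y hy.symm
        exact ⟨⟨j, t⟩, ht.1⟩
      · exact nonempty_isInitial_of_hom (g.map _ _ ≫ eqToHom (by rw [w', w']))
          (hd.cross i j ((f i).obj a) ((f j).obj b) hij)

end GraphLextensive

/-! ### Preservation of coproducts by `Γ` -/

section GammaSums

variable {V : Type u} [Category.{v} V]

/-- An initial object is the coproduct of the empty family, which `A` preserves in each variable. -/
lemma Distributive.isInitial {A : List V ⥤ V} (hA : Distributive A) {X : V}
    (h : Nonempty (IsInitial X)) (l m : List V) : Nonempty (IsInitial (A.obj (l ++ X :: m))) :=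
  (isCoprod_empty_iff (J := PEmpty.{v + 1}) (Z := fun _ => A.obj (l ++ X :: m)) _).1
    (hA l m (fun _ => X) X (fun j => j.elim) ((isCoprod_empty_iff _).2 h))

lemma isIso_consHom {a b : V} {l m : List V} (f : a ⟶ b) (g : l ⟶ m) [IsIso f] [IsIso g] :
    IsIso (consHom f g) :=
  ⟨consHom (inv f) (inv g),
    congr (congrArg consHom (IsIso.hom_inv_id f)) (IsIso.hom_inv_id g),
    congr (congrArg consHom (IsIso.inv_hom_id f)) (IsIso.inv_hom_id g)⟩

lemma Path.isIso_seqHom {X Y : Graph V} (f : X ⟶ Y) (h : ∀ a b, IsIso (f.map a b)) :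
    {a b : X.obj} → (p : Path a b) → IsIso (p.seqHom f.obj f.map)
  | _, _, .nil _ => inferInstanceAs (IsIso (𝟙 []))
  | _, _, .cons _ p =>
    haveI := isIso_seqHom f h p
    haveI := h
    isIso_consHom _ _

namespace Graph.IsSum

variable {J : Type*} {Z : J → Graph V} {P : Graph V} {c : ∀ j, Z j ⟶ P}
  {A : List V ⥤ V}

/-- A path between vertices of different summands must change summand at some step, and the hom at
that step is initial. The prefix `l` holds the steps already passed, so that the induction can run
along the path. -/
lemma isInitial_of_cross (h : IsSum c) (hA : Distributive A) {x y : P.obj} (p : Path x y) (l : List V) {i j : J} (a : (Z i).obj)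
    (b : (Z j).obj) (hx : (c i).obj a = x) (hy : (c j).obj b = y) (hij : i ≠ j) :
    Nonempty (IsInitial (A.obj (l ++ p.seq P.hom))) := by
  induction p generalizing l i with
  | nil x => exact absurd (h.fst_eq (hx.trans hy.symm)) hij
  | @cons x x' _ p ih =>
    obtain ⟨k, a', rfl⟩ := h.exists_eq x'
    by_cases hik : i = k
    · subst hik
      have := ih (l ++ [P.hom x ((c i).obj a')]) a' rfl hy hij
      rwa [List.append_assoc] at this
    · subst hx
      exact hA.isInitial (h.cross i k a a' hik) l _

/-- Either the path stays in the summand of its endpoints and lifts to it, or it takes a step into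
another summand, at which the hom is initial. -/
lemma exists_map_or_isInitial (h : IsSum c) (hA : Distributive A) {j : J} {x y : P.obj} (p : Path x y) (l : List V)
    (a b : (Z j).obj) (hx : (c j).obj a = x) (hy : (c j).obj b = y) :
    (∃ q : Path a b, HEq (q.map (c j).obj) p) ∨
      Nonempty (IsInitial (A.obj (l ++ p.seq P.hom))) := by
  induction p generalizing l a with
  | nil x =>
    subst hx
    obtain rfl := h.injective j hy
    exact .inl ⟨.nil b, HEq.rfl⟩
  | @cons x x' y p ih =>
    obtain ⟨k, a', rfl⟩ := h.exists_eq x'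
    subst hx
    by_cases hjk : j = k
    · subst hjk
      obtain ⟨q, hq⟩ | hi := ih (l ++ [P.hom ((c j).obj a) ((c j).obj a')]) a' rfl hy
      · subst hy
        cases hq
        exact .inl ⟨.cons a q, HEq.rfl⟩
      · rw [List.append_assoc] at hi
        exact .inr hi
    · exact .inr (hA.isInitial (h.cross j k a a' hjk) l _)

/-- Paths leaving a summand contribute initial objects and can be left out of the coproduct. On the
homs of a summand there remain just its own paths, and on homs between different summands nothing
remains. -/
lemma gamma [Lextensive V] (h : IsSum c) (hA : Distributive A) : IsSum fun j => (MultOp.gamma A).toFunctor.map (c j) where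
  bijective := h.bijective
  isIso j a b := by
    have h1 : IsCoprod fun q : Path a b => gι A P (q.map (c j).obj) :=
      (gι_isCoprod A P ((c j).obj a) ((c j).obj b)).of_injective (fun q => q.map (c j).obj)
        (fun q q' e => Path.map_inj₂ (fun _ _ e _ => h.injective j e) e e) fun p hp =>
          (h.exists_map_or_isInitial hA p [] a b rfl rfl).resolve_left
            fun ⟨q, hq⟩ => hp q (eq_of_heq hq)
    have h2 : ∀ q : Path a b, IsIso (A.map (q.seqHom (c j).obj (c j).map)) := fun q =>
      haveI := Path.isIso_seqHom (c j) (h.isIso j) q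
      inferInstance
    exact (gι_isCoprod A (Z j) a b).isIso_of h1 _root_.id Function.bijective_id _ _ (gι_map A (c j))
  cross i j a b hij := by
    -- Every summand is initial here, so all of them are dropped and the coproduct is reindexed by
    -- the empty type.
    have h1 := (gι_isCoprod A P ((c i).obj a) ((c j).obj b)).of_injective
      (PEmpty.elim.{_, v + 1}) (fun x => x.elim) fun p _ =>
        h.isInitial_of_cross hA p [] a b rfl rfl hij
    exact (isCoprod_empty_iff _).1 h1

end Graph.IsSum

/-- The functor `Γ A` preserves coproducts when `A` is distributive. -/
lemma gamma_isCoprod [Lextensive V] {A : List V ⥤ V} (hA : Distributive A) {J : Type v}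
    {Z : J → Graph V} {P : Graph V} {c : ∀ j, Z j ⟶ P} (hc : IsCoprod c) :
    IsCoprod fun j => (gamma A).toFunctor.map (c j) :=
  ((Graph.isSum_iff.2 hc).gamma hA).isCoprod

end GammaSums

/-! ### The multitensor of a monad -/

section TimesProperties

variable {V : Type u} [Category.{v} V]

section Products

variable [HasFiniteProducts V]

lemma prodMap_isPullback {a b c d a' b' c' d' : V} {f : a ⟶ b} {g : a ⟶ c} {h : b ⟶ d}
    {k : c ⟶ d} {f' : a' ⟶ b'} {g' : a' ⟶ c'} {h' : b' ⟶ d'} {k' : c' ⟶ d'}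
    (sq : IsPullback f g h k) (sq' : IsPullback f' g' h' k') :
    IsPullback (prod.map f f') (prod.map g g') (prod.map h h') (prod.map k k') := by
  refine isPullback_of_existsUnique (by rw [prod.map_map, prod.map_map, sq.w, sq'.w])
    fun W p q e => ?_
  have e₁ : (p ≫ prod.fst) ≫ h = (q ≫ prod.fst) ≫ k := by
    simpa using congrArg (· ≫ prod.fst) e
  have e₂ : (p ≫ prod.snd) ≫ h' = (q ≫ prod.snd) ≫ k' := by
    simpa using congrArg (· ≫ prod.snd) e
  refine ⟨prod.lift (sq.lift _ _ e₁) (sq'.lift _ _ e₂), ⟨?_, ?_⟩, ?_⟩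
  · refine Limits.prod.hom_ext ?_ ?_ <;> simp [prod.lift_fst, prod.lift_snd, prod.lift_fst_assoc, prod.lift_snd_assoc]
  · refine Limits.prod.hom_ext ?_ ?_ <;> simp [prod.lift_fst, prod.lift_snd, prod.lift_fst_assoc, prod.lift_snd_assoc]
  · rintro l ⟨rfl, rfl⟩
    refine Limits.prod.hom_ext (sq.hom_ext ?_ ?_) (sq'.hom_ext ?_ ?_) <;>
      simp [prod.lift_fst, prod.lift_snd, prod.lift_fst_assoc, prod.lift_snd_assoc]

/-- Multiplying with a fixed object is pulling back along a projection. Both the distributivity of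
products over coproducts and the cartesianness of the comparison with products come from this. -/
lemma prodFst_isPullback {a b : V} (f : a ⟶ b) (c : V) :
    IsPullback (prod.map f (𝟙 c)) prod.fst prod.fst f := by
  refine isPullback_of_existsUnique (prod.map_fst _ _) fun W p q e => ?_
  refine ⟨prod.lift q (p ≫ prod.snd), ⟨?_, prod.lift_fst _ _⟩, ?_⟩
  · refine Limits.prod.hom_ext ?_ ?_ <;> simp [prod.lift_fst, prod.lift_snd, prod.lift_fst_assoc, prod.lift_snd_assoc, e]
  · rintro l ⟨rfl, rfl⟩
    refine Limits.prod.hom_ext ?_ ?_ <;> simp [prod.lift_fst, prod.lift_snd]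

lemma prodSnd_isPullback {a b : V} (f : a ⟶ b) (c : V) :
    IsPullback (prod.map (𝟙 c) f) prod.snd prod.snd f := by
  refine isPullback_of_existsUnique (prod.map_snd _ _) fun W p q e => ?_
  refine ⟨prod.lift (p ≫ prod.fst) q, ⟨?_, prod.lift_snd _ _⟩, ?_⟩
  · refine Limits.prod.hom_ext ?_ ?_ <;> simp [prod.lift_fst, prod.lift_snd, prod.lift_fst_assoc, prod.lift_snd_assoc, e]
  · rintro l ⟨rfl, rfl⟩
    refine Limits.prod.hom_ext ?_ ?_ <;> simp [prod.lift_fst, prod.lift_snd]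

/-- The comparison with products is cartesian for a functor preserving pullbacks. -/
lemma prodComparison_isPullback (T : V ⥤ V) [PreservesLimitsOfShape WalkingCospan T]
    {a a' b b' : V} (f : a ⟶ a') (g : b ⟶ b') :
    IsPullback (T.map (prod.map f g)) (prodComparison T a b) (prodComparison T a' b')
      (prod.map (T.map f) (T.map g)) := by
  -- One variable is moved at a time, so that a projection square can be pasted below. The paste is
  -- the image under `T` of a projection square, and cancellation gives the square itself.
  have h1 : IsPullback (T.map (prod.map f (𝟙 b))) (prodComparison T a b) (prodComparison T a' b)
      (prod.map (T.map f) (𝟙 _)) := by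
    refine IsPullback.of_bot ?_ (by rw [prodComparison_natural, T.map_id])
      (prodFst_isPullback (T.map f) (T.obj b))
    rw [prodComparison_fst, prodComparison_fst]
    exact (prodFst_isPullback f b).map T
  have h2 : IsPullback (T.map (prod.map (𝟙 a') g)) (prodComparison T a' b)
      (prodComparison T a' b') (prod.map (𝟙 _) (T.map g)) := by
    refine IsPullback.of_bot ?_ (by rw [prodComparison_natural, T.map_id])
      (prodSnd_isPullback (T.map g) (T.obj a'))
    rw [prodComparison_snd, prodComparison_snd]
    exact (prodSnd_isPullback g a').map T
  have h := h1.paste_horiz h2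
  rw [← T.map_comp, prod.map_map, prod.map_map, Category.comp_id, Category.id_comp,
    Category.comp_id, Category.id_comp] at h
  exact h

/-- By recursion the map is built from a left unitor and from associators, since `shift` is an
associator followed by a product of maps. -/
lemma timesAppend_isIso (T : V ⥤ V) : (l m : List V) → IsIso (timesAppend T l m)
  | [], m => (inferInstance : IsIso (Limits.prod.leftUnitor (timesObj T m)).hom)
  | a :: l, m => by
    have := timesAppend_isIso T l m
    change IsIso (shift (T.obj a) (timesAppend T l m))
    rw [shift_eq]
    infer_instance

/-- A preserved pullback is built for each cospan entry by entry: a pullback in every place, whose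
images under `T` multiply to a pullback. -/
lemma times_pullbacks [HasPullbacks V] (T : V ⥤ V) [PreservesLimitsOfShape WalkingCospan T] :
    PreservesLimitsOfShape WalkingCospan (times T) := by
  have key : ∀ {l n : List V} (f : SeqHom l n) (m : List V) (g : m ⟶ n),
      ∃ (k : List V) (p : k ⟶ l) (q : k ⟶ m), IsPullback p q (show l ⟶ n from f) g ∧
        IsPullback ((times T).map p) ((times T).map q) ((times T).map (show l ⟶ n from f))
          ((times T).map g) := by
    intro l n f
    induction f with
    | nil =>
      intro m g
      change SeqHom _ _ at g
      cases g
      exact ⟨[], 𝟙 [], 𝟙 [], IsPullback.of_id_fst, IsPullback.of_id_fst⟩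
    | cons f f' ih =>
      intro m g
      change SeqHom _ _ at g
      cases g with | cons g g' =>
      obtain ⟨k, p, q, h, h'⟩ := ih _ g'
      exact ⟨_, consHom (pullback.fst f g) p, consHom (pullback.snd f g) q,
        consHom_isPullback (IsPullback.of_hasPullback f g) h,
        prodMap_isPullback ((IsPullback.of_hasPullback f g).map T) h'⟩
  exact preservesLimitsOfShape_walkingCospan_of_forall_isPullback fun X Y Z f g _ =>
    key f Y g

variable (T : Monad V)

/-- The product over a sequence of length one is `T a × 1`. Its projection to `T a` is cartesian and
takes the unit of the multitensor to `T.η`, so it can be cancelled. -/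
lemma timesUnit_equifibered (h : NatTrans.Equifibered T.η) :
    NatTrans.Equifibered (timesUnit T) := fun a b f => by
  refine IsPullback.of_bot (h₃₁ := T.map f) (v₂₁ := prod.fst) (v₂₂ := prod.fst) ?_
    ((timesUnit T).naturality f) ?_
  · have e : ∀ a, (timesUnit T).app a ≫ (prod.fst : T.obj a ⨯ ⊤_ V ⟶ T.obj a) = T.η.app a :=
      fun a => prod.lift_fst _ _
    refine (congrArg₂ (fun l r => IsPullback _ l r _) (e a) (e b)).mpr (h f)
  · exact prodFst_isPullback (T.map f) (⊤_ V)

variable [PreservesLimitsOfShape WalkingCospan T.toFunctor]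

/-- One step of the algebra structure is the comparison of `T` with a product followed by the
product of `T.μ` with the remaining structure. The comparison is cartesian because `T` preserves
pullbacks. -/
lemma timesAlg_isPullback (h : NatTrans.Equifibered T.μ) {l m : List V} (f : SeqHom l m) :
    IsPullback (T.map (timesMap T.toFunctor f)) (timesAlg T l) (timesAlg T m)
      (timesMap T.toFunctor f) := by
  induction f with
  | nil =>
    have : IsIso (timesMap T.toFunctor (.nil : SeqHom (C := V) [] [])) :=
      inferInstanceAs (IsIso (𝟙 (⊤_ V)))
    exact IsPullback.of_horiz_isIso ⟨timesAlg_naturality T .nil⟩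
  | @cons a b l m f g ih =>
    have e : ∀ (a : V) {L : V} (k : T.obj L ⟶ L), algCons T a k =
        prodComparison T.toFunctor (T.obj a) L ≫ prod.map (T.μ.app a) k := fun a L k => by
      rw [algCons, prodComparison, prod.lift_map]
    change IsPullback _ (algCons T a _) (algCons T b _) _
    rw [e, e]
    exact (prodComparison_isPullback T.toFunctor (T.map f) (timesMap T.toFunctor g)).paste_vert
      (prodMap_isPullback (h f) ih)

/-- The substitution is a product of algebra structures followed by an invertible regrouping. -/
lemma timesσ_equifibered (h : NatTrans.Equifibered T.μ) : NatTrans.Equifibered (timesσ T) := by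
  intro Y Z f
  change SeqHom Y Z at f
  induction f with
  | nil => exact IsPullback.of_id_fst
  | @cons y z Y Z f g ih =>
    have := timesAppend_isIso T.toFunctor y (flat.obj Y)
    have := timesAppend_isIso T.toFunctor z (flat.obj Z)
    exact (prodMap_isPullback (timesAlg_isPullback T h f) ih).paste_vert
      (IsPullback.of_vert_isIso ⟨(timesAppend_naturality T.toFunctor f (flattenHom g))⟩)

lemma timesMult_isCartesian [HasPullbacks V] (hη : NatTrans.Equifibered T.η)
    (hμ : NatTrans.Equifibered T.μ) : (timesMult T).IsCartesian where
  pullbacks := times_pullbacks T.toFunctor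
  unit := timesUnit_equifibered T hη
  subst := timesσ_equifibered T hμ

end Products

section Distributive

variable [Lextensive V]

/-- The projection squares are pullbacks over the coproduct `P`, so extensivity yields
distributivity of the product. -/
lemma IsCoprod.prodMap_id {J : Type*} [Small.{v} J] {Z : J → V} {P : V} {c : ∀ j, Z j ⟶ P}
    (hc : IsCoprod c) (b : V) : IsCoprod fun j => prod.map (c j) (𝟙 b) :=
  (hc.iff_isPullback fun j => prod.map_fst _ _).2 fun j => prodFst_isPullback (c j) b

lemma IsCoprod.id_prodMap {J : Type*} [Small.{v} J] {Z : J → V} {P : V} {c : ∀ j, Z j ⟶ P}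
    (hc : IsCoprod c) (b : V) : IsCoprod fun j => prod.map (𝟙 b) (c j) :=
  (hc.iff_isPullback fun j => prod.map_snd _ _).2 fun j => prodSnd_isPullback (c j) b

/-- In the chosen variable `T` preserves the coproduct, and multiplying with the values in the other
variables preserves it as well. -/
lemma times_distributive (T : V ⥤ V) (hT : ∀ {J : Type v} {Z : J → V} {P : V} {c : ∀ j, Z j ⟶ P},
    IsCoprod c → IsCoprod fun j => T.map (c j)) : Distributive (times T) := by
  intro l m J Z P c hc
  induction l with
  | nil =>
    have h := (hT hc).prodMap_id (timesObj T m)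
    rw [← (times T).map_id m] at h
    exact h
  | cons a l ih =>
    have h := ih.id_prodMap (T.obj a)
    rw [← T.map_id a] at h
    exact h

end Distributive

end TimesProperties

/-! ### The monads for strict `n`-categories -/

section Stages

/-- The properties of the monads `T_{≤ n}` which are carried along the induction. -/
structure Stage.IsGood (S : Stage.{w}) : Prop where
  lextensive : Lextensive S.V
  -- Not part of being a cartesian monad; it is what makes the products of the next stage
  -- distributive.
  isCoprod {J : Type w} {Z : J → S.V} {P : S.V} {c : ∀ j, Z j ⟶ P} :
    IsCoprod c → IsCoprod fun j => S.T.map (c j)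
  pullbacks : PreservesLimitsOfShape WalkingCospan S.T.toFunctor
  unit : NatTrans.Equifibered S.T.η
  mult : NatTrans.Equifibered S.T.μ

lemma Stage.isGood_zero : Stage.IsGood.{w} ⟨Type w, Monad.id (Type w)⟩ where
  lextensive := types_lextensive
  isCoprod h := h
  pullbacks := inferInstanceAs (PreservesLimitsOfShape WalkingCospan (𝟭 (Type w)))
  unit _ _ _ := IsPullback.of_id_snd
  mult _ _ _ := IsPullback.of_id_snd

namespace Stage.IsGood

variable {S : Stage.{w}} [Lextensive S.V]

lemma isDistributive (h : S.IsGood) : (timesMult S.T).IsDistributive :=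
  ⟨times_distributive S.T.toFunctor h.isCoprod⟩

lemma isCartesian (h : S.IsGood) : (timesMult S.T).IsCartesian :=
  haveI := h.pullbacks
  timesMult_isCartesian S.T h.unit h.mult

/-- Each property of the next stage is a general fact on `Γ` or on graphs, applied to the
multitensor of products, which is distributive and cartesian by the properties of the present stage.
-/
lemma succ [(timesMult S.T).IsDistributive] (h : S.IsGood) :
    Stage.IsGood ⟨Graph S.V, (timesMult S.T).gammaMonad.toMonad⟩ :=
  haveI := h.isCartesian
  { lextensive := graph_lextensive
    isCoprod := gamma_isCoprod Multitensor.IsDistributive.distributive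
    pullbacks := (gammaMonad_isCartesian (timesMult S.T)).pullbacks
    unit := fun _ _ f => (gammaMonad_isCartesian (timesMult S.T)).unit f
    mult := fun _ _ f => (gammaMonad_isCartesian (timesMult S.T)).mult f }

end Stage.IsGood

/-- The existence of the stage and its properties are proved together, because the next monad is
defined only once lextensivity and distributivity are known at the present one. -/
lemma exists_isStrictMonad (n : ℕ) : ∃ S : Stage.{w}, IsStrictMonad n S ∧ S.IsGood := by
  induction n with
  | zero => exact ⟨_, .zero, Stage.isGood_zero⟩
  | succ n ih =>
    obtain ⟨S, hS, h⟩ := ih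
    have := h.lextensive
    have := h.isDistributive
    exact ⟨_, .succ hS, h.succ⟩

end Stages

end MultOp

theorem mainTheorem6 :
    (∀ (V : Type u) [Category.{v} V] [MultOp.Lextensive V] (M : MultOp.Multitensor V)
      [M.IsDistributive] [M.IsCartesian],
      ∃ _ : M.gammaMonad.IsCartesian,
        (∃ m : (MultOp.gammaColl M).Monoidal,
          (Functor.LaxMonoidal.ε (MultOp.gammaColl M)).φ = MultOp.gammaUnit ∧
          ∀ X Y : MultOp.Coll M, (Functor.LaxMonoidal.μ (MultOp.gammaColl M) X Y).φ =
            MultOp.gammaComp X.distributive Y.A) ∧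
        (MultOp.gammaColl M).IsEquivalence ∧
        (MultOp.gammaMult M).IsEquivalence) ∧
    ∀ n : ℕ, ∃ S : MultOp.Stage.{w}, MultOp.IsStrictMonad n S ∧
      ∃ (_ : MultOp.Lextensive S.V) (_ : (MultOp.timesMult S.T).IsDistributive)
        (_ : (MultOp.timesMult S.T).IsCartesian)
        (_ : (MultOp.timesMult S.T).gammaMonad.IsCartesian),
        MultOp.IsStrictMonad (n + 1)
          ⟨MultOp.Graph S.V, (MultOp.timesMult S.T).gammaMonad.toMonad⟩ ∧
        (MultOp.gammaMult (MultOp.timesMult S.T)).IsEquivalence := by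
  refine ⟨fun V _ _ M _ _ => ⟨inferInstance, MultOp.gammaColl_monoidal M, inferInstance,
    inferInstance⟩, ?_⟩
  intro n
  obtain ⟨S, hS, h⟩ := MultOp.exists_isStrictMonad.{w} n
  have := h.lextensive
  have := h.isDistributive
  have := h.isCartesian
  exact ⟨S, hS, inferInstance, inferInstance, inferInstance, inferInstance, .succ hS,
    inferInstance⟩
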